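/- **Setting.** Let $F$ be a totally real number field, $K/F$ a totally complex quadratic extension with nontrivial automorphism $c$, and $p$ an odd prime, unramified in $F$, such that every place of $F$ above $p$ splits in $K$. Let $\Sigma_p$ be a set of places of $K$ containing exactly one place $w$ above each $v\mid p$. Let $\mathfrak s$ be a nonzero ideal of $\mathfrak o=\mathfrak o_F$ prime to $p$, all of whose prime divisors split in $K$; choose one place $w$ of $K$ above, and a uniformizer $\varpi_v$ of $F_v$ for, each $v\mid\mathfrak s$. Let $E$ be a complete nonarchimedean normed extension field of $\mathbb Q_p$ containing all conjugates of $K$, with ring of integers $\mathcal O$ (the closed unit ball). Let $\Sigma$ be the set of pairs $(w,\sigma)$ with $w\in\Sigma_p$, $w\mid v$, and $\sigma:\mathfrak o_v\to\mathcal O$ a ring homomorphism (equivalently, a continuous embedding of $K_w=F_v$ into $E$). **Group and levels.** Let $G_1$ be the definite unitary group over $F$ with $G_1(A)=\{g\in GL_2(K\otimes_FA): g\,{}^t\bar g=1\}$. If $v$ splits in $K$ and $w\mid v$, then $g\mapsto g_w$ identifies $G_1(F_v)$ with $GL_2(F_v)$. Let $K_v^0$ be the subgroup of $g\in G_1(F_v)$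 such that $g$ and $g^{-1}$ have entries in $\mathfrak o_K\otimes_{\mathfrak o}\mathfrak o_v$. Fix open subgroups $K_v\subseteq K_v^0$, stable under $g\mapsto\bar g$, with $K_v=K_v^0$ for almost all $v$ and for all $v\mid p\mathfrak s$, and assume that $K(\mathfrak n_\circ)=\prod_vK_v$ is sufficiently small: $t^{-1}G_1(F)t\cap K(\mathfrak n_\circ)=\{1\}$ for all $t\in G_1(\mathbb A_{F,f})$. Let $K=K(\mathfrak n)$ be the group of $g\in K(\mathfrak n_\circ)$ with $g_w\equiv\begin{pmatrix}1&*\\0&*\end{pmatrix}\bmod\mathfrak s$ at the chosen $w$ above all $v\mid\mathfrak s$. For $n\ge1$ let $K_1^n$ (resp. $K_0^n$) be the group of $g\in K$ with $g_w\equiv\begin{pmatrix}1&*\\0&*\end{pmatrix}$ (resp. $\begin{pmatrix}*&*\\0&*\end{pmatrix}$) $\bmod\ p^n$ for all $w\in\Sigma_p$. In what follows, matrices indexed by $p$ or $\mathfrak s$ are placed in the components $w\in\Sigma_p$, resp. at the chosen $w$ above $v\mid\mathfrak s$, with identity components at all other places of $F$. **Forms.** Let $R$ be an $\mathcal O$-algebra.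 A weight is a family $k=(k_\sigma)_{\sigma\in\Sigma}$ of integers $k_\sigma\ge0$. Let $L_k(R)$ be the $R$-module of polynomials in the pairs $(X_\sigma,Y_\sigma)_{\sigma\in\Sigma}$ that are homogeneous of degree $k_\sigma$ in each pair, with $\rho_k(g)P(X,Y)=P((X,Y)\,{}^tg^{-1})$, where $g\in GL_2$ acts on the $\sigma$-variables through $\sigma$. For $A\in M_2(\prod_{v\mid p}\mathfrak o_v)$ with nonzero determinants, write $k(\det A,1)\rho_k(A)P=P((X,Y)\,(\det A)\,{}^tA^{-1})$, which is integral. Let $M_k(K_1^n,R)$ be the module of functions $f:G_1(F)\backslash G_1(\mathbb A_{F,f})\to L_k(R)$ with $f(gu)=\rho_k(u_{\Sigma_p})^{-1}f(g)$ for $u\in K_1^n$. Put $$U_{k,p}f(g)=\sum_{b\in\mathfrak o/p}k(p,1)\,\rho_k\begin{pmatrix}p&b\\0&1\end{pmatrix}f\Big(g\begin{pmatrix}p&b\\0&1\end{pmatrix}_{p}\Big),\qquad S f(g)=f(g\,p_{p}),$$ where $p_p$ denotes the scalar matrix $p$ at the $w\in\Sigma_p$. Let $\Delta_{\mathfrak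 s}=\prod_{v\mid\mathfrak s}(\mathfrak o_v/\mathfrak s)^\times$ and $T=\prod_{v\mid p}\mathfrak o_v^\times\times\Delta_{\mathfrak s}$. Elements of $T$ act by the operators $\langle u\rangle f(g)=f(gu)$, where $u$ is viewed as a unit scalar matrix (any lift of its $\Delta_{\mathfrak s}$-component) at the $w\in\Sigma_p$ and at the chosen $w$ above $\mathfrak s$. A character $\alpha:T\to R^\times$ is said to have weight $k$ and level $n$ if $\alpha(u)=\prod_\sigma\sigma(u)^{k_\sigma}$ for all $u\in\prod_{v\mid p}(1+p^n\mathfrak o_v)$. Let $M_k^{\mathrm{ord}}(K_1^n,\alpha,R)$ be the module of $f\in M_k(K_1^n,R)$ with $\langle u\rangle f=\alpha(u)f$ for $u\in T$ that are ordinary, i.e. fixed by $e=\lim_r(U_{k,p}S)^{r!}$ ($p$-adic limit, uniform in $g$). **Pairings.** Let $k!=\prod_\sigma k_\sigma!$. On $L_k(R[1/k!])$ let $\langle\cdot,\cdot\rangle_k$ be the tensor product over $\sigma$ of the bilinear forms $\langle X^iY^{k_\sigma-i},X^jY^{k_\sigma-j}\rangle=(-1)^i\delta_{i,k_\sigma-j}\binom{k_\sigma}{i}^{-1}$,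 and let $(P,Q)_k=\langle P((X,Y)w),Q\rangle_k$ with $w=\begin{pmatrix}0&-1\\1&0\end{pmatrix}$. Let $\tau_n=\mathrm{diag}(p^n,1)$ at all $w\in\Sigma_p$, and let $\tau_n(\mathfrak s)\in G_1(\mathbb A_{F,f})$ have components $\tau_n$ at the $w\in\Sigma_p$, $\mathrm{diag}(\varpi_v,1)^{\mathrm{val}_v(\mathfrak s)}$ at the chosen $w$ above $v\mid\mathfrak s$, and $1$ elsewhere. For $f_1,f_2\in M_k^{\mathrm{ord}}(K_1^n,\alpha,R)$ put $$(f_1,f_2)_n=k(p^n,1)\sum_{g\in G_1(F)\backslash G_1(\mathbb A_{F,f})/K_0^n}\big(f_1(g),\rho_k(\tau_n)f_2(\bar g\,\tau_n(\mathfrak s))\big)_k\ \in R[1/k!].$$ **$p$-adic forms.** Let $V_p(G_1,K)=\varprojlim_m\varinjlim_n\{f:G_1(F)\backslash G_1(\mathbb A_{F,f})/K_1^n\to\mathcal O/p^m\}$, viewed as functions with values in $\mathcal O$. For $\alpha:T\to\mathcal O^\times$ let $V_p^{\mathrm{ord}}(G_1,K,\alpha)$ be the submodule of $f$ with $\langle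 u\rangle f=\alpha(u)f$ for $u\in T$ that are fixed by $\lim_r(U_pS)^{r!}$, where $U_pf(g)=\sum_{b\in\mathfrak o/p}f\big(g\begin{pmatrix}p&b\\0&1\end{pmatrix}_p\big)$. Let $\beta_k(f)$ be the function sending $g$ to the coefficient of $\prod_\sigma X_\sigma^{k_\sigma}$ in $f(g)$. **Proposition.** 1. Let $R$ be a $p$-adically complete $\mathcal O$-algebra (separatedness included), and let $\alpha:T\to R^\times$ have weight $k$ and level $n_0\ge1$. Then for all $n\ge n_0$ the operator $U_{k,p}$ is bijective on $M_k^{\mathrm{ord}}(K_1^n,\alpha,R)$. For all $f_1,f_2\in M_k^{\mathrm{ord}}(K_1^{n_0},\alpha,R)$ the value $(f_1,U_{k,p}^{-n}f_2)_n$ lies in (the image in $R[1/k!]$ of) $R$ and is the same for all $n\ge n_0$. 2. Let $\alpha:T\to\mathcal O^\times$ be a character that has some weight and some level $\ge1$. Then there is an $\mathcal O$-bilinear symmetric pairing $$\mathbf B:V_p^{\mathrm{ord}}(G_1,K,\alpha)\times V_p^{\mathrm{ord}}(G_1,K,\alpha)\to\mathcal O$$ that is non-degenerate ($\mathbf B(f,\cdot)=0$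 implies $f=0$), such that for every weight $k$ and every $n\ge1$ for which $\alpha$ has weight $k$ and level $n$, and all $f_1,f_2\in M_k^{\mathrm{ord}}(K_1^n,\alpha,\mathcal O)$, one has $\beta_k(f_1),\beta_k(f_2)\in V_p^{\mathrm{ord}}(G_1,K,\alpha)$ and $$\mathbf B(\beta_k(f_1),\beta_k(f_2))=(f_1,U_{k,p}^{-n}f_2)_n .$$ -/

import Mathlib

open scoped NumberField TensorProduct Matrix Nat RestrictedProduct
open IsDedekindDomain

namespace HidaU2

noncomputable section

/-! ### Unitary groups in two variables -/

/-- The group of `g ∈ GL₂(A)` with `g * g^* = 1`, where `g^*` is the transpose of `c(g)`. -/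
def unitary2 {A : Type*} [CommRing A] (c : A →+* A) : Subgroup (GL (Fin 2) A) where
  carrier := {g | (g : Matrix (Fin 2) (Fin 2) A) * ((g : Matrix (Fin 2) (Fin 2) A).map c)ᵀ = 1}
  one_mem' := by simp [Matrix.map_one]
  mul_mem' := by
    intro a b ha hb
    simp only [Set.mem_ofPred_eq] at ha hb ⊢
    rw [Units.val_mul, Matrix.map_mul, Matrix.transpose_mul, Matrix.mul_assoc,
      ← Matrix.mul_assoc (b : Matrix (Fin 2) (Fin 2) A), hb, Matrix.one_mul, ha]
  inv_mem' := by
    intro a ha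
    simp only [Set.mem_ofPred_eq] at ha ⊢
    have h1 : ((a : Matrix (Fin 2) (Fin 2) A).map c)ᵀ * (a : Matrix (Fin 2) (Fin 2) A) = 1 :=
      mul_eq_one_comm.mp ha
    have h2 : ((a⁻¹ : GL (Fin 2) A) : Matrix (Fin 2) (Fin 2) A)
        = ((a : Matrix (Fin 2) (Fin 2) A).map c)ᵀ := by
      rw [← mul_one ((a : Matrix (Fin 2) (Fin 2) A).map c)ᵀ, ← Units.mul_inv a,
        ← Matrix.mul_assoc, h1, one_mul]
    have h3 : (((a⁻¹ : GL (Fin 2) A) : Matrix (Fin 2) (Fin 2) A).map c)ᵀ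
        * ((a : Matrix (Fin 2) (Fin 2) A).map c)ᵀ = 1 := by
      rw [← Matrix.transpose_mul, ← Matrix.map_mul, Units.mul_inv]
      simp [Matrix.map_one]
    rw [h2] at h3 ⊢
    exact mul_eq_one_comm.mp h3

/-- Entrywise conjugation `g ↦ c(g)` on the unitary group. -/
def unitary2Bar {A : Type*} [CommRing A] (c : A →+* A) : unitary2 c →* unitary2 c where
  toFun g := ⟨Matrix.GeneralLinearGroup.map c g.1, by
    have h : (g.1 : Matrix (Fin 2) (Fin 2) A) * ((g.1 : Matrix (Fin 2) (Fin 2) A).map c)ᵀ = 1 :=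
      g.2
    have h2 := congrArg (fun M : Matrix (Fin 2) (Fin 2) A => M.map c) h
    simp only [Matrix.map_mul] at h2
    change ((g.1 : Matrix (Fin 2) (Fin 2) A).map c)
      * (((g.1 : Matrix (Fin 2) (Fin 2) A).map c).map c)ᵀ = 1
    rw [← Matrix.transpose_map]
    simpa [Matrix.map_one] using h2⟩
  map_one' := by ext1; simp
  map_mul' a b := by ext1; simp

/-- The congruence subgroup of `g ∈ GL₂(A)` congruent to an upper triangular matrix with
upper left entry `1` modulo the ideal `J`. -/
def Gamma1 {A : Type*} [CommRing A] (J : Ideal A) : Subgroup (GL (Fin 2) A) where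
  carrier := {g | g 0 0 - 1 ∈ J ∧ g 1 0 ∈ J}
  one_mem' := by simp
  mul_mem' := by
    rintro a b ⟨ha, ha'⟩ ⟨hb, hb'⟩
    simp only [Set.mem_ofPred_eq, Units.val_mul, Matrix.mul_apply, Fin.sum_univ_two]
    constructor
    · have : a 0 0 * b 0 0 + a 0 1 * b 1 0 - 1
        = (a 0 0 - 1) * b 0 0 + (b 0 0 - 1) + a 0 1 * b 1 0 := by ring
      rw [this]
      exact J.add_mem (J.add_mem (J.mul_mem_right _ ha) hb) (J.mul_mem_left _ hb')
    · exact J.add_mem (J.mul_mem_right _ ha') (J.mul_mem_left _ hb')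
  inv_mem' := by
    rintro a ⟨ha, ha'⟩
    have h := Units.inv_mul a
    have h00 := congrFun (congrFun h 0) 0
    have h10 := congrFun (congrFun h 1) 0
    simp only [Matrix.mul_apply, Fin.sum_univ_two, Matrix.one_apply_eq] at h00 h10
    rw [Matrix.one_apply_ne (by decide)] at h10
    set b := (a⁻¹ : GL (Fin 2) A)
    simp only [Set.mem_ofPred_eq]
    constructor
    · have : b 0 0 - 1 = -(b 0 0 * (a 0 0 - 1)) - b 0 1 * a 1 0 := by linear_combination h00
      rw [this]
      exact J.sub_mem (J.neg_mem (J.mul_mem_left _ ha)) (J.mul_mem_left _ ha')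
    · have : b 1 0 = -(b 1 0 * (a 0 0 - 1)) - b 1 1 * a 1 0 := by linear_combination h10
      rw [this]
      exact J.sub_mem (J.neg_mem (J.mul_mem_left _ ha)) (J.mul_mem_left _ ha')

theorem Gamma1_mono {A : Type*} [CommRing A] {I J : Ideal A} (h : I ≤ J) : Gamma1 I ≤ Gamma1 J :=
  fun _ hg => ⟨h hg.1, h hg.2⟩

/-- The congruence subgroup of `g ∈ GL₂(A)` that are upper triangular modulo the ideal `J`. -/
def Gamma0 {A : Type*} [CommRing A] (J : Ideal A) : Subgroup (GL (Fin 2) A) where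
  carrier := {g | g 1 0 ∈ J}
  one_mem' := by simp
  mul_mem' := by
    intro a b ha hb
    simp only [Set.mem_ofPred_eq, Units.val_mul, Matrix.mul_apply, Fin.sum_univ_two] at *
    exact J.add_mem (J.mul_mem_right _ ha) (J.mul_mem_left _ hb)
  inv_mem' := by
    intro a ha
    simp only [Set.mem_ofPred_eq, Matrix.coe_units_inv, Matrix.inv_def, Matrix.adjugate_fin_two,
      Matrix.smul_apply, smul_eq_mul] at *
    exact J.mul_mem_left _ (by simpa using ha)

/-! ### Local groups -/

section Local

variable {F K : Type*} [Field F] [NumberField F] [Field K] [NumberField K] [Algebra F K]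

/-- `K_v = F_v ⊗_F K`. -/
abbrev LocK (K : Type*) [Field K] [Algebra F K] (v : HeightOneSpectrum (𝓞 F)) : Type _ :=
  v.adicCompletion F ⊗[F] K

/-- Conjugation on `K_v`. -/
def locConj (c : K ≃ₐ[F] K) (v : HeightOneSpectrum (𝓞 F)) : LocK K v →+* LocK K v :=
  (Algebra.TensorProduct.map (AlgHom.id (v.adicCompletion F) (v.adicCompletion F))
    (c : K →ₐ[F] K)).toRingHom

/-- The image of `𝓞_v ⊗ 𝓞_K` in `K_v`. -/
def locInt (K : Type*) [Field K] [NumberField K] [Algebra F K] (v : HeightOneSpectrum (𝓞 F)) :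
    Subring (LocK K v) :=
  Subring.closure
    (Set.range (fun x : v.adicCompletionIntegers F => (x : v.adicCompletion F) ⊗ₜ[F] (1 : K)) ∪
      Set.range (fun y : 𝓞 K => (1 : v.adicCompletion F) ⊗ₜ[F] (y : K)))

/-- `G₁(F_v)`. -/
abbrev G1loc (c : K ≃ₐ[F] K) (v : HeightOneSpectrum (𝓞 F)) : Subgroup (GL (Fin 2) (LocK K v)) :=
  unitary2 (locConj c v)

/-- `K_v⁰`, the stabilizer of the lattice `(𝓞_K ⊗ 𝓞_v)²` of row vectors. -/
def K0loc (c : K ≃ₐ[F] K) (v : HeightOneSpectrum (𝓞 F)) : Subgroup (G1loc c v) :=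
  ((Matrix.GeneralLinearGroup.map (n := Fin 2) (locInt K v).subtype).range).subgroupOf (G1loc c v)

theorem locConj_mem {c : K ≃ₐ[F] K} {v : HeightOneSpectrum (𝓞 F)} {x : LocK K v}
    (hx : x ∈ locInt K v) : locConj c v x ∈ locInt K v := by
  have h : locInt K v ≤ (locInt K v).comap (locConj c v) := by
    refine Subring.closure_le.mpr ?_
    rintro _ (⟨a, rfl⟩ | ⟨y, rfl⟩)
    · refine Subring.subset_closure (Or.inl ⟨a, ?_⟩)
      simp [locConj]
    · refine Subring.subset_closure (Or.inr ⟨⟨c y, ?_⟩, ?_⟩)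
      · exact y.2.map ((c : K →ₐ[F] K).restrictScalars ℤ)
      · simp only [locConj, AlgHom.toRingHom_eq_coe, RingHom.coe_coe,
          Algebra.TensorProduct.map_tmul, map_one]
        rfl
  exact h hx

/-- The entrywise conjugation of `G₁(F_v)`. -/
abbrev locBar (c : K ≃ₐ[F] K) (v : HeightOneSpectrum (𝓞 F)) : G1loc c v →* G1loc c v :=
  unitary2Bar (locConj c v)

theorem locBar_mem {c : K ≃ₐ[F] K} {v : HeightOneSpectrum (𝓞 F)} {g : G1loc c v}
    (hg : g ∈ K0loc c v) : locBar c v g ∈ K0loc c v := by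
  obtain ⟨A, hA⟩ := hg
  let cc : locInt K v →+* locInt K v :=
    ((locConj c v).comp (locInt K v).subtype).codRestrict (locInt K v)
      (fun x => locConj_mem x.2)
  refine ⟨Matrix.GeneralLinearGroup.map cc A, ?_⟩
  change _ = Matrix.GeneralLinearGroup.map (locConj c v) ((G1loc c v).subtype g)
  rw [← hA]
  ext i j
  rfl

/-- For a place `w` of `K` above a split place `v`, given by the corresponding embedding
`ι : K → F_v` over `F`, the projection `K_v → K_w = F_v`. -/
def splitHom {v : HeightOneSpectrum (𝓞 F)} (ι : K →ₐ[F] v.adicCompletion F) :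
    LocK K v →ₐ[v.adicCompletion F] v.adicCompletion F :=
  Algebra.TensorProduct.lift (AlgHom.id (v.adicCompletion F) (v.adicCompletion F)) ι
    (fun _ _ => Commute.all _ _)

/-- The homomorphism `ι_w : G₁(F_v) → GL₂(F_v)`. -/
def iw (c : K ≃ₐ[F] K) {v : HeightOneSpectrum (𝓞 F)} (ι : K →ₐ[F] v.adicCompletion F) :
    G1loc c v →* GL (Fin 2) (v.adicCompletion F) :=
  (Matrix.GeneralLinearGroup.map (splitHom ι).toRingHom).comp (G1loc c v).subtype

/-- The homomorphism `K_v → F_v × F_v` given by the two places above a split `v`. -/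
def splitProd (c : K ≃ₐ[F] K) {v : HeightOneSpectrum (𝓞 F)} (ι : K →ₐ[F] v.adicCompletion F) :
    LocK K v →ₐ[v.adicCompletion F] (v.adicCompletion F × v.adicCompletion F) :=
  (splitHom ι).prod (splitHom (ι.comp (c : K →ₐ[F] K)))

theorem splitProd_bijective (h2 : Module.finrank F K = 2) {c : K ≃ₐ[F] K} (hc : c ≠ 1)
    {v : HeightOneSpectrum (𝓞 F)} (ι : K →ₐ[F] v.adicCompletion F) :
    Function.Bijective (splitProd c ι) := by
  have hfd : Module.Finite F K := Module.finite_of_finrank_pos (by omega)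
  have hs : Function.Surjective (splitProd c ι) := by
    obtain ⟨θ, hθ⟩ : ∃ θ, c θ ≠ θ := by
      by_contra h
      push Not at h
      exact hc (AlgEquiv.ext h)
    have hne : ι θ - ι (c θ) ≠ 0 := by
      rw [sub_ne_zero]
      exact fun h => hθ (ι.toRingHom.injective h).symm
    rintro ⟨x, y⟩
    refine ⟨((x * -ι (c θ) + y * ι θ) / (ι θ - ι (c θ))) ⊗ₜ[F] (1 : K)
      + ((x - y) / (ι θ - ι (c θ))) ⊗ₜ[F] θ, ?_⟩
    refine Prod.ext ?_ ?_
    · simp only [splitProd, splitHom, AlgHom.prod_apply, map_add, Algebra.TensorProduct.lift_tmul,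
        AlgHom.id_apply, map_one, mul_one, Prod.fst_add]
      field_simp
      ring
    · simp only [splitProd, splitHom, AlgHom.prod_apply, map_add, Algebra.TensorProduct.lift_tmul,
        AlgHom.id_apply, map_one, mul_one, AlgHom.comp_apply, Prod.snd_add]
      change _ + _ * ι (c θ) = y
      field_simp
      ring
  refine ⟨?_, hs⟩
  have hdim : Module.finrank (v.adicCompletion F) (LocK K v)
      = Module.finrank (v.adicCompletion F) (v.adicCompletion F × v.adicCompletion F) := by
    rw [Module.finrank_baseChange, h2, Module.finrank_prod, Module.finrank_self]
  exact (LinearMap.injective_iff_surjective_of_finrank_eq_finrank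
    (f := (splitProd c ι).toLinearMap) hdim).mpr hs

theorem splitProd_conj (h2 : Module.finrank F K = 2) {c : K ≃ₐ[F] K}
    {v : HeightOneSpectrum (𝓞 F)} (ι : K →ₐ[F] v.adicCompletion F) (x : LocK K v) :
    splitProd c ι (locConj c v x) = (splitProd c ι x).swap := by
  have hcc : ∀ y, c (c y) = y := by
    classical
    intro y
    have : Fintype.card (K ≃ₐ[F] K) ≤ 2 := by
      rw [← h2]
      have hfd : Module.Finite F K := Module.finite_of_finrank_pos (by omega)
      exact AlgEquiv.card_le
    by_cases h1 : c = 1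
    · simp [h1]
    · by_contra h
      have hcard : ({1, c, c * c} : Finset (K ≃ₐ[F] K)).card ≤ 2 :=
        (Finset.card_le_univ _).trans this
      have hne : c * c ≠ 1 := fun h' => h (by simpa using congrArg (fun f => f y) h')
      rw [Finset.card_insert_of_notMem (by simp [Ne.symm h1, Ne.symm hne]),
        Finset.card_insert_of_notMem (by simpa using h1), Finset.card_singleton] at hcard
      omega
  induction x using TensorProduct.induction_on with
  | zero => simp
  | tmul a b => refine Prod.ext ?_ ?_ <;> simp [splitProd, splitHom, locConj, hcc]
  | add x y hx hy => simp [map_add, hx, hy]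

/-- `K_v ≃ F_v × F_v` at a split place. -/
def splitEquiv (h2 : Module.finrank F K = 2) {c : K ≃ₐ[F] K} (hc : c ≠ 1)
    {v : HeightOneSpectrum (𝓞 F)} (ι : K →ₐ[F] v.adicCompletion F) :
    LocK K v ≃ₐ[v.adicCompletion F] (v.adicCompletion F × v.adicCompletion F) :=
  AlgEquiv.ofBijective (splitProd c ι) (splitProd_bijective h2 hc ι)

/-- The element of `GL₂(K_v)` with components `g` and `h` under `K_v ≃ F_v × F_v`. -/
def pairGL (h2 : Module.finrank F K = 2) {c : K ≃ₐ[F] K} (hc : c ≠ 1)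
    {v : HeightOneSpectrum (𝓞 F)} (ι : K →ₐ[F] v.adicCompletion F)
    (g h : Matrix (Fin 2) (Fin 2) (v.adicCompletion F)) : Matrix (Fin 2) (Fin 2) (LocK K v) :=
  Matrix.of fun i j => (splitEquiv h2 hc ι).symm (g i j, h i j)

theorem pairGL_mul (h2 : Module.finrank F K = 2) {c : K ≃ₐ[F] K} (hc : c ≠ 1)
    {v : HeightOneSpectrum (𝓞 F)} (ι : K →ₐ[F] v.adicCompletion F)
    (g h g' h' : Matrix (Fin 2) (Fin 2) (v.adicCompletion F)) :
    pairGL h2 hc ι g h * pairGL h2 hc ι g' h' = pairGL h2 hc ι (g * g') (h * h') := by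
  ext i j
  simp only [pairGL, Matrix.mul_apply, Matrix.of_apply, Fin.sum_univ_two, ← map_mul, ← map_add,
    Prod.mk_mul_mk, Prod.mk_add_mk]

theorem pairGL_one (h2 : Module.finrank F K = 2) {c : K ≃ₐ[F] K} (hc : c ≠ 1)
    {v : HeightOneSpectrum (𝓞 F)} (ι : K →ₐ[F] v.adicCompletion F) :
    pairGL h2 hc ι 1 1 = 1 := by
  ext i j
  by_cases h : i = j
  · subst h
    simp only [pairGL, Matrix.of_apply, Matrix.one_apply_eq]
    exact map_one _
  · simp only [pairGL, Matrix.of_apply, Matrix.one_apply_ne h]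
    exact map_zero _

theorem pairGL_conj (h2 : Module.finrank F K = 2) {c : K ≃ₐ[F] K} (hc : c ≠ 1)
    {v : HeightOneSpectrum (𝓞 F)} (ι : K →ₐ[F] v.adicCompletion F)
    (g h : Matrix (Fin 2) (Fin 2) (v.adicCompletion F)) :
    ((pairGL h2 hc ι g h).map (locConj c v))ᵀ = pairGL h2 hc ι hᵀ gᵀ := by
  ext i j
  apply (splitEquiv h2 hc ι).injective
  simp only [pairGL, Matrix.transpose_apply, Matrix.map_apply, Matrix.of_apply,
    AlgEquiv.apply_symm_apply]
  have := splitProd_conj (c := c) h2 ι ((splitEquiv h2 hc ι).symm (g j i, h j i))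
  change splitProd c ι _ = _
  rw [this]
  change ((splitEquiv h2 hc ι) _).swap = _
  rw [AlgEquiv.apply_symm_apply]
  rfl

/-- The element of `G₁(F_v)` whose component at `w` is `g ∈ GL₂(F_v)`
(and whose component at the conjugate place is `g⁻ᵀ`). -/
def ofGL (h2 : Module.finrank F K = 2) {c : K ≃ₐ[F] K} (hc : c ≠ 1)
    {v : HeightOneSpectrum (𝓞 F)} (ι : K →ₐ[F] v.adicCompletion F)
    (g : GL (Fin 2) (v.adicCompletion F)) : G1loc c v :=
  ⟨{ val := pairGL h2 hc ι (g : Matrix _ _ _) ((g⁻¹ : GL (Fin 2) _) : Matrix _ _ _)ᵀ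
     inv := pairGL h2 hc ι ((g⁻¹ : GL (Fin 2) _) : Matrix _ _ _) (g : Matrix _ _ _)ᵀ
     val_inv := by
      rw [pairGL_mul, ← Matrix.transpose_mul, Units.mul_inv, Matrix.transpose_one, pairGL_one]
     inv_val := by
      rw [pairGL_mul, ← Matrix.transpose_mul, Units.inv_mul, Matrix.transpose_one, pairGL_one] }, by
    change pairGL h2 hc ι _ _ * ((pairGL h2 hc ι _ _).map (locConj c v))ᵀ = 1
    rw [pairGL_conj, pairGL_mul, Matrix.transpose_transpose, Units.mul_inv,
      ← Matrix.transpose_mul, Units.mul_inv, Matrix.transpose_one, pairGL_one]⟩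

theorem iw_ofGL (h2 : Module.finrank F K = 2) {c : K ≃ₐ[F] K} (hc : c ≠ 1)
    {v : HeightOneSpectrum (𝓞 F)} (ι : K →ₐ[F] v.adicCompletion F)
    (g : GL (Fin 2) (v.adicCompletion F)) : iw c ι (ofGL h2 hc ι g) = g := by
  refine Units.ext (Matrix.ext fun i j => ?_)
  change (splitEquiv h2 hc ι ((splitEquiv h2 hc ι).symm _)).1 = _
  rw [AlgEquiv.apply_symm_apply]

end Local

/-! ### The adelic group and its level subgroups -/

section Global

variable {F K : Type*} [Field F] [NumberField F] [Field K] [NumberField K] [Algebra F K]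

theorem finite_places {I : Ideal (𝓞 F)} (hI : I ≠ ⊥) :
    {v : HeightOneSpectrum (𝓞 F) | I ≤ v.asIdeal}.Finite := by
  simpa only [Ideal.dvd_iff_le] using Ideal.finite_factors (I := I) hI

/-- `G₁(𝔸_{F,f})`, the restricted product of the `G₁(F_v)` with respect to the `K_v⁰`. -/
abbrev G1Adelic (c : K ≃ₐ[F] K) : Type _ :=
  Πʳ v : HeightOneSpectrum (𝓞 F), [G1loc c v, K0loc c v]

/-- The element of `G₁(𝔸_{F,f})` with `w`-component `g v` at the places `v ∣ I`, where `w` is the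
place over `v` given by `ι`, and with component `1` at all other places. -/
def place (h2 : Module.finrank F K = 2) {c : K ≃ₐ[F] K} (hc : c ≠ 1) {I : Ideal (𝓞 F)}
    (hI : I ≠ ⊥)
    (ι : ∀ v : {v : HeightOneSpectrum (𝓞 F) // I ≤ v.asIdeal}, K →ₐ[F] v.1.adicCompletion F)
    (g : ∀ v : {v : HeightOneSpectrum (𝓞 F) // I ≤ v.asIdeal},
      GL (Fin 2) (v.1.adicCompletion F)) : G1Adelic c :=
  open Classical in
  ⟨fun v => if h : I ≤ v.asIdeal then ofGL h2 hc (ι ⟨v, h⟩) (g ⟨v, h⟩) else 1, by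
    refine Filter.eventually_cofinite.mpr ((finite_places hI).subset ?_)
    intro v hv
    by_contra h
    refine hv ?_
    change ¬ (I ≤ v.asIdeal) at h
    simp only [h, dif_neg, not_false_eq_true]
    exact one_mem _⟩

/-- Entrywise conjugation on `G₁(𝔸_{F,f})`. -/
def bar {c : K ≃ₐ[F] K} (g : G1Adelic c) : G1Adelic c :=
  ⟨fun v => locBar c v (g v), g.2.mono fun _ hv => locBar_mem hv⟩

/-- The ideal of `𝓞_v` generated by an ideal of `𝓞_F`. -/
abbrev locIdeal (v : HeightOneSpectrum (𝓞 F)) (I : Ideal (𝓞 F)) :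
    Ideal (v.adicCompletionIntegers F) :=
  I.map (algebraMap (𝓞 F) (v.adicCompletionIntegers F))

/-- The inclusion `GL₂(𝓞_v) → GL₂(F_v)`. -/
abbrev intGL (v : HeightOneSpectrum (𝓞 F)) :
    GL (Fin 2) (v.adicCompletionIntegers F) →* GL (Fin 2) (v.adicCompletion F) :=
  Matrix.GeneralLinearGroup.map (v.adicCompletionIntegers F).subtype

/-- The quadratic extension `K/F`, the places `w` chosen above the places dividing `p` and the
auxiliary ideal `𝔰`, and the tame level. A place `w` of `K` above a place `v` of `F` that splits
in `K` is the same as an embedding over `F` of `K` into `F_v`; in particular the fields `wp` and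
`ws` force the places dividing `p𝔰` to split in `K`. -/
structure Datum (F K : Type*) [Field F] [NumberField F] [Field K] [NumberField K] [Algebra F K]
    (p : ℕ) where
  /-- `K` is quadratic over `F`. -/
  finrank_eq : Module.finrank F K = 2
  /-- The nontrivial element of `Gal(K/F)`. -/
  c : K ≃ₐ[F] K
  c_ne_one : c ≠ 1
  /-- `p` is a prime, unramified in `F`. -/
  prime : p.Prime
  unramified : ∀ v : HeightOneSpectrum (𝓞 F), ¬ v.asIdeal ^ 2 ∣ Ideal.span {(p : 𝓞 F)}
  /-- The places of `Σ_p`, one above each place of `F` above `p`. -/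
  wp : ∀ v : {v : HeightOneSpectrum (𝓞 F) // Ideal.span {(p : 𝓞 F)} ≤ v.asIdeal},
    K →ₐ[F] v.1.adicCompletion F
  /-- The ideal `𝔰`, prime to `p`. -/
  s : Ideal (𝓞 F)
  s_ne_bot : s ≠ ⊥
  s_coprime : IsCoprime s (Ideal.span {(p : 𝓞 F)})
  /-- The places dividing `𝔣`, one above each place of `F` dividing `𝔰`. -/
  ws : ∀ v : {v : HeightOneSpectrum (𝓞 F) // s ≤ v.asIdeal}, K →ₐ[F] v.1.adicCompletion F
  /-- Uniformizers at the places dividing `𝔰`. -/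
  unif : ∀ v : {v : HeightOneSpectrum (𝓞 F) // s ≤ v.asIdeal}, v.1.adicCompletionIntegers F
  unif_irreducible : ∀ v, Irreducible (unif v)
  /-- The components `K_v` of the tame level subgroup `K(𝔫_∘) = ∏ K_v`. -/
  Kv : ∀ v : HeightOneSpectrum (𝓞 F), Subgroup (G1loc c v)
  Kv_le : ∀ v, Kv v ≤ K0loc c v
  /-- `K_v` is open: it contains a principal congruence subgroup. -/
  Kv_open : ∀ v, ∃ r : 𝓞 F, r ≠ 0 ∧ ∀ g : G1loc c v,
    (∀ i j, ∃ y ∈ locInt K v, (g : GL (Fin 2) (LocK K v)) i j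
      - (1 : Matrix (Fin 2) (Fin 2) (LocK K v)) i j
        = algebraMap F (LocK K v) (r : F) * y) → g ∈ Kv v
  Kv_bar : ∀ v, ∀ g ∈ Kv v, locBar c v g ∈ Kv v
  Kv_almost : {v | Kv v ≠ K0loc c v}.Finite
  Kv_p : ∀ v : HeightOneSpectrum (𝓞 F), Ideal.span {(p : 𝓞 F)} ≤ v.asIdeal → Kv v = K0loc c v
  Kv_s : ∀ v : HeightOneSpectrum (𝓞 F), s ≤ v.asIdeal → Kv v = K0loc c v

namespace Datum

variable {p : ℕ} (D : Datum F K p)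

/-- `G₁(𝔸_{F,f})`. -/
abbrev G : Type _ := G1Adelic D.c

/-- The places of `F` above `p`. -/
abbrev Sp (_D : Datum F K p) : Type _ := {v : HeightOneSpectrum (𝓞 F) // Ideal.span {(p : 𝓞 F)} ≤ v.asIdeal}

/-- The places of `F` dividing `𝔰`. -/
abbrev Ss : Type _ := {v : HeightOneSpectrum (𝓞 F) // D.s ≤ v.asIdeal}

/-- The subgroup `G₁(F)` of `G₁(𝔸_{F,f})`. -/
def rational : Subgroup D.G where
  carrier := {x | ∃ γ : unitary2 (D.c : K →+* K), ∀ v,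
    ((x v : G1loc D.c v) : GL (Fin 2) (LocK K v))
      = Matrix.GeneralLinearGroup.map
          (Algebra.TensorProduct.includeRight : K →ₐ[F] LocK K v).toRingHom γ.1}
  one_mem' := ⟨1, fun v => by simp⟩
  mul_mem' := by
    rintro x y ⟨γ, h⟩ ⟨δ, h'⟩
    exact ⟨γ * δ, fun v => by simp [h v, h' v]⟩
  inv_mem' := by
    rintro x ⟨γ, h⟩
    exact ⟨γ⁻¹, fun v => by simp [h v]⟩

/-- The subgroup `K(𝔫_∘) = ∏ K_v`. -/
def levelCirc : Subgroup D.G :=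
  ⨅ v, (D.Kv v).comap (RestrictedProduct.evalMonoidHom _ v)

/-- The condition that `K(𝔫_∘)` is sufficiently small. -/
def SufficientlySmall : Prop :=
  ∀ t : D.G, ∀ γ ∈ D.rational, t⁻¹ * γ * t ∈ D.levelCirc → γ = 1

/-- The component at the chosen place `w` above a place `v` dividing `p`. -/
def atP (v : D.Sp) : D.G →* GL (Fin 2) (v.1.adicCompletion F) :=
  (iw D.c (D.wp v)).comp (RestrictedProduct.evalMonoidHom _ v.1)

/-- The component at the chosen place `w` above a place `v` dividing `𝔰`. -/
def atS (v : D.Ss) : D.G →* GL (Fin 2) (v.1.adicCompletion F) :=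
  (iw D.c (D.ws v)).comp (RestrictedProduct.evalMonoidHom _ v.1)

/-- The subgroup `K = K(𝔫)`. -/
def level : Subgroup D.G :=
  D.levelCirc ⊓ ⨅ v : D.Ss, ((Gamma1 (locIdeal v.1 D.s)).map (intGL v.1)).comap (D.atS v)

/-- The subgroup `K₁ⁿ(𝔫)`. -/
def K1 (n : ℕ) : Subgroup D.G :=
  D.level ⊓ ⨅ v : D.Sp,
    ((Gamma1 (locIdeal v.1 (Ideal.span {(p : 𝓞 F) ^ n}))).map (intGL v.1)).comap (D.atP v)

/-- The subgroup `K₀ⁿ(𝔫)`. -/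
def K0 (n : ℕ) : Subgroup D.G :=
  D.level ⊓ ⨅ v : D.Sp,
    ((Gamma0 (locIdeal v.1 (Ideal.span {(p : 𝓞 F) ^ n}))).map (intGL v.1)).comap (D.atP v)

theorem K1_anti {n n' : ℕ} (h : n ≤ n') : D.K1 n' ≤ D.K1 n := by
  refine inf_le_inf le_rfl (iInf_mono fun v => Subgroup.comap_mono (Subgroup.map_mono
    (Gamma1_mono (Ideal.map_mono ?_))))
  rw [Ideal.span_singleton_le_span_singleton]
  exact pow_dvd_pow _ h

theorem span_p_ne_bot (D : Datum F K p) : Ideal.span {(p : 𝓞 F)} ≠ ⊥ := by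
  simpa using D.prime.ne_zero

theorem p_ne_zero (D : Datum F K p) (v : HeightOneSpectrum (𝓞 F)) : (p : v.adicCompletion F) ≠ 0 := by
  have h : (p : F) ≠ 0 := by exact_mod_cast D.prime.ne_zero
  intro h'
  apply h
  apply (algebraMap F (v.adicCompletion F)).injective
  simpa using h'

/-- The element of `G₁(𝔸_{F,f})` with given components at the `w ∈ Σ_p` and `1` away from `p`. -/
def placeP (g : ∀ v : D.Sp, GL (Fin 2) (v.1.adicCompletion F)) : D.G :=
  place D.finrank_eq D.c_ne_one D.span_p_ne_bot D.wp g

/-- The element of `G₁(𝔸_{F,f})` with given components at the `w ∣ 𝔣` and `1` away from `𝔰`. -/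
def placeS (g : ∀ v : D.Ss, GL (Fin 2) (v.1.adicCompletion F)) : D.G :=
  place D.finrank_eq D.c_ne_one D.s_ne_bot D.ws g

/-- Scalar matrices with unit entries in the components at `p` and at `𝔰`. -/
def scalar (u : ∀ v : D.Sp, (v.1.adicCompletionIntegers F)ˣ)
    (t : ∀ v : D.Ss, (v.1.adicCompletionIntegers F)ˣ) : D.G :=
  D.placeP (fun v => intGL v.1 (Units.map (Matrix.scalar (Fin 2)).toMonoidHom (u v)))
    * D.placeS (fun v => intGL v.1 (Units.map (Matrix.scalar (Fin 2)).toMonoidHom (t v)))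

/-- The scalar matrix `p` at all places above `p`. -/
def scalarP : D.G :=
  D.placeP (fun v => Matrix.GeneralLinearGroup.mkOfDetNeZero
    (K := v.1.adicCompletion F)
    !![(p : v.1.adicCompletion F), 0; 0, (p : v.1.adicCompletion F)]
      (by simpa using D.p_ne_zero v.1))

/-- The matrix with rows `(p, b)` and `(0, 1)` at all places above `p`. -/
def upper (b : 𝓞 F) : D.G :=
  D.placeP (fun v => Matrix.GeneralLinearGroup.mkOfDetNeZero
    (K := v.1.adicCompletion F)
    !![(p : v.1.adicCompletion F), algebraMap (𝓞 F) (v.1.adicCompletion F) b; 0, 1]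
      (by simpa using D.p_ne_zero v.1))

/-- The element `τ_n(𝔰)`: the matrix `diag(pⁿ, 1)` at the places `w ∈ Σ_p`, and
`diag(ϖ_v, 1)` to the power `val_v(𝔰)` at the places `w ∣ 𝔣`. -/
def tau (n : ℕ) : D.G :=
  D.placeP (fun v => Matrix.GeneralLinearGroup.mkOfDetNeZero
    (K := v.1.adicCompletion F)
    !![(p : v.1.adicCompletion F) ^ n, 0; 0, 1] (by simpa using fun h => absurd h (D.p_ne_zero v.1)))
  * D.placeS (fun v => Matrix.GeneralLinearGroup.mkOfDetNeZero
    (K := v.1.adicCompletion F)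
    !![(D.unif v : v.1.adicCompletion F), 0; 0, 1]
      (by simpa using (D.unif_irreducible v).ne_zero)
        ^ multiplicity v.1.asIdeal D.s)

/-! ### The coefficient representations -/

variable (O : Type*) [CommRing O]

/-- The index set `Σ`: pairs of a place `w ∈ Σ_p` and a homomorphism `𝓞_w = 𝓞_v → O`.
When `O` is the ring of integers of a `p`-adic field these homomorphisms are the restrictions of
the continuous embeddings of `K_w = F_v`. -/
abbrev Emb : Type _ := Σ v : D.Sp, (v.1.adicCompletionIntegers F →+* O)

/-- Polynomials in pairs of variables `X_σ = (σ, 0)`, `Y_σ = (σ, 1)` indexed by `σ ∈ Σ`. -/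
abbrev Poly (R : Type*) [CommRing R] : Type _ := MvPolynomial (D.Emb O × Fin 2) R

variable {O} {R : Type*} [CommRing R]

/-- The module `L_k(R)` for the weight `(k, 0)`: polynomials homogeneous of degree `k_σ` in
`X_σ, Y_σ` for each `σ`, that is the tensor product over `σ` of the modules of homogeneous binary
forms of degree `k_σ`. -/
def Lk (k : D.Emb O →₀ ℕ) : Submodule R (D.Poly O R) where
  carrier := {P | ∀ m, P.coeff m ≠ 0 → ∀ σ, m (σ, 0) + m (σ, 1) = k σ}
  zero_mem' := by simp
  add_mem' := by
    intro P Q hP hQ m hm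
    by_cases h : P.coeff m = 0
    · exact hQ m (by simpa [h] using hm)
    · exact hP m h
  smul_mem' := by
    intro a P hP m hm
    refine hP m fun h => hm ?_
    simp [h]

/-- The substitution `P(X, Y) ↦ P((X, Y) A)`, where `A` is a matrix for each `σ`. -/
def subst (A : D.Emb O → Matrix (Fin 2) (Fin 2) R) : D.Poly O R →ₐ[R] D.Poly O R :=
  MvPolynomial.aeval fun x =>
    ∑ i : Fin 2, MvPolynomial.X (x.1, i) * MvPolynomial.C (A x.1 i x.2)

section Rep

variable [Algebra O R]

/-- The matrices over `R` obtained by applying the `σ ∈ Σ` to matrices over the `𝓞_v`. -/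
def embMat (A : ∀ v : D.Sp, Matrix (Fin 2) (Fin 2) (v.1.adicCompletionIntegers F)) :
    D.Emb O → Matrix (Fin 2) (Fin 2) R :=
  fun σ => (A σ.1).map fun x => algebraMap O R (σ.2 x)

/-- The action `ρ_k(A)` of `A ∈ ∏ GL₂(𝓞_v)` on `L_k(R)`, given by `P(X, Y) ↦ P((X, Y) A⁻ᵀ)`. -/
def rho (A : ∀ v : D.Sp, GL (Fin 2) (v.1.adicCompletionIntegers F)) :
    D.Poly O R →ₐ[R] D.Poly O R :=
  D.subst (D.embMat fun v => (((A v)⁻¹ : GL (Fin 2) (v.1.adicCompletionIntegers F)) :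
    Matrix (Fin 2) (Fin 2) (v.1.adicCompletionIntegers F))ᵀ)

/-- The operator `(k, 0)(det A, 1) ρ_k(A)` on `L_k(R)` for integral matrices `A` with nonzero
determinants. Since `L_k` is homogeneous of degree `k` this is `P(X, Y) ↦ P((X, Y) (det A) A⁻ᵀ)`,
where `(det A) A⁻ᵀ` is the transpose of the adjugate of `A`. -/
def rhoNorm (A : ∀ v : D.Sp, Matrix (Fin 2) (Fin 2) (v.1.adicCompletionIntegers F)) :
    D.Poly O R →ₐ[R] D.Poly O R :=
  D.subst (D.embMat fun v => (A v).adjugateᵀ)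

end Rep

/-- The value `(k, 0)(u, u) = ∏ σ(u)^{k_σ}`. -/
def weightChar (k : D.Emb O →₀ ℕ) (u : ∀ v : D.Sp, (v.1.adicCompletionIntegers F)ˣ) : O :=
  k.prod fun σ a => σ.2 (u σ.1) ^ a

/-- `k! = ∏ k_σ!`. -/
def fact (k : D.Emb O →₀ ℕ) : ℕ := k.prod fun _ a => a !

/-- The pairing `⟨·, ·⟩_k` on `L_k`, the tensor product over `σ` of the pairings
`⟨X^i Y^(k-i), X^j Y^(k-j)⟩ = (-1)^i δ_{i, k-j} binom(k, i)⁻¹`. It is used over rings in which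
`k!` is invertible. -/
def angle (k : D.Emb O →₀ ℕ) (P Q : D.Poly O R) : R :=
  ∑ m ∈ P.support, (-1) ^ (k.sum fun σ _ => m (σ, 0)) * P.coeff m
    * Q.coeff (m.mapDomain (Prod.map id (Equiv.swap 0 1)))
    * Ring.inverse ((k.prod fun σ a => a.choose (m (σ, 0)) : ℕ) : R)

/-- The twisted pairing `(P, Q)_k = ⟨ρ^k(w) P, Q⟩_k`, where `w` has rows `(0, -1)` and `(1, 0)`
and `ρ^k(g) P (X, Y) = P((X, Y) g)`. -/
def twisted (k : D.Emb O →₀ ℕ) (P Q : D.Poly O R) : R :=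
  D.angle k (D.subst (fun _ => !![0, -1; 1, 0]) P) Q

/-! ### Algebraic modular forms and Hecke operators -/

section Forms

variable {M : Type*} [AddCommGroup M] [Module R M]

/-- The group `T(p⁰) × Δ_𝔰`. -/
abbrev Tor : Type _ :=
  (∀ v : D.Sp, (v.1.adicCompletionIntegers F)ˣ)
    × (∀ v : D.Ss, (v.1.adicCompletionIntegers F ⧸ locIdeal v.1 D.s)ˣ)

/-- The functions on which the operators `⟨u⟩`, `u ∈ T(p⁰) × Δ_𝔰`, act through `α`. -/
def nebentypus (α : D.Tor →* Rˣ) : Submodule R (D.G → M) where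
  carrier := {f | ∀ u t g, f (g * D.scalar u t)
    = ((α (u, fun v => Units.map (Ideal.Quotient.mk (locIdeal v.1 D.s)).toMonoidHom (t v)) : Rˣ)
        : R) • f g}
  zero_mem' := by simp
  add_mem' := by
    intro f f' hf hf' u t g
    simp [hf u t g, hf' u t g]
  smul_mem' := by
    intro a f hf u t g
    simp [hf u t g, smul_smul, mul_comm]

/-- The operator `f ↦ (g ↦ ∑_b act_b (f (g (p b; 0 1))))`, where `b` runs over representatives of
`𝓞_F / p = 𝓞_p / p`. -/
def hecke (act : 𝓞 F → M →ₗ[R] M) : Module.End R (D.G → M) :=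
  haveI : Finite (𝓞 F ⧸ Ideal.span {(p : 𝓞 F)}) :=
    Ideal.finiteQuotientOfFreeOfNeBot _ D.span_p_ne_bot
  letI := Fintype.ofFinite (𝓞 F ⧸ Ideal.span {(p : 𝓞 F)})
  { toFun := fun f g => ∑ b : 𝓞 F ⧸ Ideal.span {(p : 𝓞 F)},
      act (Quotient.out b) (f (g * D.upper (Quotient.out b)))
    map_add' := by
      intro f f'
      ext g
      simp [Finset.sum_add_distrib]
    map_smul' := by
      intro a f
      ext g
      simp [Finset.smul_sum] }

variable (R M) in
/-- The translation `f ↦ (g ↦ f (g p))` by the scalar matrix `p` at the places above `p`, which is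
the product of the operators `U_w^{(2)}` for `w ∈ Σ_p`. -/
def central : Module.End R (D.G → M) := LinearMap.funLeft R M fun g => g * D.scalarP

/-- The functions fixed by `e = lim T^{r!}`, the limit taken in the `p`-adic topology. -/
def ordinary (T : Module.End R (D.G → M)) : Submodule R (D.G → M) where
  carrier := {f | ∀ m : ℕ, ∃ r₀ : ℕ, ∀ r ≥ r₀, ∀ g,
    ∃ y : M, (T ^ r !) f g - f g = (p : R) ^ m • y}
  zero_mem' := fun m => ⟨0, fun r _ g => ⟨0, by simp⟩⟩
  add_mem' := by
    intro f f' hf hf' m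
    obtain ⟨r₁, h₁⟩ := hf m
    obtain ⟨r₂, h₂⟩ := hf' m
    refine ⟨max r₁ r₂, fun r hr g => ?_⟩
    obtain ⟨y₁, hy₁⟩ := h₁ r (le_of_max_le_left hr) g
    obtain ⟨y₂, hy₂⟩ := h₂ r (le_of_max_le_right hr) g
    refine ⟨y₁ + y₂, ?_⟩
    rw [smul_add, ← hy₁, ← hy₂, map_add, Pi.add_apply, Pi.add_apply]
    abel
  smul_mem' := by
    intro a f hf m
    obtain ⟨r₁, h₁⟩ := hf m
    refine ⟨r₁, fun r hr g => ?_⟩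
    obtain ⟨y₁, hy₁⟩ := h₁ r hr g
    refine ⟨a • y₁, ?_⟩
    rw [smul_comm, ← hy₁, map_smul, Pi.smul_apply, Pi.smul_apply, smul_sub]

end Forms

section AlgForms

variable [Algebra O R]

/-- The space `M_k(K₁ⁿ, R)` of algebraic modular forms of weight `(k, 0)` and level `K₁ⁿ`. -/
def forms (k : D.Emb O →₀ ℕ) (n : ℕ) : Submodule R (D.G → D.Poly O R) where
  carrier := {f | (∀ g, f g ∈ D.Lk k) ∧ (∀ γ ∈ D.rational, ∀ g, f (γ * g) = f g) ∧
    ∀ u ∈ D.K1 n, ∀ A : ∀ v : D.Sp, GL (Fin 2) (v.1.adicCompletionIntegers F),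
      (∀ v, intGL v.1 (A v) = D.atP v u) → ∀ g, f (g * u) = D.rho A⁻¹ (f g)}
  zero_mem' := by simp
  add_mem' := by
    rintro f f' ⟨h1, h2, h3⟩ ⟨h1', h2', h3'⟩
    refine ⟨fun g => add_mem (h1 g) (h1' g), fun γ hγ g => ?_, fun u hu A hA g => ?_⟩
    · simp [h2 γ hγ g, h2' γ hγ g]
    · simp [h3 u hu A hA g, h3' u hu A hA g]
  smul_mem' := by
    rintro a f ⟨h1, h2, h3⟩
    refine ⟨fun g => Submodule.smul_mem _ a (h1 g), fun γ hγ g => ?_, fun u hu A hA g => ?_⟩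
    · simp [h2 γ hγ g]
    · simp [h3 u hu A hA g]

/-- The operator `U_{k,p}`. -/
def Uk : Module.End R (D.G → D.Poly O R) :=
  D.hecke fun b => (D.rhoNorm fun v =>
    !![(p : v.1.adicCompletionIntegers F),
      algebraMap (𝓞 F) (v.1.adicCompletionIntegers F) b; 0, 1]).toLinearMap

/-- The space `M_k^ord(K₁ⁿ, α, R)` of ordinary forms with nebentypus `α`. -/
def ordForms (k : D.Emb O →₀ ℕ) (n : ℕ) (α : D.Tor →* Rˣ) : Submodule R (D.G → D.Poly O R) :=
  D.forms k n ⊓ D.nebentypus α ⊓ D.ordinary (D.Uk * D.central R (D.Poly O R))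

/-- The condition that `α` restricts to the character `(k, 0)(u, u)` on `T(pⁿ)`. -/
def HasWeight (k : D.Emb O →₀ ℕ) (n : ℕ) (α : D.Tor →* Rˣ) : Prop :=
  ∀ u : ∀ v : D.Sp, (v.1.adicCompletionIntegers F)ˣ,
    (∀ v, (u v : v.1.adicCompletionIntegers F) - 1
      ∈ locIdeal v.1 (Ideal.span {(p : 𝓞 F) ^ n})) →
    ((α (u, 1) : Rˣ) : R) = algebraMap O R (D.weightChar k u)

/-- The pairing `(f₁, f₂)_n`, with values in `R[1/k!]`. -/
def pairing (k : D.Emb O →₀ ℕ) (n : ℕ) (f₁ f₂ : D.G → D.Poly O R) :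
    Localization.Away ((D.fact k : ℕ) : R) :=
  ∑ᶠ q : DoubleCoset.Quotient (D.rational : Set D.G) (D.K0 n : Set D.G),
    D.twisted k
      (MvPolynomial.map (algebraMap R _) (f₁ (Quotient.out q)))
      (MvPolynomial.map (algebraMap R _)
        (D.rhoNorm (fun v => !![(p : v.1.adicCompletionIntegers F) ^ n, 0; 0, 1])
          (f₂ (bar (Quotient.out q) * D.tau n))))

end AlgForms

/-! ### `p`-adic modular forms -/

/-- The space `V_p(G₁, K)` for a `p`-adically complete ring `O`: the functions on
`G₁(F) \ G₁(𝔸_{F,f})` whose reduction modulo each `p^m` is invariant under some `K₁ⁿ`; this is the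
inverse limit over `m` of the unions over `n` of the modules of functions
`G₁(F) \ G₁(𝔸_{F,f}) / K₁ⁿ → O / p^m`. -/
def padicForms : Submodule O (D.G → O) where
  carrier := {f | (∀ γ ∈ D.rational, ∀ g, f (γ * g) = f g) ∧
    ∀ m : ℕ, ∃ n ≥ 1, ∀ u ∈ D.K1 n, ∀ g, (p : O) ^ m ∣ f (g * u) - f g}
  zero_mem' := ⟨by simp, fun m => ⟨1, le_rfl, by simp⟩⟩
  add_mem' := by
    rintro f f' ⟨h1, h2⟩ ⟨h1', h2'⟩
    refine ⟨fun γ hγ g => by simp [h1 γ hγ g, h1' γ hγ g], fun m => ?_⟩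
    obtain ⟨n, hn, h⟩ := h2 m
    obtain ⟨n', hn', h'⟩ := h2' m
    refine ⟨max n n', le_max_of_le_left hn, fun u hu g => ?_⟩
    have e : (f + f') (g * u) - (f + f') g = (f (g * u) - f g) + (f' (g * u) - f' g) := by
      simp only [Pi.add_apply]; ring
    rw [e]
    exact dvd_add (h u (K1_anti D (le_max_left _ _) hu) g)
      (h' u (K1_anti D (le_max_right _ _) hu) g)
  smul_mem' := by
    rintro a f ⟨h1, h2⟩
    refine ⟨fun γ hγ g => by simp [h1 γ hγ g], fun m => ?_⟩
    obtain ⟨n, hn, h⟩ := h2 m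
    refine ⟨n, hn, fun u hu g => ?_⟩
    have e : (a • f) (g * u) - (a • f) g = a * (f (g * u) - f g) := by
      simp only [Pi.smul_apply, smul_eq_mul]; ring
    rw [e]
    exact Dvd.dvd.mul_left (h u hu g) a

variable (O) in
/-- The operator `U_p` on functions with values in `O`. -/
def Utriv : Module.End O (D.G → O) := D.hecke fun _ => LinearMap.id

/-- The space `V_p^ord(G₁, K, α)`. -/
def padicOrd (α : D.Tor →* Oˣ) : Submodule O (D.G → O) :=
  D.padicForms ⊓ D.nebentypus α ⊓ D.ordinary (D.Utriv O * D.central O O)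

/-- The map `β_k`, given by composition with the functional `l_k` that takes the coefficient of
the lowest weight vector `∏ X_σ^{k_σ}`. -/
def beta (k : D.Emb O →₀ ℕ) (f : D.G → D.Poly O O) : D.G → O :=
  fun g => (f g).coeff (k.mapDomain fun σ => (σ, 0))

end Datum

end Global

/-! ### The coefficient ring -/

/-- The ring of integers of an extension `E` of `ℚ_p` with ultrametric norm. -/
def ringOfIntegers (E : Type*) [NormedField E] [IsUltrametricDist E] : Subring E where
  carrier := {x | ‖x‖ ≤ 1}
  mul_mem' := by
    intro a b ha hb
    simp only [Set.mem_ofPred_eq] at *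
    rw [norm_mul]
    exact mul_le_one₀ ha (norm_nonneg _) hb
  one_mem' := by simp
  add_mem' := by
    intro a b ha hb
    exact (IsUltrametricDist.norm_add_le_max a b).trans (max_le ha hb)
  zero_mem' := by simp
  neg_mem' := by
    intro a ha
    simpa using ha

end

end HidaU2

namespace HidaU2

noncomputable section

/-! ### Approximation in completions -/

section Approx

variable {F : Type*} [Field F] [NumberField F]

/-! Bijectivity of `U`. Put `T = U S`, with `U = U_{k,p}`. An ordinary form is the limit of `T^{r!}
f`, and `U` commutes with `S`. Hence `lim S T^{r!-1} f` is an ordinary preimage of `f` under `U`,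
and `U f` determines `f`. The limits exist because `L_k(R)` has finitely many monomials and the
conditions that define forms of a given level and nebentypus are closed (`isAdicClosed_forms`,
`OrdinaryFor.exists_preimage`). The level does not change.

Independence of `n`. Everything rests on the identity `τ_n (p b; 0 1) = ū_b τ_{n+1}` with `u_b = (1
0; -pⁿb 1)` (`tau_mul_upper`). For `b` in `𝔬/p` the `u_b` represent `K₀ⁿ/K₀ⁿ⁺¹`. The level is small,
so `G₁(F)` acts freely on the cosets, and a sum at level `n + 1` is the sum at level `n` of the sums
over `b`. Therefore `(f₁, U f₂)_n = (f₁, f₂)_{n+1}` (`cosetSum_hecke`, `pairing_Uk`), and `(f₁,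
U⁻ⁿf₂)_n` does not depend on `n`.

Integrality. The normalised action of `τ_n` fixes every `X_σ` and multiplies every `Y_σ` by `pⁿ`. On
every monomial other than `∏ X_σ^{k_σ}` a large `n` absorbs the denominators of the pairing. At such
a level the pairing lies in `R` and is congruent, modulo a power of `p` that grows with `n`, to `∑
β(f₁)(g) β(f₂)(ḡ τ_n)` (`exists_tauPairing_eq`, `exists_pairing_eq`).

The pairing on `p`-adic forms. This congruence dictates `B(h, h') = lim ∑ h(g) (U_p⁻ⁿ h')(ḡ τ_n)`.
Modulo `p^m` both functions have a finite level, which `U_p⁻¹` preserves, and from that level on the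
sequence is constant modulo `p^m` by the same relation between levels (`exists_padicPairing`).
Symmetry holds because `g ↦ ḡ τ_n` is an involution of the double coset space and `U_p` is
self-adjoint at every level (`adicLim_symm`). For non-degeneracy, `h` is paired with the ordinary
projection of a function supported on one coset of `K₀₀ⁿ`. The projector is self-adjoint and fixes
`h`, so the result is `|Δ_𝔰| h(t)` modulo `p^m` (`padicPairing_nondegenerate`). The comparison with
forms of weight `k` holds because `β_k` intertwines the Hecke operators (`beta_Uk`,
`pairing_eq_padicPairing`).

Finiteness of the double coset spaces. All these sums must be finite, which is proved directly. The
lattice attached to an adelic point `g` has the covolume of `𝓞_K²`, so a pigeonhole argument gives a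
short nonzero vector in it. Its Hermitian norm is an integer of `F` with bounded conjugates; complex
conjugation induces `c`, so the norm is nonzero. A second bounded integer records `det g`. These two
integers together with finitely many residues determine the double coset (`exists_invariants`,
`exists_rational_of_congr`, `finite_quotient`). -/

theorem valued_algebraMap (v : HeightOneSpectrum (𝓞 F)) (k : F) :
    Valued.v (algebraMap F (v.adicCompletion F) k) = v.valuation F k :=
  v.valuedAdicCompletion_eq_valuation' k

theorem exists_valued_sub_lt (v : HeightOneSpectrum (𝓞 F)) (x : v.adicCompletion F)
    {y : v.adicCompletion F} (hy : y ≠ 0) :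
    ∃ k : F, Valued.v (x - algebraMap F (v.adicCompletion F) k) < Valued.v y := by
  have hopen : IsOpen {z : v.adicCompletion F | Valued.v (x - z) < Valued.v y} := by
    rw [isOpen_iff_mem_nhds]
    intro z hz
    rw [Valued.mem_nhds]
    refine ⟨Units.mk0 (Valued.v.restrict y) (by simpa using hy), ?_⟩
    intro w hw
    simp only [Units.val_mk0, Set.mem_ofPred_eq] at hw hz ⊢
    have hw' : Valued.v (w - z) < Valued.v y := by
      simpa using hw
    have : x - w = (x - z) - (w - z) := by ring
    rw [this]
    exact (Valuation.map_sub _ _ _).trans_lt (max_lt hz hw')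
  obtain ⟨k, hk⟩ := (v.denseRange_algebraMap F).exists_mem_open hopen
    ⟨x, by simp [zero_lt_iff, hy]⟩
  exact ⟨k, hk⟩

theorem exists_eq_mul_of_valued_le (v : HeightOneSpectrum (𝓞 F)) {x y : v.adicCompletion F}
    (h : Valued.v x ≤ Valued.v y) : ∃ z : v.adicCompletionIntegers F, x = y * z := by
  by_cases hy : y = 0
  · refine ⟨0, ?_⟩
    subst hy
    simpa using h
  · refine ⟨⟨x / y, ?_⟩, ?_⟩
    · rw [HeightOneSpectrum.mem_adicCompletionIntegers, map_div₀]
      exact div_le_one_of_le₀ h zero_le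
    · simp only
      field_simp

theorem coe_algebraMap_integers (v : HeightOneSpectrum (𝓞 F)) (a : 𝓞 F) :
    ((algebraMap (𝓞 F) (v.adicCompletionIntegers F) a : v.adicCompletionIntegers F) :
      v.adicCompletion F) = algebraMap F (v.adicCompletion F) (a : F) := rfl

theorem exists_ringOfIntegers_sub (v : HeightOneSpectrum (𝓞 F)) (x : v.adicCompletionIntegers F)
    {r : 𝓞 F} (hr : r ≠ 0) : ∃ a : 𝓞 F, ∃ y : v.adicCompletionIntegers F,
      x - algebraMap (𝓞 F) (v.adicCompletionIntegers F) a = algebraMap (𝓞 F) _ r * y := by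
  have hr' : algebraMap F (v.adicCompletion F) (r : F) ≠ 0 := by
    simpa using hr
  obtain ⟨k, hk⟩ := exists_valued_sub_lt v (x : v.adicCompletion F) hr'
  have hr1 : Valued.v (algebraMap F (v.adicCompletion F) (r : F)) ≤ 1 := by
    rw [valued_algebraMap]; exact v.valuation_le_one r
  have hk1 : v.valuation F k ≤ 1 := by
    rw [← valued_algebraMap]
    have : algebraMap F (v.adicCompletion F) k
      = x - (x - algebraMap F (v.adicCompletion F) k) := by ring
    rw [this]
    exact (Valuation.map_sub _ _ _).trans (max_le x.2 (hk.le.trans hr1))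
  have hγ : v.valuation F (r : F) ≠ 0 := by simpa using hr
  -- Density gives only `k ∈ F`, integral at `v` but perhaps not elsewhere; it is replaced by a
  -- global integer that is close to it at `v`.
  obtain ⟨a, ha⟩ := v.exists_valuation_sub_lt_of_integer hk1 (Units.mk0 _ hγ)
  have hle : Valued.v ((x : v.adicCompletion F) - algebraMap F (v.adicCompletion F) (a : F))
      ≤ Valued.v (algebraMap F (v.adicCompletion F) (r : F)) := by
    have : (x : v.adicCompletion F) - algebraMap F (v.adicCompletion F) (a : F)
        = (x - algebraMap F (v.adicCompletion F) k)
          - algebraMap F (v.adicCompletion F) ((a : F) - k) := by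
      rw [map_sub]; ring
    rw [this]
    refine (Valuation.map_sub _ _ _).trans (max_le hk.le ?_)
    rw [valued_algebraMap, valued_algebraMap]
    exact ha.le
  obtain ⟨z, hz⟩ := exists_eq_mul_of_valued_le v hle
  exact ⟨a, z, Subtype.ext hz⟩

theorem isUnit_algebraMap_of_notMem (v : HeightOneSpectrum (𝓞 F)) {r : 𝓞 F}
    (hr : r ∉ v.asIdeal) : IsUnit (algebraMap (𝓞 F) (v.adicCompletionIntegers F) r) := by
  rw [HeightOneSpectrum.adicCompletionIntegers.isUnit_iff_valued_eq_one, coe_algebraMap_integers,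
    valued_algebraMap]
  exact (v.valuation_eq_one_iff_notMem (K := F)).mpr hr

/-- Elements of a power of a prime that are divisible by `r` in the completion. -/
theorem exists_pow_dvd (v : HeightOneSpectrum (𝓞 F)) {r : 𝓞 F} (hr : r ≠ 0) :
    ∃ e : ℕ, ∀ a ∈ v.asIdeal ^ e,
      algebraMap (𝓞 F) (v.adicCompletionIntegers F) r ∣ algebraMap (𝓞 F) _ a := by
  obtain ⟨e, he⟩ : ∃ e : ℕ, WithZero.exp (-(e : ℤ)) ≤ v.intValuation r := by
    refine ⟨_, (v.intValuation_eq_exp_neg_multiplicity hr).ge⟩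
  refine ⟨e, fun a ha => ?_⟩
  have h1 := ((v.intValuation_le_pow_iff_mem a e).mpr ha).trans he
  rw [← v.valuation_of_algebraMap (K := F), ← v.valuation_of_algebraMap (K := F),
    ← valued_algebraMap, ← valued_algebraMap] at h1
  obtain ⟨z, hz⟩ := exists_eq_mul_of_valued_le v h1
  exact ⟨z, Subtype.ext hz⟩

/-- Only the places dividing `r` impose a condition, since `r` is a unit elsewhere. At those
finitely many places the local approximations are glued by the Chinese remainder theorem. -/
theorem exists_approx (x : ∀ v : HeightOneSpectrum (𝓞 F), v.adicCompletionIntegers F)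
    {r : 𝓞 F} (hr : r ≠ 0) : ∃ a : 𝓞 F, ∀ v : HeightOneSpectrum (𝓞 F),
      algebraMap (𝓞 F) (v.adicCompletionIntegers F) r ∣ x v - algebraMap (𝓞 F) _ a := by
  classical
  have hI : Ideal.span {r} ≠ ⊥ := by simpa using hr
  choose e he using fun v : HeightOneSpectrum (𝓞 F) => exists_pow_dvd v hr
  choose b hb using fun v : HeightOneSpectrum (𝓞 F) => exists_ringOfIntegers_sub v (x v) hr
  obtain ⟨a, ha⟩ := IsDedekindDomain.exists_forall_sub_mem_ideal
    (s := (finite_places hI).toFinset) (fun v => v.asIdeal) e (fun v _ => v.prime)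
    (fun v _ w _ h h' => h (HeightOneSpectrum.ext h')) (fun v => b v.1)
  refine ⟨a, fun v => ?_⟩
  by_cases hv : Ideal.span {r} ≤ v.asIdeal
  · have h1 := he v _ (ha v (by simpa using hv))
    obtain ⟨y, hy⟩ := hb v
    have : x v - algebraMap (𝓞 F) (v.adicCompletionIntegers F) a
        = (x v - algebraMap (𝓞 F) (v.adicCompletionIntegers F) (b v))
          - algebraMap (𝓞 F) (v.adicCompletionIntegers F) (a - b v) := by
      rw [map_sub]; ring
    rw [this, hy]
    exact dvd_sub (dvd_mul_right _ _) h1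
  · refine (isUnit_algebraMap_of_notMem v fun h => hv ?_).dvd
    rwa [Ideal.span_singleton_le_iff_mem]

theorem exists_ringOfIntegers_of_forall_mem {z : F}
    (h : ∀ v : HeightOneSpectrum (𝓞 F),
      algebraMap F (v.adicCompletion F) z ∈ v.adicCompletionIntegers F) :
    ∃ a : 𝓞 F, (a : F) = z :=
  HeightOneSpectrum.mem_integers_of_valuation_le_one F z fun v => by
    rw [← valued_algebraMap]; exact h v

end Approx

/-! ### The integral structure at split places -/

section Split

variable {F K : Type*} [Field F] [NumberField F] [Field K] [NumberField K] [Algebra F K]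

theorem exists_algebraMap_eq_of_fixed (h2 : Module.finrank F K = 2) {c : K ≃ₐ[F] K} (hc : c ≠ 1)
    {w : K} (hw : c w = w) : ∃ a : F, algebraMap F K a = w := by
  have hfd : Module.Finite F K := Module.finite_of_finrank_pos (by omega)
  obtain ⟨θ, hθ⟩ : ∃ θ, c θ ≠ θ := by
    by_contra h
    push Not at h
    exact hc (AlgEquiv.ext h)
  have hli : LinearIndependent F ![(1 : K), θ] := by
    rw [LinearIndependent.pair_iff]
    intro s t hst
    have h1 := congrArg c hst
    simp only [Algebra.smul_def, map_add, map_mul, AlgEquiv.commutes, map_one, map_zero] at h1 hst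
    have h3 : t • (c θ - θ) = 0 := by
      rw [Algebra.smul_def]
      linear_combination h1 - hst
    rcases smul_eq_zero.mp h3 with h | h
    · subst h
      exact ⟨by simpa using hst, rfl⟩
    · exact absurd (sub_eq_zero.mp h) hθ
  have hspan := hli.span_eq_top_of_card_eq_finrank (by simp [h2])
  have hmem : w ∈ Submodule.span F (Set.range ![(1 : K), θ]) := by rw [hspan]; trivial
  rw [Matrix.range_cons, Matrix.range_cons, Matrix.range_empty, Set.union_empty,
    Set.singleton_union, Submodule.mem_span_pair] at hmem
  obtain ⟨s, t, rfl⟩ := hmem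
  simp only [Algebra.smul_def, map_add, map_mul, AlgEquiv.commutes, map_one, add_right_inj] at hw
  have h3 : t • (c θ - θ) = 0 := by rw [Algebra.smul_def]; linear_combination hw
  rcases smul_eq_zero.mp h3 with h | h
  · exact ⟨s, by simp [h, Algebra.smul_def]⟩
  · exact absurd (sub_eq_zero.mp h) hθ

theorem conj_conj (h2 : Module.finrank F K = 2) (c : K ≃ₐ[F] K) (y : K) : c (c y) = y := by
  have hfd : Module.Finite F K := Module.finite_of_finrank_pos (by omega)
  classical
  by_cases h1 : c = 1
  · simp [h1]
  by_contra h
  have hcard : ({1, c, c * c} : Finset (K ≃ₐ[F] K)).card ≤ 2 :=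
    (Finset.card_le_univ _).trans (by rw [← h2]; exact AlgEquiv.card_le)
  have hne : c * c ≠ 1 := fun h' => h (by simpa using congrArg (fun f => f y) h')
  rw [Finset.card_insert_of_notMem (by simp [Ne.symm h1, Ne.symm hne]),
    Finset.card_insert_of_notMem (by simpa using h1), Finset.card_singleton] at hcard
  omega

theorem mem_integers_of_isIntegral (v : HeightOneSpectrum (𝓞 F)) {x : v.adicCompletion F}
    (hx : (Int.castRingHom (v.adicCompletion F)).IsIntegralElem x) :
    x ∈ v.adicCompletionIntegers F := by
  have h : IsIntegral (v.adicCompletionIntegers F) x := by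
    obtain ⟨P, hP, h0⟩ := hx
    refine ⟨P.map (Int.castRingHom _), hP.map _, ?_⟩
    rw [Polynomial.eval₂_map, ← h0]
    congr 1
  obtain ⟨y, rfl⟩ := IsIntegrallyClosed.isIntegral_iff.mp h
  exact y.2

theorem embedding_mem_integers {v : HeightOneSpectrum (𝓞 F)} (ι : K →ₐ[F] v.adicCompletion F)
    (a : 𝓞 K) : ι (a : K) ∈ v.adicCompletionIntegers F :=
  mem_integers_of_isIntegral v (by
    obtain ⟨P, hP, h0⟩ := NumberField.RingOfIntegers.isIntegral_coe a
    refine ⟨P, hP, ?_⟩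
    have h1 := congrArg ι h0
    rw [map_zero, ← RingHom.coe_coe, Polynomial.hom_eval₂] at h1
    rw [← h1]
    congr 1
    exact RingHom.ext_int _ _)

theorem splitHom_mem {v : HeightOneSpectrum (𝓞 F)} (ι : K →ₐ[F] v.adicCompletion F)
    {x : LocK K v} (hx : x ∈ locInt K v) : splitHom ι x ∈ v.adicCompletionIntegers F := by
  have h : locInt K v ≤
      (v.adicCompletionIntegers F).toSubring.comap (splitHom ι).toRingHom := by
    refine Subring.closure_le.mpr ?_
    rintro _ (⟨a, rfl⟩ | ⟨y, rfl⟩)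
    · simp [splitHom]
    · simpa [splitHom] using embedding_mem_integers ι y
  exact h hx

/-- The places `w` and `w̄` can be separated by a global integer. Subtracting from some `θ ≠ c θ` an
element of `F` close to `ι θ` gives `z` that is small at `w` compared with `c z`. Then `y = c z / (c
z + z)` has trace `1`, is a unit at `w`, and its conjugate is not. Its norm is integral at `v`, so a
multiple `d y`, with `d` prime to `v`, is a root of a monic quadratic polynomial over `𝓞_F`. -/
theorem exists_integer_valued_sub_conj_eq_one (h2 : Module.finrank F K = 2) {c : K ≃ₐ[F] K}
    (hc : c ≠ 1) {v : HeightOneSpectrum (𝓞 F)} (ι : K →ₐ[F] v.adicCompletion F) :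
    ∃ θ : 𝓞 K, Valued.v (ι (θ : K) - ι (c (θ : K))) = 1 := by
  obtain ⟨θ, hθ⟩ : ∃ θ, c θ ≠ θ := by
    by_contra h
    push Not at h
    exact hc (AlgEquiv.ext h)
  have hδ : ι θ - ι (c θ) ≠ 0 := by
    rw [sub_ne_zero]
    exact fun h => hθ (ι.toRingHom.injective h).symm
  obtain ⟨f, hf⟩ := exists_valued_sub_lt v (ι θ) hδ
  set z : K := θ - algebraMap F K f with hz
  have hιz : ι z = ι θ - algebraMap F (v.adicCompletion F) f := by simp [hz]
  have hcz : ι (c z) = ι z - (ι θ - ι (c θ)) := by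
    rw [hιz]; simp [hz]
  have hvz : Valued.v (ι z) < Valued.v (ι θ - ι (c θ)) := by rw [hιz]; exact hf
  have hvcz : Valued.v (ι (c z)) = Valued.v (ι θ - ι (c θ)) := by
    rw [hcz]; exact Valuation.map_sub_eq_of_lt_right _ hvz
  have hvs : Valued.v (ι (c z) + ι z) = Valued.v (ι θ - ι (c θ)) := by
    rw [← hvcz]
    exact Valuation.map_add_eq_of_lt_left _ (by rw [hvcz]; exact hvz)
  have hδ' : Valued.v (ι θ - ι (c θ)) ≠ 0 := by simpa using hδ
  have hs : c z + z ≠ 0 := by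
    intro h
    rw [← map_add, h, map_zero, map_zero] at hvs
    exact hδ' hvs.symm
  have hιs : ι (c z) + ι z ≠ 0 := by
    rw [← map_add]; exact fun h => hs (ι.toRingHom.injective (by simpa using h))
  set y : K := c z / (c z + z) with hy
  have hcy : c y = z / (c z + z) := by
    rw [hy, map_div₀, map_add, conj_conj h2, add_comm]
  have hsum : y + c y = 1 := by rw [hcy, hy]; field_simp
  have hιy : Valued.v (ι y) = 1 := by
    rw [hy, map_div₀, map_div₀, map_add, hvs, hvcz, div_self hδ']
  have hιcy : Valued.v (ι (c y)) < 1 := by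
    rw [hcy, map_div₀, map_div₀, map_add, hvs]
    exact (div_lt_one₀ (zero_lt_iff.mpr hδ')).mpr hvz
  obtain ⟨n, hn⟩ := exists_algebraMap_eq_of_fixed h2 hc (w := y * c y)
    (by rw [map_mul, conj_conj h2, mul_comm])
  have hvn : v.valuation F n ≤ 1 := by
    rw [← valued_algebraMap, ← ι.commutes, hn, map_mul, map_mul, hιy, one_mul]
    exact hιcy.le
  obtain ⟨m, d, hmd⟩ := v.exists_primeCompl_mul_eq_of_integer n hvn
  have hint : IsIntegral (𝓞 F) (algebraMap F K ((d : 𝓞 F) : F) * y) := by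
    refine ⟨Polynomial.X ^ 2 - Polynomial.C (d : 𝓞 F) * Polynomial.X + Polynomial.C (d * m),
      by monicity!, ?_⟩
    simp only [Polynomial.eval₂_add, Polynomial.eval₂_sub, Polynomial.eval₂_pow,
      Polynomial.eval₂_X, Polynomial.eval₂_mul, Polynomial.eval₂_C]
    have e1 : ∀ a : 𝓞 F, algebraMap (𝓞 F) K a = algebraMap F K (a : F) := fun a => rfl
    have e2 : algebraMap F K (m : F) = y * c y * algebraMap F K ((d : 𝓞 F) : F) := by
      rw [← hn, ← map_mul]; exact congrArg _ hmd.symm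
    rw [map_mul, e1, e1, e2]
    linear_combination ((algebraMap F K ((d : 𝓞 F) : F)) ^ 2 * y) * hsum
  refine ⟨⟨_, isIntegral_trans (R := ℤ) _ hint⟩, ?_⟩
  have hd : Valued.v (algebraMap F (v.adicCompletion F) ((d : 𝓞 F) : F)) = 1 := by
    rw [valued_algebraMap]
    exact (v.valuation_eq_one_iff_notMem (K := F)).mpr d.2
  change Valued.v (ι (algebraMap F K ((d : 𝓞 F) : F) * y)
    - ι (c (algebraMap F K ((d : 𝓞 F) : F) * y))) = 1
  rw [map_mul, map_mul c, map_mul ι, AlgEquiv.commutes, AlgHom.commutes, ← mul_sub, map_mul, hd,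
    one_mul, Valuation.map_sub_eq_of_lt_left _ (by rw [hιy]; exact hιcy), hιy]

/-- Interpolation at the two conjugates `a`, `b` of an integer `θ`. The only denominator is `a - b`,
which is a unit for the `θ` supplied by `exists_integer_valued_sub_conj_eq_one`. -/
theorem splitEquiv_symm_mem (h2 : Module.finrank F K = 2) {c : K ≃ₐ[F] K} (hc : c ≠ 1)
    {v : HeightOneSpectrum (𝓞 F)} (ι : K →ₐ[F] v.adicCompletion F)
    {x y : v.adicCompletion F} (hx : x ∈ v.adicCompletionIntegers F)
    (hy : y ∈ v.adicCompletionIntegers F) : (splitEquiv h2 hc ι).symm (x, y) ∈ locInt K v := by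
  obtain ⟨θ, hθ⟩ := exists_integer_valued_sub_conj_eq_one h2 hc ι
  have hθ1 := embedding_mem_integers ι θ
  have hθ2 := embedding_mem_integers (ι.comp (c : K →ₐ[F] K)) θ
  set a := ι (θ : K) with ha
  set b := ι (c (θ : K)) with hb
  change b ∈ _ at hθ2
  have hne : a - b ≠ 0 := fun h => by simp [h] at hθ
  have hinv : (a - b)⁻¹ ∈ v.adicCompletionIntegers F := by
    rw [HeightOneSpectrum.mem_adicCompletionIntegers, map_inv₀, hθ, inv_one]
  have key : (splitEquiv h2 hc ι).symm (x, y)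
      = ((x * -b + y * a) * (a - b)⁻¹) ⊗ₜ[F] (1 : K)
        + (((x - y) * (a - b)⁻¹) ⊗ₜ[F] (1 : K)) * ((1 : v.adicCompletion F) ⊗ₜ[F] (θ : K)) := by
    rw [AlgEquiv.symm_apply_eq]
    change (x, y) = splitProd c ι _
    refine Prod.ext ?_ ?_
    · simp only [splitProd, splitHom, AlgHom.prod_apply, map_add, Algebra.TensorProduct.lift_tmul,
        AlgHom.id_apply, map_one, mul_one, Prod.fst_add, map_mul, Prod.fst_mul, one_mul]
      rw [← ha]
      field_simp
      ring
    · simp only [splitProd, splitHom, AlgHom.prod_apply, map_add, Algebra.TensorProduct.lift_tmul,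
        AlgHom.id_apply, map_one, mul_one, AlgHom.comp_apply, Prod.snd_add, map_mul, Prod.snd_mul,
        one_mul]
      change y = _ + _ * b
      field_simp
      ring
  rw [key]
  have hO : ∀ z ∈ v.adicCompletionIntegers F, (z ⊗ₜ[F] (1 : K)) ∈ locInt K v :=
    fun z hz => Subring.subset_closure (Or.inl ⟨⟨z, hz⟩, rfl⟩)
  refine add_mem (hO _ ?_) (mul_mem (hO _ ?_) (Subring.subset_closure (Or.inr ⟨θ, rfl⟩)))
  · exact mul_mem (add_mem (mul_mem hx (neg_mem hθ2)) (mul_mem hy hθ1)) hinv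
  · exact mul_mem (sub_mem hx hy) hinv

theorem unitary2_inv {A : Type*} [CommRing A] (c : A →+* A) (g : unitary2 c) :
    ((g.1⁻¹ : GL (Fin 2) A) : Matrix (Fin 2) (Fin 2) A)
      = ((g.1 : Matrix (Fin 2) (Fin 2) A).map c)ᵀ := by
  have h : (g.1 : Matrix (Fin 2) (Fin 2) A) * ((g.1 : Matrix (Fin 2) (Fin 2) A).map c)ᵀ = 1 := g.2
  rw [← one_mul ((g.1 : Matrix (Fin 2) (Fin 2) A).map c)ᵀ, ← Units.inv_mul g.1, Matrix.mul_assoc,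
    h, Matrix.mul_one]

/-- The component at the conjugate place is determined by unitarity. -/
theorem iw_locBar {c : K ≃ₐ[F] K} {v : HeightOneSpectrum (𝓞 F)}
    (ι : K →ₐ[F] v.adicCompletion F) (g : G1loc c v) :
    (iw c ι (locBar c v g) : Matrix (Fin 2) (Fin 2) (v.adicCompletion F))
      = (((iw c ι g)⁻¹ : GL (Fin 2) (v.adicCompletion F)) : Matrix _ _ _)ᵀ := by
  rw [← map_inv]
  refine Matrix.ext fun i j => ?_
  change splitHom ι (locConj c v _) = splitHom ι (((g.1⁻¹ : GL (Fin 2) _) : Matrix _ _ _) j i)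
  rw [unitary2_inv]
  rfl

theorem iw_injective (h2 : Module.finrank F K = 2) {c : K ≃ₐ[F] K} (hc : c ≠ 1)
    {v : HeightOneSpectrum (𝓞 F)} (ι : K →ₐ[F] v.adicCompletion F) :
    Function.Injective (iw c ι) := by
  intro g h hgh
  refine Subtype.ext (Units.ext (Matrix.ext fun i j => (splitProd_bijective h2 hc ι).1 ?_))
  have key : ∀ g : G1loc c v, splitProd c ι ((g.1 : Matrix _ _ _) i j)
      = ((iw c ι g : Matrix (Fin 2) (Fin 2) (v.adicCompletion F)) i j,
        (((iw c ι g)⁻¹ : GL (Fin 2) (v.adicCompletion F)) : Matrix _ _ _) j i) := by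
    intro g
    have h1 := congrFun (congrFun (iw_locBar ι g) i) j
    rw [Matrix.transpose_apply] at h1
    rw [← h1]
    have h3 := splitProd_conj (c := c) h2 ι ((g.1 : Matrix _ _ _) i j)
    refine Prod.ext rfl ?_
    exact (congrArg Prod.fst h3).symm
  rw [key, key, hgh]

theorem ofGL_iw (h2 : Module.finrank F K = 2) {c : K ≃ₐ[F] K} (hc : c ≠ 1)
    {v : HeightOneSpectrum (𝓞 F)} (ι : K →ₐ[F] v.adicCompletion F) (g : G1loc c v) :
    ofGL h2 hc ι (iw c ι g) = g :=
  iw_injective h2 hc ι (iw_ofGL h2 hc ι _)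

theorem mem_range_intGL {v : HeightOneSpectrum (𝓞 F)} {g : GL (Fin 2) (v.adicCompletion F)}
    (h : ∀ i j, g.1 i j ∈ v.adicCompletionIntegers F)
    (h' : ∀ i j, (g⁻¹).1 i j
      ∈ v.adicCompletionIntegers F) : g ∈ (intGL v).range := by
  refine ⟨⟨Matrix.of fun i j => ⟨_, h i j⟩, Matrix.of fun i j => ⟨_, h' i j⟩, ?_, ?_⟩, ?_⟩
  · refine Matrix.ext fun i j => Subtype.ext ?_
    have := congrFun (congrFun (Units.mul_inv g) i) j
    rw [Matrix.mul_apply] at this ⊢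
    simp only [Matrix.of_apply, Matrix.one_apply, Fin.sum_univ_two] at this ⊢
    change _ = Subtype.val (ite _ _ _)
    rw [apply_ite Subtype.val]
    exact this
  · refine Matrix.ext fun i j => Subtype.ext ?_
    have := congrFun (congrFun (Units.inv_mul g) i) j
    rw [Matrix.mul_apply] at this ⊢
    simp only [Matrix.of_apply, Matrix.one_apply, Fin.sum_univ_two] at this ⊢
    change _ = Subtype.val (ite _ _ _)
    rw [apply_ite Subtype.val]
    exact this
  · rfl

theorem coe_mem_locInt {c : K ≃ₐ[F] K} {v : HeightOneSpectrum (𝓞 F)} {g : G1loc c v}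
    (hg : g ∈ K0loc c v) (i j : Fin 2) : g.1.1 i j ∈ locInt K v := by
  obtain ⟨A, hA⟩ := hg
  change ((G1loc c v).subtype g).1 i j ∈ _
  rw [← hA]
  exact Subtype.prop (A.1 i j)

theorem mem_K0loc_of {c : K ≃ₐ[F] K} {v : HeightOneSpectrum (𝓞 F)} {g : G1loc c v}
    (h : ∀ i j, g.1.1 i j ∈ locInt K v) : g ∈ K0loc c v := by
  have h' : ∀ i j, (g.1⁻¹).1 i j ∈ locInt K v := by
    intro i j
    rw [unitary2_inv]
    exact locConj_mem (h j i)
  refine ⟨⟨Matrix.of fun i j => ⟨_, h i j⟩, Matrix.of fun i j => ⟨_, h' i j⟩, ?_, ?_⟩, ?_⟩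
  · refine Matrix.ext fun i j => Subtype.ext ?_
    have := congrFun (congrFun (Units.mul_inv g.1) i) j
    rw [Matrix.mul_apply] at this ⊢
    simp only [Matrix.of_apply, Matrix.one_apply, Fin.sum_univ_two] at this ⊢
    change _ = Subtype.val (ite _ _ _)
    rw [apply_ite Subtype.val]
    exact this
  · refine Matrix.ext fun i j => Subtype.ext ?_
    have := congrFun (congrFun (Units.inv_mul g.1) i) j
    rw [Matrix.mul_apply] at this ⊢
    simp only [Matrix.of_apply, Matrix.one_apply, Fin.sum_univ_two] at this ⊢
    change _ = Subtype.val (ite _ _ _)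
    rw [apply_ite Subtype.val]
    exact this
  · rfl

/-- One direction projects integral entries to `w`. In the other, the component at the conjugate
place is the inverse transpose of the component at `w`, so both are integral, and
`splitEquiv_symm_mem` combines them. -/
theorem mem_K0loc_iff_iw (h2 : Module.finrank F K = 2) {c : K ≃ₐ[F] K} (hc : c ≠ 1)
    {v : HeightOneSpectrum (𝓞 F)} (ι : K →ₐ[F] v.adicCompletion F) (g : G1loc c v) :
    g ∈ K0loc c v ↔ iw c ι g ∈ (intGL v).range := by
  constructor
  · intro hg
    refine mem_range_intGL (fun i j => splitHom_mem ι (coe_mem_locInt hg i j)) fun i j => ?_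
    rw [← map_inv]
    exact splitHom_mem ι (coe_mem_locInt (inv_mem hg) i j)
  · rintro ⟨A, hA⟩
    refine mem_K0loc_of fun i j => ?_
    rw [← ofGL_iw h2 hc ι g, ← hA]
    refine splitEquiv_symm_mem h2 hc ι (Subtype.prop (A.1 i j)) ?_
    rw [← map_inv]
    exact Subtype.prop ((A⁻¹).1 j i)

end Split

end

end HidaU2

/-! ### The contragredient -/

namespace HidaU2

noncomputable section

/-- The contragredient `g ↦ g⁻ᵀ`. -/
def contra {A : Type*} [CommRing A] : GL (Fin 2) A →* GL (Fin 2) A where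
  toFun g := ⟨(g⁻¹).1ᵀ, g.1ᵀ, by rw [← Matrix.transpose_mul, Units.mul_inv, Matrix.transpose_one],
    by rw [← Matrix.transpose_mul, Units.inv_mul, Matrix.transpose_one]⟩
  map_one' := by ext1; simp
  map_mul' a b := by ext1; simp [Matrix.transpose_mul]

theorem contra_val {A : Type*} [CommRing A] (g : GL (Fin 2) A) : (contra g).1 = (g⁻¹).1ᵀ := rfl

theorem det_isUnit {A : Type*} [CommRing A] (g : GL (Fin 2) A) :
    IsUnit (g.1 0 0 * g.1 1 1 - g.1 0 1 * g.1 1 0) := by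
  rw [← Matrix.det_fin_two]
  exact (Matrix.isUnit_iff_isUnit_det _).mp g.isUnit

theorem intGL_injective {F : Type*} [Field F] [NumberField F] (v : HeightOneSpectrum (𝓞 F)) :
    Function.Injective (intGL v) := by
  intro g h hgh
  refine Units.ext (Matrix.ext fun i j => Subtype.ext ?_)
  exact congrArg (fun x : GL (Fin 2) (v.adicCompletion F) => x.1 i j) hgh

theorem contra_intGL {F : Type*} [Field F] [NumberField F] (v : HeightOneSpectrum (𝓞 F))
    (g : GL (Fin 2) (v.adicCompletionIntegers F)) :
    contra (intGL v g) = intGL v (contra g) := by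
  ext1
  rw [contra_val, ← map_inv]
  rfl

section Instances

variable {F K : Type*} [Field F] [NumberField F] [Field K] [NumberField K] [Algebra F K]
  (c : K ≃ₐ[F] K)

instance instMulMemClassG1loc (v : HeightOneSpectrum (𝓞 F)) :
    MulMemClass (Subgroup (G1loc c v)) (G1loc c v) := inferInstance
instance instSubmonoidClassG1loc (v : HeightOneSpectrum (𝓞 F)) :
    SubmonoidClass (Subgroup (G1loc c v)) (G1loc c v) := inferInstance
instance instInvMemClassG1loc (v : HeightOneSpectrum (𝓞 F)) :
    InvMemClass (Subgroup (G1loc c v)) (G1loc c v) := inferInstance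
instance instInvOneClassG1loc (v : HeightOneSpectrum (𝓞 F)) : InvOneClass (G1loc c v) :=
  inferInstance
instance instDivisionMonoidG1loc (v : HeightOneSpectrum (𝓞 F)) : DivisionMonoid (G1loc c v) :=
  inferInstance
instance instGroupG1Adelic : Group (G1Adelic c) := inferInstance
instance instDivisionMonoidG1Adelic : DivisionMonoid (G1Adelic c) := inferInstance
instance instMonoidG1Adelic : Monoid (G1Adelic c) := inferInstance
instance instMulOneClassG1Adelic : MulOneClass (G1Adelic c) := inferInstance
instance instMulOneG1Adelic : MulOne (G1Adelic c) := inferInstance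
instance instOneG1Adelic : One (G1Adelic c) := inferInstance
instance instInvG1Adelic : Inv (G1Adelic c) := inferInstance
instance instMulG1Adelic : Mul (G1Adelic c) := inferInstance

variable (v : HeightOneSpectrum (𝓞 F))

instance instGroupGLAdic : Group (GL (Fin 2) (v.adicCompletion F)) := inferInstance
instance instDivisionMonoidGLAdic : DivisionMonoid (GL (Fin 2) (v.adicCompletion F)) :=
  inferInstance
instance instMulOneClassGLAdic : MulOneClass (GL (Fin 2) (v.adicCompletion F)) := inferInstance
instance instInvOneClassGLAdic : InvOneClass (GL (Fin 2) (v.adicCompletion F)) := inferInstance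
instance instGroupGLInt : Group (GL (Fin 2) (v.adicCompletionIntegers F)) := inferInstance

end Instances

/-! ### Components of adelic elements at the places dividing `p` and `𝔰` -/

namespace Datum

variable {F K : Type*} [Field F] [NumberField F] [Field K] [NumberField K] [Algebra F K]
  {p : ℕ} (D : Datum F K p)

theorem not_le_of_le {v : HeightOneSpectrum (𝓞 F)} (hv : Ideal.span {(p : 𝓞 F)} ≤ v.asIdeal) :
    ¬ D.s ≤ v.asIdeal := by
  intro h
  have := Ideal.isCoprime_iff_sup_eq.mp D.s_coprime
  exact v.isPrime.ne_top (top_le_iff.mp (this ▸ sup_le h hv))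

theorem placeP_apply_of_not_le {v : HeightOneSpectrum (𝓞 F)}
    (hv : ¬ Ideal.span {(p : 𝓞 F)} ≤ v.asIdeal)
    (g : ∀ v : D.Sp, GL (Fin 2) (v.1.adicCompletion F)) : D.placeP g v = 1 :=
  dif_neg hv

theorem placeS_apply_of_not_le {v : HeightOneSpectrum (𝓞 F)} (hv : ¬ D.s ≤ v.asIdeal)
    (g : ∀ v : D.Ss, GL (Fin 2) (v.1.adicCompletion F)) : D.placeS g v = 1 :=
  dif_neg hv

@[simp]
theorem atP_placeP (v : D.Sp) (g : ∀ v : D.Sp, GL (Fin 2) (v.1.adicCompletion F)) :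
    D.atP v (D.placeP g) = g v := by
  have h : D.placeP g v.1 = ofGL D.finrank_eq D.c_ne_one (D.wp v) (g v) := dif_pos v.2
  change iw _ _ (D.placeP g v.1) = _
  rw [h, iw_ofGL]

@[simp]
theorem atS_placeS (v : D.Ss) (g : ∀ v : D.Ss, GL (Fin 2) (v.1.adicCompletion F)) :
    D.atS v (D.placeS g) = g v := by
  have h : D.placeS g v.1 = ofGL D.finrank_eq D.c_ne_one (D.ws v) (g v) := dif_pos v.2
  change iw _ _ (D.placeS g v.1) = _
  rw [h, iw_ofGL]

@[simp]
theorem atS_placeP (v : D.Ss) (g : ∀ v : D.Sp, GL (Fin 2) (v.1.adicCompletion F)) :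
    D.atS v (D.placeP g) = 1 := by
  change iw _ _ (D.placeP g v.1) = _
  rw [D.placeP_apply_of_not_le (fun h => D.not_le_of_le h v.2), map_one]

@[simp]
theorem atP_placeS (v : D.Sp) (g : ∀ v : D.Ss, GL (Fin 2) (v.1.adicCompletion F)) :
    D.atP v (D.placeS g) = 1 := by
  change iw _ _ (D.placeS g v.1) = _
  rw [D.placeS_apply_of_not_le (D.not_le_of_le v.2), map_one]

theorem ext_components {x y : D.G} (hp : ∀ v, D.atP v x = D.atP v y)
    (hs : ∀ v, D.atS v x = D.atS v y)
    (h : ∀ v : HeightOneSpectrum (𝓞 F), ¬ Ideal.span {(p : 𝓞 F)} ≤ v.asIdeal →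
      ¬ D.s ≤ v.asIdeal → x v = y v) : x = y := by
  refine RestrictedProduct.ext _ _ fun v => ?_
  by_cases h1 : Ideal.span {(p : 𝓞 F)} ≤ v.asIdeal
  · exact iw_injective D.finrank_eq D.c_ne_one (D.wp ⟨v, h1⟩) (hp ⟨v, h1⟩)
  · by_cases h2 : D.s ≤ v.asIdeal
    · exact iw_injective D.finrank_eq D.c_ne_one (D.ws ⟨v, h2⟩) (hs ⟨v, h2⟩)
    · exact h v h1 h2

/-- The elements of `G₁(𝔸_{F,f})` with trivial components away from `p𝔰`. -/
def supported : Subgroup D.G where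
  carrier := {x | ∀ v : HeightOneSpectrum (𝓞 F), ¬ Ideal.span {(p : 𝓞 F)} ≤ v.asIdeal →
      ¬ D.s ≤ v.asIdeal → x v = 1}
  one_mem' := fun v _ _ => rfl
  mul_mem' := fun hx hy v h h' => by
    rw [RestrictedProduct.mul_apply, hx v h h', hy v h h', mul_one]
  inv_mem' := fun hx v h h' => by
    rw [RestrictedProduct.inv_apply, hx v h h', inv_one]

theorem placeP_mem_supported (g : ∀ v : D.Sp, GL (Fin 2) (v.1.adicCompletion F)) :
    D.placeP g ∈ D.supported := fun _ h _ => D.placeP_apply_of_not_le h g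

theorem placeS_mem_supported (g : ∀ v : D.Ss, GL (Fin 2) (v.1.adicCompletion F)) :
    D.placeS g ∈ D.supported := fun _ _ h => D.placeS_apply_of_not_le h g

theorem ext_supported {x y : D.G} (hx : x ∈ D.supported) (hy : y ∈ D.supported)
    (hp : ∀ v, D.atP v x = D.atP v y) (hs : ∀ v, D.atS v x = D.atS v y) : x = y :=
  D.ext_components hp hs fun v h h' => (hx v h h').trans (hy v h h').symm

/-! ### Conjugation -/

/-- Conjugation as an endomorphism of `G₁(𝔸_{F,f})`. -/
def barHom : D.G →* D.G where
  toFun := bar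
  map_one' := RestrictedProduct.ext _ _ fun v => map_one (locBar D.c v)
  map_mul' x y := RestrictedProduct.ext _ _ fun v => map_mul (locBar D.c v) (x v) (y v)

theorem bar_mul (x y : D.G) : bar (x * y) = bar x * bar y := D.barHom.map_mul x y

theorem locConj_locConj (v : HeightOneSpectrum (𝓞 F)) (x : LocK K v) :
    locConj D.c v (locConj D.c v x) = x := by
  induction x using TensorProduct.induction_on with
  | zero => simp
  | tmul a b => simp [locConj, conj_conj D.finrank_eq]
  | add x y hx hy => simp [map_add, hx, hy]

theorem bar_bar (x : D.G) : bar (bar x) = x :=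
  RestrictedProduct.ext _ _ fun v => Subtype.ext (Units.ext (Matrix.ext fun i j =>
    D.locConj_locConj v ((x v).1.1 i j)))

@[simp]
theorem atP_bar (v : D.Sp) (x : D.G) : D.atP v (bar x) = contra (D.atP v x) :=
  Units.ext (iw_locBar (D.wp v) (x v.1))

@[simp]
theorem atS_bar (v : D.Ss) (x : D.G) : D.atS v (bar x) = contra (D.atS v x) :=
  Units.ext (iw_locBar (D.ws v) (x v.1))

theorem bar_mem_supported {x : D.G} (hx : x ∈ D.supported) : bar x ∈ D.supported := by
  intro v h h'
  change locBar D.c v (x v) = 1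
  rw [hx v h h', map_one]

theorem bar_mem_rational {x : D.G} (hx : x ∈ D.rational) : bar x ∈ D.rational := by
  obtain ⟨γ, hγ⟩ := hx
  refine ⟨unitary2Bar _ γ, fun v => ?_⟩
  refine Units.ext (Matrix.ext fun i j => ?_)
  change locConj D.c v ((x v).1.1 i j) = (1 : v.adicCompletion F) ⊗ₜ[F] D.c (γ.1.1 i j)
  rw [hγ v]
  change locConj D.c v ((1 : v.adicCompletion F) ⊗ₜ[F] (γ.1.1 i j)) = _
  simp [locConj]

/-! ### Level subgroups -/

/-- The subgroup of `K(𝔫_∘)` cut out by conditions in `GL₂(𝓞_v)` at the places dividing `p𝔰`. -/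
def levelGroup (P : ∀ v : D.Sp, Subgroup (GL (Fin 2) (v.1.adicCompletionIntegers F)))
    (Q : ∀ v : D.Ss, Subgroup (GL (Fin 2) (v.1.adicCompletionIntegers F))) : Subgroup D.G where
  carrier := {x | (∀ v : HeightOneSpectrum (𝓞 F), ¬ Ideal.span {(p : 𝓞 F)} ≤ v.asIdeal →
      ¬ D.s ≤ v.asIdeal → x v ∈ D.Kv v) ∧ (∀ v, D.atP v x ∈ (P v).map (intGL v.1)) ∧
      ∀ v, D.atS v x ∈ (Q v).map (intGL v.1)}
  one_mem' := ⟨fun v _ _ => one_mem _, fun v => by rw [map_one]; exact one_mem _,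
    fun v => by rw [map_one]; exact one_mem _⟩
  mul_mem' := fun hx hy => ⟨fun v h h' => mul_mem (hx.1 v h h') (hy.1 v h h'),
    fun v => by rw [map_mul]; exact mul_mem (hx.2.1 v) (hy.2.1 v),
    fun v => by rw [map_mul]; exact mul_mem (hx.2.2 v) (hy.2.2 v)⟩
  inv_mem' := fun hx => ⟨fun v h h' => inv_mem (hx.1 v h h'),
    fun v => by rw [map_inv]; exact inv_mem (hx.2.1 v),
    fun v => by rw [map_inv]; exact inv_mem (hx.2.2 v)⟩

/-- At a place dividing `p𝔰` the group `K_v` is `K_v⁰`, that is `GL₂(𝓞_v)` at the chosen place, so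
any condition stated inside `GL₂(𝓞_v)` already implies membership. -/
theorem levelGroup_le_levelCirc
    (P : ∀ v : D.Sp, Subgroup (GL (Fin 2) (v.1.adicCompletionIntegers F)))
    (Q : ∀ v : D.Ss, Subgroup (GL (Fin 2) (v.1.adicCompletionIntegers F))) :
    D.levelGroup P Q ≤ D.levelCirc := by
  intro x hx
  rw [levelCirc, Subgroup.mem_iInf]
  intro v
  rw [Subgroup.mem_comap]
  change x v ∈ _
  by_cases h1 : Ideal.span {(p : 𝓞 F)} ≤ v.asIdeal
  · rw [D.Kv_p v h1, mem_K0loc_iff_iw D.finrank_eq D.c_ne_one (D.wp ⟨v, h1⟩)]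
    exact Subgroup.map_le_range _ _ (hx.2.1 ⟨v, h1⟩)
  · by_cases h2 : D.s ≤ v.asIdeal
    · rw [D.Kv_s v h2, mem_K0loc_iff_iw D.finrank_eq D.c_ne_one (D.ws ⟨v, h2⟩)]
      exact Subgroup.map_le_range _ _ (hx.2.2 ⟨v, h2⟩)
    · exact hx.1 v h1 h2

theorem mem_Kv_of_mem_levelCirc {x : D.G} (hx : x ∈ D.levelCirc)
    (v : HeightOneSpectrum (𝓞 F)) : x v ∈ D.Kv v := by
  rw [levelCirc, Subgroup.mem_iInf] at hx
  exact hx v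

/-- The ideal `(pⁿ)` of `𝓞_v`. -/
abbrev pIdeal (n : ℕ) (v : D.Sp) : Ideal (v.1.adicCompletionIntegers F) :=
  locIdeal v.1 (Ideal.span {(p : 𝓞 F) ^ n})

theorem mem_pIdeal_iff {n : ℕ} {v : D.Sp} {x : v.1.adicCompletionIntegers F} :
    x ∈ D.pIdeal n v ↔ (p : v.1.adicCompletionIntegers F) ^ n ∣ x := by
  rw [pIdeal, locIdeal, Ideal.map_span, Set.image_singleton, Ideal.mem_span_singleton, map_pow,
    map_natCast]

theorem mem_K1_iff {n : ℕ} {x : D.G} : x ∈ D.K1 n ↔ x ∈ D.levelGroup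
    (fun v => Gamma1 (D.pIdeal n v)) (fun v => Gamma1 (locIdeal v.1 D.s)) := by
  constructor
  · rintro ⟨⟨h1, h2⟩, h3⟩
    refine ⟨fun v _ _ => D.mem_Kv_of_mem_levelCirc h1 v, fun v => ?_, fun v => ?_⟩
    · have := (Subgroup.mem_iInf.mp h3) v
      exact this
    · have := (Subgroup.mem_iInf.mp h2) v
      exact this
  · intro h
    exact ⟨⟨D.levelGroup_le_levelCirc _ _ h, Subgroup.mem_iInf.mpr h.2.2⟩,
      Subgroup.mem_iInf.mpr h.2.1⟩

theorem mem_K0_iff {n : ℕ} {x : D.G} : x ∈ D.K0 n ↔ x ∈ D.levelGroup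
    (fun v => Gamma0 (D.pIdeal n v)) (fun v => Gamma1 (locIdeal v.1 D.s)) := by
  constructor
  · rintro ⟨⟨h1, h2⟩, h3⟩
    refine ⟨fun v _ _ => D.mem_Kv_of_mem_levelCirc h1 v, fun v => ?_, fun v => ?_⟩
    · have := (Subgroup.mem_iInf.mp h3) v
      exact this
    · have := (Subgroup.mem_iInf.mp h2) v
      exact this
  · intro h
    exact ⟨⟨D.levelGroup_le_levelCirc _ _ h, Subgroup.mem_iInf.mpr h.2.2⟩,
      Subgroup.mem_iInf.mpr h.2.1⟩

/-- The subgroup of `K(𝔫_∘)` of matrices that are upper triangular modulo `pⁿ` and `𝔰`. -/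
def K00 (n : ℕ) : Subgroup D.G :=
  D.levelGroup (fun v => Gamma0 (D.pIdeal n v)) (fun v => Gamma0 (locIdeal v.1 D.s))

theorem Gamma1_le_Gamma0 {A : Type*} [CommRing A] (J : Ideal A) : Gamma1 J ≤ Gamma0 J :=
  fun _ h => h.2

theorem levelGroup_mono
    {P P' : ∀ v : D.Sp, Subgroup (GL (Fin 2) (v.1.adicCompletionIntegers F))}
    {Q Q' : ∀ v : D.Ss, Subgroup (GL (Fin 2) (v.1.adicCompletionIntegers F))}
    (hP : ∀ v, P v ≤ P' v) (hQ : ∀ v, Q v ≤ Q' v) : D.levelGroup P Q ≤ D.levelGroup P' Q' :=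
  fun _ h => ⟨h.1, fun v => Subgroup.map_mono (hP v) (h.2.1 v),
    fun v => Subgroup.map_mono (hQ v) (h.2.2 v)⟩

theorem K1_le_K0 (n : ℕ) : D.K1 n ≤ D.K0 n := fun _ h => D.mem_K0_iff.mpr
  (D.levelGroup_mono (fun _ => Gamma1_le_Gamma0 _) (fun _ => le_rfl) (D.mem_K1_iff.mp h))

theorem K0_le_K00 (n : ℕ) : D.K0 n ≤ D.K00 n := fun _ h =>
  D.levelGroup_mono (fun _ => le_rfl) (fun _ => Gamma1_le_Gamma0 _) (D.mem_K0_iff.mp h)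

theorem K00_le_levelCirc (n : ℕ) : D.K00 n ≤ D.levelCirc := D.levelGroup_le_levelCirc _ _

theorem pIdeal_anti {n m : ℕ} (h : n ≤ m) (v : D.Sp) : D.pIdeal m v ≤ D.pIdeal n v := by
  intro x hx
  rw [mem_pIdeal_iff] at hx ⊢
  exact (pow_dvd_pow _ h).trans hx

theorem K0_anti {n m : ℕ} (h : n ≤ m) : D.K0 m ≤ D.K0 n := fun _ hx =>
  D.mem_K0_iff.mpr (D.levelGroup_mono (fun v _ hg => D.pIdeal_anti h v hg) (fun _ => le_rfl)
    (D.mem_K0_iff.mp hx))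

/-! ### Components of the special elements -/

theorem p_ne_zero' (D : Datum F K p) (v : HeightOneSpectrum (𝓞 F)) : (p : v.adicCompletionIntegers F) ≠ 0 :=
  fun h => D.p_ne_zero v (congrArg Subtype.val h)

@[simp]
theorem atP_upper (v : D.Sp) (b : 𝓞 F) : (D.atP v (D.upper b)).1
    = !![(p : v.1.adicCompletion F), algebraMap (𝓞 F) (v.1.adicCompletion F) b; 0, 1] := by
  rw [upper, atP_placeP]; rfl

@[simp]
theorem atS_upper (v : D.Ss) (b : 𝓞 F) : D.atS v (D.upper b) = 1 := D.atS_placeP v _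

@[simp]
theorem atP_scalarP (v : D.Sp) : (D.atP v D.scalarP).1
    = !![(p : v.1.adicCompletion F), 0; 0, (p : v.1.adicCompletion F)] := by
  rw [scalarP, atP_placeP]; rfl

@[simp]
theorem atS_scalarP (v : D.Ss) : D.atS v D.scalarP = 1 := D.atS_placeP v _

theorem diag_pow {A : Type*} [Field A] (t : A) (h : Matrix.det !![t, 0; 0, 1] ≠ 0) (m : ℕ) :
    (Matrix.GeneralLinearGroup.mkOfDetNeZero (K := A) !![t, 0; 0, 1] h ^ m).1
      = !![t ^ m, 0; 0, 1] := by
  induction m with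
  | zero => simp [Matrix.one_fin_two]
  | succ m ih =>
    rw [pow_succ, Units.val_mul, ih]
    change _ * !![t, 0; 0, 1] = _
    simp [pow_succ]

@[simp]
theorem atP_tau (v : D.Sp) (n : ℕ) : (D.atP v (D.tau n)).1
    = !![(p : v.1.adicCompletion F) ^ n, 0; 0, 1] := by
  rw [tau, map_mul, atP_placeP, atP_placeS, mul_one]; rfl

@[simp]
theorem atS_tau (v : D.Ss) (n : ℕ) : (D.atS v (D.tau n)).1
    = !![(D.unif v : v.1.adicCompletion F) ^ multiplicity v.1.asIdeal D.s, 0; 0, 1] := by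
  rw [tau, map_mul, atS_placeP, atS_placeS, one_mul]
  exact diag_pow _ _ _

theorem upper_mem_supported (b : 𝓞 F) : D.upper b ∈ D.supported := D.placeP_mem_supported _

theorem scalarP_mem_supported : D.scalarP ∈ D.supported := D.placeP_mem_supported _

theorem tau_mem_supported (n : ℕ) : D.tau n ∈ D.supported :=
  mul_mem (D.placeP_mem_supported _) (D.placeS_mem_supported _)

variable (u : ∀ v : D.Sp, (v.1.adicCompletionIntegers F)ˣ)
  (t : ∀ v : D.Ss, (v.1.adicCompletionIntegers F)ˣ)

theorem scalar_mem_supported : D.scalar u t ∈ D.supported :=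
  mul_mem (D.placeP_mem_supported _) (D.placeS_mem_supported _)

@[simp]
theorem atP_scalar (v : D.Sp) : D.atP v (D.scalar u t)
    = intGL v.1 (Units.map (Matrix.scalar (Fin 2)).toMonoidHom (u v)) := by
  rw [scalar, map_mul, atP_placeP, atP_placeS, mul_one]

@[simp]
theorem atS_scalar (v : D.Ss) : D.atS v (D.scalar u t)
    = intGL v.1 (Units.map (Matrix.scalar (Fin 2)).toMonoidHom (t v)) := by
  rw [scalar, map_mul, atS_placeP, atS_placeS, one_mul]

theorem intGL_scalar_val (v : HeightOneSpectrum (𝓞 F)) (a : (v.adicCompletionIntegers F)ˣ) :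
    (intGL v (Units.map (Matrix.scalar (Fin 2)).toMonoidHom a)).1
      = !![(a.1 : v.adicCompletion F), 0; 0, (a.1 : v.adicCompletion F)] := by
  refine Matrix.ext fun i j => ?_
  change ((Matrix.scalar (Fin 2) a.1 i j : v.adicCompletionIntegers F) : v.adicCompletion F) = _
  fin_cases i <;> fin_cases j <;> simp

theorem commute_scalar {A : Type*} [CommRing A] (g z : GL (Fin 2) A) {a : A}
    (hz : z.1 = !![a, 0; 0, a]) : g * z = z * g := by
  ext i j : 3
  rw [Units.val_mul, Units.val_mul, hz]
  fin_cases i <;> fin_cases j <;> simp [Matrix.mul_apply, Fin.sum_univ_two, mul_comm]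

theorem scalar_comm (g : D.G) : g * D.scalar u t = D.scalar u t * g := by
  refine D.ext_components (fun v => ?_) (fun v => ?_) fun v h h' => ?_
  · rw [map_mul, map_mul, atP_scalar]
    exact commute_scalar _ _ (intGL_scalar_val _ _)
  · rw [map_mul, map_mul, atS_scalar]
    exact commute_scalar _ _ (intGL_scalar_val _ _)
  · rw [RestrictedProduct.mul_apply, RestrictedProduct.mul_apply,
      D.scalar_mem_supported u t v h h', mul_one, one_mul]

theorem scalarP_comm (g : D.G) : g * D.scalarP = D.scalarP * g := by
  refine D.ext_components (fun v => ?_) (fun v => ?_) fun v h h' => ?_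
  · rw [map_mul, map_mul]
    exact commute_scalar _ _ (D.atP_scalarP v)
  · rw [map_mul, map_mul, atS_scalarP, mul_one, one_mul]
  · rw [RestrictedProduct.mul_apply, RestrictedProduct.mul_apply,
      D.scalarP_mem_supported v h h', mul_one, one_mul]

theorem scalar_mul (u' : ∀ v : D.Sp, (v.1.adicCompletionIntegers F)ˣ)
    (t' : ∀ v : D.Ss, (v.1.adicCompletionIntegers F)ˣ) :
    D.scalar (u * u') (t * t') = D.scalar u t * D.scalar u' t' := by
  refine D.ext_supported (D.scalar_mem_supported _ _)
    (mul_mem (D.scalar_mem_supported _ _) (D.scalar_mem_supported _ _)) (fun v => ?_) fun v => ?_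
  · simp only [map_mul, atP_scalar, Pi.mul_apply]
  · simp only [map_mul, atS_scalar, Pi.mul_apply]

theorem contra_diag {A : Type*} [CommRing A] (g : GL (Fin 2) A) {a d : A}
    (hg : g.1 = !![a, 0; 0, d]) : contra g = g⁻¹ := by
  have h : g * (contra g)⁻¹ = g * g := by
    ext1
    rw [← map_inv, Units.val_mul, Units.val_mul, contra_val, inv_inv, hg]
    congr 1
    ext i j
    fin_cases i <;> fin_cases j <;> simp
  rw [← inv_inj, inv_inv]
  exact mul_left_cancel h

theorem bar_scalar : bar (D.scalar u t) = (D.scalar u t)⁻¹ := by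
  refine D.ext_supported (D.bar_mem_supported (D.scalar_mem_supported _ _))
    (inv_mem (D.scalar_mem_supported _ _)) (fun v => ?_) fun v => ?_
  · rw [atP_bar, map_inv, atP_scalar]
    exact contra_diag _ (intGL_scalar_val _ _)
  · rw [atS_bar, map_inv, atS_scalar]
    exact contra_diag _ (intGL_scalar_val _ _)

theorem bar_scalarP : bar D.scalarP = D.scalarP⁻¹ := by
  refine D.ext_supported (D.bar_mem_supported D.scalarP_mem_supported)
    (inv_mem D.scalarP_mem_supported) (fun v => ?_) fun v => ?_
  · rw [atP_bar, map_inv]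
    exact contra_diag _ (D.atP_scalarP v)
  · rw [atS_bar, map_inv, atS_scalarP, map_one, inv_one]

/-- Conjugation acts at split places by the contragredient, which inverts diagonal matrices. This is
what makes `g ↦ ḡ τ_n` an involution. -/
theorem bar_tau (n : ℕ) : bar (D.tau n) = (D.tau n)⁻¹ := by
  refine D.ext_supported (D.bar_mem_supported (D.tau_mem_supported n))
    (inv_mem (D.tau_mem_supported n)) (fun v => ?_) fun v => ?_
  · rw [atP_bar, map_inv]
    exact contra_diag _ (D.atP_tau v n)
  · rw [atS_bar, map_inv]
    exact contra_diag _ (D.atS_tau v n)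

end Datum

end

end HidaU2

namespace HidaU2

noncomputable section

/-! ### Ideals of the local rings -/

section LocalIdeals

variable {F : Type*} [Field F] [NumberField F]

theorem mem_maximalIdeal_iff_valued {v : HeightOneSpectrum (𝓞 F)} {x : v.adicCompletionIntegers F} :
    x ∈ IsLocalRing.maximalIdeal (v.adicCompletionIntegers F) ↔
      Valued.v (x : v.adicCompletion F) < 1 := by
  rw [IsLocalRing.mem_maximalIdeal, mem_nonunits_iff,
    HeightOneSpectrum.adicCompletionIntegers.isUnit_iff_valued_eq_one]
  exact ⟨fun h => lt_of_le_of_ne x.2 h, fun h => h.ne⟩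

theorem map_asIdeal (v : HeightOneSpectrum (𝓞 F)) :
    v.asIdeal.map (algebraMap (𝓞 F) (v.adicCompletionIntegers F))
      = IsLocalRing.maximalIdeal (v.adicCompletionIntegers F) := by
  refine le_antisymm (Ideal.map_le_iff_le_comap.mpr fun a ha => ?_) fun x hx => ?_
  · rw [Ideal.mem_comap, mem_maximalIdeal_iff_valued, coe_algebraMap_integers, valued_algebraMap]
    exact (v.valuation_lt_one_iff_mem a).mpr ha
  · rw [mem_maximalIdeal_iff_valued] at hx
    obtain ⟨r, hr⟩ := v.intValuation_exists_uniformizer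
    have hr1 : Valued.v (algebraMap F (v.adicCompletion F) (r : F)) = WithZero.exp (-1 : ℤ) := by
      rw [valued_algebraMap, ← hr]
      exact v.valuation_of_algebraMap r
    obtain ⟨z, hz⟩ := exists_eq_mul_of_valued_le v
      (x := (x : v.adicCompletion F)) (y := algebraMap F (v.adicCompletion F) (r : F)) (by
        rw [hr1]
        by_cases h0 : Valued.v (x : v.adicCompletion F) = 0
        · rw [h0]; exact zero_le
        · rw [← WithZero.exp_log h0, ← WithZero.exp_zero, WithZero.exp_lt_exp] at hx
          rw [← WithZero.exp_log h0, WithZero.exp_le_exp]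
          omega)
    have hx' : x = algebraMap (𝓞 F) (v.adicCompletionIntegers F) r * z := Subtype.ext hz
    rw [hx']
    refine Ideal.mul_mem_right _ _ (Ideal.mem_map_of_mem _ ?_)
    rw [← v.intValuation_lt_one_iff_mem, hr, ← WithZero.exp_zero, WithZero.exp_lt_exp]
    norm_num

/-- The part of `I` prime to `v` generates the unit ideal of `𝓞_v`. In this form conjugation by
`diag(ϖ_v, 1)^{val(𝔰)}` can be compared with the congruence conditions modulo `𝔰`. -/
theorem locIdeal_eq_span_pow (v : HeightOneSpectrum (𝓞 F)) {I : Ideal (𝓞 F)} (hI : I ≠ ⊥)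
    {ϖ : v.adicCompletionIntegers F} (hϖ : Irreducible ϖ) :
    locIdeal v I = Ideal.span {ϖ ^ multiplicity v.asIdeal I} := by
  obtain ⟨c, hc, hvc⟩ := (FiniteMultiplicity.of_prime_left v.prime
    hI).exists_eq_pow_mul_and_not_dvd
  have hct : c.map (algebraMap (𝓞 F) (v.adicCompletionIntegers F)) = ⊤ := by
    rw [Ideal.dvd_iff_le, SetLike.not_le_iff_exists] at hvc
    obtain ⟨a, ha, hav⟩ := hvc
    exact Ideal.eq_top_of_isUnit_mem _ (Ideal.mem_map_of_mem _ ha)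
      (isUnit_algebraMap_of_notMem v hav)
  set m := multiplicity v.asIdeal I
  rw [locIdeal, hc, Ideal.map_mul, Ideal.map_pow, hct, map_asIdeal, hϖ.maximalIdeal_eq,
    Ideal.mul_top, Ideal.span_singleton_pow]

theorem locIdeal_le_maximalIdeal {v : HeightOneSpectrum (𝓞 F)} {I : Ideal (𝓞 F)}
    (h : I ≤ v.asIdeal) :
    locIdeal v I ≤ IsLocalRing.maximalIdeal (v.adicCompletionIntegers F) := by
  rw [← map_asIdeal]
  exact Ideal.map_mono h

end LocalIdeals

/-! ### Matrix computations -/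

section Matrices

variable {A : Type*} [CommRing A]

theorem isUnit_of_det [IsLocalRing A] (g : GL (Fin 2) A)
    (h : g.1 1 0 ∈ IsLocalRing.maximalIdeal A) : IsUnit (g.1 0 0) ∧ IsUnit (g.1 1 1) := by
  have hu := det_isUnit g
  have h1 : ¬ IsUnit (g.1 0 1 * g.1 1 0) := fun h' =>
    h (isUnit_of_mul_isUnit_right h')
  have h2 : IsUnit (g.1 0 0 * g.1 1 1) := by
    by_contra h3
    refine (IsLocalRing.mem_maximalIdeal _).mp (sub_mem ?_ ?_) hu
    · exact (IsLocalRing.mem_maximalIdeal _).mpr h3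
    · exact (IsLocalRing.mem_maximalIdeal _).mpr h1
  exact ⟨isUnit_of_mul_isUnit_left h2, isUnit_of_mul_isUnit_right h2⟩

/-- Multiply the relation by `M'.adjugate` on the left and by `M.adjugate` on the right, then cancel
the common determinant. It transports relations between integral matrices to the normalised action,
which is defined through adjugates. -/
theorem adjugate_intertwine [IsDomain A] {B C M M' : Matrix (Fin 2) (Fin 2) A}
    (h : B * M = M' * C) (hdet : M.det = M'.det) (h0 : M.det ≠ 0) :
    C * M.adjugate = M'.adjugate * B := by
  have h1 : M.det • (C * M.adjugate) = M.det • (M'.adjugate * B) := by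
    calc M.det • (C * M.adjugate) = M'.adjugate * M' * (C * M.adjugate) := by
          rw [Matrix.adjugate_mul, ← hdet, Matrix.smul_mul, Matrix.one_mul]
      _ = M'.adjugate * (M' * C) * M.adjugate := by simp only [Matrix.mul_assoc]
      _ = M'.adjugate * B * (M * M.adjugate) := by rw [← h]; simp only [Matrix.mul_assoc]
      _ = M.det • (M'.adjugate * B) := by
          rw [Matrix.mul_adjugate, Matrix.mul_smul, Matrix.mul_one]
  exact smul_right_injective _ h0 h1

/-- Conjugating the contragredient of a matrix with lower left entry `tc` by `diag(t, 1)`. -/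
theorem exists_contra_mul_diag (g : GL (Fin 2) A) {t c : A} (hc : g.1 1 0 = t * c) :
    ∃ h : GL (Fin 2) A, (contra g).1 * !![t, 0; 0, 1] = !![t, 0; 0, 1] * h.1 ∧
      t ∣ h.1 1 0 ∧ ∀ J : Ideal A, g.1 0 0 - 1 ∈ J → g.1 1 0 ∈ J → h.1 0 0 - 1 ∈ J := by
  obtain ⟨δ, hδ⟩ := (det_isUnit g).exists_right_inv
  have hinv : (g⁻¹).1 = !![g.1 1 1 * δ, -g.1 0 1 * δ; -g.1 1 0 * δ, g.1 0 0 * δ] := by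
    have h1 : g.1 * !![g.1 1 1 * δ, -g.1 0 1 * δ; -g.1 1 0 * δ, g.1 0 0 * δ] = 1 := by
      refine Matrix.ext fun i j => ?_
      fin_cases i <;> fin_cases j <;> simp [Matrix.mul_apply, Fin.sum_univ_two]
      · linear_combination hδ
      · ring
      · ring
      · linear_combination hδ
    rw [← Matrix.one_mul (!![g.1 1 1 * δ, -g.1 0 1 * δ; -g.1 1 0 * δ, g.1 0 0 * δ]),
      ← Units.inv_mul g, Matrix.mul_assoc, h1, Matrix.mul_one]
  have hdet : IsUnit (!![g.1 1 1 * δ, -c * δ; -g.1 0 1 * t * δ, g.1 0 0 * δ] : Matrix _ _ A).det := by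
    rw [Matrix.det_fin_two_of]
    refine IsUnit.of_mul_eq_one (g.1 0 0 * g.1 1 1 - g.1 0 1 * g.1 1 0) ?_
    rw [hc] at hδ ⊢
    linear_combination ((g.1 0 0 * g.1 1 1 - g.1 0 1 * (t * c)) * δ + 1) * hδ
  refine ⟨Matrix.GeneralLinearGroup.mk'' _ hdet, ?_, ?_, fun J h1 h2 => ?_⟩
  · rw [contra_val, hinv]
    change _ = _ * !![g.1 1 1 * δ, -c * δ; -g.1 0 1 * t * δ, g.1 0 0 * δ]
    refine Matrix.ext fun i j => ?_
    fin_cases i <;> fin_cases j <;> simp [Matrix.mul_apply, Fin.sum_univ_two]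
    · ring
    · rw [hc]; ring
    · ring
  · change t ∣ -g.1 0 1 * t * δ
    exact ⟨-g.1 0 1 * δ, by ring⟩
  · change g.1 1 1 * δ - 1 ∈ J
    have : g.1 1 1 * δ - 1 = -(δ * g.1 1 1) * (g.1 0 0 - 1) + δ * g.1 0 1 * g.1 1 0 := by
      linear_combination hδ
    rw [this]
    exact add_mem (J.mul_mem_left _ h1) (J.mul_mem_left _ h2)

end Matrices

theorem intGL_mul_eq_mul_intGL_iff {F : Type*} [Field F] [NumberField F]
    {v : HeightOneSpectrum (𝓞 F)} {A B : GL (Fin 2) (v.adicCompletionIntegers F)}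
    {x y : GL (Fin 2) (v.adicCompletion F)}
    {X Y : Matrix (Fin 2) (Fin 2) (v.adicCompletionIntegers F)}
    (hx : x.1 = X.map (v.adicCompletionIntegers F).subtype)
    (hy : y.1 = Y.map (v.adicCompletionIntegers F).subtype) :
    intGL v A * x = y * intGL v B ↔ A.1 * X = Y * B.1 := by
  have h : ∀ A, (intGL v A).1 = A.1.map (v.adicCompletionIntegers F).subtype := fun _ => rfl
  rw [Units.ext_iff, Units.val_mul, Units.val_mul, hx, hy, h, h, ← Matrix.map_mul,
    ← Matrix.map_mul]
  exact (Matrix.map_injective Subtype.val_injective).eq_iff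

theorem map_subtype_fin_two {F : Type*} [Field F] [NumberField F]
    {v : HeightOneSpectrum (𝓞 F)} (a b c d : v.adicCompletionIntegers F) :
    (!![a, b; c, d]).map (v.adicCompletionIntegers F).subtype
      = !![(a : v.adicCompletion F), (b : v.adicCompletion F); (c : v.adicCompletion F),
        (d : v.adicCompletion F)] := by
  refine Matrix.ext fun i j => ?_
  fin_cases i <;> fin_cases j <;> rfl

/-! ### Coset representatives and relations between them -/

namespace Datum

variable {F K : Type*} [Field F] [NumberField F] [Field K] [NumberField K] [Algebra F K]
  {p : ℕ} (D : Datum F K p)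

theorem p_pow_mem_maximalIdeal {n : ℕ} (hn : 1 ≤ n) (v : D.Sp) :
    D.pIdeal n v ≤ IsLocalRing.maximalIdeal _ :=
  (D.pIdeal_anti hn v).trans <| locIdeal_le_maximalIdeal (by
    rw [pow_one]; exact v.2)

theorem exists_approx_p (x : ∀ v : D.Sp, v.1.adicCompletionIntegers F) :
    ∃ b : 𝓞 F, ∀ v : D.Sp, (p : v.1.adicCompletionIntegers F) ∣ x v - algebraMap (𝓞 F) _ b := by
  classical
  have hp : (p : 𝓞 F) ≠ 0 := by exact_mod_cast D.prime.ne_zero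
  obtain ⟨b, hb⟩ := exists_approx (fun v : HeightOneSpectrum (𝓞 F) =>
    if h : Ideal.span {(p : 𝓞 F)} ≤ v.asIdeal then x ⟨v, h⟩ else 0) hp
  refine ⟨b, fun v => ?_⟩
  have := hb v.1
  rwa [dif_pos v.2, map_natCast] at this

/-- The quotient `b / p` is integral at the places above `p` by hypothesis and at all others because
`p` is a unit there. -/
theorem p_dvd_of_forall {b : 𝓞 F} (h : ∀ v : D.Sp,
    (p : v.1.adicCompletionIntegers F) ∣ algebraMap (𝓞 F) _ b) : (p : 𝓞 F) ∣ b := by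
  have hp : (p : F) ≠ 0 := by exact_mod_cast D.prime.ne_zero
  obtain ⟨a, ha⟩ := exists_ringOfIntegers_of_forall_mem (z := (b : F) / p) fun v => by
    rw [HeightOneSpectrum.mem_adicCompletionIntegers, map_div₀, map_div₀]
    by_cases hv : Ideal.span {(p : 𝓞 F)} ≤ v.asIdeal
    · obtain ⟨y, hy⟩ := h ⟨v, hv⟩
      have hy' : algebraMap F (v.adicCompletion F) (b : F) = (p : v.adicCompletion F) * y :=
        congrArg Subtype.val hy
      rw [hy', map_natCast, ← map_div₀, mul_div_cancel_left₀ _ (D.p_ne_zero v)]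
      exact y.2
    · have h1 : Valued.v (algebraMap F (v.adicCompletion F) (p : F)) = 1 := by
        rw [valued_algebraMap]
        have := (v.valuation_eq_one_iff_notMem (K := F) (r := (p : 𝓞 F))).mpr
          (fun h' => hv ((Ideal.span_singleton_le_iff_mem _).mpr h'))
        simpa using this
      rw [h1, div_one, valued_algebraMap]
      exact v.valuation_le_one b
  refine ⟨a, ?_⟩
  apply NumberField.RingOfIntegers.ext
  simp only [map_mul, map_natCast]
  have ha' : (algebraMap (𝓞 F) F) a = (b : F) / p := ha
  rw [ha']
  field_simp

theorem exists_intGL_of_mem_K1 {n : ℕ} {u : D.G} (hu : u ∈ D.K1 n) :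
    ∃ A : ∀ v : D.Sp, GL (Fin 2) (v.1.adicCompletionIntegers F),
      (∀ v, intGL v.1 (A v) = D.atP v u) ∧
        ∀ v, (A v).1 0 0 - 1 ∈ D.pIdeal n v ∧ (A v).1 1 0 ∈ D.pIdeal n v := by
  choose A hA using (D.mem_K1_iff.mp hu).2.1
  exact ⟨A, fun v => (hA v).2, fun v => (hA v).1⟩

theorem exists_intGL_of_mem_K0 {n : ℕ} {u : D.G} (hu : u ∈ D.K0 n) :
    ∃ A : ∀ v : D.Sp, GL (Fin 2) (v.1.adicCompletionIntegers F),
      (∀ v, intGL v.1 (A v) = D.atP v u) ∧ ∀ v, (A v).1 1 0 ∈ D.pIdeal n v := by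
  choose A hA using (D.mem_K0_iff.mp hu).2.1
  exact ⟨A, fun v => (hA v).2, fun v => (hA v).1⟩

theorem atP_upper_eq_map (v : D.Sp) (b : 𝓞 F) : (D.atP v (D.upper b)).1
    = (!![(p : v.1.adicCompletionIntegers F), algebraMap (𝓞 F) _ b; 0, 1]).map
      (v.1.adicCompletionIntegers F).subtype := by
  rw [atP_upper, map_subtype_fin_two]
  rfl

/-- Changing `(p b; 0 1)` and `(p b'; 0 1)` by elements of `K₁ⁿ`. -/
theorem upper_inv_mul_mem {n : ℕ} {u : D.G} (hu : u ∈ D.K1 n)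
    {A : ∀ v : D.Sp, GL (Fin 2) (v.1.adicCompletionIntegers F)}
    (hA : ∀ v, intGL v.1 (A v) = D.atP v u) {b b' : 𝓞 F}
    (h : ∀ v : D.Sp, (p : v.1.adicCompletionIntegers F) ∣
      (A v).1 0 0 * algebraMap (𝓞 F) _ b + (A v).1 0 1
        - algebraMap (𝓞 F) _ b' * ((A v).1 1 0 * algebraMap (𝓞 F) _ b + (A v).1 1 1)) :
    (D.upper b')⁻¹ * u * D.upper b ∈ D.K1 n := by
  obtain ⟨h1, h2, h3⟩ := D.mem_K1_iff.mp hu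
  refine D.mem_K1_iff.mpr ⟨fun v hv hv' => ?_, fun v => ?_, fun v => ?_⟩
  · have e1 : (D.upper b) v = 1 := D.upper_mem_supported b v hv hv'
    have e2 : (D.upper b')⁻¹ v = 1 := inv_mem (D.upper_mem_supported b') v hv hv'
    rw [RestrictedProduct.mul_apply, RestrictedProduct.mul_apply, e1, e2, one_mul, mul_one]
    exact h1 v hv hv'
  · obtain ⟨B, hB, hBu⟩ := h2 v
    have hBA : B = A v := intGL_injective v.1 (hBu.trans (hA v).symm)
    subst hBA
    obtain ⟨y, hy⟩ := h v
    -- This is `(p b'; 0 1)⁻¹ u (p b; 0 1)`. Only its upper right entry involves a division by `p`,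
    -- and `y` is that quotient.
    set M : Matrix (Fin 2) (Fin 2) (v.1.adicCompletionIntegers F) :=
      !![(A v).1 0 0 - algebraMap (𝓞 F) _ b' * (A v).1 1 0, y;
        (p : v.1.adicCompletionIntegers F) * (A v).1 1 0,
        (A v).1 1 0 * algebraMap (𝓞 F) _ b + (A v).1 1 1] with hM
    have hdet : M.det = (A v).1 0 0 * (A v).1 1 1 - (A v).1 0 1 * (A v).1 1 0 := by
      rw [hM, Matrix.det_fin_two_of]
      linear_combination (A v).1 1 0 * hy
    have hMu : IsUnit M.det := hdet ▸ det_isUnit (A v)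
    refine ⟨Matrix.GeneralLinearGroup.mk'' M hMu, ⟨?_, ?_⟩, ?_⟩
    · change (A v).1 0 0 - algebraMap (𝓞 F) _ b' * (A v).1 1 0 - 1 ∈ D.pIdeal n v
      rw [sub_right_comm]
      exact sub_mem hB.1 (Ideal.mul_mem_left _ _ hB.2)
    · exact Ideal.mul_mem_left _ (p : v.1.adicCompletionIntegers F) hB.2
    · rw [map_mul, map_mul, map_inv, mul_assoc, eq_inv_mul_iff_mul_eq, ← hA v, eq_comm,
        intGL_mul_eq_mul_intGL_iff (D.atP_upper_eq_map v b) (D.atP_upper_eq_map v b')]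
      change _ = _ * M
      refine Matrix.ext fun i j => ?_
      fin_cases i <;> fin_cases j <;> simp [Matrix.mul_apply, Fin.sum_univ_two, hM]
      · ring
      · linear_combination hy
      · ring
  · simpa using h3 v

/-- The element `b'` is the image of `b` modulo `p` under the Möbius transformation `(a b + a') / (c
b + d)`. The denominator is a unit because `c` lies in the maximal ideal when `n ≥ 1`. -/
theorem exists_upper_of_mem_K1 {n : ℕ} (hn : 1 ≤ n) {u : D.G} (hu : u ∈ D.K1 n) (b : 𝓞 F) :
    ∃ b' : 𝓞 F, (D.upper b')⁻¹ * u * D.upper b ∈ D.K1 n := by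
  obtain ⟨A, hA, hA1⟩ := D.exists_intGL_of_mem_K1 hu
  have hunit : ∀ v, IsUnit ((A v).1 1 0 * algebraMap (𝓞 F) _ b + (A v).1 1 1) := by
    intro v
    have hm := D.p_pow_mem_maximalIdeal hn v (hA1 v).2
    by_contra h3
    have h4 := sub_mem ((IsLocalRing.mem_maximalIdeal _).mpr h3)
      (Ideal.mul_mem_right (algebraMap (𝓞 F) _ b) _ hm)
    rw [add_sub_cancel_left] at h4
    exact (IsLocalRing.mem_maximalIdeal _).mp h4 (isUnit_of_det (A v) hm).2
  choose δ hδ using fun v => (hunit v).exists_right_inv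
  obtain ⟨b', hb'⟩ := D.exists_approx_p fun v =>
    ((A v).1 0 0 * algebraMap (𝓞 F) _ b + (A v).1 0 1) * δ v
  refine ⟨b', D.upper_inv_mul_mem hu hA fun v => ?_⟩
  have := (hb' v).mul_right ((A v).1 1 0 * algebraMap (𝓞 F) _ b + (A v).1 1 1)
  convert this using 1
  linear_combination (-((A v).1 0 0 * algebraMap (𝓞 F) _ b + (A v).1 0 1)) * hδ v

theorem upper_inv_mul_upper_mem (n : ℕ) {b b' : 𝓞 F} (h : (p : 𝓞 F) ∣ b - b') :
    (D.upper b')⁻¹ * D.upper b ∈ D.K1 n := by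
  have := D.upper_inv_mul_mem (n := n) (one_mem _) (A := fun _ => 1) (by simp) (b := b) (b' := b')
    fun v => by
      obtain ⟨y, hy⟩ := h
      refine ⟨algebraMap (𝓞 F) _ y, ?_⟩
      rw [← map_natCast (algebraMap (𝓞 F) (v.1.adicCompletionIntegers F)), ← map_mul, ← hy]
      simp
  rwa [mul_one] at this

theorem dvd_of_upper_inv_mul_upper_mem {b b' : 𝓞 F}
    (h : (D.upper b')⁻¹ * D.upper b ∈ D.K1 0) : (p : 𝓞 F) ∣ b - b' := by
  refine D.p_dvd_of_forall fun v => ?_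
  obtain ⟨B, -, hB⟩ := (D.mem_K1_iff.mp h).2.1 v
  rw [map_mul, map_inv, eq_inv_mul_iff_mul_eq] at hB
  have h01 := congrArg (fun g : GL (Fin 2) (v.1.adicCompletion F) => g.1 0 1) hB
  have h11 := congrArg (fun g : GL (Fin 2) (v.1.adicCompletion F) => g.1 1 1) hB
  have hBv : ∀ i j, (intGL v.1 B).1 i j = (B.1 i j : _) := fun _ _ => rfl
  simp only [Units.val_mul, atP_upper, Matrix.mul_apply, Fin.sum_univ_two, Matrix.of_apply,
    Matrix.cons_val_zero, Matrix.cons_val_one, Matrix.cons_val', Matrix.cons_val_fin_one, hBv,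
    zero_mul, one_mul, zero_add] at h01 h11
  refine ⟨B.1 0 1, Subtype.ext ?_⟩
  rw [h11, mul_one] at h01
  change algebraMap (𝓞 F) (v.1.adicCompletion F) (b - b') = (p : v.1.adicCompletion F) * _
  rw [map_sub]
  linear_combination -h01

/-- The integral matrix relation underlying `u (p b; 0 1) = (p b'; 0 1) u'`. -/
theorem matrix_relation {u u' : D.G} {b b' : 𝓞 F} (h : u * D.upper b = D.upper b' * u')
    {v : D.Sp} {A A' : GL (Fin 2) (v.1.adicCompletionIntegers F)}
    (hA : intGL v.1 A = D.atP v u) (hA' : intGL v.1 A' = D.atP v u') :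
    A.1 * !![(p : v.1.adicCompletionIntegers F), algebraMap (𝓞 F) _ b; 0, 1]
      = !![(p : v.1.adicCompletionIntegers F), algebraMap (𝓞 F) _ b'; 0, 1] * A'.1 := by
  have h1 := congrArg (D.atP v) h
  rwa [map_mul, map_mul, ← hA, ← hA',
    intGL_mul_eq_mul_intGL_iff (D.atP_upper_eq_map v b) (D.atP_upper_eq_map v b')] at h1

/-! ### Lower triangular representatives -/

/-- The matrix with rows `(1, 0)` and `(-pⁿ b, 1)` at the places above `p`. -/
def lowMat (n : ℕ) (b : 𝓞 F) (v : D.Sp) : GL (Fin 2) (v.1.adicCompletionIntegers F) :=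
  Matrix.GeneralLinearGroup.mk''
    !![1, 0; -((p : v.1.adicCompletionIntegers F) ^ n * algebraMap (𝓞 F) _ b), 1]
    (by rw [Matrix.det_fin_two_of]; simp)

/-- The element `lowMat n b` of the adelic group. -/
def low (n : ℕ) (b : 𝓞 F) : D.G := D.placeP fun v => intGL v.1 (D.lowMat n b v)

theorem low_mem_K1 (n : ℕ) (b : 𝓞 F) : D.low n b ∈ D.K1 n := by
  refine D.mem_K1_iff.mpr ⟨fun v hv hv' => ?_, fun v => ?_, fun v => ?_⟩
  · have : (D.low n b) v = 1 := D.placeP_mem_supported _ v hv hv'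
    rw [this]
    exact one_mem _
  · refine ⟨D.lowMat n b v, ⟨?_, ?_⟩, by rw [low, atP_placeP]⟩
    · change (1 : v.1.adicCompletionIntegers F) - 1 ∈ _
      simp
    · change -((p : v.1.adicCompletionIntegers F) ^ n * algebraMap (𝓞 F) _ b) ∈ D.pIdeal n v
      rw [neg_mem_iff, mem_pIdeal_iff]
      exact dvd_mul_right _ _
  · rw [low, atS_placeP]
    exact one_mem _

theorem lowMat_inv (n : ℕ) (b : 𝓞 F) (v : D.Sp) : (D.lowMat n b v)⁻¹ = D.lowMat n (-b) v := by
  rw [inv_eq_iff_mul_eq_one]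
  ext1
  change !![1, 0; -((p : v.1.adicCompletionIntegers F) ^ n * algebraMap (𝓞 F) _ b), 1]
    * !![1, 0; -((p : v.1.adicCompletionIntegers F) ^ n * algebraMap (𝓞 F) _ (-b)), 1] = 1
  rw [Matrix.mul_fin_two, Matrix.one_fin_two]
  simp

theorem contra_lowMat (n : ℕ) (b : 𝓞 F) (v : D.Sp) : (contra (D.lowMat n b v)).1
    = !![1, (p : v.1.adicCompletionIntegers F) ^ n * algebraMap (𝓞 F) _ b; 0, 1] := by
  rw [contra_val, lowMat_inv]
  change !![1, 0; -((p : v.1.adicCompletionIntegers F) ^ n * algebraMap (𝓞 F) _ (-b)), 1]ᵀ = _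
  refine Matrix.ext fun i j => ?_
  fin_cases i <;> fin_cases j <;> simp

/-- Both sides are `(pⁿ⁺¹ pⁿb; 0 1)` at `p`: the contragredient of `(1 0; -pⁿb 1)` is `(1 pⁿb; 0
1)`. The identity converts a Hecke translate at level `n` into a coset representative at level `n +
1`. -/
theorem tau_mul_upper (n : ℕ) (b : 𝓞 F) :
    D.tau n * D.upper b = bar (D.low n b) * D.tau (n + 1) := by
  refine D.ext_supported (mul_mem (D.tau_mem_supported _) (D.upper_mem_supported _))
    (mul_mem (D.bar_mem_supported (D.placeP_mem_supported _)) (D.tau_mem_supported _))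
    (fun v => ?_) fun v => ?_
  · rw [map_mul, map_mul, atP_bar, low, atP_placeP, contra_intGL]
    refine Units.ext ?_
    rw [Units.val_mul, Units.val_mul, atP_tau, atP_tau, atP_upper]
    have : (intGL v.1 (contra (D.lowMat n b v))).1
        = !![1, (p : v.1.adicCompletion F) ^ n * algebraMap (𝓞 F) _ b; 0, 1] := by
      refine Matrix.ext fun i j => ?_
      change ((contra (D.lowMat n b v)).1 i j : v.1.adicCompletion F) = _
      rw [contra_lowMat]
      fin_cases i <;> fin_cases j <;> rfl
    rw [this, Matrix.mul_fin_two, Matrix.mul_fin_two]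
    simp [pow_succ]
  · rw [map_mul, map_mul, atS_bar, low, atS_placeP, map_one, one_mul, atS_upper, mul_one]
    exact Units.ext ((D.atS_tau v n).trans (D.atS_tau v (n + 1)).symm)

theorem low_inv_mul_val (n : ℕ) (b : 𝓞 F) (v : D.Sp)
    (A : GL (Fin 2) (v.1.adicCompletionIntegers F)) :
    ((D.lowMat n b v)⁻¹ * A).1 1 0
      = (p : v.1.adicCompletionIntegers F) ^ n * algebraMap (𝓞 F) _ b * A.1 0 0 + A.1 1 0 := by
  rw [lowMat_inv, Units.val_mul]
  change (!![1, 0; -((p : v.1.adicCompletionIntegers F) ^ n * algebraMap (𝓞 F) _ (-b)), 1]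
    * A.1) 1 0 = _
  simp [Matrix.mul_apply, Fin.sum_univ_two]

/-- Multiplication by the inverse of `low n b` adds `pⁿ b a` to the lower left entry `pⁿ c` of `u`,
where the upper left entry `a` is a unit; so `b` has to be `-c / a` modulo `p`. With
`dvd_of_low_inv_mul_low_mem` this shows that the elements `low n b` represent `K₀ⁿ / K₀ⁿ⁺¹`. -/
theorem exists_low_of_mem_K0 {n : ℕ} (hn : 1 ≤ n) {u : D.G} (hu : u ∈ D.K0 n) :
    ∃ b : 𝓞 F, ∀ b', (p : 𝓞 F) ∣ b - b' → (D.low n b')⁻¹ * u ∈ D.K0 (n + 1) := by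
  obtain ⟨A, hA, hA1⟩ := D.exists_intGL_of_mem_K0 hu
  choose δ hδ using fun v => (isUnit_of_det (A v)
    (D.p_pow_mem_maximalIdeal hn v (hA1 v))).1.exists_right_inv
  choose c hc using fun v => D.mem_pIdeal_iff.mp (hA1 v)
  obtain ⟨b, hb⟩ := D.exists_approx_p fun v => -c v * δ v
  refine ⟨b, fun b' hbb => ?_⟩
  obtain ⟨h1, -, h3⟩ := D.mem_K0_iff.mp
    (mul_mem (inv_mem (D.K1_le_K0 n (D.low_mem_K1 n b'))) hu)
  refine D.mem_K0_iff.mpr ⟨h1, fun v => ⟨(D.lowMat n b' v)⁻¹ * A v, ?_, ?_⟩, h3⟩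
  · change ((D.lowMat n b' v)⁻¹ * A v).1 1 0 ∈ D.pIdeal (n + 1) v
    rw [low_inv_mul_val, mem_pIdeal_iff, hc v, pow_succ]
    have e : (p : v.1.adicCompletionIntegers F) ^ n * algebraMap (𝓞 F) _ b' * (A v).1 0 0
        + (p : v.1.adicCompletionIntegers F) ^ n * c v
        = (p : v.1.adicCompletionIntegers F) ^ n
          * (-((-c v * δ v - algebraMap (𝓞 F) _ b) * (A v).1 0 0)
            - algebraMap (𝓞 F) _ (b - b') * (A v).1 0 0) := by
      rw [map_sub]
      linear_combination (-(p : v.1.adicCompletionIntegers F) ^ n * c v) * hδ v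
    rw [e]
    refine mul_dvd_mul_left _ (dvd_sub (((hb v).mul_right _).neg_right) (Dvd.dvd.mul_right ?_ _))
    have := map_dvd (algebraMap (𝓞 F) (v.1.adicCompletionIntegers F)) hbb
    rwa [map_natCast] at this
  · rw [map_mul, map_inv, hA v, map_mul, map_inv, low, atP_placeP]

theorem dvd_of_low_inv_mul_low_mem {n : ℕ} {b b' : 𝓞 F}
    (h : (D.low n b)⁻¹ * D.low n b' ∈ D.K0 (n + 1)) : (p : 𝓞 F) ∣ b - b' := by
  refine D.p_dvd_of_forall fun v => ?_
  obtain ⟨B, hB0, hB⟩ := (D.mem_K0_iff.mp h).2.1 v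
  rw [map_mul, map_inv, low, low, atP_placeP, atP_placeP, ← map_inv, ← map_mul] at hB
  have hB' := intGL_injective v.1 hB
  subst hB'
  change ((D.lowMat n b v)⁻¹ * D.lowMat n b' v).1 1 0 ∈ D.pIdeal (n + 1) v at hB0
  rw [low_inv_mul_val, mem_pIdeal_iff] at hB0
  have e : (p : v.1.adicCompletionIntegers F) ^ n * algebraMap (𝓞 F) _ b * (D.lowMat n b' v).1 0 0
      + (D.lowMat n b' v).1 1 0 = (p : v.1.adicCompletionIntegers F) ^ n
        * algebraMap (𝓞 F) _ (b - b') := by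
    change (p : v.1.adicCompletionIntegers F) ^ n * algebraMap (𝓞 F) _ b * 1
      + -((p : v.1.adicCompletionIntegers F) ^ n * algebraMap (𝓞 F) _ b') = _
    rw [map_sub]; ring
  rw [e, pow_succ] at hB0
  exact (mul_dvd_mul_iff_left (pow_ne_zero _ (p_ne_zero' D v.1))).mp hB0

/-! ### The automorphism `u ↦ τ⁻¹ ū τ` -/

/-- The automorphism `u ↦ τ⁻¹ ū τ`. -/
def theta (n : ℕ) (u : D.G) : D.G := (D.tau n)⁻¹ * bar u * D.tau n

theorem theta_mul (n : ℕ) (u u' : D.G) : D.theta n (u * u') = D.theta n u * D.theta n u' := by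
  simp only [theta, bar_mul]; group

theorem theta_apply_away (n : ℕ) (u : D.G) {v : HeightOneSpectrum (𝓞 F)}
    (hv : ¬ Ideal.span {(p : 𝓞 F)} ≤ v.asIdeal) (hv' : ¬ D.s ≤ v.asIdeal) :
    D.theta n u v = locBar D.c v (u v) := by
  have e1 : (D.tau n) v = 1 := D.tau_mem_supported n v hv hv'
  have e2 : (D.tau n)⁻¹ v = 1 := inv_mem (D.tau_mem_supported n) v hv hv'
  rw [theta, RestrictedProduct.mul_apply, RestrictedProduct.mul_apply, e1, e2, one_mul, mul_one]
  rfl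

/-- The matrix identity `ū τ = τ θ(u)` at a place where `u` is given by `g`. -/
theorem exists_theta_component {v : HeightOneSpectrum (𝓞 F)} {g : GL (Fin 2)
    (v.adicCompletionIntegers F)} {t : v.adicCompletionIntegers F}
    (ht : t ∣ g.1 1 0) {τ : GL (Fin 2) (v.adicCompletion F)}
    (hτ : τ.1 = !![(t : v.adicCompletion F), 0; 0, 1]) :
    ∃ h : GL (Fin 2) (v.adicCompletionIntegers F),
      (contra g).1 * !![t, 0; 0, 1] = !![t, 0; 0, 1] * h.1 ∧
      intGL v h = τ⁻¹ * contra (intGL v g) * τ ∧ h ∈ Gamma0 (Ideal.span {t}) ∧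
      ∀ J : Ideal (v.adicCompletionIntegers F), t ∈ J → g ∈ Gamma1 J → h ∈ Gamma1 J := by
  obtain ⟨c, hc⟩ := ht
  obtain ⟨h, h1, h2, h3⟩ := exists_contra_mul_diag g hc
  refine ⟨h, h1, ?_, Ideal.mem_span_singleton.mpr h2, fun J hJ hg =>
    ⟨h3 J hg.1 hg.2, J.mem_of_dvd h2 hJ⟩⟩
  have hτ' : τ.1 = (!![t, 0; 0, 1]).map (v.adicCompletionIntegers F).subtype := by
    rw [hτ, map_subtype_fin_two]
    rfl
  rw [mul_assoc, eq_inv_mul_iff_mul_eq, contra_intGL, eq_comm,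
    intGL_mul_eq_mul_intGL_iff hτ' hτ']
  exact h1

/-- At a place dividing `p𝔰` let `t` be `pⁿ` or the power of the uniformizer generating `𝔰`. The
contragredient of `(a b; tc d)` conjugated by `diag(t, 1)` is `(d -c; -tb a)` divided by the
determinant. It is again triangular modulo `t`, and its upper left entry is inverse to `a` modulo
`t`. At all other places the stability of `K_v` under conjugation is used. -/
theorem theta_mem_levelGroup {n : ℕ}
    {P : ∀ v : D.Sp, Subgroup (GL (Fin 2) (v.1.adicCompletionIntegers F))}
    {Q : ∀ v : D.Ss, Subgroup (GL (Fin 2) (v.1.adicCompletionIntegers F))}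
    (hP : ∀ v, P v = Gamma0 (D.pIdeal n v) ∨ P v = Gamma1 (D.pIdeal n v))
    (hQ : ∀ v, Q v = Gamma0 (locIdeal v.1 D.s) ∨ Q v = Gamma1 (locIdeal v.1 D.s))
    {u : D.G} (hu : u ∈ D.levelGroup P Q) : D.theta n u ∈ D.levelGroup P Q := by
  refine ⟨fun v hv hv' => ?_, fun v => ?_, fun v => ?_⟩
  · rw [D.theta_apply_away n u hv hv']
    exact D.Kv_bar v _ (hu.1 v hv hv')
  · obtain ⟨g, hg, hgu⟩ := hu.2.1 v
    have hI : D.pIdeal n v = Ideal.span {(p : v.1.adicCompletionIntegers F) ^ n} :=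
      Ideal.ext fun x => by rw [mem_pIdeal_iff, Ideal.mem_span_singleton]
    have h10 : g.1 1 0 ∈ D.pIdeal n v := by
      rcases hP v with h | h <;> rw [h] at hg
      · exact hg
      · exact hg.2
    obtain ⟨h, -, h2, h3, h4⟩ := exists_theta_component (D.mem_pIdeal_iff.mp h10)
      (τ := D.atP v (D.tau n)) (by rw [atP_tau]; rfl)
    refine ⟨h, ?_, ?_⟩
    · rcases hP v with h' | h' <;> rw [h'] at hg ⊢
      · rw [hI]; exact h3
      · exact h4 _ (D.mem_pIdeal_iff.mpr dvd_rfl) hg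
    · rw [h2, theta, map_mul, map_mul, map_inv, atP_bar, hgu]
  · obtain ⟨g, hg, hgu⟩ := hu.2.2 v
    have hI := locIdeal_eq_span_pow v.1 D.s_ne_bot (D.unif_irreducible v)
    have h10 : g.1 1 0 ∈ locIdeal v.1 D.s := by
      rcases hQ v with h | h <;> rw [h] at hg
      · exact hg
      · exact hg.2
    rw [hI, Ideal.mem_span_singleton] at h10
    obtain ⟨h, -, h2, h3, h4⟩ := exists_theta_component h10
      (τ := D.atS v (D.tau n)) (by rw [atS_tau]; rfl)
    refine ⟨h, ?_, ?_⟩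
    · rcases hQ v with h' | h' <;> rw [h'] at hg ⊢
      · rw [hI]; exact h3
      · exact h4 _ (by rw [hI]; exact Ideal.mem_span_singleton_self _) hg
    · rw [h2, theta, map_mul, map_mul, map_inv, atS_bar, hgu]

theorem theta_mem_K1 {n : ℕ} {u : D.G} (hu : u ∈ D.K1 n) : D.theta n u ∈ D.K1 n :=
  D.mem_K1_iff.mpr (D.theta_mem_levelGroup (fun _ => Or.inr rfl) (fun _ => Or.inr rfl)
    (D.mem_K1_iff.mp hu))

theorem theta_mem_K0 {n : ℕ} {u : D.G} (hu : u ∈ D.K0 n) : D.theta n u ∈ D.K0 n :=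
  D.mem_K0_iff.mpr (D.theta_mem_levelGroup (fun _ => Or.inl rfl) (fun _ => Or.inr rfl)
    (D.mem_K0_iff.mp hu))

theorem theta_mem_K00 {n : ℕ} {u : D.G} (hu : u ∈ D.K00 n) : D.theta n u ∈ D.K00 n :=
  D.theta_mem_levelGroup (fun _ => Or.inl rfl) (fun _ => Or.inl rfl) hu

/-- The integral matrix relation underlying `ū τ = τ θ(u)`. -/
theorem theta_matrix_relation {n : ℕ} {u : D.G} {v : D.Sp}
    {A A' : GL (Fin 2) (v.1.adicCompletionIntegers F)}
    (hA : intGL v.1 A = D.atP v u) (hA' : intGL v.1 A' = D.atP v (D.theta n u))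
    (h10 : A.1 1 0 ∈ D.pIdeal n v) :
    (contra A).1 * !![(p : v.1.adicCompletionIntegers F) ^ n, 0; 0, 1]
      = !![(p : v.1.adicCompletionIntegers F) ^ n, 0; 0, 1] * A'.1 := by
  obtain ⟨h, h1, h2, -⟩ := exists_theta_component (D.mem_pIdeal_iff.mp h10)
    (τ := D.atP v (D.tau n)) (by rw [atP_tau]; rfl)
  have : h = A' := intGL_injective v.1 (by
    rw [h2, hA', hA, theta, map_mul, map_mul, map_inv, atP_bar])
  rw [← this, h1]

theorem theta_scalar (n : ℕ) (u : ∀ v : D.Sp, (v.1.adicCompletionIntegers F)ˣ)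
    (t : ∀ v : D.Ss, (v.1.adicCompletionIntegers F)ˣ) :
    D.theta n (D.scalar u t) = D.scalar u⁻¹ t⁻¹ := by
  have h1 : (D.scalar u t)⁻¹ = D.scalar u⁻¹ t⁻¹ := by
    rw [inv_eq_iff_mul_eq_one, ← scalar_mul, mul_inv_cancel, mul_inv_cancel]
    refine D.ext_supported (D.scalar_mem_supported _ _) (one_mem _) (fun v => ?_) fun v => ?_
    · rw [atP_scalar, map_one, Pi.one_apply, map_one, map_one]
    · rw [atS_scalar, map_one, Pi.one_apply, map_one, map_one]
  rw [theta, bar_scalar, h1, mul_assoc, ← scalar_comm, inv_mul_cancel_left]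

end Datum

end

end HidaU2

namespace HidaU2

noncomputable section

/-! ### Hermitian planes -/

section Hermitian

variable {R : Type*} [CommRing R]

/-- The matrix whose columns are `x` and `(-c(x₁), c(x₀))`. -/
def perpMat (c : R →+* R) (x : Fin 2 → R) : Matrix (Fin 2) (Fin 2) R :=
  !![x 0, -c (x 1); x 1, c (x 0)]

/-- The conjugate transpose of `perpMat c x` if `c` is an involution. -/
def perpMatStar (c : R →+* R) (x : Fin 2 → R) : Matrix (Fin 2) (Fin 2) R :=
  !![c (x 0), c (x 1); -x 1, x 0]

theorem perpMat_mul_star (c : R →+* R) (x : Fin 2 → R) :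
    perpMat c x * perpMatStar c x = (x 0 * c (x 0) + x 1 * c (x 1)) • (1 : Matrix _ _ R) := by
  rw [perpMat, perpMatStar, Matrix.mul_fin_two, Matrix.one_fin_two]
  ext i j
  fin_cases i <;> fin_cases j <;> simp <;> ring

theorem star_mul_perpMat (c : R →+* R) (x : Fin 2 → R) :
    perpMatStar c x * perpMat c x = (x 0 * c (x 0) + x 1 * c (x 1)) • (1 : Matrix _ _ R) := by
  rw [perpMat, perpMatStar, Matrix.mul_fin_two, Matrix.one_fin_two]
  ext i j
  fin_cases i <;> fin_cases j <;> simp <;> ring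

theorem map_perpMat_transpose {c : R →+* R} (hc : ∀ x, c (c x) = x) (x : Fin 2 → R) :
    ((perpMat c x).map c)ᵀ = perpMatStar c x := by
  rw [perpMat, perpMatStar]
  ext i j
  fin_cases i <;> fin_cases j <;> simp [hc]

theorem map_perpMatStar_transpose {c : R →+* R} (hc : ∀ x, c (c x) = x) (x : Fin 2 → R) :
    ((perpMatStar c x).map c)ᵀ = perpMat c x := by
  rw [perpMat, perpMatStar]
  ext i j
  fin_cases i <;> fin_cases j <;> simp [hc]

theorem unitary2_entries {c : R →+* R} (k : unitary2 c) :
    k.1.1 0 0 * k.1.1 1 1 - k.1.1 0 1 * k.1.1 1 0 = k.1.1.det ∧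
    k.1.1.det * c (k.1.1 0 0) = k.1.1 1 1 ∧ k.1.1.det * c (k.1.1 0 1) = -k.1.1 1 0 ∧
    k.1.1.det * c (k.1.1 1 0) = -k.1.1 0 1 ∧ k.1.1.det * c (k.1.1 1 1) = k.1.1 0 0 := by
  have h1 : k.1.1.adjugate = k.1.1.det • (k.1.1.map c)ᵀ := by
    have h2 : k.1.1 * (k.1.1.map c)ᵀ = 1 := k.2
    calc k.1.1.adjugate = k.1.1.adjugate * (k.1.1 * (k.1.1.map c)ᵀ) := by rw [h2, Matrix.mul_one]
      _ = _ := by rw [← Matrix.mul_assoc, Matrix.adjugate_mul, Matrix.smul_mul, Matrix.one_mul]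
  rw [Matrix.adjugate_fin_two] at h1
  have h := fun i j => congrFun (congrFun h1 i) j
  refine ⟨(Matrix.det_fin_two _).symm, ?_, ?_, ?_, ?_⟩
  · simpa using (h 0 0).symm
  · simpa using (h 1 0).symm
  · simpa using (h 0 1).symm
  · simpa using (h 1 1).symm

/-- A unitary matrix moves the orthogonal vector to the orthogonal vector, up to `det`. -/
theorem unitary2_mul_perpMat {c : R →+* R} (k : unitary2 c) (x : Fin 2 → R) :
    k.1.1 * perpMat c x = perpMat c (k.1.1 *ᵥ x) * !![1, 0; 0, k.1.1.det] := by
  obtain ⟨-, h00, h01, h10, h11⟩ := unitary2_entries k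
  rw [perpMat, perpMat]
  ext i j
  fin_cases i <;> fin_cases j <;>
    simp only [Matrix.mul_apply, Fin.sum_univ_two, Matrix.mulVec, dotProduct, Matrix.of_apply,
      Matrix.cons_val', Matrix.cons_val_zero, Matrix.cons_val_one, Matrix.cons_val_fin_one,
      Fin.zero_eta, Fin.mk_one, map_add, map_mul]
  · ring
  · linear_combination c (x 0) * h10 + c (x 1) * h11
  · ring
  · linear_combination -c (x 0) * h00 - c (x 1) * h01

theorem unitary2_det {c : R →+* R} (k : unitary2 c) : k.1.1.det * c k.1.1.det = 1 := by
  have h2 : k.1.1 * (k.1.1.map c)ᵀ = 1 := k.2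
  have := congrArg Matrix.det h2
  rwa [Matrix.det_mul, Matrix.det_transpose, Matrix.det_one, ← RingHom.mapMatrix_apply,
    ← RingHom.map_det] at this

theorem unitary2_star_mul {c : R →+* R} (k : unitary2 c) : (k.1.1.map c)ᵀ * k.1.1 = 1 :=
  mul_eq_one_comm.mp k.2

/-- The Hermitian form is preserved by unitary matrices. -/
theorem unitary2_norm {c : R →+* R} (k : unitary2 c) (x : Fin 2 → R) :
    (k.1.1 *ᵥ x) 0 * c ((k.1.1 *ᵥ x) 0) + (k.1.1 *ᵥ x) 1 * c ((k.1.1 *ᵥ x) 1)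
      = x 0 * c (x 0) + x 1 * c (x 1) := by
  have h := unitary2_star_mul k
  have h' := fun i j => congrFun (congrFun h i) j
  have h00 := h' 0 0
  have h01 := h' 0 1
  have h10 := h' 1 0
  have h11 := h' 1 1
  simp only [Matrix.mul_apply, Fin.sum_univ_two, Matrix.transpose_apply, Matrix.map_apply,
    Matrix.one_apply_eq, Matrix.one_apply_ne (show (0 : Fin 2) ≠ 1 by decide),
    Matrix.one_apply_ne (show (1 : Fin 2) ≠ 0 by decide)] at h00 h01 h10 h11
  simp only [Matrix.mulVec, dotProduct, Fin.sum_univ_two, map_add, map_mul]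
  linear_combination x 0 * c (x 0) * h00 + x 1 * c (x 0) * h01 + x 0 * c (x 1) * h10
    + x 1 * c (x 1) * h11

/-- The unitary matrix taking `x` to `x'` and acting by `η` on the determinant. -/
theorem transport_mem {c : R →+* R} (hc : ∀ x, c (c x) = x) {x x' : Fin 2 → R} {d d₁ η : R}
    (hx : x 0 * c (x 0) + x 1 * c (x 1) = d) (hx' : x' 0 * c (x' 0) + x' 1 * c (x' 1) = d)
    (hd : d * d₁ = 1) (hη : η * c η = 1) :
    (d₁ • (perpMat c x' * !![1, 0; 0, η] * perpMatStar c x))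
      * ((d₁ • (perpMat c x' * !![1, 0; 0, η] * perpMatStar c x)).map c)ᵀ = 1 := by
  have hcd : c d = d := by rw [← hx]; simp only [map_add, map_mul, hc]; ring
  have hcd1 : c d₁ = d₁ := by
    have h1 := congrArg c hd
    rw [map_mul, hcd, map_one] at h1
    linear_combination d₁ * h1 - c d₁ * hd
  have e1 : ((d₁ • (perpMat c x' * !![1, 0; 0, η] * perpMatStar c x)).map c)ᵀ
      = d₁ • (perpMat c x * (!![1, 0; 0, c η] * perpMatStar c x')) := by
    have e0 : ∀ M : Matrix (Fin 2) (Fin 2) R, (d₁ • M).map c = d₁ • M.map c := fun M => by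
      ext i j
      simp [hcd1]
    rw [e0, Matrix.transpose_smul, Matrix.map_mul, Matrix.map_mul, Matrix.transpose_mul,
      Matrix.transpose_mul, map_perpMat_transpose hc, map_perpMatStar_transpose hc]
    congr 3
    ext i j
    fin_cases i <;> fin_cases j <;> simp
  have e2 : (!![1, 0; 0, η] : Matrix _ _ R) * !![1, 0; 0, c η] = 1 := by
    rw [Matrix.mul_fin_two, Matrix.one_fin_two]; simp [hη]
  rw [e1, Matrix.smul_mul, Matrix.mul_smul, Matrix.mul_assoc, Matrix.mul_assoc,
    ← Matrix.mul_assoc (perpMatStar c x), star_mul_perpMat, hx, Matrix.smul_mul, Matrix.one_mul,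
    Matrix.mul_smul, ← Matrix.mul_assoc !![1, 0; 0, η], e2, Matrix.one_mul, Matrix.mul_smul,
    perpMat_mul_star, hx', smul_smul, smul_smul, smul_smul]
  have : d₁ * d₁ * d * d = 1 := by linear_combination (d * d₁ + 1) * hd
  rw [this, one_smul]

/-- The difference between two unitary matrices whose effect on chosen vectors agrees modulo
a multiple of `N`. -/
theorem transport_congr {c : R →+* R} (hc : ∀ x, c (c x) = x) {B : Subring R}
    (hB : ∀ x ∈ B, c x ∈ B) (k k' : unitary2 c) {x x' : Fin 2 → R} {e e' d d₁ d' d'₁ N η : R}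
    (hx : x 0 * c (x 0) + x 1 * c (x 1) = d)
    (he : e * c e = d') (he' : e' * c e' = d') (hd : d * d₁ = 1) (hd' : d' * d'₁ = 1)
    (hη : η * e' = e) (hN : c N = N)
    (hy : ∀ i, (k.1.1 *ᵥ x) i ∈ B) (hf : c k.1.1.det * e ∈ B)
    (hy' : ∀ i, (k'.1.1 *ᵥ x') i ∈ B) (hyy : ∀ i, ∃ z ∈ B, (k'.1.1 *ᵥ x') i - (k.1.1 *ᵥ x) i = d * d' * N * z)
    (hff : ∃ z ∈ B, c k'.1.1.det * e' - c k.1.1.det * e = d * d' * N * z) :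
    ∀ i j, ∃ z ∈ B, (k'.1.1 * (d₁ • (perpMat c x' * !![1, 0; 0, η] * perpMatStar c x))
      * (k.1.1.map c)ᵀ) i j - (1 : Matrix _ _ R) i j = N * z := by
  set y := k.1.1 *ᵥ x with hydef
  set y' := k'.1.1 *ᵥ x' with hydef'
  set δ := k.1.1.det
  set δ' := k'.1.1.det
  have hδ : δ * c δ = 1 := unitary2_det k
  have hδ' : δ' * c δ' = 1 := unitary2_det k'
  have hcd : c d = d := by rw [← hx]; simp only [map_add, map_mul, hc]; ring
  have hcd' : c d' = d' := by rw [← he]; simp only [map_mul, hc]; ring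
  have hyd : y 0 * c (y 0) + y 1 * c (y 1) = d := (unitary2_norm k x).trans hx
  have e1 : perpMatStar c x * (k.1.1.map c)ᵀ = !![1, 0; 0, c δ] * perpMatStar c y := by
    have h := congrArg (fun M : Matrix (Fin 2) (Fin 2) R => (M.map c)ᵀ) (unitary2_mul_perpMat k x)
    simp only [Matrix.map_mul, Matrix.transpose_mul, map_perpMat_transpose hc] at h
    rw [h]
    congr 1
    ext i j
    fin_cases i <;> fin_cases j <;> simp [δ]
  obtain ⟨z0, hz0, h0⟩ := hyy 0
  obtain ⟨z1, hz1, h1⟩ := hyy 1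
  obtain ⟨w, hw, hfw⟩ := hff
  set f := c δ * e with hfdef
  have hff' : f * c f = d' := by rw [hfdef, map_mul, hc]; linear_combination e * c e * hδ + he
  have hcf : δ' * c e' = c f + d * d' * N * c w := by
    have := congrArg c hfw
    simp only [map_sub, map_mul, hc, hcd, hcd', hN] at this
    linear_combination this
  -- After multiplication by `d' = f c(f)` the left side is `f` times the conjugate of `c(δ') e'`,
  -- which is congruent to `f` modulo `d d' N`. Dividing by `d'` leaves a congruence modulo `d N`.
  have hkey : δ' * (η * c δ) = 1 + d * N * (f * c w) := by
    have h2 : d' * (δ' * (η * c δ)) = f * (δ' * c e') := by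
      rw [hfdef]; linear_combination (-δ' * η * c δ) * he' + c δ * δ' * c e' * hη
    rw [hcf] at h2
    linear_combination d'₁ * h2 - (δ' * (η * c δ)) * hd' + d'₁ * hff'
      + (1 + d * N * (f * c w)) * hd'
  have hy0 : y' 0 = y 0 + d * d' * N * z0 := by linear_combination h0
  have hy1 : y' 1 = y 1 + d * d' * N * z1 := by linear_combination h1
  have hcy0 : c (y' 0) = c (y 0) + d * d' * N * c z0 := by
    rw [hy0]; simp only [map_add, map_mul, hcd, hcd', hN]
  have hcy1 : c (y' 1) = c (y 1) + d * d' * N * c z1 := by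
    rw [hy1]; simp only [map_add, map_mul, hcd, hcd', hN]
  -- The product carries the orthogonal frame of `y = k x` to that of `y' = k' x'`. The frames agree
  -- modulo `d d' N`, and a frame times its adjoint is `d`, so dividing by `d` gives the identity
  -- modulo `N`.
  have e2 : k'.1.1 * (d₁ • (perpMat c x' * !![1, 0; 0, η] * perpMatStar c x)) * (k.1.1.map c)ᵀ
      = d₁ • (perpMat c y' * (!![1, 0; 0, δ' * (η * c δ)] * perpMatStar c y)) := by
    have e3 : (!![1, 0; 0, δ'] : Matrix _ _ R) * (!![1, 0; 0, η] * !![1, 0; 0, c δ])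
        = !![1, 0; 0, δ' * (η * c δ)] := by
      simp
    rw [Matrix.mul_smul, Matrix.smul_mul, ← e3]
    congr 1
    simp only [Matrix.mul_assoc]
    rw [e1, ← Matrix.mul_assoc k'.1.1, unitary2_mul_perpMat k' x']
    simp only [Matrix.mul_assoc]
    rfl
  rw [e2, hkey]
  have hd'B : d' ∈ B := hff' ▸ mul_mem hf (hB _ hf)
  have hcw := hB _ hw
  have hcf' := hB _ hf
  have hq : f * c w ∈ B := mul_mem hf hcw
  have hcy'0 := hB _ (hy' 0)
  have hcy'1 := hB _ (hy' 1)
  have hy0B := hy 0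
  have hy1B := hy 1
  have hcy0B := hB _ hy0B
  have hcy1B := hB _ hy1B
  have hcz0 := hB _ hz0
  have hcz1 := hB _ hz1
  set q := f * c w
  have h01 : (1 : Matrix (Fin 2) (Fin 2) R) 0 1 = 0 := rfl
  have h10 : (1 : Matrix (Fin 2) (Fin 2) R) 1 0 = 0 := rfl
  rw [Fin.forall_fin_two, Fin.forall_fin_two, Fin.forall_fin_two]
  refine ⟨⟨?_, ?_⟩, ?_, ?_⟩ <;>
    simp only [perpMat, perpMatStar, Matrix.smul_apply, Matrix.mul_apply, Fin.sum_univ_two,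
      Matrix.of_apply, Matrix.cons_val', Matrix.cons_val_zero, Matrix.cons_val_one,
      Matrix.cons_val_fin_one, smul_eq_mul, Matrix.one_apply_eq,
      h01, h10, zero_mul, one_mul, zero_add, add_zero]
  · refine ⟨d' * (z0 * c (y 0) + c z1 * y 1) + c (y' 1) * y 1 * q, add_mem (mul_mem hd'B
      (add_mem (mul_mem hz0 hcy0B) (mul_mem hcz1 hy1B))) (mul_mem (mul_mem hcy'1 hy1B) hq), ?_⟩
    linear_combination (1 + N * (d' * (z0 * c (y 0) + c z1 * y 1) + c (y' 1) * y 1 * q)) * hd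
      + d₁ * hyd + d₁ * c (y 0) * hy0 + d₁ * y 1 * hcy1
  · refine ⟨d' * (z0 * c (y 1) - c z1 * y 0) - c (y' 1) * y 0 * q, sub_mem (mul_mem hd'B
      (sub_mem (mul_mem hz0 hcy1B) (mul_mem hcz1 hy0B))) (mul_mem (mul_mem hcy'1 hy0B) hq), ?_⟩
    linear_combination (N * (d' * (z0 * c (y 1) - c z1 * y 0) - c (y' 1) * y 0 * q)) * hd
      + d₁ * c (y 1) * hy0 - d₁ * y 0 * hcy1
  · refine ⟨d' * (z1 * c (y 0) - c z0 * y 1) - c (y' 0) * y 1 * q, sub_mem (mul_mem hd'B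
      (sub_mem (mul_mem hz1 hcy0B) (mul_mem hcz0 hy1B))) (mul_mem (mul_mem hcy'0 hy1B) hq), ?_⟩
    linear_combination (N * (d' * (z1 * c (y 0) - c z0 * y 1) - c (y' 0) * y 1 * q)) * hd
      + d₁ * c (y 0) * hy1 - d₁ * y 1 * hcy0
  · refine ⟨d' * (z1 * c (y 1) + c z0 * y 0) + c (y' 0) * y 0 * q, add_mem (mul_mem hd'B
      (add_mem (mul_mem hz1 hcy1B) (mul_mem hcz0 hy0B))) (mul_mem (mul_mem hcy'0 hy0B) hq), ?_⟩
    linear_combination (1 + N * (d' * (z1 * c (y 1) + c z0 * y 0) + c (y' 0) * y 0 * q)) * hd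
      + d₁ * hyd + d₁ * c (y 1) * hy1 + d₁ * y 0 * hcy0

end Hermitian

/-! ### Short vectors in lattices of given index -/

section Lattice

variable {K : Type*} [Field K] [NumberField K]

/-- The norm is the determinant of an integral multiplication matrix, and that matrix is the
identity modulo `M`. -/
theorem norm_one_add_mul_modEq (M : ℕ) (w : 𝓞 K) :
    ∃ k : ℤ, Algebra.norm ℤ (1 + (M : 𝓞 K) * w) = 1 + M * k := by
  classical
  set b := NumberField.RingOfIntegers.basis K
  have h : ((Int.castRingHom (ZMod M)) (Algebra.norm ℤ (1 + (M : 𝓞 K) * w))) = 1 := by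
    rw [Algebra.norm_eq_matrix_det b, RingHom.map_det, map_add, map_one, map_mul, map_natCast,
      map_add, map_one, map_mul, map_natCast]
    have : ((M : ℕ) : Matrix (Module.Free.ChooseBasisIndex ℤ (𝓞 K))
        (Module.Free.ChooseBasisIndex ℤ (𝓞 K)) (ZMod M)) = 0 := by
      ext i j
      simp [Matrix.natCast_apply]
    rw [this, zero_mul, add_zero, Matrix.det_one]
  have h2 : ((Algebra.norm ℤ (1 + (M : 𝓞 K) * w) - 1 : ℤ) : ZMod M) = 0 := by
    push_cast
    rw [sub_eq_zero]
    simpa using h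
  rw [ZMod.intCast_zmod_eq_zero_iff_dvd] at h2
  obtain ⟨k, hk⟩ := h2
  exact ⟨k, by linarith⟩

/-- A lattice in `𝓞_K²` that contains `M² 𝓞_K²` and the image of a matrix whose determinant has
absolute norm `M⁴` up to factors prime to `M` has index at most that of `M 𝓞_K`. -/
theorem index_le_of_det (c : K ≃+* K) {M : ℕ} (hM : 0 < M) (A : Matrix (Fin 2) (Fin 2) (𝓞 K))
    (w : 𝓞 K) (h : A.det * NumberField.RingOfIntegers.mapRingHom (c : K →+* K) A.det
      = (M : 𝓞 K) ^ 4 * (1 + M * w)) (L : Submodule ℤ (Fin 2 → 𝓞 K))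
    (hA : ∀ x, A *ᵥ x ∈ L) (hL : ∀ x : Fin 2 → 𝓞 K, (M ^ 2 : ℕ) • x ∈ L) :
    Finite ((Fin 2 → 𝓞 K) ⧸ L) ∧
      Nat.card ((Fin 2 → 𝓞 K) ⧸ L) ≤ M ^ (2 * Module.finrank ℚ K) := by
  classical
  set D := Module.finrank ℚ K
  obtain ⟨k, hk⟩ := norm_one_add_mul_modEq M w
  have hnc : Algebra.norm ℤ (NumberField.RingOfIntegers.mapRingHom (c : K →+* K) A.det)
      = Algebra.norm ℤ A.det := by
    have := Algebra.norm_eq_of_algEquiv (R := ℤ)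
      ((NumberField.RingOfIntegers.mapRingEquiv c).toIntAlgEquiv) A.det
    exact this
  -- Conjugation preserves the absolute norm, so the relation for `det A · c(det A)` becomes one for
  -- the square of the norm of `det A`.
  have hnorm : (Algebra.norm ℤ A.det) ^ 2 = (M : ℤ) ^ (4 * D) * (1 + M * k) := by
    have h1 := congrArg (Algebra.norm ℤ) h
    rw [map_mul, hnc, map_mul, hk, map_pow, ← map_natCast (algebraMap ℤ (𝓞 K)) M,
      Algebra.norm_algebraMap, NumberField.RingOfIntegers.rank, ← pow_mul] at h1
    rw [sq, h1, mul_comm D 4]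
  -- The factor `1 + M k` can vanish only if `M = 1`; in that case the lattice is everything.
  have hone : (1 + (M : ℤ) * k) ≠ 0 ∨ M = 1 := by
    by_cases hM1 : M = 1
    · exact Or.inr hM1
    · left
      intro h0
      have : (M : ℤ) ∣ 1 := ⟨-k, by linarith⟩
      rw [Int.natCast_dvd_ofNat, Nat.dvd_one] at this
      exact hM1 this
  rcases hone with hone | hM1
  swap
  · subst hM1
    have hLt : L = ⊤ := by
      rw [eq_top_iff]
      intro x _
      simpa using hL x
    subst hLt
    have : Subsingleton ((Fin 2 → 𝓞 K) ⧸ (⊤ : Submodule ℤ (Fin 2 → 𝓞 K))) :=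
      Submodule.Quotient.subsingleton_iff.mpr rfl
    exact ⟨inferInstance, by simp⟩
  have hMz : (M : ℤ) ≠ 0 := by exact_mod_cast hM.ne'
  have hn0 : Algebra.norm ℤ A.det ≠ 0 := by
    intro h0
    rw [h0] at hnorm
    have : (M : ℤ) ^ (4 * D) * (1 + M * k) ≠ 0 := mul_ne_zero (pow_ne_zero _ hMz) hone
    exact this (by rw [← hnorm]; simp)
  set f : (Fin 2 → 𝓞 K) →ₗ[ℤ] (Fin 2 → 𝓞 K) := (Matrix.toLin' A).restrictScalars ℤ with hf
  have hdetf : LinearMap.det f = Algebra.norm ℤ A.det := by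
    have := LinearMap.det_restrictScalars (R := ℤ) (f := Matrix.toLin' A)
    rw [LinearMap.det_toLin'] at this
    exact this
  have hinj : Function.Injective f := by
    rw [← LinearMap.ker_eq_bot]
    by_contra hker
    exact hn0 (hdetf ▸ LinearMap.det_eq_zero_iff_ker_ne_bot.mpr hker)
  have hcard : Nat.card ((Fin 2 → 𝓞 K) ⧸ LinearMap.range f) = (Algebra.norm ℤ A.det).natAbs := by
    rw [← Submodule.natAbs_det_equiv _ (LinearEquiv.ofInjective f hinj), ← hdetf]
    rfl
  have hle : LinearMap.range f ≤ L := by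
    rintro _ ⟨x, rfl⟩
    exact hA x
  have hfin0 : Finite ((Fin 2 → 𝓞 K) ⧸ LinearMap.range f) :=
    Nat.finite_of_card_ne_zero (by rw [hcard]; simpa using hn0)
  have hsurj : Function.Surjective (Submodule.factor hle) := Submodule.factor_surjective hle
  have hfin : Finite ((Fin 2 → 𝓞 K) ⧸ L) := Finite.of_surjective _ hsurj
  refine ⟨hfin, ?_⟩
  set q := Nat.card ((Fin 2 → 𝓞 K) ⧸ L) with hq
  have hqd : q ∣ (Algebra.norm ℤ A.det).natAbs := by
    rw [← hcard]
    exact AddSubgroup.card_dvd_of_surjective (Submodule.factor hle).toAddMonoidHom hsurj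
  -- The quotient is killed by `M²`, so every prime dividing the index divides `M`, hence does not
  -- divide `1 + M k`. The index therefore divides only the `M`-part of the norm.
  have hcop : Nat.Coprime q (1 + (M : ℤ) * k).natAbs := by
    refine Nat.Coprime.symm (Nat.coprime_of_dvd fun l hl h1 h2 => ?_)
    have : Fact l.Prime := ⟨hl⟩
    obtain ⟨x, hx⟩ := exists_prime_addOrderOf_dvd_card' (G := (Fin 2 → 𝓞 K) ⧸ L) l h2
    have hxM : (M ^ 2) • x = 0 := by
      obtain ⟨y, rfl⟩ := Submodule.Quotient.mk_surjective _ x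
      rw [← Submodule.Quotient.mk_smul]
      exact (Submodule.Quotient.mk_eq_zero L).mpr (hL y)
    have hlM : l ∣ M := hl.dvd_of_dvd_pow (hx ▸ addOrderOf_dvd_of_nsmul_eq_zero hxM)
    have h3 : (l : ℤ) ∣ 1 + M * k := Int.natCast_dvd.mpr h1
    have h4 : (l : ℤ) ∣ 1 := by
      have := (Int.natCast_dvd_natCast.mpr hlM).mul_right k
      simpa using (Int.dvd_add_right this).mp (by rwa [add_comm])
    rw [Int.natCast_dvd_ofNat, Nat.dvd_one] at h4
    exact hl.one_lt.ne' h4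
  have hsq : q ^ 2 ∣ M ^ (4 * D) := by
    have h1 : q ^ 2 ∣ M ^ (4 * D) * (1 + (M : ℤ) * k).natAbs := by
      have h2 := pow_dvd_pow_of_dvd hqd 2
      rw [← Int.natAbs_pow, hnorm, Int.natAbs_mul, Int.natAbs_pow, Int.natAbs_natCast] at h2
      exact h2
    exact (Nat.Coprime.pow_left 2 hcop).dvd_of_dvd_mul_right h1
  have hle2 : q ^ 2 ≤ (M ^ (2 * D)) ^ 2 := by
    rw [← pow_mul]
    have := Nat.le_of_dvd (pow_pos hM _) hsq
    convert this using 2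
    ring
  exact (pow_le_pow_iff_left₀ (Nat.zero_le _) (Nat.zero_le _) two_ne_zero).mp hle2

/-- Pigeonhole: there are `(M + 1)^{2[K:ℚ]}` vectors with coordinates between `0` and `M`, more than
there are classes modulo `L`. The difference of two vectors in one class has coordinates of absolute
value at most `M`. -/
theorem exists_small_mem_of_index_le {M : ℕ} (L : Submodule ℤ (Fin 2 → 𝓞 K))
    (hfin : Finite ((Fin 2 → 𝓞 K) ⧸ L))
    (hcard : Nat.card ((Fin 2 → 𝓞 K) ⧸ L) ≤ M ^ (2 * Module.finrank ℚ K)) :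
    ∃ z ∈ L, z ≠ 0 ∧ ∀ i, ∃ n : Module.Free.ChooseBasisIndex ℤ (𝓞 K) → ℤ,
      (∀ j, |n j| ≤ M) ∧ z i = ∑ j, n j • NumberField.RingOfIntegers.basis K j := by
  classical
  set b := NumberField.RingOfIntegers.basis K
  have hι : Fintype.card (Module.Free.ChooseBasisIndex ℤ (𝓞 K)) = Module.finrank ℚ K := by
    rw [← NumberField.RingOfIntegers.rank, Module.finrank_eq_card_chooseBasisIndex]
  have hpos : 0 < Module.finrank ℚ K := Module.finrank_pos
  let ev : (Fin 2 → Module.Free.ChooseBasisIndex ℤ (𝓞 K) → Fin (M + 1)) → (Fin 2 → 𝓞 K) := fun n i => ∑ j, ((n i j : ℕ) : ℤ) • b j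
  have := Fintype.ofFinite ((Fin 2 → 𝓞 K) ⧸ L)
  have hlt : Fintype.card ((Fin 2 → 𝓞 K) ⧸ L) < Fintype.card (Fin 2 → Module.Free.ChooseBasisIndex ℤ (𝓞 K) → Fin (M + 1)) := by
    rw [← Nat.card_eq_fintype_card]
    refine hcard.trans_lt ?_
    rw [Fintype.card_fun, Fintype.card_fun, Fintype.card_fin, Fintype.card_fin, hι, ← pow_mul,
      mul_comm]
    exact Nat.pow_lt_pow_left (Nat.lt_succ_self M) (by positivity)
  obtain ⟨m, n, hmn, hmneq⟩ := Fintype.exists_ne_map_eq_of_card_lt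
    (fun x => (Submodule.Quotient.mk (ev x) : (Fin 2 → 𝓞 K) ⧸ L)) hlt
  have hdiff : ∀ i, (ev m - ev n) i = ∑ j, (((m i j : ℕ) : ℤ) - ((n i j : ℕ) : ℤ)) • b j := by
    intro i
    simp only [ev, Pi.sub_apply, sub_smul, Finset.sum_sub_distrib]
  refine ⟨ev m - ev n, (Submodule.Quotient.eq L).mp hmneq, fun h0 => hmn ?_, fun i =>
    ⟨fun j => ((m i j : ℕ) : ℤ) - ((n i j : ℕ) : ℤ), fun j => ?_, hdiff i⟩⟩
  · funext i j
    have h1 := hdiff i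
    rw [h0] at h1
    have := (Fintype.linearIndependent_iff.mp b.linearIndependent) _ h1.symm j
    exact Fin.ext (by omega)
  · have h1 := (m i j).is_lt
    have h2 := (n i j).is_lt
    change |((m i j : ℕ) : ℤ) - ((n i j : ℕ) : ℤ)| ≤ M
    rw [abs_le]
    constructor <;> omega

end Lattice

end

end HidaU2

namespace HidaU2

noncomputable section

/-! ### Integral elements of `K_v` and approximation -/

section LocalLattice

variable {F K : Type*} [Field F] [NumberField F] [Field K] [NumberField K] [Algebra F K]

/-- The inclusion `K → K_v`. -/
def incl (K : Type*) [Field K] [Algebra F K] (v : HeightOneSpectrum (𝓞 F)) : K →ₐ[F] LocK K v :=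
  Algebra.TensorProduct.includeRight

theorem locConj_incl (c : K ≃ₐ[F] K) (v : HeightOneSpectrum (𝓞 F)) (y : K) :
    locConj c v (incl K v y) = incl K v (c y) := by
  simp [locConj, incl]

theorem incl_mem (v : HeightOneSpectrum (𝓞 F)) (y : 𝓞 K) : incl K v (y : K) ∈ locInt K v :=
  Subring.subset_closure (Or.inr ⟨y, rfl⟩)

theorem algebraMap_mem_locInt {v : HeightOneSpectrum (𝓞 F)} {x : v.adicCompletion F}
    (hx : x ∈ v.adicCompletionIntegers F) : algebraMap (v.adicCompletion F) (LocK K v) x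
      ∈ locInt K v :=
  Subring.subset_closure (Or.inl ⟨⟨x, hx⟩, rfl⟩)

theorem algebraMap_F_eq (v : HeightOneSpectrum (𝓞 F)) (r : F) :
    algebraMap F (LocK K v) r
      = algebraMap (v.adicCompletion F) (LocK K v) (algebraMap F (v.adicCompletion F) r) :=
  IsScalarTower.algebraMap_apply _ _ _ _

theorem exists_nat_mul_integer {L : Type*} [Field L] [NumberField L] (y : L) :
    ∃ m : ℕ, 0 < m ∧ ∃ a : 𝓞 L, (m : L) * y = a := by
  have hy : IsAlgebraic ℤ y :=
    (IsFractionRing.isAlgebraic_iff ℤ ℚ L).mpr (Algebra.IsAlgebraic.isAlgebraic y)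
  obtain ⟨n, hn, hi⟩ := hy.exists_integral_multiple
  refine ⟨n.natAbs, Int.natAbs_pos.mpr hn, ?_⟩
  have h : IsIntegral ℤ ((n.natAbs : L) * y) := by
    rcases Int.natAbs_eq n with h | h
    · rw [h] at hi
      simpa using hi
    · rw [h] at hi
      simpa using hi
  exact ⟨⟨_, h⟩, rfl⟩

theorem exists_nat_mul_mem (v : HeightOneSpectrum (𝓞 F)) (x : LocK K v) :
    ∃ m : ℕ, 0 < m ∧ (m : LocK K v) * x ∈ locInt K v := by
  induction x using TensorProduct.induction_on with
  | zero => exact ⟨1, one_pos, by simp [zero_mem]⟩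
  | tmul a b =>
    obtain ⟨m, hm, β, hβ⟩ := exists_nat_mul_integer b
    obtain ⟨k, hk⟩ := exists_valued_sub_lt v a one_ne_zero
    obtain ⟨n, hn, κ, hκ⟩ := exists_nat_mul_integer k
    refine ⟨n * m, Nat.mul_pos hn hm, ?_⟩
    have h1 : a - algebraMap F _ k ∈ v.adicCompletionIntegers F := by
      rw [HeightOneSpectrum.mem_adicCompletionIntegers]
      rw [map_one] at hk
      exact hk.le
    have h2 : (n : v.adicCompletion F) * a ∈ v.adicCompletionIntegers F := by
      have h3 : (n : v.adicCompletion F) * a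
          = n * (a - algebraMap F _ k) + algebraMap F _ (κ : F) := by
        rw [← hκ, map_mul, map_natCast]; ring
      rw [h3]
      refine add_mem (mul_mem (natCast_mem _ n) h1) ?_
      rw [← coe_algebraMap_integers]
      exact Subtype.prop _
    have h4 : ((n * m : ℕ) : LocK K v) * a ⊗ₜ[F] b
        = algebraMap (v.adicCompletion F) (LocK K v) (n * a) * incl K v (β : K) := by
      rw [← hβ, map_mul, map_mul, map_natCast, map_natCast]
      change _ = _ * (a ⊗ₜ[F] (1 : K)) * (_ * (1 : v.adicCompletion F) ⊗ₜ[F] b)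
      rw [mul_mul_mul_comm, Algebra.TensorProduct.tmul_mul_tmul, mul_one, one_mul]
      push_cast
      rfl
    rw [h4]
    exact mul_mem (algebraMap_mem_locInt h2) (incl_mem v β)
  | add x y hx hy =>
    obtain ⟨m, hm, h⟩ := hx
    obtain ⟨n, hn, h'⟩ := hy
    refine ⟨m * n, Nat.mul_pos hm hn, ?_⟩
    have : ((m * n : ℕ) : LocK K v) * (x + y) = n * (m * x) + m * (n * y) := by
      push_cast; ring
    rw [this]
    exact add_mem (mul_mem (natCast_mem _ n) h) (mul_mem (natCast_mem _ m) h')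

/-- The multiples of `r` in the image of `𝓞_v ⊗ 𝓞_K`. -/
def locMul (K : Type*) [Field K] [NumberField K] [Algebra F K] (v : HeightOneSpectrum (𝓞 F))
    (r : F) : AddSubgroup (LocK K v) :=
  (locInt K v).toAddSubgroup.map (AddMonoidHom.mulLeft (algebraMap F (LocK K v) r))

theorem mem_locMul {v : HeightOneSpectrum (𝓞 F)} {r : F} {x : LocK K v} :
    x ∈ locMul K v r ↔ ∃ z ∈ locInt K v, x = algebraMap F (LocK K v) r * z := by
  constructor
  · rintro ⟨z, hz, rfl⟩
    exact ⟨z, hz, rfl⟩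
  · rintro ⟨z, hz, rfl⟩
    exact ⟨z, hz, rfl⟩

theorem mul_mem_locMul {v : HeightOneSpectrum (𝓞 F)} {r : F} {x y : LocK K v}
    (hx : x ∈ locInt K v) (hy : y ∈ locMul K v r) : x * y ∈ locMul K v r := by
  obtain ⟨z, hz, rfl⟩ := mem_locMul.mp hy
  exact mem_locMul.mpr ⟨x * z, mul_mem hx hz, by ring⟩

theorem algebraMap_ringOfIntegers_mem (v : HeightOneSpectrum (𝓞 F)) (a : 𝓞 F) :
    algebraMap F (LocK K v) (a : F) ∈ locInt K v := by
  rw [algebraMap_F_eq, ← coe_algebraMap_integers]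
  exact algebraMap_mem_locInt (Subtype.prop _)

theorem locMul_le {v : HeightOneSpectrum (𝓞 F)} (r : 𝓞 F) {x : LocK K v}
    (hx : x ∈ locMul K v (r : F)) : x ∈ locInt K v := by
  obtain ⟨z, hz, rfl⟩ := mem_locMul.mp hx
  exact mul_mem (algebraMap_ringOfIntegers_mem v r) hz

theorem locMul_anti {v : HeightOneSpectrum (𝓞 F)} {r s : 𝓞 F} (h : r ∣ s) {x : LocK K v}
    (hx : x ∈ locMul K v (s : F)) : x ∈ locMul K v (r : F) := by
  obtain ⟨z, hz, rfl⟩ := mem_locMul.mp hx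
  obtain ⟨t, rfl⟩ := h
  refine mem_locMul.mpr ⟨algebraMap F _ (t : F) * z,
    mul_mem (algebraMap_ringOfIntegers_mem v t) hz, ?_⟩
  rw [← mul_assoc, ← map_mul]
  rfl

theorem algebraMap_mem_locMul {v : HeightOneSpectrum (𝓞 F)} {r : 𝓞 F}
    {x : v.adicCompletionIntegers F} (h : algebraMap (𝓞 F) (v.adicCompletionIntegers F) r ∣ x) :
    algebraMap (v.adicCompletion F) (LocK K v) (x : v.adicCompletion F) ∈ locMul K v (r : F) := by
  obtain ⟨y, rfl⟩ := h
  refine mem_locMul.mpr ⟨_, algebraMap_mem_locInt y.2, ?_⟩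
  rw [algebraMap_F_eq, ← coe_algebraMap_integers, ← map_mul]
  rfl

theorem mem_locMul_of_notMem {v : HeightOneSpectrum (𝓞 F)} {r : 𝓞 F} (hr : r ∉ v.asIdeal)
    {x : LocK K v} (hx : x ∈ locInt K v) : x ∈ locMul K v (r : F) := by
  obtain ⟨u, hu⟩ := isUnit_algebraMap_of_notMem v hr
  have h := algebraMap_mem_locMul (K := K) (v := v) (r := r) (x := 1) ⟨(u⁻¹).1, by
    rw [← hu, Units.mul_inv]⟩
  have := mul_mem_locMul hx h
  rwa [show ((1 : v.adicCompletionIntegers F) : v.adicCompletion F) = 1 from rfl, map_one,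
    mul_one] at this

theorem exists_ringOfIntegers_sub_mem_locMul (v : HeightOneSpectrum (𝓞 F)) {x : LocK K v}
    (hx : x ∈ locInt K v) {r : 𝓞 F} (hr : r ≠ 0) :
    ∃ a : 𝓞 K, x - incl K v (a : K) ∈ locMul K v (r : F) := by
  induction hx using Subring.closure_induction with
  | mem x hx =>
    rcases hx with ⟨a, rfl⟩ | ⟨y, rfl⟩
    · obtain ⟨b, y, hy⟩ := exists_ringOfIntegers_sub v a hr
      refine ⟨algebraMap (𝓞 F) (𝓞 K) b, ?_⟩
      have h := algebraMap_mem_locMul (K := K) (v := v) (r := r) ⟨y, hy⟩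
      have e : incl K v ((algebraMap (𝓞 F) (𝓞 K) b : 𝓞 K) : K)
          = algebraMap (v.adicCompletion F) (LocK K v)
            (algebraMap (𝓞 F) (v.adicCompletionIntegers F) b : v.adicCompletionIntegers F) := by
        rw [coe_algebraMap_integers, ← algebraMap_F_eq]
        exact (incl K v).commutes (b : F)
      rw [e]
      change algebraMap (v.adicCompletion F) (LocK K v) _ - _ ∈ _
      rw [← map_sub]
      exact h
    · exact ⟨y, by
        change incl K v (y : K) - _ ∈ _
        rw [sub_self]; exact zero_mem _⟩
  | zero => exact ⟨0, by simp [zero_mem]⟩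
  | one => exact ⟨1, by simp [zero_mem]⟩
  | add x y _ _ hx hy =>
    obtain ⟨a, ha⟩ := hx
    obtain ⟨b, hb⟩ := hy
    refine ⟨a + b, ?_⟩
    have : x + y - incl K v ((a + b : 𝓞 K) : K)
      = (x - incl K v (a : K)) + (y - incl K v (b : K)) := by
      push_cast; rw [map_add]; ring
    rw [this]
    exact add_mem ha hb
  | neg x _ hx =>
    obtain ⟨a, ha⟩ := hx
    refine ⟨-a, ?_⟩
    have : -x - incl K v ((-a : 𝓞 K) : K) = -(x - incl K v (a : K)) := by
      push_cast; rw [map_neg]; ring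
    rw [this]
    exact neg_mem ha
  | mul x y hx' hy' hx hy =>
    obtain ⟨a, ha⟩ := hx
    obtain ⟨b, hb⟩ := hy
    refine ⟨a * b, ?_⟩
    have : x * y - incl K v ((a * b : 𝓞 K) : K)
      = y * (x - incl K v (a : K)) + incl K v (a : K) * (y - incl K v (b : K)) := by
      push_cast; rw [map_mul]; ring
    rw [this]
    exact add_mem (mul_mem_locMul hy' ha) (mul_mem_locMul (incl_mem v a) hb)

theorem finite_mem {r : 𝓞 F} (hr : r ≠ 0) :
    {v : HeightOneSpectrum (𝓞 F) | r ∈ v.asIdeal}.Finite := by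
  have := finite_places (F := F) (I := Ideal.span {r}) (by simpa using hr)
  refine this.subset fun v hv => ?_
  exact (Ideal.span_singleton_le_iff_mem _).mpr hv

/-- Simultaneous approximation in `𝓞_K` at all places. -/
theorem exists_approx_locInt (y : ∀ v : HeightOneSpectrum (𝓞 F), LocK K v)
    (hy : ∀ v, y v ∈ locInt K v) {r : 𝓞 F} (hr : r ≠ 0) :
    ∃ a : 𝓞 K, ∀ v, y v - incl K v (a : K) ∈ locMul K v (r : F) := by
  classical
  choose a ha using fun v => exists_ringOfIntegers_sub_mem_locMul v (hy v) hr
  -- The element `e v` is congruent to `1` at `v` and to `0` at all other places, modulo `r`; with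
  -- these the local approximations are glued.
  choose e he using fun v : HeightOneSpectrum (𝓞 F) =>
    exists_approx (fun w : HeightOneSpectrum (𝓞 F) => if w = v then 1 else 0) hr
  set s := (finite_mem hr).toFinset
  refine ⟨∑ v ∈ s, algebraMap (𝓞 F) (𝓞 K) (e v) * a v, fun w => ?_⟩
  by_cases hw : r ∈ w.asIdeal
  swap
  · exact mem_locMul_of_notMem hw (sub_mem (hy w) (incl_mem w _))
  have hws : w ∈ s := by simpa [s] using hw
  have hincl : ∀ v, incl K w ((algebraMap (𝓞 F) (𝓞 K) (e v) : 𝓞 K) : K)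
      = algebraMap (w.adicCompletion F) (LocK K w)
        (algebraMap (𝓞 F) (w.adicCompletionIntegers F) (e v) : w.adicCompletionIntegers F) := by
    intro v
    rw [coe_algebraMap_integers, ← algebraMap_F_eq]
    exact (incl K w).commutes ((e v : 𝓞 F) : F)
  have h1 : ∀ v, v ≠ w → incl K w ((algebraMap (𝓞 F) (𝓞 K) (e v) * a v : 𝓞 K) : K)
      ∈ locMul K w (r : F) := by
    intro v hv
    have := he v w
    rw [if_neg (Ne.symm hv), zero_sub, dvd_neg] at this
    have := mul_mem_locMul (incl_mem w (a v)) (algebraMap_mem_locMul (K := K) this)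
    rw [← hincl, ← map_mul, mul_comm] at this
    exact this
  have h2 : incl K w (a w : K) - incl K w ((algebraMap (𝓞 F) (𝓞 K) (e w) * a w : 𝓞 K) : K)
      ∈ locMul K w (r : F) := by
    have := he w w
    rw [if_pos rfl] at this
    have := mul_mem_locMul (incl_mem w (a w)) (algebraMap_mem_locMul (K := K) this)
    have e1 : (((1 : w.adicCompletionIntegers F) - algebraMap (𝓞 F) _ (e w) :
        w.adicCompletionIntegers F) : w.adicCompletion F) = 1 - ((algebraMap (𝓞 F)
          (w.adicCompletionIntegers F) (e w) : w.adicCompletionIntegers F) :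
          w.adicCompletion F) := rfl
    rw [e1, map_sub, ← hincl, map_one] at this
    convert this using 1
    rw [mul_sub, mul_one, ← map_mul, mul_comm (a w : K)]
    rfl
  have h3 : y w - incl K w ((∑ v ∈ s, algebraMap (𝓞 F) (𝓞 K) (e v) * a v : 𝓞 K) : K)
      = (y w - incl K w (a w : K)) + (incl K w (a w : K)
        - incl K w ((algebraMap (𝓞 F) (𝓞 K) (e w) * a w : 𝓞 K) : K))
        - ∑ v ∈ s.erase w, incl K w ((algebraMap (𝓞 F) (𝓞 K) (e v) * a v : 𝓞 K) : K) := by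
    rw [← Finset.add_sum_erase s _ hws]
    push_cast
    rw [map_add, map_sum]
    ring
  rw [h3]
  exact sub_mem (add_mem (ha w) h2) (sum_mem fun v hv => h1 v (Finset.ne_of_mem_erase hv))

theorem isIntegralElem_of_mem_locInt {v : HeightOneSpectrum (𝓞 F)} {x : LocK K v}
    (hx : x ∈ locInt K v) : ((algebraMap (v.adicCompletion F) (LocK K v)).comp
      (v.adicCompletionIntegers F).subtype).IsIntegralElem x := by
  induction hx using Subring.closure_induction with
  | mem x hx =>
    rcases hx with ⟨a, rfl⟩ | ⟨y, rfl⟩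
    · exact RingHom.isIntegralElem_map _
    · obtain ⟨q, hq, h⟩ := y.2
      refine ⟨q.map (Int.castRingHom _), hq.map _, ?_⟩
      rw [Polynomial.eval₂_map]
      have h' := congrArg (incl K v) h
      rw [map_zero] at h'
      change (incl K v).toRingHom _ = 0 at h'
      rw [Polynomial.hom_eval₂] at h'
      rw [RingHom.ext_int ((incl K v).toRingHom.comp (algebraMap ℤ K))
        (((algebraMap (v.adicCompletion F) (LocK K v)).comp
          (v.adicCompletionIntegers F).subtype).comp (Int.castRingHom _))] at h'
      exact h'
  | zero => exact RingHom.isIntegralElem_zero _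
  | one => exact RingHom.isIntegralElem_one _
  | add x y _ _ hx hy => exact hx.add _ hy
  | neg x _ hx => exact hx.neg _
  | mul x y _ _ hx hy => exact hx.mul _ hy

/-- The image of `𝓞_v ⊗ 𝓞_K` is integral over `𝓞_v`, which is integrally closed in `F_v`. -/
theorem mem_integers_of_algebraMap_mem_locInt {v : HeightOneSpectrum (𝓞 F)}
    {x : v.adicCompletion F} (hx : algebraMap (v.adicCompletion F) (LocK K v) x ∈ locInt K v) :
    x ∈ v.adicCompletionIntegers F := by
  obtain ⟨q, hq, h⟩ := isIntegralElem_of_mem_locInt hx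
  rw [← Polynomial.hom_eval₂] at h
  have h' : Polynomial.eval₂ (v.adicCompletionIntegers F).subtype x q = 0 :=
    (algebraMap (v.adicCompletion F) (LocK K v)).injective (by rw [h, map_zero])
  have : IsIntegral (v.adicCompletionIntegers F) x := ⟨q, hq, h'⟩
  obtain ⟨z, hz⟩ := IsIntegrallyClosed.isIntegral_iff.mp this
  rw [← hz]
  exact z.2

theorem exists_ringOfIntegers_of_forall_mem_locInt (h2 : Module.finrank F K = 2) {c : K ≃ₐ[F] K}
    (hc : c ≠ 1) {w : K} (hw : c w = w) 
    (h : ∀ v : HeightOneSpectrum (𝓞 F), incl K v w ∈ locInt K v) :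
    ∃ a : 𝓞 F, algebraMap F K (a : F) = w := by
  obtain ⟨z, rfl⟩ := exists_algebraMap_eq_of_fixed h2 hc hw
  obtain ⟨a, rfl⟩ := exists_ringOfIntegers_of_forall_mem (z := z) fun v => by
    refine mem_integers_of_algebraMap_mem_locInt (K := K) ?_
    rw [← algebraMap_F_eq, ← (incl K v).commutes]
    exact h v
  exact ⟨a, rfl⟩

end LocalLattice

end

end HidaU2

namespace HidaU2

noncomputable section

/-! ### Short vectors and finiteness of the class number -/

section ClassNumber

variable {F K : Type*} [Field F] [NumberField F] [Field K] [NumberField K] [Algebra F K]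

theorem mem_locMul_nat {v : HeightOneSpectrum (𝓞 F)} {M : ℕ} {x : LocK K v} :
    x ∈ locMul K v (M : F) ↔ ∃ z ∈ locInt K v, x = M * z := by
  rw [mem_locMul, map_natCast]

theorem mul_mem_locInt_of_dvd {v : HeightOneSpectrum (𝓞 F)} {m M : ℕ} (h : m ∣ M) {x : LocK K v}
    (hx : (m : LocK K v) * x ∈ locInt K v) : (M : LocK K v) * x ∈ locInt K v := by
  obtain ⟨k, rfl⟩ := h
  have : ((m * k : ℕ) : LocK K v) * x = k * (m * x) := by push_cast; ring
  rw [this]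
  exact mul_mem (natCast_mem _ k) hx

theorem natCast_mul_cancel {v : HeightOneSpectrum (𝓞 F)} {M : ℕ} (hM : 0 < M) {x y : LocK K v}
    (h : (M : LocK K v) * x = M * y) : x = y := by
  have hM' : (M : F) ≠ 0 := by exact_mod_cast hM.ne'
  have h1 : algebraMap F (LocK K v) (M : F)⁻¹ * (M : LocK K v) = 1 := by
    rw [← map_natCast (algebraMap F (LocK K v)) M, ← map_mul, inv_mul_cancel₀ hM', map_one]
  calc x = algebraMap F (LocK K v) (M : F)⁻¹ * (M : LocK K v) * x := by rw [h1, one_mul]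
    _ = algebraMap F (LocK K v) (M : F)⁻¹ * (M : LocK K v) * y := by rw [mul_assoc, h, mul_assoc]
    _ = y := by rw [h1, one_mul]

/-- Complex conjugation induces `c` on a CM field. -/
theorem embedding_conj [NumberField.IsTotallyReal F] [NumberField.IsTotallyComplex K]
    (h2 : Module.finrank F K = 2) {c : K ≃ₐ[F] K} (hc : c ≠ 1) (ψ : K →+* ℂ) (y : K) :
    ψ (c y) = (starRingEnd ℂ) (ψ y) := by
  obtain ⟨θ, hθ⟩ : ∃ θ, c θ ≠ θ := by
    by_contra h
    push Not at h
    exact hc (AlgEquiv.ext h)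
  have hcc := conj_conj h2 c
  have hF : ∀ a : F, (starRingEnd ℂ) (ψ (algebraMap F K a)) = ψ (algebraMap F K a) := fun a =>
    RingHom.congr_fun (NumberField.IsTotallyReal.complexEmbedding_isReal
      (ψ.comp (algebraMap F K))) a
  have hdec : ∀ y : K, ∃ a b : F, y = algebraMap F K a + algebraMap F K b * θ := by
    intro y
    have hne : θ - c θ ≠ 0 := sub_ne_zero.mpr (Ne.symm hθ)
    obtain ⟨b, hb⟩ := exists_algebraMap_eq_of_fixed h2 hc (w := (y - c y) / (θ - c θ)) (by
      rw [map_div₀, map_sub, map_sub, hcc, hcc, ← neg_sub y, ← neg_sub θ, neg_div_neg_eq])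
    obtain ⟨a, ha⟩ := exists_algebraMap_eq_of_fixed h2 hc (w := y - algebraMap F K b * θ) (by
      rw [map_sub, map_mul, AlgEquiv.commutes, hb]
      field_simp
      ring)
    exact ⟨a, b, by rw [ha]; ring⟩
  -- The trace and the norm of `θ` lie in `F`, whose embeddings are real. So the complex conjugate
  -- of `ψ θ` is a root of the same quadratic polynomial as `ψ θ` and `ψ (c θ)`. The case of `ψ θ`
  -- itself is excluded because it would make `ψ` a real embedding.
  have hroot : ((starRingEnd ℂ) (ψ θ) - ψ θ) * ((starRingEnd ℂ) (ψ θ) - ψ (c θ)) = 0 := by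
    obtain ⟨t, ht⟩ := exists_algebraMap_eq_of_fixed h2 hc (w := θ + c θ) (by
      rw [map_add, hcc, add_comm])
    obtain ⟨n, hn⟩ := exists_algebraMap_eq_of_fixed h2 hc (w := θ * c θ) (by
      rw [map_mul, hcc, mul_comm])
    have h1 := hF t
    have h2 := hF n
    rw [ht] at h1
    rw [hn] at h2
    simp only [map_add, map_mul] at h1 h2
    have h3 : (ψ θ) ^ 2 - (ψ θ + ψ (c θ)) * ψ θ + ψ θ * ψ (c θ) = 0 := by ring
    have h4 := congrArg (starRingEnd ℂ) h3
    simp only [map_add, map_mul, map_sub, map_pow, map_zero] at h4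
    rw [h1, h2] at h4
    linear_combination h4
  have hne : (starRingEnd ℂ) (ψ θ) ≠ ψ θ := by
    intro h
    refine NumberField.IsTotallyComplex.complexEmbedding_not_isReal ψ ?_
    refine RingHom.ext fun y => ?_
    obtain ⟨a, b, rfl⟩ := hdec y
    change (starRingEnd ℂ) (ψ _) = ψ _
    rw [map_add, map_mul, map_add, map_mul, hF, hF, h]
  have hθ' : (starRingEnd ℂ) (ψ θ) = ψ (c θ) := by
    rcases mul_eq_zero.mp hroot with h | h
    · exact absurd (sub_eq_zero.mp h) hne
    · exact sub_eq_zero.mp h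
  obtain ⟨a, b, rfl⟩ := hdec y
  rw [map_add, map_mul, AlgEquiv.commutes, AlgEquiv.commutes]
  simp only [map_add, map_mul, hF, hθ']

variable {p : ℕ} (D : Datum F K p)

namespace Datum

theorem exists_nat_mul_entries_mem (g : D.G) :
    ∃ M : ℕ, 0 < M ∧ ∀ v i j, (M : LocK K v) * (g v).1.1 i j ∈ locInt K v := by
  classical
  choose m hm hm' using fun v : HeightOneSpectrum (𝓞 F) => fun x : LocK K v =>
    exists_nat_mul_mem v x
  have hfin : {v | ¬ g v ∈ K0loc D.c v}.Finite := g.2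
  refine ⟨∏ v ∈ hfin.toFinset, ∏ i, ∏ j, m v ((g v).1.1 i j), ?_, fun v i j => ?_⟩
  · exact Finset.prod_pos fun v _ => Finset.prod_pos fun i _ => Finset.prod_pos fun j _ => hm _ _
  · by_cases hv : g v ∈ K0loc D.c v
    · exact mul_mem (natCast_mem _ _) (coe_mem_locInt hv i j)
    · refine mul_mem_locInt_of_dvd ?_ (hm' v _)
      have h1 : m v ((g v).1.1 i j) ∣ ∏ j, m v ((g v).1.1 i j) :=
        Finset.dvd_prod_of_mem (fun j => m v ((g v).1.1 i j)) (Finset.mem_univ j)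
      have h2 : (∏ j, m v ((g v).1.1 i j)) ∣ ∏ i, ∏ j, m v ((g v).1.1 i j) :=
        Finset.dvd_prod_of_mem (fun i => ∏ j, m v ((g v).1.1 i j)) (Finset.mem_univ i)
      refine h1.trans (h2.trans (Finset.dvd_prod_of_mem
        (fun v => ∏ i, ∏ j, m v ((g v).1.1 i j)) ?_))
      simpa using hv

/-- For `M g` the product `det · c(det)` is `M⁴`. The precision `M⁵` contains one further factor
`M`, so that for `A` this product is `M⁴` times an element congruent to `1` modulo `M`. -/
theorem exists_matrix_approx (g : D.G) {M : ℕ} (hM : 0 < M)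
    (h : ∀ v i j, (M : LocK K v) * (g v).1.1 i j ∈ locInt K v) :
    ∃ A : Matrix (Fin 2) (Fin 2) (𝓞 K), ∀ v i j, ∃ z ∈ locInt K v,
      incl K v (A i j : K) = M * (g v).1.1 i j + M ^ 5 * z := by
  have hM' : ((M : 𝓞 F) ^ 5) ≠ 0 := pow_ne_zero _ (by exact_mod_cast hM.ne')
  choose A hA using fun i j => exists_approx_locInt (fun v => (M : LocK K v) * (g v).1.1 i j)
    (fun v => h v i j) hM'
  refine ⟨A, fun v i j => ?_⟩
  obtain ⟨z, hz, h1⟩ := mem_locMul.mp (hA i j v)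
  refine ⟨-z, neg_mem hz, ?_⟩
  have h2 : algebraMap F (LocK K v) (((M : 𝓞 F) ^ 5 : 𝓞 F) : F) = (M : LocK K v) ^ 5 := by
    push_cast
    rfl
  rw [h2] at h1
  linear_combination -h1

/-- Solving for `w` in `K` gives an element fixed by `c`. Since `det g · c(det g) = 1`, a local
expansion shows that it is integral at every place, hence comes from `𝓞_F`. -/
theorem exists_det_approx (g : D.G) {M : ℕ} (hM : 0 < M)
    (h : ∀ v i j, (M : LocK K v) * (g v).1.1 i j ∈ locInt K v)
    (A : Matrix (Fin 2) (Fin 2) (𝓞 K)) (hA : ∀ v i j, ∃ z ∈ locInt K v,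
      incl K v (A i j : K) = M * (g v).1.1 i j + M ^ 5 * z) :
    ∃ w : 𝓞 K, A.det * NumberField.RingOfIntegers.mapRingHom
      ((D.c : K ≃+* K) : K →+* K) A.det = (M : 𝓞 K) ^ 4 * (1 + M * w) := by
  have hM' : (M : K) ≠ 0 := by exact_mod_cast hM.ne'
  set δ : K := (A.det : K) with hδ
  have hcc := conj_conj D.finrank_eq D.c
  set w : K := (δ * D.c δ / (M : K) ^ 4 - 1) / M with hw
  have hδw : δ * D.c δ = (M : K) ^ 4 * (1 + M * w) := by
    rw [hw]; field_simp; ring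
  have hcw : D.c w = w := by
    rw [hw]
    simp only [map_div₀, map_sub, map_mul, map_pow, map_natCast, map_one, hcc]
    rw [mul_comm (D.c δ)]
  have hint : ∀ v : HeightOneSpectrum (𝓞 F), incl K v w ∈ locInt K v := by
    intro v
    choose z hz hz' using hA v
    set G := (g v).1.1
    set σ := locConj D.c v
    have hG : ∀ i j, (M : LocK K v) * G i j ∈ locInt K v := h v
    set X : LocK K v := (M * G 0 0) * z 1 1 + z 0 0 * (M * G 1 1) - (M * G 0 1) * z 1 0
      - z 0 1 * (M * G 1 0) + M ^ 5 * (z 0 0 * z 1 1 - z 0 1 * z 1 0) with hX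
    set Y : LocK K v := (M * G 0 0) * (M * G 1 1) - (M * G 0 1) * (M * G 1 0) with hY
    have hXm : X ∈ locInt K v := by
      refine add_mem (sub_mem (sub_mem (add_mem ?_ ?_) ?_) ?_) ?_
      · exact mul_mem (hG _ _) (hz _ _)
      · exact mul_mem (hz _ _) (hG _ _)
      · exact mul_mem (hG _ _) (hz _ _)
      · exact mul_mem (hz _ _) (hG _ _)
      · exact mul_mem (pow_mem (natCast_mem _ _) _) (sub_mem (mul_mem (hz _ _) (hz _ _))
          (mul_mem (hz _ _) (hz _ _)))
    have hYm : Y ∈ locInt K v := sub_mem (mul_mem (hG _ _) (hG _ _)) (mul_mem (hG _ _) (hG _ _))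
    have hδX : incl K v δ = Y + M ^ 5 * X := by
      rw [hδ, Matrix.det_fin_two]
      push_cast
      rw [map_sub, map_mul, map_mul, hz', hz', hz', hz', hX, hY]
      ring
    have hYY : Y * σ Y = M ^ 4 := by
      have h1 : Y = M ^ 2 * G.det := by rw [Matrix.det_fin_two, hY]; ring
      have h2 : G.det * σ G.det = 1 := unitary2_det (g v)
      rw [h1, map_mul, map_pow, map_natCast]
      linear_combination M ^ 4 * h2
    have h3 : incl K v (δ * D.c δ) = M ^ 4 * (1 + M * (Y * σ X + X * σ Y + M ^ 5 * (X * σ X))) := by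
      rw [map_mul, ← locConj_incl, hδX]
      change (Y + M ^ 5 * X) * σ (Y + M ^ 5 * X) = _
      rw [map_add, map_mul, map_pow, map_natCast]
      linear_combination hYY
    rw [hδw, map_mul, map_pow, map_add, map_one, map_mul, map_natCast] at h3
    have h4 : incl K v w = Y * σ X + X * σ Y + M ^ 5 * (X * σ X) := by
      have h5 : ((M ^ 5 : ℕ) : LocK K v) * incl K v w
          = ((M ^ 5 : ℕ) : LocK K v) * (Y * σ X + X * σ Y + M ^ 5 * (X * σ X)) := by
        push_cast
        linear_combination h3
      exact natCast_mul_cancel (pow_pos hM 5) h5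
    rw [h4]
    exact add_mem (add_mem (mul_mem hYm (locConj_mem hXm)) (mul_mem hXm (locConj_mem hYm)))
      (mul_mem (pow_mem (natCast_mem _ _) _) (mul_mem hXm (locConj_mem hXm)))
  obtain ⟨a, ha⟩ := exists_ringOfIntegers_of_forall_mem_locInt D.finrank_eq D.c_ne_one hcw hint
  refine ⟨algebraMap (𝓞 F) (𝓞 K) a, NumberField.RingOfIntegers.coe_injective ?_⟩
  have e : ((algebraMap (𝓞 F) (𝓞 K) a : 𝓞 K) : K) = w := ha
  calc ((A.det * NumberField.RingOfIntegers.mapRingHom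
      ((D.c : K ≃+* K) : K →+* K) A.det : 𝓞 K) : K) = δ * D.c δ := rfl
    _ = (M : K) ^ 4 * (1 + M * w) := hδw
    _ = _ := by rw [← e]; push_cast; rfl

/-- The integral vectors that a family of matrices maps into `M` times the standard lattices. -/
def latticeOf (H : ∀ v : HeightOneSpectrum (𝓞 F), Matrix (Fin 2) (Fin 2) (LocK K v)) (M : ℕ) :
    Submodule ℤ (Fin 2 → 𝓞 K) where
  carrier := {z | ∀ v i, H v i 0 * incl K v (z 0 : K) + H v i 1 * incl K v (z 1 : K)
    ∈ locMul K v (M : F)}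
  zero_mem' := by
    intro v i
    simp [zero_mem]
  add_mem' := by
    intro a b ha hb v i
    have := add_mem (ha v i) (hb v i)
    simp only [Pi.add_apply]
    push_cast
    rw [map_add, map_add]
    convert this using 1
    ring
  smul_mem' := by
    intro n a ha v i
    have := zsmul_mem (ha v i) n
    rw [zsmul_eq_mul] at this
    simp only [Pi.smul_apply, zsmul_eq_mul]
    push_cast
    rw [map_mul, map_mul]
    simp only [map_intCast]
    convert this using 1
    ring

/-- The integral vectors that `H = g⁻¹` maps into `M` times the standard lattices form a lattice. It
contains `M² 𝓞_K²` and the image of the approximation `A` of `M g`, so its index is at most that of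
`M 𝓞_K²`. Pigeonhole gives `z` in it with coordinates at most `M`, and `x = z / M` satisfies a bound
that does not depend on `g`. -/
theorem exists_short_vector_aux (g : D.G)
    (H : ∀ v : HeightOneSpectrum (𝓞 F), Matrix (Fin 2) (Fin 2) (LocK K v))
    (hHG : ∀ v, H v * (g v).1.1 = 1) (hHc : ∀ v i j, H v i j = locConj D.c v ((g v).1.1 j i)) :
    ∃ x : Fin 2 → K, x ≠ 0 ∧
      (∀ v i, H v i 0 * incl K v (x 0) + H v i 1 * incl K v (x 1) ∈ locInt K v) ∧
      ∀ i (ψ : K →+* ℂ), ‖ψ (x i)‖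
        ≤ ∑ ψ : K →+* ℂ, ∑ j, ‖ψ (NumberField.RingOfIntegers.basis K j : K)‖ := by
  classical
  obtain ⟨M, hM, hMg⟩ := D.exists_nat_mul_entries_mem g
  have hM' : (M : K) ≠ 0 := by exact_mod_cast hM.ne'
  obtain ⟨A, hA⟩ := D.exists_matrix_approx g hM hMg
  obtain ⟨w, hw⟩ := D.exists_det_approx g hM hMg A hA
  have hinv : ∀ v i j, (M : LocK K v) * H v i j ∈ locInt K v := by
    intro v i j
    have h2 := locConj_mem (c := D.c) (hMg v j i)
    rwa [map_mul, map_natCast, ← hHc] at h2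
  have hmem : ∀ z, z ∈ latticeOf H M ↔ ∀ v i, H v i 0 * incl K v (z 0 : K)
      + H v i 1 * incl K v (z 1 : K) ∈ locMul K v (M : F) := fun z => Iff.rfl
  have hLM : ∀ x : Fin 2 → 𝓞 K, (M ^ 2 : ℕ) • x ∈ latticeOf H M := by
    intro x
    rw [hmem]
    intro v i
    refine mem_locMul_nat.mpr ⟨(M * H v i 0) * incl K v (x 0 : K)
      + (M * H v i 1) * incl K v (x 1 : K),
      add_mem (mul_mem (hinv v i 0) (incl_mem v _)) (mul_mem (hinv v i 1) (incl_mem v _)), ?_⟩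
    simp only [Pi.smul_apply, nsmul_eq_mul]
    push_cast
    simp only [map_mul, map_pow, map_natCast]
    ring
  have hLA : ∀ x, A *ᵥ x ∈ latticeOf H M := by
    intro x
    rw [hmem]
    intro v i
    choose z hz hz' using hA v
    have hone : ∀ j, (1 : Matrix (Fin 2) (Fin 2) (LocK K v)) i j ∈ locInt K v := by
      intro j
      rw [Matrix.one_apply]
      split_ifs
      · exact one_mem _
      · exact zero_mem _
    have hent : ∀ j : Fin 2, H v i 0 * (g v).1.1 0 j + H v i 1 * (g v).1.1 1 j
        = (1 : Matrix (Fin 2) (Fin 2) (LocK K v)) i j := by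
      intro j
      rw [← hHG v, Matrix.mul_apply, Fin.sum_univ_two]
    refine mem_locMul_nat.mpr ⟨
      ((1 : Matrix (Fin 2) (Fin 2) (LocK K v)) i 0
        + M ^ 3 * ((M * H v i 0) * z 0 0 + (M * H v i 1) * z 1 0)) * incl K v (x 0 : K)
      + ((1 : Matrix (Fin 2) (Fin 2) (LocK K v)) i 1
        + M ^ 3 * ((M * H v i 0) * z 0 1 + (M * H v i 1) * z 1 1)) * incl K v (x 1 : K), ?_, ?_⟩
    · have hent' : ∀ j, (1 : Matrix (Fin 2) (Fin 2) (LocK K v)) i j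
          + M ^ 3 * ((M * H v i 0) * z 0 j + (M * H v i 1) * z 1 j) ∈ locInt K v := fun j =>
        add_mem (hone j) (mul_mem (pow_mem (natCast_mem _ _) _) (add_mem
          (mul_mem (hinv v i 0) (hz _ _)) (mul_mem (hinv v i 1) (hz _ _))))
      exact add_mem (mul_mem (hent' 0) (incl_mem v _)) (mul_mem (hent' 1) (incl_mem v _))
    · simp only [Matrix.mulVec, dotProduct, Fin.sum_univ_two]
      push_cast
      simp only [map_add, map_mul, hz']
      linear_combination M * incl K v (x 0 : K) * hent 0 + M * incl K v (x 1 : K) * hent 1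
  obtain ⟨hfin, hcard⟩ := index_le_of_det (D.c : K ≃+* K) hM A w hw (latticeOf H M) hLA hLM
  obtain ⟨z, hzL, hz0, hzb⟩ := exists_small_mem_of_index_le _ hfin hcard
  refine ⟨fun i => (z i : K) / M, fun h0 => hz0 (funext fun i => ?_), fun v i => ?_,
    fun i ψ => ?_⟩
  · have := congrFun h0 i
    simp only [Pi.zero_apply, div_eq_zero_iff, hM', or_false] at this
    exact NumberField.RingOfIntegers.coe_injective this
  · obtain ⟨t, ht, h1⟩ := mem_locMul_nat.mp ((hmem z).mp hzL v i)
    have h2 : H v i 0 * incl K v ((z 0 : K) / M) + H v i 1 * incl K v ((z 1 : K) / M) = t := by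
      refine natCast_mul_cancel hM ?_
      rw [← h1]
      have h3 : ∀ i, incl K v (z i : K) = M * incl K v ((z i : K) / M) := by
        intro i
        rw [← map_natCast (incl K v) M, ← map_mul, mul_div_cancel₀ _ hM']
      rw [h3, h3]
      ring
    rw [h2]
    exact ht
  · obtain ⟨n, hn, hzn⟩ := hzb i
    have hMr : (0 : ℝ) < M := by exact_mod_cast hM
    rw [map_div₀, map_natCast, norm_div, Complex.norm_natCast, div_le_iff₀ hMr, hzn]
    push_cast
    rw [map_sum]
    refine (norm_sum_le _ _).trans ?_
    have h1 : ∀ j, ‖ψ ((n j • NumberField.RingOfIntegers.basis K j : 𝓞 K) : K)‖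
        ≤ ‖ψ (NumberField.RingOfIntegers.basis K j : K)‖ * M := by
      intro j
      have e : ∀ t : 𝓞 K, ψ ((n j • t : 𝓞 K) : K) = n j * ψ (t : K) := fun t => by
        rw [show ((n j • t : 𝓞 K) : K) = n j • (t : K) from map_zsmul (algebraMap (𝓞 K) K) _ _,
          map_zsmul, zsmul_eq_mul]
      rw [e, norm_mul, mul_comm, Complex.norm_intCast]
      refine mul_le_mul_of_nonneg_left ?_ (norm_nonneg _)
      exact_mod_cast hn j
    refine (Finset.sum_le_sum fun j _ => h1 j).trans ?_
    rw [← Finset.sum_mul]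
    refine mul_le_mul_of_nonneg_right ?_ hMr.le
    exact Finset.single_le_sum (f := fun ψ : K →+* ℂ =>
      ∑ j, ‖ψ (NumberField.RingOfIntegers.basis K j : K)‖)
      (fun _ _ => Finset.sum_nonneg fun _ _ => norm_nonneg _) (Finset.mem_univ ψ)

end Datum

end ClassNumber

end

end HidaU2

namespace HidaU2

noncomputable section

/-! ### Invariants of adelic points and finiteness of the double coset spaces -/

section ClassNumber

variable {F K : Type*} [Field F] [NumberField F] [Field K] [NumberField K] [Algebra F K]
  {p : ℕ} (D : Datum F K p)

namespace Datum

/-- The diagonal embedding of `G₁(F)`. -/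
def ofRational (γ : unitary2 (D.c : K →+* K)) : D.G :=
  ⟨fun v => ⟨Matrix.GeneralLinearGroup.map (incl K v).toRingHom γ.1, by
      have h : γ.1.1 * (γ.1.1.map D.c)ᵀ = 1 := γ.2
      change γ.1.1.map (incl K v) * ((γ.1.1.map (incl K v)).map (locConj D.c v))ᵀ = 1
      have e : (γ.1.1.map (incl K v)).map (locConj D.c v) = (γ.1.1.map D.c).map (incl K v) := by
        refine Matrix.ext fun i j => ?_
        exact locConj_incl D.c v _
      have h1 := congrArg (fun M : Matrix (Fin 2) (Fin 2) K => M.map (incl K v)) h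
      rw [e]
      simp only [Matrix.map_mul] at h1
      rw [← Matrix.transpose_map] at h1
      rw [← Matrix.transpose_map]
      refine h1.trans ?_
      exact Matrix.map_one _ (map_zero _) (map_one _)⟩, by
    choose m hm a ha using fun y : K => exists_nat_mul_integer y
    set N := ∏ i, ∏ j, m (γ.1.1 i j) with hN
    have hN0 : 0 < N := Finset.prod_pos fun i _ => Finset.prod_pos fun j _ => hm _
    have hN' : ((N : ℕ) : 𝓞 F) ≠ 0 := by exact_mod_cast hN0.ne'
    refine Filter.eventually_cofinite.mpr ((finite_mem hN').subset ?_)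
    intro v hv
    by_contra h
    refine hv (mem_K0loc_of fun i j => ?_)
    have h1 : (m (γ.1.1 i j) : LocK K v) * incl K v (γ.1.1 i j) ∈ locInt K v := by
      rw [← map_natCast (incl K v), ← map_mul, ha]
      exact incl_mem v _
    have h2 : m (γ.1.1 i j) ∣ N :=
      (Finset.dvd_prod_of_mem (fun j => m (γ.1.1 i j)) (Finset.mem_univ j)).trans
        (Finset.dvd_prod_of_mem (fun i => ∏ j, m (γ.1.1 i j)) (Finset.mem_univ i))
    have h3 := mem_locMul_of_notMem h (mul_mem_locInt_of_dvd h2 h1)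
    obtain ⟨z, hz, h4⟩ := mem_locMul.mp h3
    have h5 : algebraMap F (LocK K v) (((N : ℕ) : 𝓞 F) : F) = (N : LocK K v) := by
      push_cast
      rfl
    rw [h5] at h4
    have h6 := natCast_mul_cancel hN0 h4
    change incl K v (γ.1.1 i j) ∈ _
    rw [h6]
    exact hz⟩

theorem ofRational_mem (γ : unitary2 (D.c : K →+* K)) : D.ofRational γ ∈ D.rational :=
  ⟨γ, fun _ => rfl⟩

/-- The Hermitian form `x₀ c(x₀) + x₁ c(x₁)`. -/
def hermForm (x : Fin 2 → K) : K := x 0 * D.c (x 0) + x 1 * D.c (x 1)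

/-- Adelic points with the same invariants modulo `d d' N` are related by an element of `G₁(F)`
up to the principal congruence subgroup of level `N`. -/
theorem exists_rational_of_congr (g g' : D.G) (x x' : Fin 2 → K) (e e' : K) (d d' : 𝓞 F)
    (hd0 : d ≠ 0) (hd0' : d' ≠ 0) (N : ℕ)
    (hx : D.hermForm x = algebraMap F K d) (hx' : D.hermForm x' = algebraMap F K d)
    (he : e * D.c e = algebraMap F K d') (he' : e' * D.c e' = algebraMap F K d')
    (hy : ∀ v i, ((g⁻¹ v).1.1 *ᵥ fun i => incl K v (x i)) i ∈ locInt K v)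
    (hy' : ∀ v i, ((g'⁻¹ v).1.1 *ᵥ fun i => incl K v (x' i)) i ∈ locInt K v)
    (hf : ∀ v, (g v).1.1.det * incl K v e ∈ locInt K v)
    (hyy : ∀ v i, ((g'⁻¹ v).1.1 *ᵥ fun i => incl K v (x' i)) i
      - ((g⁻¹ v).1.1 *ᵥ fun i => incl K v (x i)) i ∈ locMul K v ((d * d' * N : 𝓞 F) : F))
    (hff : ∀ v, (g' v).1.1.det * incl K v e' - (g v).1.1.det * incl K v e
      ∈ locMul K v ((d * d' * N : 𝓞 F) : F)) :
    ∃ γ ∈ D.rational, ∀ v i j, ((g'⁻¹ * γ * g) v).1.1 i j - (1 : Matrix _ _ (LocK K v)) i j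
      ∈ locMul K v (N : F) := by
  have hcc := conj_conj D.finrank_eq D.c
  have hdK : algebraMap F K (d : F) ≠ 0 := by
    simpa using fun h => hd0 (NumberField.RingOfIntegers.coe_injective h)
  have hdK' : algebraMap F K (d' : F) ≠ 0 := by
    simpa using fun h => hd0' (NumberField.RingOfIntegers.coe_injective h)
  have he0' : e' ≠ 0 := by
    rintro rfl
    rw [zero_mul] at he'
    exact hdK' he'.symm
  have hce0' : D.c e' ≠ 0 := by simpa using he0'
  set η := e / e' with hη
  have hηη : η * (D.c : K →+* K) η = 1 := by
    change η * D.c η = 1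
    rw [hη, map_div₀, div_mul_div_comm, he, he', div_self hdK']
  set d₁ := (algebraMap F K (d : F))⁻¹ with hd₁
  have hdd : algebraMap F K (d : F) * d₁ = 1 := mul_inv_cancel₀ hdK
  -- The columns of `perpMat x` are `x` and a vector orthogonal to it. This matrix takes `x` to `x'`
  -- and has determinant `η = e / e'`, so both invariants of `g` and `g'` are matched.
  set G₀ : Matrix (Fin 2) (Fin 2) K := d₁ • (perpMat (D.c : K →+* K) x' * !![1, 0; 0, η]
    * perpMatStar (D.c : K →+* K) x) with hG₀
  have hG : G₀ * (G₀.map (D.c : K →+* K))ᵀ = 1 :=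
    transport_mem (c := (D.c : K →+* K)) hcc hx hx' hdd hηη
  set γ : unitary2 (D.c : K →+* K) := ⟨⟨G₀, (G₀.map (D.c : K →+* K))ᵀ, hG,
    mul_eq_one_comm.mp hG⟩, hG⟩ with hγ
  refine ⟨D.ofRational γ, D.ofRational_mem γ, fun v i j => ?_⟩
  have hform : ∀ x : Fin 2 → K, incl K v (x 0) * locConj D.c v (incl K v (x 0))
      + incl K v (x 1) * locConj D.c v (incl K v (x 1)) = incl K v (D.hermForm x) := by
    intro x
    rw [locConj_incl, locConj_incl, hermForm, map_add, map_mul, map_mul]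
  have hdet : ∀ g : D.G, locConj D.c v (g⁻¹ v).1.1.det = (g v).1.1.det := by
    intro g
    have h1 := unitary2_det (g⁻¹ v)
    have h2 : (g⁻¹ v).1.1.det * (g v).1.1.det = 1 := by
      rw [← Matrix.det_mul]
      have : (g⁻¹ v) * g v = 1 := inv_mul_cancel (g v)
      have h3 := congrArg (fun u : G1loc D.c v => u.1.1.det) this
      exact h3.trans Matrix.det_one
    have h3 : (g⁻¹ v).1.1.det * (locConj D.c v (g⁻¹ v).1.1.det - (g v).1.1.det) = 0 := by
      rw [mul_sub, h1, h2, sub_self]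
    linear_combination (g v).1.1.det * h3
      - (locConj D.c v (g⁻¹ v).1.1.det - (g v).1.1.det) * h2
  have hmap : G₀.map (incl K v) = incl K v d₁ • (perpMat (locConj D.c v) (fun i => incl K v (x' i))
      * !![1, 0; 0, incl K v η] * perpMatStar (locConj D.c v) (fun i => incl K v (x i))) := by
    have e0 : ∀ M : Matrix (Fin 2) (Fin 2) K,
        (d₁ • M).map (incl K v) = incl K v d₁ • M.map (incl K v) := fun M => by
      refine Matrix.ext fun i j => ?_
      exact map_mul (incl K v) _ _
    have e1 : (perpMat (D.c : K →+* K) x').map (incl K v)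
        = perpMat (locConj D.c v) (fun i => incl K v (x' i)) := by
      rw [perpMat, perpMat, locConj_incl, locConj_incl]
      refine Matrix.ext fun i j => ?_
      fin_cases i <;> fin_cases j <;> simp
    have e2 : (perpMatStar (D.c : K →+* K) x).map (incl K v)
        = perpMatStar (locConj D.c v) (fun i => incl K v (x i)) := by
      rw [perpMatStar, perpMatStar, locConj_incl, locConj_incl]
      refine Matrix.ext fun i j => ?_
      fin_cases i <;> fin_cases j <;> simp
    have e3 : (!![1, 0; 0, η] : Matrix (Fin 2) (Fin 2) K).map (incl K v)
        = !![1, 0; 0, incl K v η] := by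
      refine Matrix.ext fun i j => ?_
      fin_cases i <;> fin_cases j <;> simp
    rw [hG₀, e0, Matrix.map_mul, Matrix.map_mul, e1, e2, e3]
  have hcast : algebraMap F (LocK K v) ((d * d' * N : 𝓞 F) : F)
      = incl K v (algebraMap F K d) * incl K v (algebraMap F K d') * (N : LocK K v) := by
    have h1 : ((d * d' * N : 𝓞 F) : F) = (d : F) * (d' : F) * (N : F) := by
      push_cast
      rfl
    rw [h1, map_mul, map_mul, map_natCast, (incl K v).commutes, (incl K v).commutes]
  have key := transport_congr (c := locConj D.c v) (B := locInt K v) (D.locConj_locConj v)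
    (fun x hx => locConj_mem hx) (g⁻¹ v) (g'⁻¹ v) (x := fun i => incl K v (x i))
    (x' := fun i => incl K v (x' i)) (e := incl K v e) (e' := incl K v e')
    (d := incl K v (algebraMap F K d)) (d₁ := incl K v d₁) (d' := incl K v (algebraMap F K d'))
    (d'₁ := incl K v (algebraMap F K d')⁻¹) (N := (N : LocK K v)) (η := incl K v η)
    ((hform x).trans (by rw [hx])) (by rw [locConj_incl, ← map_mul, he])
    (by rw [locConj_incl, ← map_mul, he']) (by rw [← map_mul, hdd, map_one])
    (by rw [← map_mul, mul_inv_cancel₀ hdK', map_one])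
    (by rw [← map_mul, hη, div_mul_cancel₀ _ he0']) (map_natCast _ _) (hy v)
    (by rw [hdet]; exact hf v) (hy' v)
    (fun i => by
      obtain ⟨z, hz, h⟩ := mem_locMul.mp (hyy v i)
      exact ⟨z, hz, by rw [h, hcast]⟩)
    (by
      obtain ⟨z, hz, h⟩ := mem_locMul.mp (hff v)
      refine ⟨z, hz, ?_⟩
      rw [hdet, hdet, h, hcast]) i j
  obtain ⟨z, hz, h⟩ := key
  refine mem_locMul_nat.mpr ⟨z, hz, ?_⟩
  rw [← h, ← hmap]
  have hval : ((g'⁻¹ * D.ofRational γ * g) v).1.1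
      = (g'⁻¹ v).1.1 * G₀.map (incl K v) * (g v).1.1 := rfl
  have hinv : ((g⁻¹ v).1.1.map (locConj D.c v))ᵀ = (g v).1.1 := by
    have h1 := unitary2_inv (locConj D.c v) (g⁻¹ v)
    rw [← h1]
    have : (g⁻¹ v)⁻¹ = g v := inv_inv (g v)
    exact congrArg (fun u : G1loc D.c v => u.1.1) this
  rw [hval, hinv]

/-- The scalar matrix `det(g)⁻¹`. -/
def detInv (g : D.G) : D.G :=
  ⟨fun v => ⟨Units.map (Matrix.scalar (Fin 2)).toMonoidHom (Matrix.GeneralLinearGroup.det (g v).1)⁻¹,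
      by
    have h : (g⁻¹ v).1.1.det * locConj D.c v (g⁻¹ v).1.1.det = 1 := unitary2_det (g⁻¹ v)
    have e : ((Matrix.GeneralLinearGroup.det (g v).1)⁻¹).1 = (g⁻¹ v).1.1.det := by
      rw [← map_inv]; rfl
    change Matrix.scalar (Fin 2) ((Matrix.GeneralLinearGroup.det (g v).1)⁻¹).1
      * ((Matrix.scalar (Fin 2) ((Matrix.GeneralLinearGroup.det (g v).1)⁻¹).1).map
        (locConj D.c v))ᵀ = 1
    rw [e]
    have e2 : ∀ a : LocK K v, ((Matrix.scalar (Fin 2) a).map (locConj D.c v))ᵀ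
        = Matrix.scalar (Fin 2) (locConj D.c v a) := by
      intro a
      rw [Matrix.scalar_apply, Matrix.scalar_apply, Matrix.diagonal_map (map_zero _),
        Matrix.diagonal_transpose]
    rw [e2, ← map_mul, h, map_one]⟩, by
    have hg : ∀ᶠ v in Filter.cofinite, (g⁻¹ v) ∈ K0loc D.c v := (g⁻¹).2
    refine hg.mono fun v hv => mem_K0loc_of fun i j => ?_
    have e : ((Matrix.GeneralLinearGroup.det (g v).1)⁻¹).1 = (g⁻¹ v).1.1.det := by
      rw [← map_inv]; rfl
    change Matrix.scalar (Fin 2) ((Matrix.GeneralLinearGroup.det (g v).1)⁻¹).1 i j ∈ _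
    rw [e, Matrix.scalar_apply, Matrix.diagonal_apply]
    split_ifs
    · rw [Matrix.det_fin_two]
      exact sub_mem (mul_mem (coe_mem_locInt hv _ _) (coe_mem_locInt hv _ _))
        (mul_mem (coe_mem_locInt hv _ _) (coe_mem_locInt hv _ _))
    · exact zero_mem _⟩

theorem detInv_inv_mulVec (g : D.G) (v : HeightOneSpectrum (𝓞 F)) (x : Fin 2 → LocK K v)
    (i : Fin 2) : (((D.detInv g)⁻¹ v).1.1 *ᵥ x) i = (g v).1.1.det * x i := by
  have h : ((D.detInv g)⁻¹ v).1.1 = Matrix.scalar (Fin 2) (g v).1.1.det := by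
    have : ((D.detInv g)⁻¹ v).1 = Units.map (Matrix.scalar (Fin 2)).toMonoidHom
        (Matrix.GeneralLinearGroup.det (g v).1) := by
      change (Units.map (Matrix.scalar (Fin 2)).toMonoidHom
        (Matrix.GeneralLinearGroup.det (g v).1)⁻¹)⁻¹ = _
      rw [← map_inv, inv_inv]
    exact congrArg Units.val this
  rw [h, Matrix.scalar_apply, Matrix.mulVec_diagonal]

variable [NumberField.IsTotallyReal F] [NumberField.IsTotallyComplex K]

/-- The invariants of adelic points lie in a finite set. -/
theorem exists_invariants : ∃ S : Finset (𝓞 F), (∀ d ∈ S, d ≠ 0) ∧ ∀ g : D.G,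
    ∃ (x : Fin 2 → K) (d : 𝓞 F) (e : K) (d' : 𝓞 F), d ∈ S ∧ d' ∈ S ∧
      D.hermForm x = algebraMap F K d ∧ e * D.c e = algebraMap F K d' ∧
      (∀ v i, ((g⁻¹ v).1.1 *ᵥ fun i => incl K v (x i)) i ∈ locInt K v) ∧
      ∀ v, (g v).1.1.det * incl K v e ∈ locInt K v := by
  set C := ∑ ψ : K →+* ℂ, ∑ j, ‖ψ (NumberField.RingOfIntegers.basis K j : K)‖ with hC
  have hcc := conj_conj D.finrank_eq D.c
  have hC0 : 0 ≤ C := Finset.sum_nonneg fun _ _ => Finset.sum_nonneg fun _ _ => norm_nonneg _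
  -- Algebraic integers with bounded conjugates form a finite set. Both invariants, a sum of two
  -- squared absolute values and a single one, satisfy the bound `2 C²`.
  have hfin : {d : 𝓞 F | d ≠ 0 ∧ ∀ ψ : K →+* ℂ, ‖ψ (algebraMap F K d)‖ ≤ 2 * C ^ 2}.Finite := by
    have h1 := NumberField.Embeddings.finite_of_norm_le K ℂ (2 * C ^ 2)
    refine Set.Finite.of_finite_image (f := fun d : 𝓞 F => algebraMap F K d) (h1.subset ?_) ?_
    · rintro _ ⟨d, hd, rfl⟩
      exact ⟨d.2.map (Algebra.ofId F K |>.restrictScalars ℤ), hd.2⟩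
    · intro a _ b _ h
      exact NumberField.RingOfIntegers.coe_injective ((algebraMap F K).injective h)
  have hshort : ∀ g : D.G, ∃ x : Fin 2 → K, x ≠ 0 ∧
      (∀ v i, ((g⁻¹ v).1.1 *ᵥ fun i => incl K v (x i)) i ∈ locInt K v) ∧
      ∀ i (ψ : K →+* ℂ), ‖ψ (x i)‖ ≤ C := by
    intro g
    obtain ⟨x, hx0, hx, hxC⟩ := D.exists_short_vector_aux g (fun v => (g⁻¹ v).1.1)
      (fun v => by
        have : (g⁻¹ v) * g v = 1 := inv_mul_cancel (g v)
        exact congrArg (fun u : G1loc D.c v => u.1.1) this)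
      (fun v i j => congrFun (congrFun (unitary2_inv (locConj D.c v) (g v)) i) j)
    refine ⟨x, hx0, fun v i => ?_, hxC⟩
    simpa only [Matrix.mulVec, dotProduct, Fin.sum_univ_two] using hx v i
  have hpos : ∀ (ψ : K →+* ℂ) (y : K), ψ (y * D.c y) = ((‖ψ y‖ ^ 2 : ℝ) : ℂ) := by
    intro ψ y
    rw [map_mul, embedding_conj D.finrank_eq D.c_ne_one, Complex.mul_conj, Complex.normSq_eq_norm_sq]
  obtain ⟨ψ₀⟩ : Nonempty (K →+* ℂ) := inferInstance
  refine ⟨hfin.toFinset, fun d hd => ((Set.Finite.mem_toFinset _).mp hd).1, fun g => ?_⟩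
  obtain ⟨x, hx0, hx, hxC⟩ := hshort g
  -- Unitary scalar matrices are adelic points too. A nonzero coordinate of a short vector for the
  -- scalar `det(g)⁻¹` is a bounded element `e` of `K` with `det(g) e` integral everywhere.
  obtain ⟨z, hz0, hz, hzC⟩ := hshort (D.detInv g)
  obtain ⟨i₀, hi₀⟩ : ∃ i, z i ≠ 0 := by
    by_contra h
    push Not at h
    exact hz0 (funext h)
  have hf : ∀ v, (g v).1.1.det * incl K v (z i₀) ∈ locInt K v := by
    intro v
    have := hz v i₀
    rwa [detInv_inv_mulVec] at this
  have hsq : ∀ (y : K) (ψ : K →+* ℂ), ‖ψ y‖ ≤ C → ‖ψ y‖ ^ 2 ≤ C ^ 2 := fun y ψ h =>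
    pow_le_pow_left₀ (norm_nonneg _) h 2
  obtain ⟨d, hd⟩ := exists_ringOfIntegers_of_forall_mem_locInt D.finrank_eq D.c_ne_one
    (w := D.hermForm x) (by
      rw [hermForm]
      simp only [map_add, map_mul, hcc]
      ring) (fun v => by
      have h1 := unitary2_norm (g⁻¹ v) (fun i => incl K v (x i))
      have h2 : incl K v (D.hermForm x) = incl K v (x 0) * locConj D.c v (incl K v (x 0))
          + incl K v (x 1) * locConj D.c v (incl K v (x 1)) := by
        rw [locConj_incl, locConj_incl, hermForm, map_add, map_mul, map_mul]
      rw [h2, ← h1]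
      exact add_mem (mul_mem (hx v 0) (locConj_mem (hx v 0)))
        (mul_mem (hx v 1) (locConj_mem (hx v 1))))
  obtain ⟨d', hd'⟩ := exists_ringOfIntegers_of_forall_mem_locInt D.finrank_eq D.c_ne_one
    (w := z i₀ * D.c (z i₀)) (by rw [map_mul, hcc, mul_comm]) (fun v => by
      have h1 := mul_mem (hf v) (locConj_mem (c := D.c) (hf v))
      have h2 : (g v).1.1.det * locConj D.c v (g v).1.1.det = 1 := unitary2_det (g v)
      rw [map_mul, locConj_incl] at h1
      rw [map_mul]
      have h3 : incl K v (z i₀) * incl K v (D.c (z i₀))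
          = (g v).1.1.det * incl K v (z i₀)
            * (locConj D.c v (g v).1.1.det * incl K v (D.c (z i₀))) := by
        linear_combination -(incl K v (z i₀) * incl K v (D.c (z i₀))) * h2
      rw [h3]
      exact h1)
  have hψform : ∀ ψ : K →+* ℂ, ψ (D.hermForm x) = ((‖ψ (x 0)‖ ^ 2 + ‖ψ (x 1)‖ ^ 2 : ℝ) : ℂ) := by
    intro ψ
    rw [hermForm, map_add, hpos, hpos]
    push_cast
    rfl
  refine ⟨x, d, z i₀, d', ?_, ?_, hd.symm, hd'.symm, hx, hf⟩
  · refine (Set.Finite.mem_toFinset _).mpr ⟨?_, fun ψ => ?_⟩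
    · rintro rfl
      refine hx0 (funext fun i => ?_)
      have h1 := hψform ψ₀
      rw [← hd] at h1
      simp only [NumberField.RingOfIntegers.coe_eq_algebraMap, map_zero] at h1
      have h2 : ‖ψ₀ (x 0)‖ ^ 2 + ‖ψ₀ (x 1)‖ ^ 2 = 0 := by exact_mod_cast h1.symm
      have h4 : ∀ i, ‖ψ₀ (x i)‖ ^ 2 = 0 := by
        have := sq_nonneg ‖ψ₀ (x 1)‖
        have := sq_nonneg ‖ψ₀ (x 0)‖
        rw [Fin.forall_fin_two]
        constructor <;> linarith
      have h3 : ‖ψ₀ (x i)‖ = 0 := (pow_eq_zero_iff two_ne_zero).mp (h4 i)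
      rw [norm_eq_zero, map_eq_zero] at h3
      exact h3
    · rw [hd, hψform, Complex.norm_real, Real.norm_of_nonneg (by positivity)]
      have := hsq _ ψ (hxC 0 ψ)
      have := hsq _ ψ (hxC 1 ψ)
      linarith
  · refine (Set.Finite.mem_toFinset _).mpr ⟨?_, fun ψ => ?_⟩
    · rintro rfl
      rw [NumberField.RingOfIntegers.coe_eq_algebraMap, map_zero, map_zero] at hd'
      rcases mul_eq_zero.mp hd'.symm with h | h
      · exact hi₀ h
      · exact hi₀ (by simpa using h)
    · rw [hd', hpos, Complex.norm_real, Real.norm_of_nonneg (by positivity)]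
      have := hsq _ ψ (hzC i₀ ψ)
      have := sq_nonneg C
      linarith

/-- Finiteness of the double coset space for open subgroups. -/
theorem finite_quotient_of_principal (N : ℕ) (hN : 0 < N) (H : Subgroup D.G)
    (hH : ∀ u : D.G, (∀ v i j, (u v).1.1 i j - (1 : Matrix _ _ (LocK K v)) i j
      ∈ locMul K v (N : F)) → u ∈ H) :
    Finite (DoubleCoset.Quotient (D.rational : Set D.G) (H : Set D.G)) := by
  classical
  obtain ⟨S, hS0, hS⟩ := D.exists_invariants
  choose x d e d' hdS hdS' hx he hy hf using hS
  -- A common multiple of all moduli `d d' N` with `d, d' ∈ S`. One modulus then serves all points,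
  -- and the residues lie in one finite ring.
  set m : 𝓞 F := (∏ s ∈ S, s) * (∏ s ∈ S, s) * N with hm
  have hN' : (N : 𝓞 F) ≠ 0 := by exact_mod_cast hN.ne'
  have hprod : (∏ s ∈ S, s) ≠ 0 := Finset.prod_ne_zero_iff.mpr hS0
  have hm0 : m ≠ 0 := mul_ne_zero (mul_ne_zero hprod hprod) hN'
  choose a ha using fun (g : D.G) (i : Fin 2) => exists_approx_locInt
    (fun v => ((g⁻¹ v).1.1 *ᵥ fun i => incl K v (x g i)) i) (fun v => hy g v i) hm0
  choose b hb using fun (g : D.G) => exists_approx_locInt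
    (fun v => (g v).1.1.det * incl K v (e g)) (hf g) hm0
  set J : Ideal (𝓞 K) := Ideal.span {algebraMap (𝓞 F) (𝓞 K) m} with hJ
  have hJ0 : J ≠ ⊥ := by
    rw [hJ, Ne, Ideal.span_singleton_eq_bot]
    exact (map_ne_zero_iff _ (FaithfulSMul.algebraMap_injective (𝓞 F) (𝓞 K))).mpr hm0
  have hJfin : Finite (𝓞 K ⧸ J) := Ideal.finiteQuotientOfFreeOfNeBot _ hJ0
  have hJv : ∀ (v : HeightOneSpectrum (𝓞 F)) (t : 𝓞 K), t ∈ J →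
      incl K v (t : K) ∈ locMul K v (m : F) := by
    intro v t ht
    obtain ⟨r, rfl⟩ := Ideal.mem_span_singleton.mp ht
    refine mem_locMul.mpr ⟨_, incl_mem v r, ?_⟩
    rw [← (incl K v).commutes, ← map_mul]
    rfl
  set inv : DoubleCoset.Quotient (D.rational : Set D.G) (H : Set D.G) →
      S × S × (Fin 2 → 𝓞 K ⧸ J) × (𝓞 K ⧸ J) := fun q =>
    (⟨d q.out, hdS _⟩, ⟨d' q.out, hdS' _⟩, fun i => Ideal.Quotient.mk J (a q.out i),
      Ideal.Quotient.mk J (b q.out)) with hinv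
  refine Finite.of_injective inv fun q q' h => ?_
  simp only [hinv, Prod.mk.injEq, Subtype.mk.injEq] at h
  obtain ⟨h1, h2, h3, h4⟩ := h
  set g := q.out
  set g' := q'.out
  have hdvd : (d g * d' g * N : 𝓞 F) ∣ m :=
    mul_dvd_mul (mul_dvd_mul (Finset.dvd_prod_of_mem _ (hdS g))
      (Finset.dvd_prod_of_mem _ (hdS' g))) dvd_rfl
  obtain ⟨γ, hγ, hu⟩ := D.exists_rational_of_congr g g' (x g) (x g') (e g) (e g') (d g) (d' g)
    (hS0 _ (hdS g)) (hS0 _ (hdS' g)) N (hx g) (by rw [hx g', h1]) (he g) (by rw [he g', h2])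
    (hy g) (hy g') (hf g) (fun v i => locMul_anti hdvd (by
      have h5 := Ideal.Quotient.eq.mp (congrFun h3 i)
      have h6 := hJv v _ h5
      push_cast at h6
      rw [map_sub] at h6
      have h7 := sub_mem (sub_mem (ha g' i v) (ha g i v)) h6
      convert h7 using 1
      ring)) (fun v => locMul_anti hdvd (by
      have h6 := hJv v _ (Ideal.Quotient.eq.mp h4)
      push_cast at h6
      rw [map_sub] at h6
      have h7 := sub_mem (sub_mem (hb g' v) (hb g v)) h6
      convert h7 using 1
      ring))
  have h5 := hH _ hu
  rw [← DoubleCoset.out_eq' D.rational H q, ← DoubleCoset.out_eq' D.rational H q',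
    DoubleCoset.eq]
  refine ⟨γ, hγ, (g'⁻¹ * γ * g)⁻¹, inv_mem h5, ?_⟩
  change g' = γ * g * (g'⁻¹ * γ * g)⁻¹
  group

theorem dvd_absNorm_cast (I : Ideal (𝓞 F)) {N : ℕ} (h : Ideal.absNorm I ∣ N) : (N : 𝓞 F) ∈ I := by
  obtain ⟨k, rfl⟩ := h
  push_cast
  exact I.mul_mem_right _ (Ideal.absNorm_mem I)

theorem entries_of_principal {v : HeightOneSpectrum (𝓞 F)} (ι : K →ₐ[F] v.adicCompletion F)
    {g : G1loc D.c v} {N : ℕ} (hg : ∀ i j, g.1.1 i j - (1 : Matrix _ _ (LocK K v)) i j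
      ∈ locMul K v (N : F)) :
    ∃ A : GL (Fin 2) (v.adicCompletionIntegers F), intGL v A = iw D.c ι g ∧
      ∀ i j, (N : v.adicCompletionIntegers F)
        ∣ A.1 i j - (1 : Matrix _ _ (v.adicCompletionIntegers F)) i j := by
  have hK : g ∈ K0loc D.c v := mem_K0loc_of fun i j => by
    have h1 := locMul_le ((N : 𝓞 F)) (x := g.1.1 i j - (1 : Matrix _ _ (LocK K v)) i j) (by
      have h2 := hg i j
      have h3 : (((N : 𝓞 F)) : F) = (N : F) := by push_cast; rfl
      rw [h3]
      exact h2)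
    have h2 : (1 : Matrix (Fin 2) (Fin 2) (LocK K v)) i j ∈ locInt K v := by
      rw [Matrix.one_apply]
      split_ifs
      · exact one_mem _
      · exact zero_mem _
    have := add_mem h1 h2
    rwa [sub_add_cancel] at this
  obtain ⟨A, hA⟩ := (mem_K0loc_iff_iw D.finrank_eq D.c_ne_one ι g).mp hK
  refine ⟨A, hA, fun i j => ?_⟩
  obtain ⟨z, hz, h⟩ := mem_locMul_nat.mp (hg i j)
  refine ⟨⟨_, splitHom_mem ι hz⟩, Subtype.ext ?_⟩
  have h1 : ((A.1 i j : v.adicCompletionIntegers F) : v.adicCompletion F)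
      = splitHom ι (g.1.1 i j) := congrArg (fun B : GL (Fin 2) (v.adicCompletion F) => B.1 i j) hA
  have h2 := congrArg (splitHom ι) h
  rw [map_sub, map_mul, map_natCast, ← h1] at h2
  have h3 : splitHom ι ((1 : Matrix (Fin 2) (Fin 2) (LocK K v)) i j)
      = (((1 : Matrix (Fin 2) (Fin 2) (v.adicCompletionIntegers F)) i j :
        v.adicCompletionIntegers F) : v.adicCompletion F) := by
    rw [Matrix.one_apply, Matrix.one_apply]
    split_ifs
    · exact map_one _
    · exact map_zero _
  rw [h3] at h2
  exact h2

/-- Finiteness of the double coset spaces of the groups between `K₁ⁿ` and `G₁(𝔸)`. -/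
theorem finite_quotient (n : ℕ) (H : Subgroup D.G) (hH : D.K1 n ≤ H) :
    Finite (DoubleCoset.Quotient (D.rational : Set D.G) (H : Set D.G)) := by
  classical
  choose r hr0 hr using D.Kv_open
  -- A multiple of `pⁿ`, an element of `𝔰`, and a multiple of `r v` at each of the finitely many `v`
  -- where `K_v` differs from `K_v⁰`. At the other places integrality of the entries suffices.
  set N : ℕ := p ^ n * Ideal.absNorm D.s
    * ∏ v ∈ D.Kv_almost.toFinset, Ideal.absNorm (Ideal.span {r v}) with hN
  have hN0 : 0 < N := by
    refine Nat.mul_pos (Nat.mul_pos (pow_pos D.prime.pos n) (Nat.pos_of_ne_zero fun h => D.s_ne_bot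
      (Ideal.absNorm_eq_zero_iff.mp h))) (Finset.prod_pos fun v _ => Nat.pos_of_ne_zero fun h => ?_)
    have := Ideal.absNorm_eq_zero_iff.mp h
    rw [Ideal.span_singleton_eq_bot] at this
    exact hr0 v this
  have hNv : ∀ v : HeightOneSpectrum (𝓞 F), ((N : 𝓞 F) : F) = (N : F) := fun _ => by
    push_cast; rfl
  refine D.finite_quotient_of_principal N hN0 H fun u hu => hH (D.mem_K1_iff.mpr ⟨?_, ?_, ?_⟩)
  · intro v _ _
    by_cases hv : D.Kv v = K0loc D.c v
    · rw [hv]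
      refine mem_K0loc_of fun i j => ?_
      have h1 := locMul_le ((N : 𝓞 F)) (x := (u v).1.1 i j - (1 : Matrix _ _ (LocK K v)) i j)
        (by rw [hNv v]; exact hu v i j)
      have h2 : (1 : Matrix (Fin 2) (Fin 2) (LocK K v)) i j ∈ locInt K v := by
        rw [Matrix.one_apply]
        split_ifs
        · exact one_mem _
        · exact zero_mem _
      have := add_mem h1 h2
      rwa [sub_add_cancel] at this
    · refine hr v (u v) fun i j => ?_
      have hrN : r v ∣ (N : 𝓞 F) := by
        rw [← Ideal.mem_span_singleton]
        refine dvd_absNorm_cast _ ((Finset.dvd_prod_of_mem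
          (fun v => Ideal.absNorm (Ideal.span {r v})) ?_).trans (dvd_mul_left _ _))
        simpa using hv
      obtain ⟨y, hy, h⟩ := mem_locMul.mp (locMul_anti hrN (x := (u v).1.1 i j
        - (1 : Matrix _ _ (LocK K v)) i j) (by rw [hNv v]; exact hu v i j))
      exact ⟨y, hy, h⟩
  · intro v
    obtain ⟨A, hA, h⟩ := D.entries_of_principal (D.wp v) (hu v.1)
    have hpN : ∀ x : v.1.adicCompletionIntegers F, (N : v.1.adicCompletionIntegers F) ∣ x →
        x ∈ D.pIdeal n v := by
      intro x hx
      refine D.mem_pIdeal_iff.mpr (dvd_trans ?_ hx)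
      rw [hN]
      push_cast
      rw [mul_assoc]
      exact dvd_mul_right _ _
    refine ⟨A, ⟨?_, ?_⟩, hA⟩
    · simpa using hpN _ (h 0 0)
    · simpa using hpN _ (h 1 0)
  · intro v
    obtain ⟨A, hA, h⟩ := D.entries_of_principal (D.ws v) (hu v.1)
    have hsN : ∀ x : v.1.adicCompletionIntegers F, (N : v.1.adicCompletionIntegers F) ∣ x →
        x ∈ locIdeal v.1 D.s := by
      rintro _ ⟨y, rfl⟩
      refine Ideal.mul_mem_right _ _ ?_
      have h1 : (N : 𝓞 F) ∈ D.s := dvd_absNorm_cast _ (by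
        rw [hN, mul_assoc]
        exact (dvd_mul_right _ _).trans (dvd_mul_left _ _))
      have h2 := Ideal.mem_map_of_mem (algebraMap (𝓞 F) (v.1.adicCompletionIntegers F)) h1
      rwa [map_natCast] at h2
    refine ⟨A, ⟨?_, ?_⟩, hA⟩
    · simpa using hsN _ (h 0 0)
    · simpa using hsN _ (h 1 0)

end Datum

end ClassNumber

end

end HidaU2

namespace HidaU2

noncomputable section

/-! ### Sums over double cosets -/

section CosetSum

variable {G A : Type*} [Group G] [AddCommMonoid A] {Γ H : Subgroup G}

/-- The sum of a function over representatives of a double coset space. -/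
def cosetSum (Γ H : Subgroup G) (Ψ : G → A) : A :=
  ∑ᶠ q : DoubleCoset.Quotient (Γ : Set G) (H : Set G), Ψ (Quotient.out q)

/-- Functions on a double coset space. -/
def BiInv (Γ H : Subgroup G) (Ψ : G → A) : Prop := ∀ γ ∈ Γ, ∀ g, ∀ h ∈ H, Ψ (γ * g * h) = Ψ g

theorem BiInv.out_mk {Ψ : G → A} (hΨ : BiInv Γ H Ψ) (g : G) :
    Ψ (Quotient.out (DoubleCoset.mk Γ H g)) = Ψ g := by
  obtain ⟨γ, h, hγ, hh, e⟩ := DoubleCoset.mk_out_eq_mul Γ H g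
  rw [e]
  exact hΨ γ hγ g h hh

/-- The maps `σ` and `σ'` descend to mutually inverse permutations of the double coset space, and
the sum is reindexed along them. -/
theorem cosetSum_comp {Ψ : G → A} (hΨ : BiInv Γ H Ψ) (σ σ' : G → G) (hσσ' : ∀ g, σ (σ' g) = g)
    (hσ'σ : ∀ g, σ' (σ g) = g)
    (hσ : ∀ γ ∈ Γ, ∀ g, ∀ h ∈ H, ∃ γ' ∈ Γ, ∃ h' ∈ H, σ (γ * g * h) = γ' * σ g * h')
    (hσ' : ∀ γ ∈ Γ, ∀ g, ∀ h ∈ H, ∃ γ' ∈ Γ, ∃ h' ∈ H, σ' (γ * g * h) = γ' * σ' g * h') :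
    cosetSum Γ H (fun g => Ψ (σ g)) = cosetSum Γ H Ψ := by
  have key : ∀ τ : G → G,
      (∀ γ ∈ Γ, ∀ g, ∀ h ∈ H, ∃ γ' ∈ Γ, ∃ h' ∈ H, τ (γ * g * h) = γ' * τ g * h') →
      ∀ g, DoubleCoset.mk Γ H (τ (Quotient.out (DoubleCoset.mk Γ H g)))
        = DoubleCoset.mk Γ H (τ g) := by
    intro τ hτ g
    obtain ⟨γ, h, hγ, hh, e⟩ := DoubleCoset.mk_out_eq_mul Γ H g
    rw [e]
    obtain ⟨γ', hγ', h', hh', e'⟩ := hτ γ hγ g h hh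
    exact ((DoubleCoset.eq Γ H _ _).mpr ⟨γ', hγ', h', hh', e'⟩).symm
  let e : DoubleCoset.Quotient (Γ : Set G) (H : Set G)
      ≃ DoubleCoset.Quotient (Γ : Set G) (H : Set G) :=
    { toFun := fun q => DoubleCoset.mk Γ H (σ (Quotient.out q))
      invFun := fun q => DoubleCoset.mk Γ H (σ' (Quotient.out q))
      left_inv := fun q => by
        change DoubleCoset.mk Γ H (σ' (Quotient.out (DoubleCoset.mk Γ H (σ (Quotient.out q))))) = q
        rw [key σ' hσ', hσ'σ]
        exact DoubleCoset.out_eq' Γ H q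
      right_inv := fun q => by
        change DoubleCoset.mk Γ H (σ (Quotient.out (DoubleCoset.mk Γ H (σ' (Quotient.out q))))) = q
        rw [key σ hσ, hσσ']
        exact DoubleCoset.out_eq' Γ H q }
  have h1 : ∀ q : DoubleCoset.Quotient (Γ : Set G) (H : Set G), Ψ (σ (Quotient.out q)) = Ψ (Quotient.out (e q)) := fun q => (hΨ.out_mk _).symm
  rw [cosetSum, cosetSum, finsum_congr h1]
  exact finsum_comp_equiv e (f := fun q => Ψ (Quotient.out q))

/-- Decomposition of a sum over `Γ \ G / H'` along the projection to `Γ \ G / H` for a free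
action of `Γ` on `G / H`. -/
theorem cosetSum_eq_of_reps {H' : Subgroup G} (hH : H' ≤ H)
    (hfree : ∀ t : G, ∀ γ ∈ Γ, t⁻¹ * γ * t ∈ H → γ = 1)
    [Finite (DoubleCoset.Quotient (Γ : Set G) (H : Set G))] {I : Type*} [Fintype I] (u : I → G)
    (hu : ∀ i, u i ∈ H) (hex : ∀ h ∈ H, ∃ i, (u i)⁻¹ * h ∈ H')
    (huniq : ∀ i j, (u i)⁻¹ * u j ∈ H' → i = j) {Ψ : G → A} (hΨ : BiInv Γ H' Ψ) :
    cosetSum Γ H' Ψ = cosetSum Γ H (fun g => ∑ i, Ψ (g * u i)) := by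
  classical
  have : Fintype (DoubleCoset.Quotient (Γ : Set G) (H : Set G)) := Fintype.ofFinite _
  let e : DoubleCoset.Quotient (Γ : Set G) (H : Set G) × I →
      DoubleCoset.Quotient (Γ : Set G) (H' : Set G) := fun x =>
    DoubleCoset.mk Γ H' (Quotient.out x.1 * u x.2)
  have he : Function.Bijective e := by
    constructor
    · rintro ⟨q, i⟩ ⟨r, j⟩ h
      obtain ⟨γ, hγ, h', hh', e1⟩ := (DoubleCoset.eq Γ H' _ _).mp h
      have hqr : q = r := by
        rw [← DoubleCoset.out_eq' Γ H q, ← DoubleCoset.out_eq' Γ H r, DoubleCoset.eq]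
        refine ⟨γ, hγ, u i * h' * (u j)⁻¹, mul_mem (mul_mem (hu i) (hH hh')) (inv_mem (hu j)), ?_⟩
        change Quotient.out r = γ * Quotient.out q * _
        have : Quotient.out r = γ * (Quotient.out q * u i) * h' * (u j)⁻¹ := by
          rw [← e1]; group
        rw [this]; group
      subst hqr
      set t := Quotient.out q
      -- Here `t⁻¹ γ t` lies in `H`. Freeness of the action ensures that distinct representatives
      -- give distinct double cosets.
      have hγ1 : γ = 1 := by
        refine hfree t γ hγ ?_
        have h2 : t⁻¹ * γ * t = u j * h'⁻¹ * (u i)⁻¹ := by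
          have e2 : t * u j = γ * (t * u i) * h' := e1
          have e3 : γ = t * u j * h'⁻¹ * (t * u i)⁻¹ := by rw [e2]; group
          rw [e3]; group
        rw [h2]
        exact mul_mem (mul_mem (hu j) (inv_mem (hH hh'))) (inv_mem (hu i))
      subst hγ1
      have e2 : t * u j = 1 * (t * u i) * h' := e1
      rw [one_mul, mul_assoc, mul_right_inj] at e2
      have := huniq i j (by rw [e2, inv_mul_cancel_left]; exact hh')
      rw [this]
    · intro q'
      set g := Quotient.out q' with hg
      obtain ⟨γ, h, hγ, hh, e1⟩ := DoubleCoset.mk_out_eq_mul Γ H g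
      obtain ⟨i, hi⟩ := hex h⁻¹ (inv_mem hh)
      refine ⟨(DoubleCoset.mk Γ H g, i), ?_⟩
      rw [← DoubleCoset.out_eq' Γ H' q']
      refine (DoubleCoset.eq Γ H' _ _).mpr ⟨γ⁻¹, inv_mem hγ, (u i)⁻¹ * h⁻¹, hi, ?_⟩
      change g = γ⁻¹ * (Quotient.out (DoubleCoset.mk Γ H g) * u i) * _
      rw [show Quotient.out (DoubleCoset.mk Γ H g) = γ * g * h from e1]
      group
  have h1 : ∀ x, Ψ (Quotient.out (e x)) = Ψ (Quotient.out x.1 * u x.2) := fun x => hΨ.out_mk _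
  rw [cosetSum, ← finsum_comp_equiv (Equiv.ofBijective e he), cosetSum,
    finsum_eq_sum_of_fintype, finsum_eq_sum_of_fintype, Fintype.sum_prod_type]
  exact Finset.sum_congr rfl fun q _ => Finset.sum_congr rfl fun i _ => h1 (q, i)

theorem cosetSum_congr {Ψ Ψ' : G → A} (h : ∀ g, Ψ g = Ψ' g) : cosetSum Γ H Ψ = cosetSum Γ H Ψ' :=
  congrArg _ (funext h)

theorem map_cosetSum [Finite (DoubleCoset.Quotient (Γ : Set G) (H : Set G))] {B F : Type*}
    [AddCommMonoid B] [FunLike F A B] [AddMonoidHomClass F A B] (f : F) (Ψ : G → A) :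
    f (cosetSum Γ H Ψ) = cosetSum Γ H (fun g => f (Ψ g)) :=
  (AddMonoidHomClass.toAddMonoidHom f).map_finsum (Set.toFinite _)

end CosetSum

/-! ### The involution `g ↦ ḡ τ_n` and the relation between levels `n` and `n + 1` -/

section Adelic

variable {F K : Type*} [Field F] [NumberField F] [NumberField.IsTotallyReal F]
  [Field K] [NumberField K] [NumberField.IsTotallyComplex K] [Algebra F K] {p : ℕ} (D : Datum F K p)

namespace Datum

theorem finite_K0 (n : ℕ) :
    Finite (DoubleCoset.Quotient (D.rational : Set D.G) (D.K0 n : Set D.G)) :=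
  D.finite_quotient n _ (D.K1_le_K0 n)

theorem finite_K00 (n : ℕ) :
    Finite (DoubleCoset.Quotient (D.rational : Set D.G) (D.K00 n : Set D.G)) :=
  D.finite_quotient n _ ((D.K1_le_K0 n).trans (D.K0_le_K00 n))

/-- The involution `g ↦ \bar g τ_n(𝔰)`. -/
def iota (n : ℕ) (g : D.G) : D.G := bar g * D.tau n

theorem iota_iota (n : ℕ) (g : D.G) : D.iota n (D.iota n g) = g := by
  rw [iota, iota, bar_mul, bar_bar, bar_tau, inv_mul_cancel_right]

theorem iota_mul (n : ℕ) (g u : D.G) : D.iota n (g * u) = D.iota n g * D.theta n u := by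
  rw [iota, iota, theta, bar_mul]
  group

theorem iota_rational_mul (n : ℕ) (γ g : D.G) : D.iota n (γ * g) = bar γ * D.iota n g := by
  rw [iota, iota, bar_mul, mul_assoc]

theorem cosetSum_iota {A : Type*} [AddCommMonoid A] {n : ℕ} {Ψ : D.G → A}
    (hΨ : BiInv D.rational (D.K0 n) Ψ) :
    cosetSum D.rational (D.K0 n) (fun g => Ψ (D.iota n g)) = cosetSum D.rational (D.K0 n) Ψ := by
  have h : ∀ γ ∈ D.rational, ∀ g, ∀ h ∈ D.K0 n, ∃ γ' ∈ D.rational, ∃ h' ∈ D.K0 n,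
      D.iota n (γ * g * h) = γ' * D.iota n g * h' := fun γ hγ g h hh =>
    ⟨bar γ, D.bar_mem_rational hγ, D.theta n h, D.theta_mem_K0 hh, by
      rw [iota_mul, iota_rational_mul]⟩
  exact cosetSum_comp hΨ _ _ (D.iota_iota n) (D.iota_iota n) h h

theorem cosetSum_scalarP {A : Type*} [AddCommMonoid A] {n : ℕ} {Ψ : D.G → A}
    (hΨ : BiInv D.rational (D.K0 n) Ψ) :
    cosetSum D.rational (D.K0 n) (fun g => Ψ (g * D.scalarP)) = cosetSum D.rational (D.K0 n) Ψ := by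
  have hc : ∀ h : D.G, h * D.scalarP⁻¹ = D.scalarP⁻¹ * h := fun h => by
    rw [eq_inv_mul_iff_mul_eq, ← mul_assoc, ← D.scalarP_comm, mul_inv_cancel_right]
  refine cosetSum_comp hΨ (fun g => g * D.scalarP) (fun g => g * D.scalarP⁻¹)
    (fun g => inv_mul_cancel_right _ _) (fun g => mul_inv_cancel_right _ _) ?_ ?_
  · intro γ hγ g h hh
    exact ⟨γ, hγ, h, hh, by rw [mul_assoc, D.scalarP_comm h]; simp only [mul_assoc]⟩
  · intro γ hγ g h hh
    exact ⟨γ, hγ, h, hh, by rw [mul_assoc, hc h]; simp only [mul_assoc]⟩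

/-- Decomposition of the sum defining a pairing at level `n + 1` by representatives of `𝓞_F / p`. -/
theorem cosetSum_succ (hD : D.SufficientlySmall) {A : Type*} [AddCommMonoid A] {n : ℕ} (hn : 1 ≤ n)
    [Fintype (𝓞 F ⧸ Ideal.span {(p : 𝓞 F)})]
    {Ψ : D.G → A} (hΨ : BiInv D.rational (D.K0 (n + 1)) Ψ) :
    cosetSum D.rational (D.K0 (n + 1)) Ψ = cosetSum D.rational (D.K0 n)
      (fun g => ∑ b : 𝓞 F ⧸ Ideal.span {(p : 𝓞 F)}, Ψ (g * D.low n (Quotient.out b))) := by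
  have := D.finite_K0 n
  have hK : D.K0 n ≤ D.levelCirc := (D.K0_le_K00 n).trans (D.K00_le_levelCirc n)
  refine cosetSum_eq_of_reps (D.K0_anti (Nat.le_succ n)) (fun t γ hγ ht => hD t γ hγ (hK ht))
    (fun b : 𝓞 F ⧸ Ideal.span {(p : 𝓞 F)} => D.low n (Quotient.out b))
    (fun b => D.K1_le_K0 n (D.low_mem_K1 n _)) ?_ ?_ hΨ
  · intro h hh
    obtain ⟨b, hb⟩ := D.exists_low_of_mem_K0 hn hh
    refine ⟨Ideal.Quotient.mk _ b, hb _ ?_⟩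
    rw [← Ideal.mem_span_singleton, ← Ideal.Quotient.eq]
    exact (Quotient.out_eq (Ideal.Quotient.mk (Ideal.span {(p : 𝓞 F)}) b)).symm
  · intro b b' h
    have := D.dvd_of_low_inv_mul_low_mem h
    rw [← Ideal.mem_span_singleton, ← Ideal.Quotient.eq] at this
    rw [← Quotient.out_eq b, ← Quotient.out_eq b']
    exact this

/-- The Hecke operator at `p` relates the pairings of levels `n` and `n + 1`. -/
theorem cosetSum_hecke (hD : D.SufficientlySmall) {R M₁ M A : Type*} [CommRing R]
    [AddCommGroup M] [Module R M] [AddCommMonoid A] {n : ℕ} (hn : 1 ≤ n)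
    (act : 𝓞 F → M →ₗ[R] M) (P P' : M₁ → M → A) (f₁ : D.G → M₁) (f₂ : D.G → M)
    (hPadd : ∀ x, ∃ f : M →+ A, ∀ y, P x y = f y)
    (hP : ∀ b g y, P (f₁ g) (act b y) = P' (f₁ (g * D.low n b)) y)
    (hinv : BiInv D.rational (D.K0 (n + 1)) fun g => P' (f₁ g) (f₂ (D.iota (n + 1) g))) :
    cosetSum D.rational (D.K0 n) (fun g => P (f₁ g) (D.hecke act f₂ (D.iota n g)))
      = cosetSum D.rational (D.K0 (n + 1)) (fun g => P' (f₁ g) (f₂ (D.iota (n + 1) g))) := by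
  have hfin : Finite (𝓞 F ⧸ Ideal.span {(p : 𝓞 F)}) :=
    Ideal.finiteQuotientOfFreeOfNeBot _ D.span_p_ne_bot
  letI := Fintype.ofFinite (𝓞 F ⧸ Ideal.span {(p : 𝓞 F)})
  rw [D.cosetSum_succ hD hn hinv]
  refine cosetSum_congr fun g => ?_
  obtain ⟨f, hf⟩ := hPadd (f₁ g)
  have h1 : D.hecke act f₂ (D.iota n g) = ∑ b : 𝓞 F ⧸ Ideal.span {(p : 𝓞 F)},
      act (Quotient.out b) (f₂ (D.iota n g * D.upper (Quotient.out b))) := rfl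
  rw [h1, hf, map_sum]
  refine Finset.sum_congr rfl fun b _ => ?_
  rw [← hf, hP]
  congr 2
  -- The translate of `ḡ τ_n` by `(p b; 0 1)` is the image of `g · low n b` under the involution of
  -- level `n + 1`.
  rw [iota, mul_assoc, tau_mul_upper, iota, bar_mul, mul_assoc]

end Datum

end Adelic

end

end HidaU2

namespace HidaU2

noncomputable section

/-! ### Scalar matrices, the group `Δ_𝔰` and the passage from `K₀ⁿ` to `K₀₀ⁿ` -/

section ScalarDecomposition

theorem scalar_inv_mul_mem_Gamma1 {A : Type*} [CommRing A] {J : Ideal A} {g : GL (Fin 2) A} {a : Aˣ}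
    (h0 : g.1 0 0 - a.1 ∈ J) (h1 : g.1 1 0 ∈ J) :
    (Units.map (Matrix.scalar (Fin 2)).toMonoidHom a)⁻¹ * g ∈ Gamma1 J := by
  have h : ∀ i, ((Units.map (Matrix.scalar (Fin 2)).toMonoidHom a)⁻¹ * g).1 i 0
      = (a⁻¹).1 * g.1 i 0 := by
    intro i
    rw [← map_inv]
    change (Matrix.scalar (Fin 2) (a⁻¹).1 * g.1) i 0 = _
    rw [Matrix.scalar_apply, Matrix.diagonal_mul]
  refine ⟨?_, ?_⟩
  · rw [h, show (a⁻¹).1 * g.1 0 0 - 1 = (a⁻¹).1 * (g.1 0 0 - a.1) by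
      rw [mul_sub, Units.inv_mul]]
    exact J.mul_mem_left _ h0
  · rw [h]
    exact J.mul_mem_left _ h1

variable {F K : Type*} [Field F] [NumberField F] [Field K] [NumberField K] [Algebra F K]
  {p : ℕ} (D : Datum F K p)

namespace Datum

variable (u : ∀ v : D.Sp, (v.1.adicCompletionIntegers F)ˣ)
  (t : ∀ v : D.Ss, (v.1.adicCompletionIntegers F)ˣ)

theorem scalar_inv_mul_apply_away (x : D.G) {v : HeightOneSpectrum (𝓞 F)}
    (hv : ¬ Ideal.span {(p : 𝓞 F)} ≤ v.asIdeal) (hv' : ¬ D.s ≤ v.asIdeal) :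
    ((D.scalar u t)⁻¹ * x) v = x v := by
  have h1 : D.scalar u t v = 1 := by
    have h2 : D.scalar u t v = D.placeP _ v * D.placeS _ v := rfl
    rw [h2, D.placeP_apply_of_not_le hv, D.placeS_apply_of_not_le hv', one_mul]
  have h3 : ((D.scalar u t)⁻¹ * x) v = (D.scalar u t v)⁻¹ * x v := rfl
  rw [h3, h1, inv_one, one_mul]

/-- Elements of `K₀₀ⁿ` are products of scalars and elements of `K₁ⁿ`. -/
theorem scalar_inv_mul_mem_K1 {n : ℕ} {x : D.G} (hx : x ∈ D.K00 n)
    (hp : ∀ v, ∀ A : GL (Fin 2) (v.1.adicCompletionIntegers F), intGL v.1 A = D.atP v x →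
      A.1 0 0 - (u v).1 ∈ D.pIdeal n v)
    (hs : ∀ v, ∀ A : GL (Fin 2) (v.1.adicCompletionIntegers F), intGL v.1 A = D.atS v x →
      A.1 0 0 - (t v).1 ∈ locIdeal v.1 D.s) : (D.scalar u t)⁻¹ * x ∈ D.K1 n := by
  obtain ⟨h1, h2, h3⟩ := hx
  refine D.mem_K1_iff.mpr ⟨fun v hv hv' => ?_, fun v => ?_, fun v => ?_⟩
  · rw [D.scalar_inv_mul_apply_away u t x hv hv']
    exact h1 v hv hv'
  · obtain ⟨A, hA, hA'⟩ := h2 v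
    refine ⟨_, scalar_inv_mul_mem_Gamma1 (hp v A hA') hA, ?_⟩
    rw [map_mul, map_inv, map_mul, map_inv, atP_scalar, hA']
  · obtain ⟨A, hA, hA'⟩ := h3 v
    refine ⟨_, scalar_inv_mul_mem_Gamma1 (hs v A hA') hA, ?_⟩
    rw [map_mul, map_inv, map_mul, map_inv, atS_scalar, hA']

theorem exists_scalar_of_mem_K00 {n : ℕ} (hn : 1 ≤ n) {x : D.G} (hx : x ∈ D.K00 n) :
    ∃ u t, (D.scalar u t)⁻¹ * x ∈ D.K1 n := by
  choose A hA hA' using hx.2.1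
  choose C hC hC' using hx.2.2
  have hu : ∀ v, IsUnit ((A v).1 0 0) := fun v =>
    (isUnit_of_det (A v) (D.p_pow_mem_maximalIdeal hn v (hA v))).1
  have ht : ∀ v, IsUnit ((C v).1 0 0) := fun v =>
    (isUnit_of_det (C v) (locIdeal_le_maximalIdeal v.2 (hC v))).1
  refine ⟨fun v => (hu v).unit, fun v => (ht v).unit, D.scalar_inv_mul_mem_K1 _ _ hx ?_ ?_⟩
  · intro v B hB
    rw [intGL_injective v.1 (hB.trans (hA' v).symm), IsUnit.unit_spec, sub_self]
    exact zero_mem _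
  · intro v B hB
    rw [intGL_injective v.1 (hB.trans (hC' v).symm), IsUnit.unit_spec, sub_self]
    exact zero_mem _

theorem exists_scalar_of_mem_K0 {n : ℕ} (hn : 1 ≤ n) {x : D.G} (hx : x ∈ D.K0 n) :
    ∃ u, (D.scalar u 1)⁻¹ * x ∈ D.K1 n := by
  obtain ⟨A, hA', hA⟩ := D.exists_intGL_of_mem_K0 hx
  have hu : ∀ v, IsUnit ((A v).1 0 0) := fun v =>
    (isUnit_of_det (A v) (D.p_pow_mem_maximalIdeal hn v (hA v))).1
  refine ⟨fun v => (hu v).unit, D.scalar_inv_mul_mem_K1 _ _ (D.K0_le_K00 n hx) ?_ ?_⟩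
  · intro v B hB
    rw [intGL_injective v.1 (hB.trans (hA' v).symm), IsUnit.unit_spec, sub_self]
    exact zero_mem _
  · intro v B hB
    obtain ⟨C, hC, hC'⟩ := (D.mem_K0_iff.mp hx).2.2 v
    rw [intGL_injective v.1 (hB.trans hC'.symm)]
    exact hC.1

theorem scalar_mem_K00 (n : ℕ) : D.scalar u t ∈ D.K00 n := by
  have h0 : ∀ {A : Type _} [CommRing A] (J : Ideal A) (a : Aˣ),
      Units.map (Matrix.scalar (Fin 2)).toMonoidHom a ∈ Gamma0 J := by
    intro A _ J a
    change (Matrix.scalar (Fin 2) a.1) 1 0 ∈ J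
    rw [Matrix.scalar_apply, Matrix.diagonal_apply_ne _ (by decide)]
    exact J.zero_mem
  refine ⟨fun v hv hv' => ?_, fun v => ⟨_, h0 _ (u v), (D.atP_scalar u t v).symm⟩,
    fun v => ⟨_, h0 _ (t v), (D.atS_scalar u t v).symm⟩⟩
  have h2 : D.scalar u t v = D.placeP _ v * D.placeS _ v := rfl
  rw [h2, D.placeP_apply_of_not_le hv, D.placeS_apply_of_not_le hv', one_mul]
  exact one_mem _

theorem scalar_mem_K0_iff (n : ℕ) : D.scalar u t ∈ D.K0 n ↔
    ∀ v, (t v).1 - 1 ∈ locIdeal v.1 D.s := by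
  constructor
  · intro h v
    obtain ⟨C, hC, hC'⟩ := (D.mem_K0_iff.mp h).2.2 v
    rw [atS_scalar] at hC'
    have := intGL_injective v.1 hC'
    have h1 := hC.1
    rw [this] at h1
    change (Matrix.scalar (Fin 2) (t v).1) 0 0 - 1 ∈ _ at h1
    rwa [Matrix.scalar_apply, Matrix.diagonal_apply_eq] at h1
  · intro h
    obtain ⟨h1, h2, h3⟩ := D.scalar_mem_K00 u t n
    refine D.mem_K0_iff.mpr ⟨h1, h2, fun v => ?_⟩
    obtain ⟨C, hC, hC'⟩ := h3 v
    refine ⟨C, ⟨?_, hC⟩, hC'⟩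
    rw [atS_scalar] at hC'
    rw [intGL_injective v.1 hC']
    change (Matrix.scalar (Fin 2) (t v).1) 0 0 - 1 ∈ _
    rw [Matrix.scalar_apply, Matrix.diagonal_apply_eq]
    exact h v

theorem scalar_inv : (D.scalar u t)⁻¹ = D.scalar u⁻¹ t⁻¹ := by
  rw [inv_eq_iff_mul_eq_one, ← scalar_mul, mul_inv_cancel, mul_inv_cancel]
  refine ext_supported D (D.scalar_mem_supported _ _) (one_mem _) (fun v => ?_) fun v => ?_
  · rw [atP_scalar, Pi.one_apply, map_one, map_one, map_one]
  · rw [atS_scalar, Pi.one_apply, map_one, map_one, map_one]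

/-- The group `Δ_𝔰`. -/
abbrev Delta : Type _ := ∀ v : D.Ss, (v.1.adicCompletionIntegers F ⧸ locIdeal v.1 D.s)ˣ

theorem exists_lift_unit (v : D.Ss) (x : (v.1.adicCompletionIntegers F ⧸ locIdeal v.1 D.s)ˣ) :
    ∃ y : (v.1.adicCompletionIntegers F)ˣ,
      Units.map (Ideal.Quotient.mk (locIdeal v.1 D.s)).toMonoidHom y = x := by
  obtain ⟨y, hy⟩ := Ideal.Quotient.mk_surjective x.1
  have hyu : IsUnit y := by
    by_contra h
    have h1 : y ∈ IsLocalRing.maximalIdeal _ := (IsLocalRing.mem_maximalIdeal y).mpr h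
    obtain ⟨z, hz⟩ := Ideal.Quotient.mk_surjective (x⁻¹).1
    have h2 : Ideal.Quotient.mk (locIdeal v.1 D.s) (y * z) = Ideal.Quotient.mk _ 1 := by
      rw [map_mul, hy, hz, Units.mul_inv, map_one]
    have h3 := locIdeal_le_maximalIdeal v.2 (Ideal.Quotient.eq.mp h2)
    have h4 := sub_mem (Ideal.mul_mem_right z _ h1) h3
    rw [sub_sub_cancel] at h4
    exact (IsLocalRing.maximalIdeal.isMaximal _).ne_top ((Ideal.eq_top_iff_one _).mpr h4)
  exact ⟨hyu.unit, Units.ext hy⟩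

theorem finite_quotient_locIdeal (v : D.Ss) :
    Finite (v.1.adicCompletionIntegers F ⧸ locIdeal v.1 D.s) := by
  obtain ⟨r, hr, hr0⟩ := (Submodule.ne_bot_iff _).mp D.s_ne_bot
  have hfin : Finite (𝓞 F ⧸ D.s) := Ideal.finiteQuotientOfFreeOfNeBot _ D.s_ne_bot
  let f : 𝓞 F ⧸ D.s →+* v.1.adicCompletionIntegers F ⧸ locIdeal v.1 D.s :=
    Ideal.quotientMap _ (algebraMap (𝓞 F) (v.1.adicCompletionIntegers F)) Ideal.le_comap_map
  refine Finite.of_surjective f fun x => ?_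
  obtain ⟨y, rfl⟩ := Ideal.Quotient.mk_surjective x
  obtain ⟨a, z, h⟩ := exists_ringOfIntegers_sub v.1 y hr0
  refine ⟨Ideal.Quotient.mk _ a, ?_⟩
  change Ideal.Quotient.mk _ (algebraMap (𝓞 F) (v.1.adicCompletionIntegers F) a) = _
  refine (Ideal.Quotient.eq.mpr ?_).symm
  rw [h]
  exact Ideal.mul_mem_right _ _ (Ideal.mem_map_of_mem _ hr)

theorem finite_Delta : Finite D.Delta := by
  have h1 : Finite D.Ss := (finite_places D.s_ne_bot).to_subtype
  have h2 := D.finite_quotient_locIdeal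
  have h3 : ∀ v : D.Ss, Finite (v.1.adicCompletionIntegers F ⧸ locIdeal v.1 D.s)ˣ := fun v =>
    Finite.of_injective _ Units.val_injective
  exact Pi.finite

/-- Sums of functions on `G₁(F) \ G₁(𝔸) / K₀₀ⁿ` over the larger space with `K₀ⁿ`. -/
theorem cosetSum_K00 [NumberField.IsTotallyReal F] [NumberField.IsTotallyComplex K]
    (hD : D.SufficientlySmall) {A : Type*} [AddCommMonoid A] {n : ℕ} (hn : 1 ≤ n) {Ψ : D.G → A}
    (hΨ : BiInv D.rational (D.K00 n) Ψ) :
    cosetSum D.rational (D.K0 n) Ψ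
      = Nat.card D.Delta • cosetSum D.rational (D.K00 n) Ψ := by
  have hfin := D.finite_Delta
  let _ := Fintype.ofFinite D.Delta
  have := D.finite_K00 n
  choose l hl using D.exists_lift_unit
  have hΨ' : BiInv D.rational (D.K0 n) Ψ := fun γ hγ g h hh => hΨ γ hγ g h (D.K0_le_K00 n hh)
  -- The group `K₀₀ⁿ / K₀ⁿ` is represented by scalar matrices lifting `Δ_𝔰`, and `Ψ` is invariant
  -- under all of them.
  rw [cosetSum_eq_of_reps (D.K0_le_K00 n)
    (fun t γ hγ ht => hD t γ hγ (D.K00_le_levelCirc n ht))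
    (fun δ : D.Delta => D.scalar 1 (fun v => l v (δ v))) (fun δ => D.scalar_mem_K00 _ _ n)
    ?_ ?_ hΨ']
  · rw [cosetSum, cosetSum, smul_finsum' _ (Set.toFinite _)]
    refine finsum_congr fun q => ?_
    have : ∀ δ : D.Delta, Ψ (Quotient.out q * D.scalar 1 (fun v => l v (δ v)))
        = Ψ (Quotient.out q) := fun δ => by
      have := hΨ 1 (one_mem _) (Quotient.out q) _ (D.scalar_mem_K00 1 (fun v => l v (δ v)) n)
      rwa [one_mul] at this
    rw [Finset.sum_congr rfl fun δ _ => this δ, Finset.sum_const, Nat.card_eq_fintype_card]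
    rfl
  · intro h hh
    obtain ⟨u, t, hut⟩ := D.exists_scalar_of_mem_K00 hn hh
    refine ⟨fun v => Units.map (Ideal.Quotient.mk (locIdeal v.1 D.s)).toMonoidHom (t v), ?_⟩
    set t' : ∀ v : D.Ss, (v.1.adicCompletionIntegers F)ˣ := fun v =>
      l v (Units.map (Ideal.Quotient.mk (locIdeal v.1 D.s)).toMonoidHom (t v)) with ht'
    have h1 : (D.scalar 1 t')⁻¹ * h = D.scalar u (t'⁻¹ * t) * ((D.scalar u t)⁻¹ * h) := by
      have h2 : D.scalar u (t'⁻¹ * t) = (D.scalar 1 t')⁻¹ * D.scalar u t := by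
        rw [scalar_inv, ← scalar_mul, inv_one, one_mul]
      rw [h2, mul_assoc, mul_inv_cancel_left]
    rw [h1]
    refine mul_mem ((D.scalar_mem_K0_iff _ _ n).mpr fun v => ?_) (D.K1_le_K0 n hut)
    have h3 := congrArg Units.val (hl v (Units.map
      (Ideal.Quotient.mk (locIdeal v.1 D.s)).toMonoidHom (t v)))
    have h4 : (t' v).1 - (t v).1 ∈ locIdeal v.1 D.s := Ideal.Quotient.eq.mp h3
    have h5 : ((t'⁻¹ * t) v).1 - 1 = -(((t' v)⁻¹).1 * ((t' v).1 - (t v).1)) := by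
      rw [mul_sub, Units.inv_mul]
      change ((t' v)⁻¹).1 * (t v).1 - 1 = _
      ring
    rw [h5]
    exact neg_mem (Ideal.mul_mem_left _ _ h4)
  · intro δ δ' h
    rw [scalar_inv, ← scalar_mul, scalar_mem_K0_iff] at h
    refine funext fun v => ?_
    rw [← hl v (δ v), ← hl v (δ' v)]
    refine Units.ext ?_
    refine Ideal.Quotient.eq.mpr ?_
    have h1 := Ideal.mul_mem_left _ (-(l v (δ v)).1) (h v)
    have h2 : -(l v (δ v)).1 * ((((fun v => l v (δ v))⁻¹ * fun v => l v (δ' v) :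
        ∀ v : D.Ss, (v.1.adicCompletionIntegers F)ˣ) v).1 - 1)
        = (l v (δ v)).1 - (l v (δ' v)).1 := by
      change -(l v (δ v)).1 * (((l v (δ v))⁻¹).1 * (l v (δ' v)).1 - 1) = _
      rw [mul_sub, neg_mul, ← mul_assoc, Units.mul_inv]
      ring
    rw [h2] at h1
    exact h1

end Datum

end ScalarDecomposition

end

end HidaU2

namespace HidaU2

noncomputable section

/-! ### Polynomials in pairs of variables -/

section Polynomials

open MvPolynomial

variable {ι τ R : Type*} [CommRing R]

/-- The linear functional on polynomials with given values on the monomials. -/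
def monoFun (f : (τ →₀ ℕ) → R) : MvPolynomial τ R →ₗ[R] R := (basisMonomials τ R).constr R f

theorem monoFun_monomial (f : (τ →₀ ℕ) → R) (m : τ →₀ ℕ) (a : R) :
    monoFun f (monomial m a) = a * f m := by
  have h : monomial m a = a • (basisMonomials τ R) m := by
    rw [coe_basisMonomials, smul_monomial, smul_eq_mul, mul_one]
  rw [h, map_smul, monoFun, Module.Basis.constr_basis, smul_eq_mul]

theorem monoFun_apply (f : (τ →₀ ℕ) → R) (P : MvPolynomial τ R) :
    monoFun f P = ∑ m ∈ P.support, P.coeff m * f m := by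
  conv_lhs => rw [← support_sum_monomial_coeff P]
  rw [map_sum]
  exact Finset.sum_congr rfl fun m _ => monoFun_monomial f m _

/-- The product of the factorials of the exponents. -/
def expFact (m : τ →₀ ℕ) : ℕ := m.prod fun _ a => a !

theorem expFact_add_single (m : τ →₀ ℕ) (x : τ) :
    expFact (m + Finsupp.single x 1) = (m x + 1) * expFact m := by
  classical
  have h0 : ∀ i : τ, (0 : ℕ)! = 1 := fun _ => rfl
  have hs : (m + Finsupp.single x 1).support ⊆ insert x m.support := by
    refine Finsupp.support_add.trans (Finset.union_subset (Finset.subset_insert _ _) ?_)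
    exact Finsupp.support_single_subset.trans (by simp)
  rw [expFact, expFact, Finsupp.prod_of_support_subset _ hs _ (fun i _ => h0 i),
    Finsupp.prod_of_support_subset _ (Finset.subset_insert x m.support) _ (fun i _ => h0 i),
    ← Finset.mul_prod_erase _ _ (Finset.mem_insert_self x m.support),
    ← Finset.mul_prod_erase (insert x m.support) (fun i => (m i)!)
      (Finset.mem_insert_self x m.support), ← mul_assoc]
  congr 1
  · simp [Nat.factorial_succ]
  · refine Finset.prod_congr rfl fun i hi => ?_
    rw [Finsupp.add_apply, Finsupp.single_eq_of_ne (Finset.ne_of_mem_erase hi), add_zero]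

/-- The apolar form `∑ m! P_m Q_m`. -/
def apolar (P Q : MvPolynomial τ R) : R := monoFun (fun m => (expFact m : R) * Q.coeff m) P

theorem apolar_add_left (P P' Q : MvPolynomial τ R) :
    apolar (P + P') Q = apolar P Q + apolar P' Q := map_add _ _ _

theorem apolar_add_right (P Q Q' : MvPolynomial τ R) :
    apolar P (Q + Q') = apolar P Q + apolar P Q' := by
  simp only [apolar, monoFun_apply, coeff_add, mul_add, Finset.sum_add_distrib]

theorem apolar_C_mul_right (P Q : MvPolynomial τ R) (a : R) :
    apolar P (C a * Q) = a * apolar P Q := by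
  simp only [apolar, monoFun_apply, coeff_C_mul, Finset.mul_sum]
  exact Finset.sum_congr rfl fun m _ => by ring

theorem apolar_mul_C_left (P Q : MvPolynomial τ R) (a : R) :
    apolar (P * C a) Q = a * apolar P Q := by
  rw [mul_comm, ← smul_eq_C_mul, apolar, map_smul, smul_eq_mul]
  rfl

/-- Multiplication by a variable is adjoint to differentiation, because adding one to an exponent
multiplies `m!` by the new exponent. This permits induction on the degree. -/
theorem apolar_mul_X (P Q : MvPolynomial τ R) (x : τ) :
    apolar (P * X x) Q = apolar P (pderiv x Q) := by
  induction P using MvPolynomial.induction_on' with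
  | monomial m a =>
    have h : monomial m a * X x = monomial (m + Finsupp.single x 1) a := by
      rw [X, monomial_mul, mul_one]
    rw [h, apolar, apolar, monoFun_monomial, monoFun_monomial, coeff_pderiv, expFact_add_single]
    push_cast
    ring
  | add P P' hP hP' => rw [add_mul, apolar_add_left, apolar_add_left, hP, hP']

/-- The substitution `P(X, Y) ↦ P((X, Y) A)`. -/
def bisubst (A : ι → Matrix (Fin 2) (Fin 2) R) :
    MvPolynomial (ι × Fin 2) R →ₐ[R] MvPolynomial (ι × Fin 2) R :=
  aeval fun x => ∑ i : Fin 2, X (x.1, i) * C (A x.1 i x.2)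

theorem bisubst_X (A : ι → Matrix (Fin 2) (Fin 2) R) (x : ι × Fin 2) :
    bisubst A (X x) = X (x.1, 0) * C (A x.1 0 x.2) + X (x.1, 1) * C (A x.1 1 x.2) := by
  rw [bisubst, aeval_X, Fin.sum_univ_two]

theorem bisubst_C (A : ι → Matrix (Fin 2) (Fin 2) R) (a : R) : bisubst A (C a) = C a :=
  algHom_C _ _

theorem bisubst_bisubst (A B : ι → Matrix (Fin 2) (Fin 2) R) (P : MvPolynomial (ι × Fin 2) R) :
    bisubst A (bisubst B P) = bisubst (fun σ => A σ * B σ) P := by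
  have h : (bisubst A).comp (bisubst B) = bisubst fun σ => A σ * B σ := by
    refine algHom_ext fun x => ?_
    rw [AlgHom.comp_apply, bisubst_X, bisubst_X]
    simp only [map_add, map_mul, bisubst_X, bisubst_C, Matrix.mul_apply, Fin.sum_univ_two]
    ring
  exact DFunLike.congr_fun h P

theorem bisubst_one (P : MvPolynomial (ι × Fin 2) R) : bisubst (fun _ => 1) P = P := by
  have h : bisubst (fun _ : ι => (1 : Matrix (Fin 2) (Fin 2) R)) = AlgHom.id R _ := by
    refine algHom_ext fun x => ?_
    obtain ⟨σ, i⟩ := x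
    rw [bisubst_X, AlgHom.id_apply]
    revert i
    rw [Fin.forall_fin_two]
    constructor <;> simp
  exact DFunLike.congr_fun h P

theorem map_bisubst {S : Type*} [CommRing S] (f : R →+* S) (A : ι → Matrix (Fin 2) (Fin 2) R)
    (P : MvPolynomial (ι × Fin 2) R) :
    map f (bisubst A P) = bisubst (fun σ => (A σ).map f) (map f P) := by
  induction P using MvPolynomial.induction_on with
  | C a => rw [bisubst_C, map_C, bisubst_C]
  | add P Q hP hQ => simp only [map_add, hP, hQ]
  | mul_X P x hP => simp [hP, bisubst_X]

/-- The chain rule for a linear substitution. Only the two variables of the pair `σ` contribute. -/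
theorem pderiv_bisubst (B : ι → Matrix (Fin 2) (Fin 2) R) (σ : ι) (j : Fin 2)
    (Q : MvPolynomial (ι × Fin 2) R) :
    pderiv (σ, j) (bisubst B Q) = C (B σ j 0) * bisubst B (pderiv (σ, 0) Q)
      + C (B σ j 1) * bisubst B (pderiv (σ, 1) Q) := by
  classical
  induction Q using MvPolynomial.induction_on with
  | C a => simp [bisubst_C]
  | add P Q hP hQ =>
    simp only [map_add, hP, hQ]
    ring
  | mul_X Q x hQ =>
    have key : pderiv (σ, j) (bisubst B (X x)) = C (B σ j 0) * bisubst B (pderiv (σ, 0) (X x))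
        + C (B σ j 1) * bisubst B (pderiv (σ, 1) (X x)) := by
      obtain ⟨τ, l⟩ := x
      rw [bisubst_X]
      simp only [Derivation.map_add, Derivation.leibniz, pderiv_C, zero_add,
        pderiv_X, smul_eq_mul, Pi.single_apply, Prod.mk.injEq]
      by_cases h : τ = σ
      · subst h
        fin_cases j <;> fin_cases l <;> simp
      · simp [h]
    rw [map_mul, Derivation.leibniz, Derivation.leibniz, Derivation.leibniz]
    simp only [smul_eq_mul, map_add, map_mul, hQ, key]
    ring

theorem coeff_zero_bisubst (A : ι → Matrix (Fin 2) (Fin 2) R) (P : MvPolynomial (ι × Fin 2) R) :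
    coeff 0 (bisubst A P) = coeff 0 P := by
  induction P using MvPolynomial.induction_on with
  | C a => rw [bisubst_C]
  | add P Q hP hQ => simp only [map_add, coeff_add, hP, hQ]
  | mul_X P x hP =>
    rw [← constantCoeff_eq]
    simp [bisubst_X]

/-- The adjoint of a substitution with respect to the apolar form is the transposed
substitution. -/
theorem apolar_bisubst (A : ι → Matrix (Fin 2) (Fin 2) R) (P Q : MvPolynomial (ι × Fin 2) R) :
    apolar (bisubst A P) Q = apolar P (bisubst (fun σ => (A σ)ᵀ) Q) := by
  induction P using MvPolynomial.induction_on generalizing Q with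
  | C a =>
    rw [bisubst_C, C_apply, apolar, apolar, monoFun_monomial, monoFun_monomial,
      coeff_zero_bisubst]
  | add P P' hP hP' => rw [map_add, apolar_add_left, apolar_add_left, hP, hP']
  | mul_X P x hP =>
    obtain ⟨σ, i⟩ := x
    rw [map_mul, bisubst_X, mul_add, ← mul_assoc, ← mul_assoc, apolar_add_left,
      apolar_mul_C_left, apolar_mul_C_left, apolar_mul_X, apolar_mul_X, hP, hP, apolar_mul_X,
      pderiv_bisubst, apolar_add_right, apolar_C_mul_right, apolar_C_mul_right]
    rfl

/-- The degree in the pairs of variables. -/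
def bidegree : ι × Fin 2 → (ι →₀ ℕ) := fun x => Finsupp.single x.1 1

theorem weight_bidegree (m : ι × Fin 2 →₀ ℕ) (σ : ι) :
    Finsupp.weight (bidegree (ι := ι)) m σ = m (σ, 0) + m (σ, 1) := by
  classical
  induction m using Finsupp.induction_linear with
  | zero => simp
  | add f g hf hg => simp only [map_add, Finsupp.add_apply, hf, hg]; ring
  | single x a =>
    obtain ⟨τ, i⟩ := x
    rw [Finsupp.weight_apply, Finsupp.sum_single_index (by simp), bidegree]
    by_cases h : τ = σ
    · subst h
      fin_cases i <;> simp
    · simp [h]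

theorem bisubst_isWeightedHomogeneous (A : ι → Matrix (Fin 2) (Fin 2) R)
    {P : MvPolynomial (ι × Fin 2) R} {k : ι →₀ ℕ} (hP : IsWeightedHomogeneous bidegree P k) :
    IsWeightedHomogeneous bidegree (bisubst A P) k := by
  rw [← support_sum_monomial_coeff P, map_sum]
  refine IsWeightedHomogeneous.sum _ _ _ fun m hm => ?_
  have hk := hP (mem_support_iff.mp hm)
  rw [bisubst, aeval_monomial, ← hk, Finsupp.weight_apply, ← zero_add (m.sum _)]
  refine (isWeightedHomogeneous_C _ _).mul (IsWeightedHomogeneous.prod _ _ _ fun x _ =>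
    IsWeightedHomogeneous.pow (IsWeightedHomogeneous.sum _ _ _ fun i _ => ?_) _)
  have := (isWeightedHomogeneous_X R (bidegree (ι := ι)) (x.1, i)).mul
    (isWeightedHomogeneous_C (bidegree (ι := ι)) (A x.1 i x.2))
  rw [add_zero] at this
  exact this

theorem prod_eq_of_weight {N : Type*} [CommMonoid N] {k : ι →₀ ℕ} {m : ι × Fin 2 →₀ ℕ}
    (hm : ∀ σ, m (σ, 0) + m (σ, 1) = k σ) (f : Fin 2 → ℕ → N) (hf : ∀ i, f i 0 = 1) :
    (m.prod fun x a => f x.2 a) = k.prod fun σ _ => f 0 (m (σ, 0)) * f 1 (m (σ, 1)) := by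
  classical
  have hs : m.support ⊆ k.support ×ˢ Finset.univ := by
    intro x hx
    obtain ⟨σ, i⟩ := x
    rw [Finset.mem_product]
    refine ⟨?_, Finset.mem_univ _⟩
    rw [Finsupp.mem_support_iff] at hx ⊢
    intro h
    have h1 := hm σ
    rw [h] at h1
    refine hx ?_
    fin_cases i
    · change m (σ, 0) = 0; omega
    · change m (σ, 1) = 0; omega
  rw [Finsupp.prod_of_support_subset _ hs _ (fun x _ => hf x.2), Finset.prod_product,
    Finsupp.prod]
  exact Finset.prod_congr rfl fun σ _ => Fin.prod_univ_two _

theorem bisubst_diag_monomial (d : Fin 2 → R) (m : ι × Fin 2 →₀ ℕ) (a : R) :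
    bisubst (fun _ => Matrix.diagonal d) (monomial m a)
      = monomial m (a * m.prod fun x e => d x.2 ^ e) := by
  rw [bisubst, aeval_monomial]
  have h : ∀ x : ι × Fin 2, (∑ i : Fin 2, X (x.1, i) * C (Matrix.diagonal d i x.2) :
      MvPolynomial (ι × Fin 2) R) = X x * C (d x.2) := by
    rintro ⟨σ, i⟩
    rw [Fin.sum_univ_two]
    fin_cases i <;> simp
  simp only [h, mul_pow]
  rw [Finsupp.prod_mul, monomial_eq (a := a * _)]
  change C a * _ = _
  rw [map_mul, Finsupp.prod, Finsupp.prod, Finsupp.prod, map_prod]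
  simp only [map_pow]
  ring

theorem bisubst_w_monomial (m : ι × Fin 2 →₀ ℕ) (a : R) :
    bisubst (fun _ => !![0, -1; 1, 0]) (monomial m a)
      = monomial (m.mapDomain (Prod.map id (Equiv.swap 0 1)))
        (a * m.prod fun x e => (![1, -1] x.2 : R) ^ e) := by
  rw [bisubst, aeval_monomial]
  have h : ∀ x : ι × Fin 2, (∑ i : Fin 2, X (x.1, i) * C ((!![0, -1; 1, 0] : Matrix _ _ R) i x.2) :
      MvPolynomial (ι × Fin 2) R) = X (Prod.map id (Equiv.swap 0 1) x) * C (![1, -1] x.2) := by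
    rintro ⟨σ, i⟩
    rw [Fin.sum_univ_two]
    fin_cases i <;> simp
  simp only [h, mul_pow]
  rw [Finsupp.prod_mul, monomial_eq (a := a * _), Finsupp.prod_mapDomain_index_inj
    (Function.Injective.prodMap Function.injective_id (Equiv.injective _))]
  change C a * _ = _
  rw [map_mul, Finsupp.prod, Finsupp.prod, Finsupp.prod, map_prod]
  simp only [map_pow]
  ring

end Polynomials

end

end HidaU2

namespace HidaU2

noncomputable section

/-! ### The representations `L_k` and their pairings -/

section Representation

open MvPolynomial

theorem coeff_bisubst_diag {ι R : Type*} [CommRing R] (t : R) (μ : ι × Fin 2 →₀ ℕ)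
    (Q : MvPolynomial (ι × Fin 2) R) :
    coeff μ (bisubst (fun _ : ι => Matrix.diagonal ![1, t]) Q)
      = coeff μ Q * μ.prod fun x e => (![1, t] x.2) ^ e := by
  classical
  induction Q using MvPolynomial.induction_on' with
  | monomial ν a =>
    rw [bisubst_diag_monomial, coeff_monomial, coeff_monomial]
    split_ifs with h
    · rw [h]
    · rw [zero_mul]
  | add P Q hP hQ =>
    rw [map_add, coeff_add, coeff_add, hP, hQ]
    ring

variable {F K : Type*} [Field F] [NumberField F] [Field K] [NumberField K] [Algebra F K]
  {p : ℕ} (D : Datum F K p) {O R : Type*} [CommRing O] [CommRing R]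

namespace Datum

theorem subst_eq_bisubst (A : D.Emb O → Matrix (Fin 2) (Fin 2) R) (P : D.Poly O R) :
    D.subst A P = bisubst A P := rfl

theorem mem_Lk_iff {k : D.Emb O →₀ ℕ} {P : D.Poly O R} :
    P ∈ D.Lk k ↔ IsWeightedHomogeneous bidegree P k := by
  constructor
  · intro h m hm
    exact Finsupp.ext fun σ => (weight_bidegree m σ).trans (h m hm σ)
  · intro h m hm σ
    rw [← weight_bidegree, h hm]

theorem subst_mem_Lk {k : D.Emb O →₀ ℕ} (A : D.Emb O → Matrix (Fin 2) (Fin 2) R) {P : D.Poly O R}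
    (hP : P ∈ D.Lk k) : D.subst A P ∈ D.Lk k :=
  D.mem_Lk_iff.mpr (bisubst_isWeightedHomogeneous A (D.mem_Lk_iff.mp hP))

theorem map_mem_Lk {S : Type*} [CommRing S] (f : R →+* S) {k : D.Emb O →₀ ℕ} {P : D.Poly O R}
    (hP : P ∈ D.Lk k) : map f P ∈ (D.Lk k : Submodule S (D.Poly O S)) := by
  intro m hm
  refine hP m fun h => hm ?_
  rw [coeff_map, h, map_zero]

section Action

variable [Algebra O R]

theorem embMat_mul (A B : ∀ v : D.Sp, Matrix (Fin 2) (Fin 2) (v.1.adicCompletionIntegers F))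
    (σ : D.Emb O) : (D.embMat A σ * D.embMat B σ : Matrix (Fin 2) (Fin 2) R)
      = D.embMat (fun v => A v * B v) σ :=
  (Matrix.map_mul (f := (algebraMap O R).comp σ.2)).symm

theorem embMat_one (σ : D.Emb O) : (D.embMat (fun _ => 1) σ : Matrix (Fin 2) (Fin 2) R) = 1 :=
  Matrix.map_one ((algebraMap O R).comp σ.2) (map_zero _) (map_one _)

theorem subst_embMat_mul (A B : ∀ v : D.Sp, Matrix (Fin 2) (Fin 2) (v.1.adicCompletionIntegers F))
    (P : D.Poly O R) : D.subst (D.embMat A) (D.subst (D.embMat B) P)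
      = D.subst (D.embMat fun v => A v * B v) P := by
  rw [subst_eq_bisubst, subst_eq_bisubst, bisubst_bisubst]
  simp only [embMat_mul]
  rfl

theorem subst_embMat_one (P : D.Poly O R) : D.subst (D.embMat fun _ => 1) P = P := by
  have h : (D.embMat fun _ => 1 : D.Emb O → Matrix (Fin 2) (Fin 2) R) = fun _ => 1 :=
    funext fun σ => D.embMat_one σ
  rw [h]
  exact bisubst_one P

theorem rho_inv_eq (A : ∀ v : D.Sp, GL (Fin 2) (v.1.adicCompletionIntegers F)) (P : D.Poly O R) :
    D.rho A⁻¹ P = D.subst (D.embMat fun v => (A v).1ᵀ) P := by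
  rw [rho]
  simp only [Pi.inv_apply, inv_inv]

theorem rhoNorm_mul (A B : ∀ v : D.Sp, Matrix (Fin 2) (Fin 2) (v.1.adicCompletionIntegers F))
    (P : D.Poly O R) : D.rhoNorm A (D.rhoNorm B P) = D.rhoNorm (fun v => A v * B v) P := by
  rw [rhoNorm, rhoNorm, rhoNorm, subst_embMat_mul]
  simp only [Matrix.adjugate_mul_distrib, Matrix.transpose_mul]

/-- If `B M = M' C` then `ρ(B)⁻¹ ρ_norm(M') = ρ_norm(M) ρ(C)⁻¹`. -/
theorem rhoNorm_rho_inv {B C : ∀ v : D.Sp, GL (Fin 2) (v.1.adicCompletionIntegers F)}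
    {M M' : ∀ v : D.Sp, Matrix (Fin 2) (Fin 2) (v.1.adicCompletionIntegers F)}
    (h : ∀ v, (B v).1 * M v = M' v * (C v).1) (hdet : ∀ v, (M v).det = (M' v).det)
    (h0 : ∀ v, (M v).det ≠ 0) (P : D.Poly O R) :
    D.rhoNorm M (D.rho C⁻¹ P) = D.rho B⁻¹ (D.rhoNorm M' P) := by
  rw [rho_inv_eq, rho_inv_eq, rhoNorm, rhoNorm, subst_embMat_mul, subst_embMat_mul]
  congr 3
  funext v
  rw [← Matrix.transpose_mul, ← Matrix.transpose_mul, adjugate_intertwine (h v) (hdet v) (h0 v)]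

/-- The evaluation of a form at `(X, Y) = (1, 0)`. -/
theorem coeff_eq_eval {k : D.Emb O →₀ ℕ} {P : D.Poly O R} (hP : P ∈ D.Lk k) :
    P.coeff (k.mapDomain fun σ => (σ, 0)) = eval (fun x => if x.2 = 0 then 1 else 0) P := by
  classical
  have hinj : Function.Injective (fun σ : D.Emb O => (σ, (0 : Fin 2))) := fun a b h =>
    (Prod.ext_iff.mp h).1
  have key : ∀ m : D.Emb O × Fin 2 →₀ ℕ, P.coeff m ≠ 0 →
      (∏ x ∈ m.support, (if x.2 = 0 then (1 : R) else 0) ^ m x)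
        = if m = k.mapDomain (fun σ => (σ, 0)) then 1 else 0 := by
    intro m hm
    have hk := hP m hm
    split_ifs with h
    · refine Finset.prod_eq_one fun x hx => ?_
      have : x.2 = 0 := by
        by_contra hx2
        rw [Finsupp.mem_support_iff, h, Finsupp.mapDomain_of_notMem_range] at hx
        · exact hx rfl
        · rintro ⟨σ, rfl⟩
          exact hx2 rfl
      rw [if_pos this, one_pow]
    · obtain ⟨σ, hσ⟩ : ∃ σ, m (σ, 1) ≠ 0 := by
        by_contra hall
        push Not at hall
        refine h (Finsupp.ext fun x => ?_)
        obtain ⟨σ, i⟩ := x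
        revert i
        rw [Fin.forall_fin_two]
        constructor
        · rw [Finsupp.mapDomain_apply hinj, ← hk σ, hall σ, add_zero]
        · rw [hall σ, Finsupp.mapDomain_of_notMem_range]
          rintro ⟨τ, hτ⟩
          exact absurd (Prod.ext_iff.mp hτ).2 (by simp)
      refine Finset.prod_eq_zero (Finsupp.mem_support_iff.mpr hσ) ?_
      rw [if_neg (by simp), zero_pow hσ]
  rw [eval_eq]
  have h1 : ∀ m ∈ P.support, P.coeff m * ∏ x ∈ m.support, (if x.2 = 0 then (1 : R) else 0) ^ m x
      = if m = k.mapDomain (fun σ => (σ, 0)) then P.coeff m else 0 := by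
    intro m hm
    rw [key m (mem_support_iff.mp hm)]
    split_ifs <;> simp
  rw [Finset.sum_congr rfl h1, Finset.sum_ite_eq']
  split_ifs with h
  · rfl
  · exact notMem_support_iff.mp h

theorem eval_subst (A : D.Emb O → Matrix (Fin 2) (Fin 2) R) (P : D.Poly O R) :
    eval (fun x => if x.2 = 0 then 1 else 0) (D.subst A P) = eval (fun x => A x.1 0 x.2) P := by
  rw [subst_eq_bisubst]
  induction P using MvPolynomial.induction_on with
  | C a => rw [bisubst_C, eval_C, eval_C]
  | add P Q hP hQ => simp only [map_add, hP, hQ]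
  | mul_X P x hP =>
    rw [map_mul, map_mul, map_mul, hP, bisubst_X]
    simp

end Action

/-! ### The twisted pairing -/

/-- The binomial weights of the pairing are `k! / m!`, so `k!` times the twisted pairing is the
apolar form, for which adjoints of substitutions are transposes. -/
theorem fact_eq {k : D.Emb O →₀ ℕ} {m : D.Emb O × Fin 2 →₀ ℕ}
    (hm : ∀ σ, m (σ, 0) + m (σ, 1) = k σ) :
    (k.prod fun σ a => a.choose (m (σ, 1))) * expFact m = D.fact k := by
  have h1 : expFact m = k.prod fun σ _ => (m (σ, 0))! * (m (σ, 1))! :=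
    prod_eq_of_weight hm (fun _ a => a !) (fun _ => rfl)
  rw [h1, ← Finsupp.prod_mul, fact]
  refine Finset.prod_congr rfl fun σ _ => ?_
  have h2 := hm σ
  change (k σ).choose (m (σ, 1)) * ((m (σ, 0))! * (m (σ, 1))!) = (k σ)!
  rw [← Nat.choose_mul_factorial_mul_factorial (show m (σ, 1) ≤ k σ by omega),
    show k σ - m (σ, 1) = m (σ, 0) by omega]
  ring

theorem angle_eq_monoFun (k : D.Emb O →₀ ℕ) (P Q : D.Poly O R) :
    D.angle k P Q = monoFun (fun m => (-1) ^ (k.sum fun σ _ => m (σ, 0))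
      * Q.coeff (m.mapDomain (Prod.map id (Equiv.swap 0 1)))
      * Ring.inverse ((k.prod fun σ a => a.choose (m (σ, 0)) : ℕ) : R)) P := by
  rw [angle, monoFun_apply]
  exact Finset.sum_congr rfl fun m _ => by ring

/-- Substitution by `w` swaps `X` and `Y` and introduces the sign given by the `Y`-degree. After the
swap this degree is the exponent of the sign in `⟨·, ·⟩_k`, so the signs cancel and the form is
diagonal on monomials. -/
theorem twisted_eq {k : D.Emb O →₀ ℕ} {P : D.Poly O R} (hP : P ∈ D.Lk k) (Q : D.Poly O R) :
    D.twisted k P Q = ∑ m ∈ P.support, P.coeff m * Q.coeff m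
      * Ring.inverse ((k.prod fun σ a => a.choose (m (σ, 1)) : ℕ) : R) := by
  have hsw : Function.Injective (Prod.map id (Equiv.swap 0 1) :
      D.Emb O × Fin 2 → D.Emb O × Fin 2) :=
    Function.Injective.prodMap Function.injective_id (Equiv.injective _)
  have hsw2 : ∀ m : D.Emb O × Fin 2 →₀ ℕ, (m.mapDomain (Prod.map id (Equiv.swap 0 1))).mapDomain
      (Prod.map id (Equiv.swap 0 1)) = m := by
    intro m
    rw [← Finsupp.mapDomain_comp]
    have : (Prod.map id (Equiv.swap 0 1) ∘ Prod.map id (Equiv.swap 0 1) :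
        D.Emb O × Fin 2 → D.Emb O × Fin 2) = id := by
      funext x
      exact Prod.ext rfl (by simp [Prod.map])
    rw [this, Finsupp.mapDomain_id]
  have hswap : ∀ (m : D.Emb O × Fin 2 →₀ ℕ) (σ : D.Emb O),
      (m.mapDomain (Prod.map id (Equiv.swap 0 1))) (σ, 0) = m (σ, 1) := by
    intro m σ
    have : ((σ, 0) : D.Emb O × Fin 2) = Prod.map id (Equiv.swap 0 1) (σ, 1) := by simp
    rw [this, Finsupp.mapDomain_apply hsw]
  rw [twisted, angle_eq_monoFun, subst_eq_bisubst]
  conv_lhs => rw [← support_sum_monomial_coeff P]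
  rw [map_sum, map_sum]
  refine Finset.sum_congr rfl fun m hm => ?_
  have hk := hP m (mem_support_iff.mp hm)
  rw [bisubst_w_monomial, monoFun_monomial, hsw2]
  simp only [hswap]
  have hsgn : (m.prod fun x e => (![1, -1] x.2 : R) ^ e) = (-1) ^ (k.sum fun σ _ => m (σ, 1)) := by
    rw [prod_eq_of_weight hk (fun i e => (![1, -1] i : R) ^ e) (fun _ => pow_zero _)]
    simp only [Matrix.cons_val_zero, one_pow, Matrix.cons_val_one, one_mul]
    rw [Finsupp.prod, Finset.prod_pow_eq_pow_sum]
    rfl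
  rw [hsgn]
  set e := k.sum fun σ _ => m (σ, 1)
  have h1 : ((-1 : R) ^ e) * (-1) ^ e = 1 := by rw [← mul_pow]; simp
  linear_combination (P.coeff m * Q.coeff m
    * Ring.inverse ((k.prod fun σ a => a.choose (m (σ, 1)) : ℕ) : R)) * h1

theorem isUnit_binom {k : D.Emb O →₀ ℕ} (hk : IsUnit ((D.fact k : ℕ) : R))
    {m : D.Emb O × Fin 2 →₀ ℕ} (hm : ∀ σ, m (σ, 0) + m (σ, 1) = k σ) :
    IsUnit ((k.prod fun σ a => a.choose (m (σ, 1)) : ℕ) : R) := by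
  rw [← D.fact_eq hm, Nat.cast_mul] at hk
  exact isUnit_of_mul_isUnit_left hk

theorem fact_mul_twisted {k : D.Emb O →₀ ℕ} (hk : IsUnit ((D.fact k : ℕ) : R)) {P : D.Poly O R}
    (hP : P ∈ D.Lk k) (Q : D.Poly O R) :
    (D.fact k : R) * D.twisted k P Q = apolar P Q := by
  rw [D.twisted_eq hP, apolar, monoFun_apply, Finset.mul_sum]
  refine Finset.sum_congr rfl fun m hm => ?_
  have hm' := hP m (mem_support_iff.mp hm)
  have h1 := Ring.mul_inverse_cancel _ (D.isUnit_binom hk hm')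
  have h2 := congrArg (Nat.cast : ℕ → R) (D.fact_eq hm')
  rw [Nat.cast_mul] at h2
  rw [← h2]
  linear_combination (expFact m * P.coeff m * Q.coeff m : R) * h1

theorem twisted_subst {k : D.Emb O →₀ ℕ} (hk : IsUnit ((D.fact k : ℕ) : R))
    (A : D.Emb O → Matrix (Fin 2) (Fin 2) R) {P : D.Poly O R} (hP : P ∈ D.Lk k)
    (Q : D.Poly O R) :
    D.twisted k (D.subst A P) Q = D.twisted k P (D.subst (fun σ => (A σ)ᵀ) Q) := by
  refine hk.mul_left_cancel ?_
  rw [D.fact_mul_twisted hk (D.subst_mem_Lk A hP), D.fact_mul_twisted hk hP, subst_eq_bisubst,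
    apolar_bisubst]
  rfl

theorem twisted_add_right {k : D.Emb O →₀ ℕ} (P Q Q' : D.Poly O R) :
    D.twisted k P (Q + Q') = D.twisted k P Q + D.twisted k P Q' := by
  simp only [twisted, angle, coeff_add, mul_add, add_mul, Finset.sum_add_distrib]

theorem twisted_smul {k : D.Emb O →₀ ℕ} (a b : R) (P Q : D.Poly O R) :
    D.twisted k (a • P) (b • Q) = a * b * D.twisted k P Q := by
  have h : ∀ Q, D.twisted k (a • P) Q = a * D.twisted k P Q := fun Q => by
    rw [twisted, twisted, angle_eq_monoFun, angle_eq_monoFun, map_smul, map_smul, smul_eq_mul]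
  rw [h]
  have h' : D.twisted k P (b • Q) = b * D.twisted k P Q := by
    simp only [twisted, angle, coeff_smul, smul_eq_mul, Finset.mul_sum]
    exact Finset.sum_congr rfl fun m _ => by ring
  rw [h', mul_assoc]

section Integrality

variable [Algebra O R]

/-- The form `(P, (k, 0)(pⁿ, 1) ρ_k(τ_n) Q)_k` with values in `R[1/k!]`. -/
def tauPairing (k : D.Emb O →₀ ℕ) (n : ℕ) (P Q : D.Poly O R) :
    Localization.Away ((D.fact k : ℕ) : R) :=
  D.twisted k (map (algebraMap R _) P)
    (map (algebraMap R _) (D.rhoNorm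
      (fun v => !![(p : v.1.adicCompletionIntegers F) ^ n, 0; 0, 1]) Q))

theorem isUnit_fact (k : D.Emb O →₀ ℕ) :
    IsUnit ((D.fact k : ℕ) : Localization.Away ((D.fact k : ℕ) : R)) := by
  have := IsLocalization.map_units (Localization.Away ((D.fact k : ℕ) : R))
    (⟨_, Submonoid.mem_powers ((D.fact k : ℕ) : R)⟩ : Submonoid.powers ((D.fact k : ℕ) : R))
  rwa [map_natCast] at this

theorem map_subst_embMat {S : Type*} [CommRing S] (f : R →+* S)
    (A : ∀ v : D.Sp, Matrix (Fin 2) (Fin 2) (v.1.adicCompletionIntegers F)) (P : D.Poly O R) :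
    map f (D.subst (D.embMat A) P)
      = D.subst (fun σ => (D.embMat A σ : Matrix (Fin 2) (Fin 2) R).map f) (map f P) :=
  map_bisubst f _ P

theorem twisted_map_subst (k : D.Emb O →₀ ℕ)
    (A : ∀ v : D.Sp, Matrix (Fin 2) (Fin 2) (v.1.adicCompletionIntegers F)) {P : D.Poly O R}
    (hP : P ∈ D.Lk k) (Q : D.Poly O R) :
    D.twisted k (map (algebraMap R (Localization.Away ((D.fact k : ℕ) : R)))
        (D.subst (D.embMat A) P)) (map (algebraMap R _) Q)
      = D.twisted k (map (algebraMap R _) P)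
          (map (algebraMap R _) (D.subst (D.embMat fun v => (A v)ᵀ) Q)) := by
  rw [map_subst_embMat, map_subst_embMat, D.twisted_subst (D.isUnit_fact k) _ (D.map_mem_Lk _ hP)]
  rfl

theorem tauPairing_add_right (k : D.Emb O →₀ ℕ) (n : ℕ) (P Q Q' : D.Poly O R) :
    D.tauPairing k n P (Q + Q') = D.tauPairing k n P Q + D.tauPairing k n P Q' := by
  rw [tauPairing, map_add, map_add, twisted_add_right]
  rfl

theorem tauPairing_smul (k : D.Emb O →₀ ℕ) (n : ℕ) (a b : R) (P Q : D.Poly O R) :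
    D.tauPairing k n (a • P) (b • Q) = algebraMap R _ (a * b) * D.tauPairing k n P Q := by
  have h : ∀ (a : R) (P : D.Poly O R),
      map (algebraMap R (Localization.Away ((D.fact k : ℕ) : R))) (a • P)
        = (algebraMap R (Localization.Away ((D.fact k : ℕ) : R)) a) • map (algebraMap R _) P := by
    intro a P
    rw [smul_eq_C_mul, map_mul, map_C, smul_eq_C_mul]
  rw [tauPairing, map_smul (D.rhoNorm _), h, h, twisted_smul, map_mul]
  rfl

/-- Write `N = p^a b` with `b` prime to `p`. In a `p`-adically complete ring `p` lies in the
Jacobson radical, so `b` is invertible. Hence a power of `p` clears the denominator `N`. -/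
theorem exists_isUnit_mul_pow [IsAdicComplete (Ideal.span {(p : R)}) R] (hp : p.Prime) {N : ℕ}
    (hN : N ≠ 0) : ∃ (a : ℕ) (c : R), (N : R) * c = (p : R) ^ a := by
  obtain ⟨a, b, hb, rfl⟩ := Nat.exists_eq_pow_mul_and_not_dvd hN p hp.ne_one
  have hcop : IsCoprime (p : ℤ) (b : ℤ) :=
    (Nat.isCoprime_iff_coprime).mpr ((Nat.Prime.coprime_iff_not_dvd hp).mpr hb)
  obtain ⟨x, y, hxy⟩ := hcop
  have hJ := IsAdicComplete.le_jacobson_bot (Ideal.span {(p : R)})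
    (Ideal.mem_span_singleton_self _)
  rw [Ideal.mem_jacobson_bot] at hJ
  obtain ⟨u, hu⟩ := hJ (-(x : R))
  have h1 : (y : R) * b = u := by
    have := congrArg (Int.cast : ℤ → R) hxy
    push_cast at this
    rw [hu]
    linear_combination this
  refine ⟨a, y * (u⁻¹).1, ?_⟩
  push_cast
  linear_combination (p : R) ^ a * (u⁻¹).1 * h1 + (p : R) ^ a * u.mul_inv

/-- For large `n` the pairing is integral, and it is close to the product of the leading
coefficients. -/
theorem exists_tauPairing_eq [IsAdicComplete (Ideal.span {(p : R)}) R] (k : D.Emb O →₀ ℕ) :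
    ∃ N₀ : ℕ, ∀ m n, N₀ + m ≤ n → ∀ P ∈ (D.Lk k : Submodule R (D.Poly O R)), ∀ Q : D.Poly O R,
      ∃ s : R, D.tauPairing k n P Q = algebraMap R _
        (P.coeff (k.mapDomain fun σ => (σ, 0)) * Q.coeff (k.mapDomain fun σ => (σ, 0))
          + (p : R) ^ m * s) := by
  classical
  have hfact : D.fact k ≠ 0 := Finset.prod_ne_zero_iff.mpr fun σ _ => Nat.factorial_ne_zero _
  -- The power `p^{N₀}` is the multiple `c k!` of `k!`, so it clears all denominators of the
  -- pairing.
  obtain ⟨N₀, c, hc⟩ := exists_isUnit_mul_pow (R := R) D.prime hfact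
  refine ⟨N₀, fun m n hn P hP Q => ?_⟩
  set S := Localization.Away ((D.fact k : ℕ) : R)
  set k0 : D.Emb O × Fin 2 →₀ ℕ := k.mapDomain fun σ => (σ, 0) with hk0
  have hinj : Function.Injective (fun σ : D.Emb O => (σ, (0 : Fin 2))) := fun a b h =>
    (Prod.ext_iff.mp h).1
  have hk0' : ∀ σ, k0 (σ, 0) = k σ := fun σ => Finsupp.mapDomain_apply hinj _ _
  have hk1' : ∀ σ, k0 (σ, 1) = 0 := fun σ => by
    rw [hk0, Finsupp.mapDomain_of_notMem_range]
    rintro ⟨τ, hτ⟩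
    exact absurd (Prod.ext_iff.mp hτ).2 (by simp)
  set t : R := (p : R) ^ n with ht
  -- The adjugate of `diag(pⁿ, 1)` is `diag(1, pⁿ)`: a monomial is multiplied by `pⁿ` to the power
  -- of its total degree in the `Y_σ`.
  have hQ : D.rhoNorm (fun v => !![(p : v.1.adicCompletionIntegers F) ^ n, 0; 0, 1]) Q
      = bisubst (fun _ => Matrix.diagonal ![1, t]) Q := by
    rw [rhoNorm, subst_eq_bisubst]
    congr 2
    funext σ
    rw [embMat, Matrix.adjugate_fin_two_of]
    ext i j
    fin_cases i <;> fin_cases j <;> simp [t]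
  have hmain : ∀ μ ∈ P.support, ∃ s : R, (map (algebraMap R S) P).coeff μ
      * (map (algebraMap R S) (D.rhoNorm (fun v => !![(p : v.1.adicCompletionIntegers F) ^ n, 0;
          0, 1]) Q)).coeff μ
      * Ring.inverse ((k.prod fun σ a => a.choose (μ (σ, 1)) : ℕ) : S)
      = algebraMap R S ((if μ = k0 then P.coeff μ * Q.coeff μ else 0) + (p : R) ^ m * s) := by
    intro μ hμ
    have hμk := hP μ (mem_support_iff.mp hμ)
    rw [coeff_map, hQ, coeff_map, coeff_bisubst_diag]
    split_ifs with h
    · refine ⟨0, ?_⟩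
      have h1 : (μ.prod fun x e => (![1, t] x.2) ^ e) = 1 := by
        rw [prod_eq_of_weight hμk (fun i e => (![1, t] i : R) ^ e) (fun _ => pow_zero _)]
        refine Finset.prod_eq_one fun σ _ => ?_
        rw [h]
        simp [hk1']
      have h2 : (k.prod fun σ a => a.choose (μ (σ, 1))) = 1 := by
        refine Finset.prod_eq_one fun σ _ => ?_
        rw [h]
        simp [hk1']
      rw [h1, h2, Nat.cast_one, Ring.inverse_one, mul_zero, add_zero, mul_one, mul_one, map_mul]
    · obtain ⟨σ, hσ⟩ : ∃ σ, μ (σ, 1) ≠ 0 := by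
        by_contra hall
        push Not at hall
        refine h (Finsupp.ext fun x => ?_)
        obtain ⟨σ, i⟩ := x
        revert i
        rw [Fin.forall_fin_two]
        constructor
        · rw [hk0', ← hμk σ, hall σ, add_zero]
        · rw [hall σ, hk1']
      obtain ⟨d, hd⟩ : t ∣ μ.prod fun x e => (![1, t] x.2) ^ e := by
        refine (dvd_pow_self t hσ).trans ?_
        exact Finset.dvd_prod_of_mem (fun x => (![1, t] x.2) ^ μ x)
          (Finsupp.mem_support_iff.mpr hσ)
      obtain ⟨j, rfl⟩ := Nat.exists_eq_add_of_le hn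
      -- Split `pⁿ = p^{N₀} p^m p^j`. Since `p^{N₀} = c k!` and the binomial factor times `μ!` is
      -- `k!`, the quotient of `p^{N₀}` by that factor is `c μ!`.
      refine ⟨P.coeff μ * Q.coeff μ * (p : R) ^ j * d * expFact μ * c, ?_⟩
      have h1 := Ring.mul_inverse_cancel _ (D.isUnit_binom (D.isUnit_fact (R := R) k) hμk)
      have h2 := congrArg (Nat.cast : ℕ → S) (D.fact_eq hμk)
      have h3 := congrArg (algebraMap R S) hc
      rw [Nat.cast_mul] at h2
      rw [hd, ht]
      simp only [map_mul, map_pow, map_natCast, zero_add, pow_add] at h3 ⊢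
      rw [← h3, ← h2]
      linear_combination (algebraMap R S (P.coeff μ) * algebraMap R S (Q.coeff μ) * (p : S) ^ m
        * (p : S) ^ j * algebraMap R S d * expFact μ * algebraMap R S c) * h1
  choose! s hs using hmain
  refine ⟨∑ μ ∈ P.support, s μ, ?_⟩
  rw [tauPairing, D.twisted_eq (D.map_mem_Lk _ hP),
    Finset.sum_subset (support_map_subset (algebraMap R S) P) fun μ _ hμ => by
      rw [notMem_support_iff.mp hμ, zero_mul, zero_mul],
    Finset.sum_congr rfl hs, ← map_sum, Finset.sum_add_distrib, Finset.sum_ite_eq',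
    ← Finset.mul_sum]
  congr 2
  split_ifs with h
  · rfl
  · rw [notMem_support_iff.mp h, zero_mul]

end Integrality

end Datum

end Representation

end

end HidaU2

namespace HidaU2

noncomputable section

/-! ### Congruences, adic limits and ordinary elements -/

section Adic

variable {R W W' : Type*} [CommRing R] [AddCommGroup W] [Module R W] [AddCommGroup W'] [Module R W']
  {π : R}

/-- Congruence modulo `π ^ m`. -/
def Close (π : R) (m : ℕ) (x y : W) : Prop := ∃ z : W, x - y = π ^ m • z

namespace Close

variable {m : ℕ} {x y z : W}

theorem refl (x : W) : Close π m x x := ⟨0, by simp⟩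

theorem of_eq (h : x = y) : Close π m x y := h ▸ refl x

theorem symm (h : Close π m x y) : Close π m y x := by
  obtain ⟨a, ha⟩ := h
  exact ⟨-a, by rw [smul_neg, ← ha, neg_sub]⟩

theorem trans (h : Close π m x y) (h' : Close π m y z) : Close π m x z := by
  obtain ⟨a, ha⟩ := h
  obtain ⟨b, hb⟩ := h'
  exact ⟨a + b, by rw [smul_add, ← ha, ← hb, sub_add_sub_cancel]⟩

theorem add {x' y' : W} (h : Close π m x y) (h' : Close π m x' y') :
    Close π m (x + x') (y + y') := by
  obtain ⟨a, ha⟩ := h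
  obtain ⟨b, hb⟩ := h'
  exact ⟨a + b, by rw [smul_add, ← ha, ← hb, add_sub_add_comm]⟩

theorem sub {x' y' : W} (h : Close π m x y) (h' : Close π m x' y') :
    Close π m (x - x') (y - y') := by
  obtain ⟨a, ha⟩ := h
  obtain ⟨b, hb⟩ := h'
  exact ⟨a - b, by rw [smul_sub, ← ha, ← hb, sub_sub_sub_comm]⟩

theorem map (f : W →ₗ[R] W') (h : Close π m x y) : Close π m (f x) (f y) := by
  obtain ⟨a, ha⟩ := h
  exact ⟨f a, by rw [← map_sub, ha, map_smul]⟩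

theorem sum {ι : Type*} (s : Finset ι) {f g : ι → W} (h : ∀ i ∈ s, Close π m (f i) (g i)) :
    Close π m (∑ i ∈ s, f i) (∑ i ∈ s, g i) := by
  classical
  induction s using Finset.induction_on with
  | empty => exact refl _
  | insert a s ha ih =>
    rw [Finset.sum_insert ha, Finset.sum_insert ha]
    exact (h a (Finset.mem_insert_self a s)).add
      (ih fun i hi => h i (Finset.mem_insert_of_mem hi))

theorem mono {m' : ℕ} (hm : m' ≤ m) (h : Close π m x y) : Close π m' x y := by
  obtain ⟨a, ha⟩ := h
  obtain ⟨j, rfl⟩ := Nat.exists_eq_add_of_le hm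
  exact ⟨π ^ j • a, by rw [ha, smul_smul, pow_add]⟩

theorem pi_iff {X : Type*} {f g : X → W} : Close π m f g ↔ ∀ t, Close π m (f t) (g t) := by
  constructor
  · rintro ⟨a, ha⟩ t
    exact ⟨a t, congrFun ha t⟩
  · intro h
    choose a ha using h
    exact ⟨a, funext ha⟩

theorem dvd_iff {x y : R} : Close π m x y ↔ π ^ m ∣ x - y := Iff.rfl

theorem mul {x y x' y' : R} (h : Close π m x y) (h' : Close π m x' y') :
    Close π m (x * x') (y * y') := by
  obtain ⟨a, ha⟩ := h
  obtain ⟨b, hb⟩ := h'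
  rw [smul_eq_mul] at ha hb
  exact ⟨a * x' + y * b, by rw [smul_eq_mul]; linear_combination x' * ha + y * hb⟩

end Close

/-- Uniform `π`-adic convergence. -/
def AdicLim (π : R) (a : ℕ → W) (L : W) : Prop := ∀ m, ∃ r₀, ∀ r ≥ r₀, Close π m (a r) L

/-- `π`-adic Cauchy sequences. -/
def AdicCauchy (π : R) (a : ℕ → W) : Prop := ∀ m, ∃ r₀, ∀ r ≥ r₀, Close π m (a r) (a r₀)

theorem AdicLim.map {a : ℕ → W} {L : W} (f : W →ₗ[R] W') (h : AdicLim π a L) :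
    AdicLim π (fun r => f (a r)) (f L) := fun m => by
  obtain ⟨r₀, h₀⟩ := h m
  exact ⟨r₀, fun r hr => (h₀ r hr).map f⟩

/-- A submodule that is separated and complete for the restriction of the `π`-adic topology. -/
structure IsAdicClosed (π : R) (N : Submodule R W) : Prop where
  sep : ∀ x ∈ N, (∀ m, Close π m x 0) → x = 0
  lim : ∀ a : ℕ → W, (∀ r, a r ∈ N) → AdicCauchy π a → ∃ L ∈ N, AdicLim π a L

namespace IsAdicClosed

variable {N : Submodule R W}

theorem eq (hN : IsAdicClosed π N) {x y : W} (hx : x ∈ N) (hy : y ∈ N)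
    (h : ∀ m, Close π m x y) : x = y := by
  refine sub_eq_zero.mp (hN.sep _ (N.sub_mem hx hy) fun m => ?_)
  have := (h m).sub (Close.refl y)
  rwa [sub_self] at this

theorem of_approx (hN : IsAdicClosed π N) {N' : Submodule R W} (hle : N' ≤ N)
    (h : ∀ f ∈ N, (∀ m, ∃ f' ∈ N', Close π m f' f) → f ∈ N') : IsAdicClosed π N' := by
  refine ⟨fun x hx => hN.sep x (hle hx), fun a ha hc => ?_⟩
  obtain ⟨L, hL, hlim⟩ := hN.lim a (fun r => hle (ha r)) hc
  refine ⟨L, h L hL fun m => ?_, hlim⟩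
  obtain ⟨r₀, h₀⟩ := hlim m
  exact ⟨a r₀, ha r₀, h₀ r₀ le_rfl⟩

theorem pi (hN : IsAdicClosed π N) (X : Type*) :
    IsAdicClosed π (Submodule.pi Set.univ fun _ : X => N) := by
  refine ⟨fun f hf h => funext fun t => hN.sep _ (hf t trivial) fun m =>
    Close.pi_iff.mp (h m) t, fun a ha hc => ?_⟩
  have h1 : ∀ t, ∃ L ∈ N, AdicLim π (fun r => a r t) L := fun t =>
    hN.lim _ (fun r => ha r t trivial) fun m => by
      obtain ⟨r₀, h₀⟩ := hc m
      exact ⟨r₀, fun r hr => Close.pi_iff.mp (h₀ r hr) t⟩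
  choose L hL hlim using h1
  refine ⟨L, fun t _ => hL t, fun m => ?_⟩
  obtain ⟨r₀, h₀⟩ := hc m
  refine ⟨r₀, fun r hr => Close.pi_iff.mpr fun t => ?_⟩
  -- The convergence at `t` may be slow, but the Cauchy estimate is uniform in `t`. Passing through
  -- an index far enough for `t` makes the convergence uniform.
  obtain ⟨r₁, h₁⟩ := hlim t m
  have e1 := Close.pi_iff.mp (h₀ r hr) t
  have e2 := Close.pi_iff.mp (h₀ (max r₀ r₁) (le_max_left _ _)) t
  exact (e1.trans e2.symm).trans (h₁ _ (le_max_right _ _))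

end IsAdicClosed

theorem isAdicClosed_top [IsAdicComplete (Ideal.span {π}) R] :
    IsAdicClosed π (⊤ : Submodule R R) := by
  have key : ∀ (m : ℕ) (x y : R),
      x ≡ y [SMOD (Ideal.span {π} ^ m • ⊤ : Submodule R R)] ↔ Close π m x y := by
    intro m x y
    rw [SModEq.sub_mem, smul_eq_mul, Ideal.mul_top, Ideal.span_singleton_pow,
      Ideal.mem_span_singleton]
    rfl
  refine ⟨fun x _ h => IsHausdorff.haus' (I := Ideal.span {π}) x fun m => (key m x 0).mpr (h m),
    fun a _ hc => ?_⟩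
  choose ρ hρ using hc
  -- Partial sums provide indices that dominate all the `ρ i` with `i ≤ m`, so the subsequence
  -- satisfies the compatibility required by `IsPrecomplete`.
  set ρ' : ℕ → ℕ := fun m => ∑ i ∈ Finset.range (m + 1), ρ i
  have hρ' : ∀ {m i}, i ≤ m → ρ i ≤ ρ' m := fun {m i} h =>
    Finset.single_le_sum (f := ρ) (fun _ _ => Nat.zero_le _) (Finset.mem_range.mpr (by omega))
  obtain ⟨L, hL⟩ := IsPrecomplete.prec' (I := Ideal.span {π}) (fun m => a (ρ' m))
    fun {m n} hmn => (key m _ _).mpr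
      ((hρ m _ (hρ' le_rfl)).trans (hρ m _ (hρ' hmn)).symm)
  refine ⟨L, trivial, fun m => ⟨ρ m, fun r hr => ?_⟩⟩
  exact ((hρ m r hr).trans (hρ m _ (hρ' le_rfl)).symm).trans ((key m _ _).mp (hL m))

/-- The elements fixed by `lim T ^ r!`. -/
def OrdinaryFor (π : R) (T : Module.End R W) (f : W) : Prop :=
  AdicLim π (fun r => (T ^ r !) f) f

variable {N : Submodule R W} {U S : Module.End R W}

theorem OrdinaryFor.map {T : Module.End R W} {T' : Module.End R W'} {f : W}
    (h : OrdinaryFor π T f) (L : W →ₗ[R] W') (hL : ∀ x, L (T x) = T' (L x)) :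
    OrdinaryFor π T' (L f) := by
  have hpow : ∀ (n : ℕ) (x : W), L ((T ^ n) x) = (T' ^ n) (L x) := by
    intro n
    induction n with
    | zero => intro x; rfl
    | succ n ih => intro x; rw [pow_succ, pow_succ, Module.End.mul_apply, ih, hL]; rfl
  intro m
  obtain ⟨r₀, h₀⟩ := h m
  refine ⟨r₀, fun r hr => ?_⟩
  change Close π m ((T' ^ r !) (L f)) (L f)
  rw [← hpow]
  exact (h₀ r hr).map L

theorem pow_mem {T : Module.End R W} (hT : ∀ x ∈ N, T x ∈ N) (n : ℕ) {x : W} (hx : x ∈ N) :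
    (T ^ n) x ∈ N := by
  induction n with
  | zero => exact hx
  | succ n ih => rw [pow_succ']; exact hT _ ih

/-- The preimage is `lim S T^{r!-1} f` with `T = U S`, since `U` maps the terms to `T^{r!} f`, which
tends to `f`. It is again ordinary because all operators involved commute. -/
theorem OrdinaryFor.exists_preimage (hN : IsAdicClosed π N) (hU : ∀ x ∈ N, U x ∈ N)
    (hS : ∀ x ∈ N, S x ∈ N) (hc : Commute U S) {f : W} (hf : f ∈ N)
    (hord : OrdinaryFor π (U * S) f) :
    ∃ L ∈ N, OrdinaryFor π (U * S) L ∧ U L = f := by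
  set T := U * S with hT
  have hTN : ∀ x ∈ N, T x ∈ N := fun x hx => hU _ (hS x hx)
  have hTS : ∀ n, Commute S (T ^ n) := fun n =>
    (Commute.mul_right hc.symm (Commute.refl S)).pow_right n
  set a : ℕ → W := fun r => S ((T ^ ((r !) - 1)) f)
  -- Replacing `f` by `T^{s!} f` in the `r`-th term, and by `T^{r!} f` in the `s`-th, gives the same
  -- element `S T^{r!+s!-1} f`.
  have hcauchy : ∀ m r₀, (∀ r ≥ r₀, Close π m ((T ^ r !) f) f) →
      ∀ r ≥ r₀, ∀ s ≥ r₀, Close π m (a r) (a s) := by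
    intro m r₀ h₀ r hr s hs
    have e1 : Close π m (a r) (S ((T ^ ((r !) - 1)) ((T ^ s !) f))) :=
      ((h₀ s hs).symm.map (T ^ ((r !) - 1))).map S
    have e2 : Close π m (S ((T ^ ((s !) - 1)) ((T ^ r !) f))) (a s) :=
      ((h₀ r hr).map (T ^ ((s !) - 1))).map S
    refine e1.trans ((Close.of_eq ?_).trans e2)
    congr 1
    have hcm : T ^ ((r !) - 1) * T ^ s ! = T ^ ((s !) - 1) * T ^ r ! := by
      have hr := Nat.factorial_pos r
      have hs := Nat.factorial_pos s
      rw [← pow_add, ← pow_add]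
      congr 1
      omega
    exact congrArg (fun X : Module.End R W => X f) hcm
  obtain ⟨L, hL, hlim⟩ := hN.lim a (fun r => hS _ (pow_mem hTN _ hf)) fun m => by
    obtain ⟨r₀, h₀⟩ := hord m
    exact ⟨r₀, fun r hr => hcauchy m r₀ h₀ r hr r₀ le_rfl⟩
  have hUa : ∀ r, U (a r) = (T ^ r !) f := fun r => by
    rw [← Nat.sub_add_cancel (Nat.factorial_pos r), pow_succ']
    rfl
  refine ⟨L, hL, fun m => ?_, ?_⟩
  · obtain ⟨r₀, h₀⟩ := hord m
    refine ⟨r₀, fun r hr => ?_⟩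
    obtain ⟨s, hs⟩ := hlim m
    have e1 := (hs s le_rfl).symm.map (T ^ r !)
    have e2 : Close π m ((T ^ r !) (a s)) (a s) := by
      have : (T ^ r !) (a s) = S ((T ^ ((s !) - 1)) ((T ^ r !) f)) := by
        change (T ^ r ! * (S * T ^ ((s !) - 1))) f = (S * (T ^ ((s !) - 1) * T ^ r !)) f
        rw [← mul_assoc, ← (hTS _).eq, mul_assoc, ← pow_add, ← pow_add, add_comm]
      rw [this]
      exact ((h₀ r hr).map (T ^ ((s !) - 1))).map S
    exact (e1.trans e2).trans (hs s le_rfl)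
  · refine hN.eq (hU _ hL) hf fun m => ?_
    obtain ⟨r₀, h₀⟩ := hord m
    obtain ⟨s, hs⟩ := hlim m
    have e := (hs (max r₀ s) (le_max_right _ _)).symm.map U
    rw [hUa] at e
    exact e.trans (h₀ _ (le_max_left _ _))

/-- In `T^{r!} = (S U)^{r!}` the operator `U` is applied first, so `U f` determines all `T^{r!} f`
and thereby their limit `f`. -/
theorem OrdinaryFor.eq_of_map_eq (hN : IsAdicClosed π N) (hc : Commute U S) {f f' : W}
    (hf : f ∈ N) (hf' : f' ∈ N) (hord : OrdinaryFor π (U * S) f)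
    (hord' : OrdinaryFor π (U * S) f') (h : U f = U f') : f = f' := by
  refine hN.eq hf hf' fun m => ?_
  obtain ⟨r₀, h₀⟩ := hord m
  obtain ⟨r₁, h₁⟩ := hord' m
  have e0 := h₀ (max r₀ r₁) (le_max_left _ _)
  have e1 := h₁ (max r₀ r₁) (le_max_right _ _)
  refine e0.symm.trans ((Close.of_eq ?_).trans e1)
  change ((U * S) ^ (max r₀ r₁)!) f = ((U * S) ^ (max r₀ r₁)!) f'
  rw [hc.eq, ← Nat.sub_add_cancel (Nat.factorial_pos (max r₀ r₁)), pow_succ,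
    Module.End.mul_apply, Module.End.mul_apply, Module.End.mul_apply, Module.End.mul_apply, h]

/-- The ordinary projection exists for elements that are eventually periodic modulo every `π ^ m`. -/
theorem exists_ordinary_limit {T : Module.End R W} (hN : IsAdicClosed π N)
    (hT : ∀ x ∈ N, T x ∈ N) {f : W} (hf : f ∈ N)
    (hper : ∀ m, ∃ a d : ℕ, 1 ≤ d ∧ Close π m ((T ^ (a + d)) f) ((T ^ a) f)) :
    ∃ L ∈ N, OrdinaryFor π T L ∧ AdicLim π (fun r => (T ^ r !) f) L := by
  -- Modulo `π^m` the sequence `Tⁱ f` has period `d` from index `a` on. For `r ≥ a + d` the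
  -- factorial `r!` is a multiple of `d` and at least `a`.
  have key : ∀ m, ∃ r₀, ∀ r ≥ r₀, ∀ i ≥ r₀ !, Close π m ((T ^ (i + r !)) f) ((T ^ i) f) := by
    intro m
    obtain ⟨a, d, hd, h⟩ := hper m
    have h1 : ∀ i ≥ a, Close π m ((T ^ (i + d)) f) ((T ^ i) f) := by
      intro i hi
      obtain ⟨j, rfl⟩ := Nat.exists_eq_add_of_le' hi
      rw [add_assoc, pow_add T j (a + d), pow_add T j a]
      exact h.map (T ^ j)
    have h2 : ∀ q, ∀ i ≥ a, Close π m ((T ^ (i + d * q)) f) ((T ^ i) f) := by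
      intro q
      induction q with
      | zero => intro i _; exact Close.refl _
      | succ q ih =>
        intro i hi
        rw [mul_add, mul_one, ← add_assoc]
        exact (h1 _ (by omega)).trans (ih i hi)
    refine ⟨a + d, fun r hr i hi => ?_⟩
    obtain ⟨q, hq⟩ := Nat.dvd_factorial hd (show d ≤ r by omega)
    rw [hq]
    exact h2 q i ((Nat.le_add_right a d).trans ((Nat.self_le_factorial _).trans hi))
  have key2 : ∀ m, ∃ r₀, ∀ r ≥ r₀, ∀ s ≥ r₀, Close π m ((T ^ r !) ((T ^ s !) f)) ((T ^ s !) f) ∧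
      Close π m ((T ^ r !) f) ((T ^ s !) f) := by
    intro m
    obtain ⟨r₀, h₀⟩ := key m
    have h1 : ∀ r ≥ r₀, ∀ s ≥ r₀, Close π m ((T ^ r !) ((T ^ s !) f)) ((T ^ s !) f) := by
      intro r hr s hs
      rw [← Module.End.mul_apply, ← pow_add, add_comm]
      exact h₀ r hr _ (Nat.factorial_le hs)
    refine ⟨r₀, fun r hr s hs => ⟨h1 r hr s hs, ?_⟩⟩
    refine (h1 s hs r hr).symm.trans ((Close.of_eq ?_).trans (h1 r hr s hs))
    rw [← Module.End.mul_apply, ← Module.End.mul_apply, ← pow_add, ← pow_add, add_comm]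
  obtain ⟨L, hL, hlim⟩ := hN.lim (fun r => (T ^ r !) f) (fun r => pow_mem hT _ hf) fun m => by
    obtain ⟨r₀, h₀⟩ := key2 m
    exact ⟨r₀, fun r hr => (h₀ r hr r₀ le_rfl).2⟩
  refine ⟨L, hL, fun m => ?_, hlim⟩
  obtain ⟨r₀, h₀⟩ := key2 m
  obtain ⟨r₁, h₁⟩ := hlim m
  refine ⟨r₀, fun r hr => ?_⟩
  have e := h₁ (max r₀ r₁) (le_max_right _ _)
  exact ((e.symm.map (T ^ r !)).trans (h₀ r hr _ (le_max_left _ _)).1).trans e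

end Adic

end

end HidaU2

namespace HidaU2

noncomputable section

/-! ### Hecke operators on algebraic forms and the bijectivity of `U_{k,p}` -/

section HeckeOperators

variable {F K : Type*} [Field F] [NumberField F] [Field K] [NumberField K] [Algebra F K]
  {p : ℕ} (D : Datum F K p)

namespace Datum

/-- Left multiplication by `u` permutes the cosets of `K₁ⁿ` represented by the matrices `(p b; 0
1)`; injectivity suffices, since the index set is finite. This is why the Hecke operators preserve
the level. -/
theorem exists_perm_upper {n : ℕ} (hn : 1 ≤ n) {u : D.G} (hu : u ∈ D.K1 n) :
    ∃ e : Equiv.Perm (𝓞 F ⧸ Ideal.span {(p : 𝓞 F)}), ∀ b, ∃ u' ∈ D.K1 n,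
      u * D.upper (Quotient.out b) = D.upper (Quotient.out (e b)) * u' := by
  have hfin : Finite (𝓞 F ⧸ Ideal.span {(p : 𝓞 F)}) :=
    Ideal.finiteQuotientOfFreeOfNeBot _ D.span_p_ne_bot
  have hdvd : ∀ {x y : 𝓞 F}, Ideal.Quotient.mk (Ideal.span {(p : 𝓞 F)}) x = Ideal.Quotient.mk _ y
      ↔ (p : 𝓞 F) ∣ x - y := by
    intro x y
    rw [Ideal.Quotient.eq, Ideal.mem_span_singleton]
  have hout : ∀ b : 𝓞 F ⧸ Ideal.span {(p : 𝓞 F)},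
      Ideal.Quotient.mk (Ideal.span {(p : 𝓞 F)}) (Quotient.out b) = b := Quotient.out_eq
  have h : ∀ b : 𝓞 F ⧸ Ideal.span {(p : 𝓞 F)}, ∃ b' : 𝓞 F ⧸ Ideal.span {(p : 𝓞 F)},
      (D.upper (Quotient.out b'))⁻¹ * u * D.upper (Quotient.out b) ∈ D.K1 n := by
    intro b
    obtain ⟨b', hb'⟩ := D.exists_upper_of_mem_K1 hn hu (Quotient.out b)
    refine ⟨Ideal.Quotient.mk _ b', ?_⟩
    have h1 := D.upper_inv_mul_upper_mem n (hdvd.mp (hout (Ideal.Quotient.mk _ b')).symm)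
    have h2 := (D.K1 n).mul_mem h1 hb'
    rwa [mul_assoc, mul_assoc, mul_inv_cancel_left, ← mul_assoc] at h2
  choose e he using h
  have hinj : Function.Injective e := by
    intro b b' hbb
    have h1 := (D.K1 n).mul_mem ((D.K1 n).inv_mem (he b)) (he b')
    rw [hbb] at h1
    have h2 : (D.upper (Quotient.out b))⁻¹ * D.upper (Quotient.out b') ∈ D.K1 n := by
      refine (congrArg (· ∈ D.K1 n) ?_).mp h1
      group
    have h3 := hdvd.mpr (D.dvd_of_upper_inv_mul_upper_mem (D.K1_anti (Nat.zero_le n) h2))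
    rw [hout, hout] at h3
    exact h3.symm
  refine ⟨Equiv.ofBijective e (Finite.injective_iff_bijective.mp hinj), fun b => ⟨_, he b, ?_⟩⟩
  change _ = D.upper (Quotient.out (e b)) * _
  group

section Hecke

variable {R M : Type*} [CommRing R] [AddCommGroup M] [Module R M] (act : 𝓞 F → M →ₗ[R] M)

theorem hecke_apply [hft : Fintype (𝓞 F ⧸ Ideal.span {(p : 𝓞 F)})] (f : D.G → M) (g : D.G) :
    D.hecke act f g = ∑ b : 𝓞 F ⧸ Ideal.span {(p : 𝓞 F)},
      act (Quotient.out b) (f (g * D.upper (Quotient.out b))) := by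
  obtain rfl : hft = @Fintype.ofFinite _
      (Ideal.finiteQuotientOfFreeOfNeBot _ D.span_p_ne_bot) := Subsingleton.elim _ _
  rfl

theorem exists_fintype_residue (D : Datum F K p) :
    Nonempty (Fintype (𝓞 F ⧸ Ideal.span {(p : 𝓞 F)})) :=
  haveI : Finite (𝓞 F ⧸ Ideal.span {(p : 𝓞 F)}) :=
    Ideal.finiteQuotientOfFreeOfNeBot _ D.span_p_ne_bot
  ⟨Fintype.ofFinite _⟩

theorem hecke_central : Commute (D.hecke act) (D.central R M) := by
  obtain ⟨_⟩ := D.exists_fintype_residue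
  refine LinearMap.ext fun f => funext fun g => ?_
  change D.hecke act (D.central R M f) g = D.hecke act f (g * D.scalarP)
  rw [hecke_apply, hecke_apply]
  refine Finset.sum_congr rfl fun b _ => ?_
  change act _ (f (g * D.upper _ * D.scalarP)) = _
  rw [mul_assoc, mul_assoc, scalarP_comm]

theorem hecke_rational_mul {f : D.G → M} (hf : ∀ γ ∈ D.rational, ∀ g, f (γ * g) = f g) :
    ∀ γ ∈ D.rational, ∀ g, D.hecke act f (γ * g) = D.hecke act f g := by
  obtain ⟨_⟩ := D.exists_fintype_residue
  intro γ hγ g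
  rw [hecke_apply, hecke_apply]
  refine Finset.sum_congr rfl fun b _ => ?_
  rw [mul_assoc, hf γ hγ]

theorem hecke_mem_nebentypus {α : D.Tor →* Rˣ} {f : D.G → M} (hf : f ∈ D.nebentypus α) :
    D.hecke act f ∈ D.nebentypus (M := M) α := by
  obtain ⟨_⟩ := D.exists_fintype_residue
  intro u t g
  rw [hecke_apply, hecke_apply, Finset.smul_sum]
  refine Finset.sum_congr rfl fun b _ => ?_
  rw [mul_assoc, ← scalar_comm, ← mul_assoc, hf u t, map_smul]

theorem central_mem_nebentypus {α : D.Tor →* Rˣ} {f : D.G → M} (hf : f ∈ D.nebentypus α) :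
    D.central R M f ∈ D.nebentypus (M := M) α := by
  intro u t g
  change f (g * D.scalar u t * D.scalarP) = _ • f (g * D.scalarP)
  rw [mul_assoc, ← scalar_comm, ← mul_assoc, hf u t]

theorem mem_ordinary_iff {T : Module.End R (D.G → M)} {f : D.G → M} :
    f ∈ D.ordinary T ↔ OrdinaryFor (p : R) T f := by
  constructor
  · intro h m
    obtain ⟨r₀, h₀⟩ := h m
    exact ⟨r₀, fun r hr => Close.pi_iff.mpr (h₀ r hr)⟩
  · intro h m
    obtain ⟨r₀, h₀⟩ := h m
    exact ⟨r₀, fun r hr => Close.pi_iff.mp (h₀ r hr)⟩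

end Hecke

section Closed

variable {O R : Type*} [CommRing O] [CommRing R]

theorem finite_exponents (k : D.Emb O →₀ ℕ) :
    {m : D.Emb O × Fin 2 →₀ ℕ | ∀ σ, m (σ, 0) + m (σ, 1) = k σ}.Finite := by
  classical
  have hinj : ∀ i : Fin 2, Function.Injective (fun σ : D.Emb O => (σ, i)) := fun i a b h =>
    (Prod.ext_iff.mp h).1
  refine (Set.finite_Iic (k.mapDomain (fun σ => (σ, (0 : Fin 2)))
    + k.mapDomain (fun σ => (σ, (1 : Fin 2))))).subset fun m hm => ?_
  rintro ⟨σ, i⟩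
  have h := hm σ
  revert i
  rw [Fin.forall_fin_two, Finsupp.add_apply, Finsupp.add_apply, Finsupp.mapDomain_apply (hinj 0),
    Finsupp.mapDomain_apply (hinj 1)]
  constructor <;> omega

open MvPolynomial in
-- Homogeneity of degree `k` leaves finitely many monomials, so coefficientwise limits exist with a
-- common rate of convergence.
theorem isAdicClosed_Lk {π : R} [IsAdicComplete (Ideal.span {π}) R] (k : D.Emb O →₀ ℕ) :
    IsAdicClosed π (D.Lk k : Submodule R (D.Poly O R)) := by
  classical
  have hR : IsAdicClosed π (⊤ : Submodule R R) := isAdicClosed_top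
  have hco : ∀ {m : ℕ} {P Q : D.Poly O R} (μ), Close π m P Q → Close π m (coeff μ P) (coeff μ Q) :=
    fun μ h => h.map (lcoeff R μ)
  set E := (D.finite_exponents k).toFinset
  have hE : ∀ {μ}, μ ∈ E ↔ ∀ σ, μ (σ, 0) + μ (σ, 1) = k σ := by simp [E]
  have hsum : ∀ P ∈ (D.Lk k : Submodule R (D.Poly O R)), ∑ μ ∈ E, monomial μ (coeff μ P) = P := by
    intro P hP
    conv_rhs => rw [← support_sum_monomial_coeff P]
    refine (Finset.sum_subset (fun μ hμ => hE.mpr (hP μ (mem_support_iff.mp hμ)))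
      fun μ _ hμ => ?_).symm
    rw [notMem_support_iff.mp hμ, map_zero]
  refine ⟨fun P hP h => MvPolynomial.ext _ _ fun μ => ?_, fun a ha hc => ?_⟩
  · exact hR.sep _ trivial fun m => by simpa using hco μ (h m)
  · have h1 : ∀ μ, ∃ L : R, L ∈ (⊤ : Submodule R R) ∧ AdicLim π (fun r => coeff μ (a r)) L :=
      fun μ => hR.lim _ (fun _ => trivial) fun m => by
        obtain ⟨r₀, h₀⟩ := hc m
        exact ⟨r₀, fun r hr => hco μ (h₀ r hr)⟩
    choose L _ hL using h1
    refine ⟨∑ μ ∈ E, monomial μ (L μ), Submodule.sum_mem _ fun μ hμ ν hν => ?_, fun m => ?_⟩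
    · rw [coeff_monomial] at hν
      by_cases h : μ = ν
      · exact h ▸ hE.mp hμ
      · rw [if_neg h] at hν
        exact absurd rfl hν
    · choose ρ hρ using fun μ => hL μ m
      refine ⟨∑ μ ∈ E, ρ μ, fun r hr => ?_⟩
      rw [← hsum _ (ha r)]
      refine Close.sum _ fun μ hμ => ?_
      exact (hρ μ r ((Finset.single_le_sum (f := ρ) (fun _ _ => Nat.zero_le _) hμ).trans hr)).map
        (monomial μ)

variable [Algebra O R]

theorem rho_mem_Lk {k : D.Emb O →₀ ℕ} (A : ∀ v : D.Sp, GL (Fin 2) (v.1.adicCompletionIntegers F))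
    {P : D.Poly O R} (hP : P ∈ D.Lk k) : D.rho A P ∈ D.Lk k :=
  D.subst_mem_Lk _ hP

theorem rhoNorm_mem_Lk {k : D.Emb O →₀ ℕ}
    (A : ∀ v : D.Sp, Matrix (Fin 2) (Fin 2) (v.1.adicCompletionIntegers F))
    {P : D.Poly O R} (hP : P ∈ D.Lk k) : D.rhoNorm A P ∈ D.Lk k :=
  D.subst_mem_Lk _ hP

theorem forms_anti (k : D.Emb O →₀ ℕ) {n n' : ℕ} (h : n ≤ n') :
    (D.forms k n : Submodule R (D.G → D.Poly O R)) ≤ D.forms k n' := by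
  rintro f ⟨h1, h2, h3⟩
  exact ⟨h1, h2, fun u hu => h3 u (D.K1_anti h hu)⟩

theorem ordForms_anti (k : D.Emb O →₀ ℕ) {n n' : ℕ} (h : n ≤ n') (α : D.Tor →* Rˣ) :
    D.ordForms k n α ≤ D.ordForms k n' α :=
  inf_le_inf (inf_le_inf (D.forms_anti k h) le_rfl) le_rfl

/-- All conditions on a form are equations between its values under linear maps, and such equations
survive uniform limits. -/
theorem isAdicClosed_forms [IsAdicComplete (Ideal.span {(p : R)}) R] (k : D.Emb O →₀ ℕ) (n : ℕ)
    (α : D.Tor →* Rˣ) : IsAdicClosed (p : R)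
      (D.forms k n ⊓ D.nebentypus α : Submodule R (D.G → D.Poly O R)) := by
  have hL : IsAdicClosed (p : R) (D.Lk k : Submodule R (D.Poly O R)) := D.isAdicClosed_Lk k
  refine (hL.pi D.G).of_approx (fun f hf g _ => hf.1.1 g) fun f hf happ => ?_
  have hfk : ∀ g, f g ∈ D.Lk k := fun g => hf g trivial
  refine ⟨⟨hfk, fun γ hγ g => hL.eq (hfk _) (hfk _) fun m => ?_, fun u hu A hA g =>
    hL.eq (hfk _) (D.rho_mem_Lk _ (hfk _)) fun m => ?_⟩, fun u t g =>
    hL.eq (hfk _) (Submodule.smul_mem _ _ (hfk _)) fun m => ?_⟩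
  all_goals
    obtain ⟨f', ⟨⟨h1, h2, h3⟩, h4⟩, hc⟩ := happ m
    have hc := Close.pi_iff.mp hc
  · exact (hc (γ * g)).symm.trans ((Close.of_eq (h2 γ hγ g)).trans (hc g))
  · exact (hc (g * u)).symm.trans ((Close.of_eq (h3 u hu A hA g)).trans
      ((hc g).map (D.rho A⁻¹).toLinearMap))
  · exact (hc _).symm.trans ((Close.of_eq (h4 u t g)).trans
      ((hc g).map (LinearMap.lsmul R (D.Poly O R) _)))

/-- The element `u` permutes the representatives, `u (p b; 0 1) = (p b'; 0 1) u'`. The same matrix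
relation intertwines the normalised actions with `ρ_k(u)⁻¹` and `ρ_k(u')⁻¹`. -/
theorem Uk_mem_forms {k : D.Emb O →₀ ℕ} {n : ℕ} (hn : 1 ≤ n) {f : D.G → D.Poly O R}
    (hf : f ∈ D.forms k n) : D.Uk f ∈ D.forms k n := by
  obtain ⟨_⟩ := D.exists_fintype_residue
  obtain ⟨h1, h2, h3⟩ := hf
  refine ⟨fun g => ?_, D.hecke_rational_mul _ h2, fun u hu A hA g => ?_⟩
  · rw [Uk, hecke_apply]
    exact Submodule.sum_mem _ fun b _ => D.rhoNorm_mem_Lk _ (h1 _)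
  · obtain ⟨e, he⟩ := D.exists_perm_upper hn hu
    rw [Uk, hecke_apply, hecke_apply, map_sum]
    refine Fintype.sum_equiv e _ _ fun b => ?_
    obtain ⟨u', hu', hrel⟩ := he b
    obtain ⟨A', hA', -⟩ := D.exists_intGL_of_mem_K1 hu'
    rw [mul_assoc, hrel, ← mul_assoc, h3 u' hu' A' hA']
    refine D.rhoNorm_rho_inv (fun v => D.matrix_relation hrel (hA v) (hA' v)) (fun v => ?_)
      (fun v => ?_) _
    · simp [Matrix.det_fin_two]
    · simpa [Matrix.det_fin_two] using D.p_ne_zero' v.1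

theorem central_mem_forms {k : D.Emb O →₀ ℕ} {n : ℕ} {f : D.G → D.Poly O R}
    (hf : f ∈ D.forms k n) : D.central R (D.Poly O R) f ∈ D.forms k n := by
  obtain ⟨h1, h2, h3⟩ := hf
  refine ⟨fun g => h1 _, fun γ hγ g => ?_, fun u hu A hA g => ?_⟩
  · change f (γ * g * D.scalarP) = f (g * D.scalarP)
    rw [mul_assoc, h2 γ hγ]
  · change f (g * u * D.scalarP) = D.rho A⁻¹ (f (g * D.scalarP))
    rw [mul_assoc, scalarP_comm, ← mul_assoc, h3 u hu A hA]

theorem mem_ordForms_iff {k : D.Emb O →₀ ℕ} {n : ℕ} {α : D.Tor →* Rˣ} {f : D.G → D.Poly O R} :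
    f ∈ D.ordForms k n α ↔ f ∈ D.forms k n ⊓ D.nebentypus α ∧
      OrdinaryFor (p : R) (D.Uk * D.central R (D.Poly O R)) f :=
  and_congr_right fun _ => D.mem_ordinary_iff

theorem Uk_bijOn [IsAdicComplete (Ideal.span {(p : R)}) R] (k : D.Emb O →₀ ℕ) {n : ℕ}
    (hn : 1 ≤ n) (α : D.Tor →* Rˣ) :
    Set.BijOn D.Uk (D.ordForms k n α : Set (D.G → D.Poly O R)) (D.ordForms k n α) := by
  have hN := D.isAdicClosed_forms (R := R) k n α
  have hU : ∀ f ∈ (D.forms k n ⊓ D.nebentypus α : Submodule R (D.G → D.Poly O R)),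
      D.Uk f ∈ (D.forms k n ⊓ D.nebentypus α : Submodule R (D.G → D.Poly O R)) := fun f hf =>
    ⟨D.Uk_mem_forms hn hf.1, D.hecke_mem_nebentypus _ hf.2⟩
  have hS : ∀ f ∈ (D.forms k n ⊓ D.nebentypus α : Submodule R (D.G → D.Poly O R)),
      D.central R (D.Poly O R) f
        ∈ (D.forms k n ⊓ D.nebentypus α : Submodule R (D.G → D.Poly O R)) := fun f hf =>
    ⟨D.central_mem_forms hf.1, D.central_mem_nebentypus hf.2⟩
  have hc : Commute (D.Uk : Module.End R (D.G → D.Poly O R)) (D.central R (D.Poly O R)) :=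
    D.hecke_central _
  refine ⟨fun f hf => ?_, fun f hf f' hf' h => ?_, fun f hf => ?_⟩
  · obtain ⟨h1, h2⟩ := D.mem_ordForms_iff.mp hf
    refine D.mem_ordForms_iff.mpr ⟨hU f h1, h2.map D.Uk fun x => ?_⟩
    exact congrArg (fun X : Module.End R (D.G → D.Poly O R) => X x)
      ((Commute.refl _).mul_right hc).eq
  · obtain ⟨h1, h2⟩ := D.mem_ordForms_iff.mp hf
    obtain ⟨h1', h2'⟩ := D.mem_ordForms_iff.mp hf'
    exact OrdinaryFor.eq_of_map_eq hN hc h1 h1' h2 h2' h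
  · obtain ⟨h1, h2⟩ := D.mem_ordForms_iff.mp hf
    obtain ⟨L, hL, hL', h⟩ := h2.exists_preimage hN hU hS hc h1
    exact ⟨L, D.mem_ordForms_iff.mpr ⟨hL, hL'⟩, h⟩

end Closed

end Datum

end HeckeOperators

end

end HidaU2

namespace HidaU2

noncomputable section

/-! ### The pairings `(·, ·)_n` on algebraic forms -/

section AlgebraicPairing

open MvPolynomial

variable {F K : Type*} [Field F] [NumberField F] [Field K] [NumberField K] [Algebra F K] {p : ℕ}
  (D : Datum F K p) {O R : Type*} [CommRing O] [CommRing R] [Algebra O R]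

namespace Datum

/-- The action on the second argument passes through `τ_n` and becomes that of the contragredient of
`A`. Moving the action on the first argument to the other side transposes it, and the two cancel. -/
theorem tauPairing_rho (k : D.Emb O →₀ ℕ) (n : ℕ)
    {A A' : ∀ v : D.Sp, GL (Fin 2) (v.1.adicCompletionIntegers F)}
    (h : ∀ v, (contra (A v)).1 * !![(p : v.1.adicCompletionIntegers F) ^ n, 0; 0, 1]
      = !![(p : v.1.adicCompletionIntegers F) ^ n, 0; 0, 1] * (A' v).1)
    {P : D.Poly O R} (hP : P ∈ D.Lk k) (Q : D.Poly O R) :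
    D.tauPairing k n (D.rho A⁻¹ P) (D.rho A'⁻¹ Q) = D.tauPairing k n P Q := by
  have h0 : ∀ v : D.Sp,
      (!![(p : v.1.adicCompletionIntegers F) ^ n, 0; 0, 1]).det ≠ 0 := fun v => by
    simpa [Matrix.det_fin_two] using fun h => absurd h (D.p_ne_zero' v.1)
  rw [tauPairing, D.rhoNorm_rho_inv (B := fun v => contra (A v)) h (fun _ => rfl) h0, rho_inv_eq,
    D.twisted_map_subst k _ hP, rho_inv_eq, subst_embMat_mul]
  have h1 : (fun v : D.Sp => ((A v).1ᵀ)ᵀ * ((contra (A v)).1)ᵀ) = fun _ => 1 := by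
    funext v
    rw [contra_val, Matrix.transpose_transpose, Matrix.transpose_transpose, ← Units.val_mul,
      mul_inv_cancel, Units.val_one]
  rw [h1, subst_embMat_one]
  rfl

/-- The identity `τ_n (p b; 0 1) = ū τ_{n+1}` on coefficients. The contragredient factor has
determinant one, so its normalised action is the adjoint of the action of `low n b`. -/
theorem tauPairing_rhoNorm_upper (k : D.Emb O →₀ ℕ) (n : ℕ) (b : 𝓞 F)
    {P : D.Poly O R} (hP : P ∈ D.Lk k) (Q : D.Poly O R) :
    D.tauPairing k n P (D.rhoNorm (fun v => !![(p : v.1.adicCompletionIntegers F),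
        algebraMap (𝓞 F) (v.1.adicCompletionIntegers F) b; 0, 1]) Q)
      = D.tauPairing k (n + 1) (D.rho (D.lowMat n b)⁻¹ P) Q := by
  have h1 : (fun v : D.Sp => !![(p : v.1.adicCompletionIntegers F) ^ n, 0; 0, 1]
      * !![(p : v.1.adicCompletionIntegers F),
        algebraMap (𝓞 F) (v.1.adicCompletionIntegers F) b; 0, 1])
      = fun v => (contra (D.lowMat n b v)).1
        * !![(p : v.1.adicCompletionIntegers F) ^ (n + 1), 0; 0, 1] := by
    funext v
    rw [contra_lowMat, Matrix.mul_fin_two, Matrix.mul_fin_two]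
    simp [pow_succ]
  have h2 : (fun v : D.Sp => ((contra (D.lowMat n b v)).1.adjugate)ᵀ)
      = fun v => (((D.lowMat n b v).1)ᵀ)ᵀ := by
    funext v
    have hdet : (contra (D.lowMat n b v)).1.det = 1 := by
      rw [contra_lowMat]
      simp [Matrix.det_fin_two]
    have h3 : (contra (D.lowMat n b v)).1.adjugate = ((D.lowMat n b v).1)ᵀ := by
      have h4 := Matrix.mul_adjugate (contra (D.lowMat n b v)).1
      rw [hdet, one_smul] at h4
      have h5 : ((D.lowMat n b v).1)ᵀ * (contra (D.lowMat n b v)).1 = 1 := by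
        rw [contra_val, ← Matrix.transpose_mul, ← Units.val_mul, inv_mul_cancel, Units.val_one,
          Matrix.transpose_one]
      rw [← one_mul (Matrix.adjugate _), ← h5, Matrix.mul_assoc, h4, mul_one]
    rw [h3]
  rw [tauPairing, rhoNorm_mul, h1, ← rhoNorm_mul, tauPairing, rho_inv_eq,
    D.twisted_map_subst k _ hP]
  conv_lhs => rw [rhoNorm, h2]

variable {k : D.Emb O →₀ ℕ} {α : D.Tor →* Rˣ} {f f' : D.G → D.Poly O R}

theorem scalar_one_smul {M : Type*} [AddCommGroup M] [Module R M] {f : D.G → M}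
    (hf : f ∈ D.nebentypus α) (u : ∀ v : D.Sp, (v.1.adicCompletionIntegers F)ˣ) (g : D.G) :
    f (g * D.scalar u 1) = ((α (u, 1) : Rˣ) : R) • f g := by
  rw [hf u 1 g]
  have h : (fun v : D.Ss => Units.map (Ideal.Quotient.mk (locIdeal v.1 D.s)).toMonoidHom
      ((1 : ∀ v : D.Ss, (v.1.adicCompletionIntegers F)ˣ) v)) = 1 := funext fun v => map_one _
  rw [h]

theorem exists_Uk_pow_eq [IsAdicComplete (Ideal.span {(p : R)}) R] {n : ℕ} (hn : 1 ≤ n)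
    (hf : f ∈ D.ordForms k n α) (i : ℕ) : ∃ h ∈ D.ordForms k n α, (D.Uk ^ i) h = f := by
  have := (D.Uk_bijOn (R := R) k hn α).iterate i
  obtain ⟨h, hh, e⟩ := this.surjOn hf
  exact ⟨h, hh, by rw [Module.End.pow_apply, e]⟩

theorem eq_of_Uk_pow_eq [IsAdicComplete (Ideal.span {(p : R)}) R] {n : ℕ} (hn : 1 ≤ n)
    (hf : f ∈ D.ordForms k n α) (hf' : f' ∈ D.ordForms k n α) {i : ℕ}
    (h : (D.Uk ^ i) f = (D.Uk ^ i) f') : f = f' := by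
  refine ((D.Uk_bijOn (R := R) k hn α).iterate i).injOn hf hf' ?_
  rwa [Module.End.pow_apply, Module.End.pow_apply] at h

/-- The sequence `U_{k,p}^{-n} f'`. -/
theorem exists_Uk_inverse [IsAdicComplete (Ideal.span {(p : R)}) R] {n₀ : ℕ} (hn₀ : 1 ≤ n₀)
    (hf' : f' ∈ D.ordForms k n₀ α) : ∃ h : ℕ → D.G → D.Poly O R,
      (∀ n, h n ∈ D.ordForms k n₀ α) ∧ (∀ n, (D.Uk ^ n) (h n) = f') ∧
      (∀ n, D.Uk (h (n + 1)) = h n) ∧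
      ∀ n ≥ n₀, ∀ h' ∈ D.ordForms k n α, (D.Uk ^ n) h' = f' → h' = h n := by
  choose h hh hU using fun n => D.exists_Uk_pow_eq hn₀ hf' n
  refine ⟨h, hh, hU, fun n => ?_, fun n hn h' hh' e => ?_⟩
  · refine D.eq_of_Uk_pow_eq (i := n) hn₀ ((D.Uk_bijOn (R := R) k hn₀ α).mapsTo (hh _)) (hh n) ?_
    rw [← Module.End.mul_apply, ← pow_succ, hU, hU]
  · exact D.eq_of_Uk_pow_eq (hn₀.trans hn) hh' (D.ordForms_anti k hn α (hh n)) (e.trans (hU n).symm)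

section TotallyReal

variable [NumberField.IsTotallyReal F] [NumberField.IsTotallyComplex K]

/-- An element of `K₀ⁿ` is a scalar at `p` times an element of `K₁ⁿ`. The latter acts by compatible
matrices on the two factors; the scalar `u` contributes `α(u) α(u⁻¹) = 1`, as `u ↦ τ⁻¹ ū τ` inverts
scalars. -/
theorem biInv_tauPairing {n : ℕ} (hn : 1 ≤ n) (hf : f ∈ D.forms k n)
    (hfα : f ∈ D.nebentypus (M := D.Poly O R) α) (hf' : f' ∈ D.forms k n)
    (hfα' : f' ∈ D.nebentypus (M := D.Poly O R) α) :
    BiInv D.rational (D.K0 n) fun g => D.tauPairing k n (f g) (f' (D.iota n g)) := by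
  intro γ hγ g x hx
  obtain ⟨u, hu⟩ := D.exists_scalar_of_mem_K0 hn hx
  obtain ⟨A, hA, hA0⟩ := D.exists_intGL_of_mem_K1 hu
  obtain ⟨A', hA', -⟩ := D.exists_intGL_of_mem_K1 (D.theta_mem_K1 hu)
  have hx' : x = D.scalar u 1 * ((D.scalar u 1)⁻¹ * x) := by group
  set y := (D.scalar u 1)⁻¹ * x
  have hinv : (D.scalar u⁻¹ 1⁻¹ : D.G) = D.scalar u⁻¹ 1 := by rw [inv_one]
  have e1 : f (γ * g * x) = D.rho A⁻¹ (((α (u, 1) : Rˣ) : R) • f g) := by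
    rw [mul_assoc, hf.2.1 γ hγ, hx', ← mul_assoc, hf.2.2 y hu A hA, D.scalar_one_smul hfα]
  have e2 : f' (D.iota n (γ * g * x))
      = D.rho A'⁻¹ (((α (u⁻¹, 1) : Rˣ) : R) • f' (D.iota n g)) := by
    rw [mul_assoc, iota_rational_mul, hf'.2.1 _ (D.bar_mem_rational hγ), iota_mul, hx', theta_mul,
      theta_scalar, hinv, ← mul_assoc, hf'.2.2 _ (D.theta_mem_K1 hu) A' hA',
      D.scalar_one_smul hfα']
  change D.tauPairing k n (f (γ * g * x)) (f' (D.iota n (γ * g * x))) = _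
  have hα : ((α (u, 1) : Rˣ) : R) * ((α (u⁻¹, 1) : Rˣ) : R) = 1 := by
    rw [← Units.val_mul, ← map_mul]
    have : ((u, 1) * (u⁻¹, 1) : D.Tor) = 1 := by
      refine Prod.ext (mul_inv_cancel u) (mul_one _)
    rw [this, map_one, Units.val_one]
  rw [e1, e2, D.tauPairing_rho k n (fun v => D.theta_matrix_relation (hA v) (hA' v) (hA0 v).2)
    (Submodule.smul_mem _ _ (hf.1 g)), tauPairing_smul, hα, map_one, one_mul]

theorem pairing_eq_cosetSum (k : D.Emb O →₀ ℕ) (n : ℕ) (f f' : D.G → D.Poly O R) :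
    D.pairing k n f f' = cosetSum D.rational (D.K0 n)
      (fun g => D.tauPairing k n (f g) (f' (D.iota n g))) := rfl

/-- The terms of the Hecke operator are matched with the representatives `low n b` of `K₀ⁿ / K₀ⁿ⁺¹`.
Raising the level by one thus compensates one factor `U⁻¹`. -/
theorem pairing_Uk (hD : D.SufficientlySmall) {n : ℕ} (hn : 1 ≤ n) (hf : f ∈ D.forms k n)
    (hfα : f ∈ D.nebentypus (M := D.Poly O R) α) (hf' : f' ∈ D.forms k n)
    (hfα' : f' ∈ D.nebentypus (M := D.Poly O R) α) :
    D.pairing k n f (D.Uk f') = D.pairing k (n + 1) f f' := by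
  rw [pairing_eq_cosetSum, pairing_eq_cosetSum]
  refine D.cosetSum_hecke hD hn _ (D.tauPairing k n) (D.tauPairing k (n + 1)) f f'
    (fun P => ⟨AddMonoidHom.mk' _ (D.tauPairing_add_right k n P), fun _ => rfl⟩)
    (fun b g Q => ?_) (D.biInv_tauPairing (by omega) (D.forms_anti k (Nat.le_succ n) hf) hfα
      (D.forms_anti k (Nat.le_succ n) hf') hfα')
  rw [hf.2.2 _ (D.low_mem_K1 n b) (D.lowMat n b) 
    (fun v => (D.atP_placeP v fun v => intGL v.1 (D.lowMat n b v)).symm)]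
  exact D.tauPairing_rhoNorm_upper k n b (hf.1 g) Q

/-- For large `n` the pairing is congruent to the pairing of the leading coefficients. -/
theorem exists_pairing_eq [IsAdicComplete (Ideal.span {(p : R)}) R] (k : D.Emb O →₀ ℕ) :
    ∃ N₀ : ℕ, ∀ m n, N₀ + m ≤ n → ∀ f f' : D.G → D.Poly O R, (∀ g, f g ∈ D.Lk k) →
      ∃ s : D.G → R, D.pairing k n f f' = algebraMap R _ (cosetSum D.rational (D.K0 n)
        (fun g => (f g).coeff (k.mapDomain fun σ => (σ, 0))
          * (f' (D.iota n g)).coeff (k.mapDomain fun σ => (σ, 0)) + (p : R) ^ m * s g)) := by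
  obtain ⟨N₀, hN₀⟩ := D.exists_tauPairing_eq (R := R) k
  refine ⟨N₀, fun m n hn f f' hf => ?_⟩
  choose s hs using fun g => hN₀ m n hn (f g) (hf g) (f' (D.iota n g))
  refine ⟨s, ?_⟩
  have := D.finite_K0 n
  rw [pairing_eq_cosetSum, cosetSum_congr hs, map_cosetSum]

theorem pairing_inverse_eq (hD : D.SufficientlySmall) {n₀ : ℕ} (hn₀ : 1 ≤ n₀)
    (hf : f ∈ D.ordForms k n₀ α) {h : ℕ → D.G → D.Poly O R}
    (hh : ∀ n, h n ∈ D.ordForms k n₀ α) (hU : ∀ n, D.Uk (h (n + 1)) = h n) {n : ℕ} (hn : n₀ ≤ n) :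
    D.pairing k n f (h n) = D.pairing k n₀ f (h n₀) := by
  induction n, hn using Nat.le_induction with
  | base => rfl
  | succ n hn ih =>
    rw [← ih, ← hU n]
    exact (D.pairing_Uk hD (hn₀.trans hn) (D.forms_anti k hn hf.1.1) hf.1.2
      (D.forms_anti k hn (hh _).1.1) (hh _).1.2).symm

/-- Integrality holds at one sufficiently large level, and the value there equals the value at every
other level. -/
theorem exists_pairing_value (hD : D.SufficientlySmall)
    [IsAdicComplete (Ideal.span {(p : R)}) R] {n₀ : ℕ} (hn₀ : 1 ≤ n₀)
    (hf : f ∈ D.ordForms k n₀ α) (hf' : f' ∈ D.ordForms k n₀ α) :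
    ∃ r : R, ∀ n ≥ n₀, ∀ h ∈ D.ordForms k n α, (D.Uk ^ n) h = f' →
      D.pairing k n f h = algebraMap R _ r := by
  obtain ⟨h, hh, -, hU, huniq⟩ := D.exists_Uk_inverse hn₀ hf'
  obtain ⟨N₀, hN₀⟩ := D.exists_pairing_eq (R := R) k
  obtain ⟨s, hs⟩ := hN₀ 0 (max N₀ n₀) (le_max_left _ _) f (h (max N₀ n₀)) hf.1.1.1
  refine ⟨cosetSum D.rational (D.K0 (max N₀ n₀)) fun g => (f g).coeff (k.mapDomain fun σ => (σ, 0))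
    * (h (max N₀ n₀) (D.iota (max N₀ n₀) g)).coeff (k.mapDomain fun σ => (σ, 0))
    + (p : R) ^ 0 * s g, fun n hn h' hh' e => ?_⟩
  rw [huniq n hn h' hh' e, D.pairing_inverse_eq hD hn₀ hf hh hU hn,
    ← D.pairing_inverse_eq hD hn₀ hf hh hU (le_max_right N₀ n₀), hs]

end TotallyReal

end Datum

end AlgebraicPairing

end

end HidaU2

namespace HidaU2

noncomputable section

/-! ### Functions with trivial coefficients and their pairings -/

section TrivialCoefficients

variable {F K : Type*} [Field F] [NumberField F] [Field K] [NumberField K] [Algebra F K] {p : ℕ}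
  (D : Datum F K p)

namespace Datum

section Definitions

variable (A : Type*) [CommRing A]

/-- The operator `U_p S` on functions with values in `A`. -/
def heckeT : Module.End A (D.G → A) := D.Utriv A * D.central A A

/-- The functions on `G₁(F) \ G₁(𝔸_{F,f}) / K₁ⁿ` with values in `A`. -/
def trivForms (n : ℕ) : Submodule A (D.G → A) where
  carrier := {f | (∀ γ ∈ D.rational, ∀ g, f (γ * g) = f g) ∧ ∀ u ∈ D.K1 n, ∀ g, f (g * u) = f g}
  zero_mem' := by simp
  add_mem' := by
    rintro f f' ⟨h1, h2⟩ ⟨h1', h2'⟩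
    exact ⟨fun γ hγ g => by simp [h1 γ hγ g, h1' γ hγ g], fun u hu g => by
      simp [h2 u hu g, h2' u hu g]⟩
  smul_mem' := by
    rintro a f ⟨h1, h2⟩
    exact ⟨fun γ hγ g => by simp [h1 γ hγ g], fun u hu g => by simp [h2 u hu g]⟩

end Definitions

variable {A : Type*} [CommRing A]

theorem Utriv_apply [Fintype (𝓞 F ⧸ Ideal.span {(p : 𝓞 F)})] (f : D.G → A) (g : D.G) :
    D.Utriv A f g = ∑ b : 𝓞 F ⧸ Ideal.span {(p : 𝓞 F)}, f (g * D.upper (Quotient.out b)) :=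
  D.hecke_apply _ f g

/-- Additivity of `c` is enough. The statement serves both reduction modulo `p^m` and the passage
from `ℤ/N` to a ring in which `N = 0`. -/
theorem heckeT_comp {A' : Type*} [CommRing A'] (c : A →+ A') (f : D.G → A) :
    D.heckeT A' (fun g => c (f g)) = fun g => c (D.heckeT A f g) := by
  obtain ⟨_⟩ := D.exists_fintype_residue
  funext g
  change D.Utriv A' _ g = c (D.Utriv A _ g)
  rw [Utriv_apply, Utriv_apply, map_sum]
  rfl

theorem Utriv_comp {A' : Type*} [CommRing A'] (c : A →+ A') (f : D.G → A) :
    D.Utriv A' (fun g => c (f g)) = fun g => c (D.Utriv A f g) := by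
  obtain ⟨_⟩ := D.exists_fintype_residue
  funext g
  rw [Utriv_apply, Utriv_apply, map_sum]

theorem heckeT_pow_comp {A' : Type*} [CommRing A'] (c : A →+ A') (n : ℕ) (f : D.G → A) :
    (D.heckeT A' ^ n) (fun g => c (f g)) = fun g => c ((D.heckeT A ^ n) f g) := by
  induction n with
  | zero => rfl
  | succ n ih => rw [pow_succ', pow_succ', Module.End.mul_apply, ih, heckeT_comp]; rfl

theorem Utriv_mem_trivForms {n : ℕ} (hn : 1 ≤ n) {f : D.G → A} (hf : f ∈ D.trivForms A n) :
    D.Utriv A f ∈ D.trivForms A n := by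
  obtain ⟨_⟩ := D.exists_fintype_residue
  refine ⟨D.hecke_rational_mul _ hf.1, fun u hu g => ?_⟩
  obtain ⟨e, he⟩ := D.exists_perm_upper hn hu
  rw [Utriv_apply, Utriv_apply]
  refine Fintype.sum_equiv e _ _ fun b => ?_
  obtain ⟨u', hu', hrel⟩ := he b
  rw [mul_assoc, hrel, ← mul_assoc, hf.2 u' hu']

theorem central_mem_trivForms {n : ℕ} {f : D.G → A} (hf : f ∈ D.trivForms A n) :
    D.central A A f ∈ D.trivForms A n := by
  refine ⟨fun γ hγ g => ?_, fun u hu g => ?_⟩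
  · change f (γ * g * D.scalarP) = f (g * D.scalarP)
    rw [mul_assoc, hf.1 γ hγ]
  · change f (g * u * D.scalarP) = f (g * D.scalarP)
    rw [mul_assoc, scalarP_comm, ← mul_assoc, hf.2 u hu]

theorem trivForms_anti {n n' : ℕ} (h : n ≤ n') : D.trivForms A n ≤ D.trivForms A n' :=
  fun _ hf => ⟨hf.1, fun u hu => hf.2 u (D.K1_anti h hu)⟩

/-- The functions of level `n` with nebentypus `α`. -/
def nebForms (n : ℕ) (α : D.Tor →* Aˣ) : Submodule A (D.G → A) :=
  D.trivForms A n ⊓ D.nebentypus α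

variable {α : D.Tor →* Aˣ} {n : ℕ} {f f' : D.G → A}

theorem Utriv_mem_nebForms (hn : 1 ≤ n) (hf : f ∈ D.nebForms n α) :
    D.Utriv A f ∈ D.nebForms n α :=
  ⟨D.Utriv_mem_trivForms hn hf.1, D.hecke_mem_nebentypus _ hf.2⟩

theorem central_mem_nebForms (hf : f ∈ D.nebForms n α) :
    D.central A A f ∈ D.nebForms n α :=
  ⟨D.central_mem_trivForms hf.1, D.central_mem_nebentypus hf.2⟩

theorem heckeT_mem_nebForms (hn : 1 ≤ n) (hf : f ∈ D.nebForms n α) :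
    D.heckeT A f ∈ D.nebForms n α :=
  D.Utriv_mem_nebForms hn (D.central_mem_nebForms hf)

theorem nebForms_anti {n' : ℕ} (h : n ≤ n') : D.nebForms n α ≤ D.nebForms n' α :=
  inf_le_inf (D.trivForms_anti h) le_rfl

section TotallyReal

variable [NumberField.IsTotallyReal F] [NumberField.IsTotallyComplex K]

/-- The pairing of functions of level `n`. -/
def levelPairing (n : ℕ) (f f' : D.G → A) : A :=
  cosetSum D.rational (D.K0 n) fun g => f g * f' (D.iota n g)

theorem map_levelPairing {A' : Type*} [CommRing A'] (c : A →+* A') (n : ℕ) (f f' : D.G → A) :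
    c (D.levelPairing n f f') = D.levelPairing n (fun g => c (f g)) (fun g => c (f' g)) := by
  have := D.finite_K0 n
  rw [levelPairing, map_cosetSum]
  exact cosetSum_congr fun g => map_mul c _ _

theorem levelPairing_add_left (n : ℕ) (f₁ f₂ f' : D.G → A) :
    D.levelPairing n (f₁ + f₂) f' = D.levelPairing n f₁ f' + D.levelPairing n f₂ f' := by
  have := D.finite_K0 n
  rw [levelPairing, cosetSum, levelPairing, cosetSum, levelPairing, cosetSum,
    ← finsum_add_distrib (Set.toFinite _) (Set.toFinite _)]
  exact finsum_congr fun q => add_mul _ _ _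

theorem levelPairing_add_right (n : ℕ) (f f₁ f₂ : D.G → A) :
    D.levelPairing n f (f₁ + f₂) = D.levelPairing n f f₁ + D.levelPairing n f f₂ := by
  have := D.finite_K0 n
  rw [levelPairing, cosetSum, levelPairing, cosetSum, levelPairing, cosetSum,
    ← finsum_add_distrib (Set.toFinite _) (Set.toFinite _)]
  exact finsum_congr fun q => mul_add _ _ _

theorem levelPairing_smul_left (n : ℕ) (a : A) (f f' : D.G → A) :
    D.levelPairing n (a • f) f' = a * D.levelPairing n f f' := by
  have := D.finite_K0 n
  have h := map_cosetSum (Γ := D.rational) (H := D.K0 n) (AddMonoidHom.mulLeft a)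
    fun g => f g * f' (D.iota n g)
  exact (cosetSum_congr fun g => mul_assoc a _ _).trans h.symm

theorem levelPairing_smul_right (n : ℕ) (a : A) (f f' : D.G → A) :
    D.levelPairing n f (a • f') = a * D.levelPairing n f f' := by
  have := D.finite_K0 n
  have h := map_cosetSum (Γ := D.rational) (H := D.K0 n) (AddMonoidHom.mulLeft a)
    fun g => f g * f' (D.iota n g)
  exact (cosetSum_congr fun g => mul_left_comm _ a _).trans h.symm

/-- Scalars at `p` and at `𝔰` act on the two factors through `α` and `α⁻¹`, so the summand is
invariant under the larger group `K₀₀ⁿ` and not only under `K₀ⁿ`. -/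
theorem biInv_levelPairing (hn : 1 ≤ n) (hf : f ∈ D.nebForms n α) (hf' : f' ∈ D.nebForms n α) :
    BiInv D.rational (D.K00 n) fun g => f g * f' (D.iota n g) := by
  intro γ hγ g x hx
  obtain ⟨u, t, hu⟩ := D.exists_scalar_of_mem_K00 hn hx
  obtain ⟨y, hy, rfl⟩ : ∃ y ∈ D.K1 n, x = D.scalar u t * y := ⟨_, hu, by group⟩
  change f (γ * g * (D.scalar u t * y)) * f' (D.iota n (γ * g * (D.scalar u t * y))) = _
  rw [mul_assoc γ g _, iota_rational_mul, iota_mul, hf.1.1 γ hγ, hf'.1.1 _ (D.bar_mem_rational hγ),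
    theta_mul, theta_scalar, ← mul_assoc, ← mul_assoc, hf.1.2 y hy,
    hf'.1.2 _ (D.theta_mem_K1 hy), hf.2 u t, hf'.2 u⁻¹ t⁻¹, smul_eq_mul, smul_eq_mul]
  set τ : D.Tor := (u, fun v => Units.map (Ideal.Quotient.mk (locIdeal v.1 D.s)).toMonoidHom (t v))
  have hτ : ((u⁻¹, fun v => Units.map (Ideal.Quotient.mk (locIdeal v.1 D.s)).toMonoidHom
      (t⁻¹ v)) : D.Tor) = τ⁻¹ := by
    refine Prod.ext rfl (funext fun v => ?_)
    exact map_inv (Units.map (Ideal.Quotient.mk (locIdeal v.1 D.s)).toMonoidHom) (t v)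
  have h1 : ((α τ : Aˣ) : A) * ((α τ⁻¹ : Aˣ) : A) = 1 := by
    rw [← Units.val_mul, ← map_mul, mul_inv_cancel, map_one, Units.val_one]
  rw [hτ]
  linear_combination (f g * f' (D.iota n g)) * h1

theorem BiInv_mono {G B : Type*} [Group G] {Γ H H' : Subgroup G} (h : H ≤ H')
    {Ψ : G → B} (hΨ : BiInv Γ H' Ψ) : BiInv Γ H Ψ := fun γ hγ g x hx => hΨ γ hγ g x (h hx)

/-- The map `g ↦ ḡ τ_n` is an involution of the double coset space and exchanges the two factors. -/
theorem levelPairing_comm (hn : 1 ≤ n) (hf : f ∈ D.nebForms n α) (hf' : f' ∈ D.nebForms n α) :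
    D.levelPairing n f f' = D.levelPairing n f' f := by
  rw [levelPairing, ← D.cosetSum_iota (BiInv_mono (D.K0_le_K00 n) (D.biInv_levelPairing hn hf hf'))]
  exact cosetSum_congr fun g => by rw [iota_iota, mul_comm]

theorem levelPairing_Utriv (hD : D.SufficientlySmall) (hn : 1 ≤ n) (hf : f ∈ D.nebForms n α)
    (hf' : f' ∈ D.nebForms n α) :
    D.levelPairing n f (D.Utriv A f') = D.levelPairing (n + 1) f f' := by
  refine D.cosetSum_hecke hD hn _ (fun x y => x * y) (fun x y => x * y) f f'
    (fun x => ⟨AddMonoidHom.mulLeft x, fun _ => rfl⟩) (fun b g y => ?_)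
    (BiInv_mono (D.K0_le_K00 _) (D.biInv_levelPairing (by omega)
      (D.nebForms_anti (Nat.le_succ n) hf) (D.nebForms_anti (Nat.le_succ n) hf')))
  change f g * y = f (g * D.low n b) * y
  rw [hf.1.2 _ (D.low_mem_K1 n b)]

/-- With `U_p` in either argument the pairing equals the pairing at level `n + 1`, which is
symmetric. -/
theorem levelPairing_Utriv_left (hD : D.SufficientlySmall) (hn : 1 ≤ n) (hf : f ∈ D.nebForms n α)
    (hf' : f' ∈ D.nebForms n α) :
    D.levelPairing n (D.Utriv A f) f' = D.levelPairing n f (D.Utriv A f') := by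
  rw [D.levelPairing_comm hn (D.Utriv_mem_nebForms hn hf) hf', D.levelPairing_Utriv hD hn hf' hf,
    D.levelPairing_Utriv hD hn hf hf', D.levelPairing_comm (by omega)
      (D.nebForms_anti (Nat.le_succ n) hf) (D.nebForms_anti (Nat.le_succ n) hf')]

/-- Translate the summation variable by the central element `p`; conjugation inverts it. -/
theorem levelPairing_central (hn : 1 ≤ n) (hf : f ∈ D.nebForms n α) (hf' : f' ∈ D.nebForms n α) :
    D.levelPairing n (D.central A A f) f' = D.levelPairing n f (D.central A A f') := by
  rw [levelPairing, levelPairing, ← D.cosetSum_scalarP (BiInv_mono (D.K0_le_K00 n)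
    (D.biInv_levelPairing hn hf (D.central_mem_nebForms hf')))]
  refine cosetSum_congr fun g => ?_
  have h : D.iota n (g * D.scalarP) * D.scalarP = D.iota n g := by
    rw [iota, bar_mul, bar_scalarP, mul_assoc, scalarP_comm, mul_assoc, inv_mul_cancel_left]
    rfl
  change f (g * D.scalarP) * _ = f (g * D.scalarP) * f' (D.iota n (g * D.scalarP) * D.scalarP)
  rw [h]

theorem levelPairing_heckeT (hD : D.SufficientlySmall) (hn : 1 ≤ n) (hf : f ∈ D.nebForms n α)
    (hf' : f' ∈ D.nebForms n α) :
    D.levelPairing n (D.heckeT A f) f' = D.levelPairing n f (D.heckeT A f') := by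
  change D.levelPairing n (D.Utriv A (D.central A A f)) f' = _
  rw [D.levelPairing_Utriv_left hD hn (D.central_mem_nebForms hf) hf',
    D.levelPairing_central hn hf (D.Utriv_mem_nebForms hn hf')]
  congr 1
  exact congrArg (fun X : Module.End A (D.G → A) => X f') (D.hecke_central fun _ => LinearMap.id).eq.symm

theorem levelPairing_pow {T : Module.End A (D.G → A)}
    (hT : ∀ f ∈ D.nebForms n α, T f ∈ D.nebForms n α)
    (hadj : ∀ f ∈ D.nebForms n α, ∀ f' ∈ D.nebForms n α,
      D.levelPairing n (T f) f' = D.levelPairing n f (T f')) (i : ℕ)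
    (hf : f ∈ D.nebForms n α) (hf' : f' ∈ D.nebForms n α) :
    D.levelPairing n ((T ^ i) f) f' = D.levelPairing n f ((T ^ i) f') := by
  induction i generalizing f with
  | zero => rfl
  | succ i ih =>
    rw [pow_succ, Module.End.mul_apply, ih (hT f hf), hadj f hf _ (pow_mem hT i hf'),
      ← Module.End.mul_apply, ← pow_succ', pow_succ]

/-- The pairing with a function supported on a single coset of `K₀₀ⁿ`. -/
theorem levelPairing_eq_of_support (hD : D.SufficientlySmall) (hn : 1 ≤ n)
    (hf : f ∈ D.nebForms n α) (hf' : f' ∈ D.nebForms n α) (t : D.G)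
    (h1 : f' (D.iota n t) = 1)
    (h0 : ∀ g, f' g ≠ 0 → ∃ γ ∈ D.rational, ∃ x ∈ D.K00 n, g = γ * D.iota n t * x) :
    D.levelPairing n f f' = Nat.card D.Delta * f t := by
  have hinv := D.biInv_levelPairing hn hf hf'
  rw [levelPairing, D.cosetSum_K00 hD hn hinv, nsmul_eq_mul]
  congr 1
  rw [cosetSum, finsum_eq_single _ (DoubleCoset.mk D.rational (D.K00 n) t)]
  · rw [hinv.out_mk, h1, mul_one]
  · intro q hq
    by_contra hne
    obtain ⟨γ, hγ, x, hx, h⟩ := h0 _ (right_ne_zero_of_mul hne)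
    refine hq ?_
    have h2 := congrArg (D.iota n) h
    rw [iota_iota, iota_mul, iota_rational_mul, iota_iota] at h2
    rw [← DoubleCoset.out_eq' _ _ q, DoubleCoset.eq]
    refine ⟨(bar γ)⁻¹, D.rational.inv_mem (D.bar_mem_rational hγ), (D.theta n x)⁻¹,
      (D.K00 n).inv_mem (D.theta_mem_K00 hx), ?_⟩
    rw [h2]
    group

theorem exists_indicator_sum (hf : f ∈ D.trivForms A n) :
    ∃ c : DoubleCoset.Quotient (D.rational : Set D.G) (D.K1 n : Set D.G) → A,
      ∀ g, f g = c (DoubleCoset.mk D.rational (D.K1 n) g) := by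
  refine ⟨fun q => f (Quotient.out q), fun g => ?_⟩
  have hinv : BiInv D.rational (D.K1 n) f := fun γ hγ g x hx => by
    rw [hf.2 x hx, hf.1 γ hγ]
  exact (hinv.out_mk g).symm

open Classical in
/-- The operator `U_p S` is eventually periodic on functions of level `n` with values in a ring in
which `N = 0`. -/
theorem exists_period (hn : 1 ≤ n) {N : ℕ} (hN : N ≠ 0) (hA : (N : A) = 0) :
    ∃ a d : ℕ, 1 ≤ d ∧ ∀ f ∈ D.trivForms A n, (D.heckeT A ^ (a + d)) f = (D.heckeT A ^ a) f := by
  have hQ : Finite (DoubleCoset.Quotient (D.rational : Set D.G) (D.K1 n : Set D.G)) :=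
    D.finite_quotient n _ le_rfl
  have := Fintype.ofFinite (DoubleCoset.Quotient (D.rational : Set D.G) (D.K1 n : Set D.G))
  have : NeZero N := ⟨hN⟩
  have hT : ∀ f ∈ D.trivForms (ZMod N) n, D.heckeT (ZMod N) f ∈ D.trivForms (ZMod N) n :=
    fun f hf => D.Utriv_mem_trivForms hn (D.central_mem_trivForms hf)
  have hfin : Finite (D.trivForms (ZMod N) n) := by
    choose c hc using fun f : D.trivForms (ZMod N) n => D.exists_indicator_sum f.2
    refine Finite.of_injective c fun f f' h => Subtype.ext (funext fun g => ?_)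
    rw [hc, hc, h]
  -- Functions with values in `ℤ/N` form a finite set, as the double coset space is finite, so two
  -- powers of the operator coincide on it.
  obtain ⟨i, j, hij, h⟩ : ∃ i j : ℕ, i < j ∧ ∀ f ∈ D.trivForms (ZMod N) n,
      (D.heckeT (ZMod N) ^ j) f = (D.heckeT (ZMod N) ^ i) f := by
    obtain ⟨i, j, hne, h⟩ := Finite.exists_ne_map_eq_of_infinite
      fun (i : ℕ) (f : D.trivForms (ZMod N) n) =>
        (⟨(D.heckeT (ZMod N) ^ i) f.1, pow_mem hT i f.2⟩ : D.trivForms (ZMod N) n)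
    have h' : ∀ f ∈ D.trivForms (ZMod N) n,
        (D.heckeT (ZMod N) ^ i) f = (D.heckeT (ZMod N) ^ j) f := fun f hf =>
      congrArg Subtype.val (congrFun h ⟨f, hf⟩)
    rcases lt_or_gt_of_ne hne with h1 | h1
    · exact ⟨i, j, h1, fun f hf => (h' f hf).symm⟩
    · exact ⟨j, i, h1, h'⟩
  refine ⟨i, j - i, by omega, fun f hf => ?_⟩
  rw [Nat.add_sub_cancel' hij.le]
  obtain ⟨c, hc⟩ := D.exists_indicator_sum hf
  set δ : DoubleCoset.Quotient (D.rational : Set D.G) (D.K1 n : Set D.G) → D.G → ZMod N :=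
    fun q g => if DoubleCoset.mk D.rational (D.K1 n) g = q then 1 else 0
  have hmk : ∀ γ ∈ D.rational, ∀ g, ∀ x ∈ D.K1 n, DoubleCoset.mk D.rational (D.K1 n) (γ * g * x)
      = DoubleCoset.mk D.rational (D.K1 n) g := by
    intro γ hγ g x hx
    rw [DoubleCoset.eq]
    refine ⟨γ⁻¹, D.rational.inv_mem hγ, x⁻¹, (D.K1 n).inv_mem hx, ?_⟩
    group
  have hδ : ∀ q, δ q ∈ D.trivForms (ZMod N) n := by
    refine fun q => ⟨fun γ hγ g => ?_, fun u hu g => ?_⟩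
    · have := hmk γ hγ g 1 (one_mem _)
      rw [mul_one] at this
      simp only [δ, this]
    · have := hmk 1 (one_mem _) g u hu
      rw [one_mul] at this
      simp only [δ, this]
  let cast : ZMod N →+ A := ZMod.lift N ⟨Int.castAddHom A, by simpa using hA⟩
  have hcast : cast 1 = 1 := by
    have : (1 : ZMod N) = ((1 : ℤ) : ZMod N) := by simp
    rw [this, ZMod.lift_coe]
    simp
  -- Indicator functions of double cosets span the functions of level `n` over `A`. They come from
  -- `ℤ/N`, so the period found there is valid over `A`.
  have hf' : f = ∑ q, c q • fun g => cast (δ q g) := by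
    funext g
    rw [Finset.sum_apply, Finset.sum_eq_single (DoubleCoset.mk D.rational (D.K1 n) g)]
    · simp [δ, hcast, hc g]
    · intro q _ hq
      simp [δ, Ne.symm hq]
    · simp
  rw [hf', map_sum, map_sum]
  refine Finset.sum_congr rfl fun q _ => ?_
  rw [map_smul, map_smul, heckeT_pow_comp, heckeT_pow_comp, h _ (hδ q)]

end TotallyReal

end Datum

end TrivialCoefficients

end

end HidaU2

namespace HidaU2

noncomputable section

section AdicLimits

variable {R W : Type*} [CommRing R] [AddCommGroup W] [Module R W] {π : R}

theorem AdicLim.add {a b : ℕ → W} {L M : W} (h : AdicLim π a L) (h' : AdicLim π b M) :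
    AdicLim π (fun r => a r + b r) (L + M) := fun m => by
  obtain ⟨r₀, h₀⟩ := h m
  obtain ⟨r₁, h₁⟩ := h' m
  exact ⟨max r₀ r₁, fun r hr => (h₀ r (le_of_max_le_left hr)).add (h₁ r (le_of_max_le_right hr))⟩

theorem AdicLim.unique {N : Submodule R W} (hN : IsAdicClosed π N) {a : ℕ → W} {L M : W}
    (hL : L ∈ N) (hM : M ∈ N) (h : AdicLim π a L) (h' : AdicLim π a M) : L = M :=
  hN.eq hL hM fun m => by
    obtain ⟨r₀, h₀⟩ := h m
    obtain ⟨r₁, h₁⟩ := h' m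
    exact (h₀ _ (le_max_left r₀ r₁)).symm.trans (h₁ _ (le_max_right r₀ r₁))

theorem close_iff_mk_eq {m : ℕ} {x y : R} :
    Close π m x y ↔ Ideal.Quotient.mk (Ideal.span {π ^ m}) x = Ideal.Quotient.mk _ y := by
  rw [Ideal.Quotient.eq, Ideal.mem_span_singleton, Close.dvd_iff]

end AdicLimits

/-! ### `p`-adic forms, the inverse of `U_p` and the limit pairing -/

section PadicForms

variable {F K : Type*} [Field F] [NumberField F] [Field K] [NumberField K] [Algebra F K] {p : ℕ}
  (D : Datum F K p) {O : Type*} [CommRing O]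

namespace Datum

/-- Invariance modulo `p ^ m` under `K₁ⁿ`. -/
def HasLevel (m n : ℕ) (f : D.G → O) : Prop :=
  ∀ u ∈ D.K1 n, ∀ g, Close (p : O) m (f (g * u)) (f g)

variable {D}

theorem HasLevel.mono {m n n' : ℕ} {f : D.G → O} (h : D.HasLevel m n f) (hn : n ≤ n') :
    D.HasLevel m n' f := fun u hu => h u (D.K1_anti hn hu)

theorem HasLevel.of_close {m n : ℕ} {f f' : D.G → O} (h : D.HasLevel m n f)
    (hf : Close (p : O) m f f') : D.HasLevel m n f' := fun u hu g =>
  ((Close.pi_iff.mp hf _).symm.trans (h u hu g)).trans (Close.pi_iff.mp hf g)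

theorem HasLevel.Utriv {m n : ℕ} (hn : 1 ≤ n) {f : D.G → O} (h : D.HasLevel m n f) :
    D.HasLevel m n (D.Utriv O f) := by
  obtain ⟨_⟩ := D.exists_fintype_residue
  intro u hu g
  obtain ⟨e, he⟩ := D.exists_perm_upper hn hu
  rw [Utriv_apply, Utriv_apply, ← Equiv.sum_comp e fun b => f (g * D.upper (Quotient.out b))]
  refine Close.sum _ fun b _ => ?_
  obtain ⟨u', hu', hrel⟩ := he b
  rw [mul_assoc, hrel, ← mul_assoc]
  exact h u' hu' _

theorem HasLevel.central {m n : ℕ} {f : D.G → O} (h : D.HasLevel m n f) :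
    D.HasLevel m n (D.central O O f) := by
  intro u hu g
  change Close (p : O) m (f (g * u * D.scalarP)) (f (g * D.scalarP))
  rw [mul_assoc, scalarP_comm, ← mul_assoc]
  exact h u hu _

theorem HasLevel.heckeT {m n : ℕ} (hn : 1 ≤ n) {f : D.G → O} (h : D.HasLevel m n f) :
    D.HasLevel m n (D.heckeT O f) := h.central.Utriv hn

theorem HasLevel.heckeT_pow {m n : ℕ} (hn : 1 ≤ n) {f : D.G → O} (h : D.HasLevel m n f) (i : ℕ) :
    D.HasLevel m n ((D.heckeT O ^ i) f) := by
  induction i with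
  | zero => exact h
  | succ i ih => rw [pow_succ']; exact ih.heckeT hn

theorem exists_hasLevel {f : D.G → O} (hf : f ∈ D.padicForms) (m : ℕ) :
    ∃ n ≥ 1, D.HasLevel m n f := hf.2 m

variable (D)

/-- The `p`-adic forms with nebentypus `α`. -/
def padicNeb (α : D.Tor →* Oˣ) : Submodule O (D.G → O) := D.padicForms ⊓ D.nebentypus α

variable {α : D.Tor →* Oˣ} {f f' : D.G → O}

theorem mem_padicOrd_iff :
    f ∈ D.padicOrd α ↔ f ∈ D.padicNeb α ∧ OrdinaryFor (p : O) (D.heckeT O) f :=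
  and_congr_right fun _ => D.mem_ordinary_iff

theorem Utriv_mem_padicNeb (hf : f ∈ D.padicNeb α) : D.Utriv O f ∈ D.padicNeb α := by
  refine ⟨⟨D.hecke_rational_mul _ hf.1.1, fun m => ?_⟩, D.hecke_mem_nebentypus _ hf.2⟩
  obtain ⟨n, hn, h⟩ := exists_hasLevel hf.1 m
  exact ⟨n, hn, h.Utriv hn⟩

theorem central_mem_padicNeb (hf : f ∈ D.padicNeb α) : D.central O O f ∈ D.padicNeb α := by
  refine ⟨⟨fun γ hγ g => ?_, fun m => ?_⟩, D.central_mem_nebentypus hf.2⟩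
  · change f (γ * g * D.scalarP) = f (g * D.scalarP)
    rw [mul_assoc, hf.1.1 γ hγ]
  · obtain ⟨n, hn, h⟩ := exists_hasLevel hf.1 m
    exact ⟨n, hn, h.central⟩

theorem heckeT_mem_padicNeb (hf : f ∈ D.padicNeb α) : D.heckeT O f ∈ D.padicNeb α :=
  D.Utriv_mem_padicNeb (D.central_mem_padicNeb hf)

theorem Utriv_central : Commute (D.Utriv O) (D.central O O) := D.hecke_central _

section Complete

variable [IsAdicComplete (Ideal.span {(p : O)}) O]

variable (O) in
theorem isAdicClosed_functions :
    IsAdicClosed (p : O) (Submodule.pi Set.univ fun _ : D.G => (⊤ : Submodule O O)) :=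
  isAdicClosed_top.pi D.G

theorem isAdicClosed_padicNeb (α : D.Tor →* Oˣ) : IsAdicClosed (p : O) (D.padicNeb α) := by
  have hO : IsAdicClosed (p : O) (⊤ : Submodule O O) := isAdicClosed_top
  refine (D.isAdicClosed_functions O).of_approx (fun f _ g _ => trivial) fun f _ happ =>
    ⟨⟨fun γ hγ g => hO.eq trivial trivial fun m => ?_, fun m => ?_⟩,
      fun u t g => hO.eq trivial trivial fun m => ?_⟩
  all_goals obtain ⟨f', hf', hc⟩ := happ m
  · exact (Close.pi_iff.mp hc _).symm.trans ((Close.of_eq (hf'.1.1 γ hγ g)).trans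
      (Close.pi_iff.mp hc _))
  · obtain ⟨n, hn, h⟩ := exists_hasLevel hf'.1 m
    exact ⟨n, hn, h.of_close hc⟩
  · exact (Close.pi_iff.mp hc _).symm.trans ((Close.of_eq (hf'.2 u t g)).trans
      ((Close.pi_iff.mp hc _).map (LinearMap.lsmul O O _)))

theorem Utriv_mem_padicOrd (hf : f ∈ D.padicOrd α) : D.Utriv O f ∈ D.padicOrd α := by
  obtain ⟨h1, h2⟩ := D.mem_padicOrd_iff.mp hf
  refine D.mem_padicOrd_iff.mpr ⟨D.Utriv_mem_padicNeb h1, h2.map (D.Utriv O) fun x => ?_⟩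
  exact congrArg (fun X : Module.End O (D.G → O) => X x)
    ((Commute.refl (D.Utriv O)).mul_right D.Utriv_central).eq

/-- The operator `U_p` on `V_p^ord`. -/
def ordEquiv (α : D.Tor →* Oˣ) : D.padicOrd α ≃ₗ[O] D.padicOrd α :=
  LinearEquiv.ofBijective ((D.Utriv O).restrict fun _ hf => D.Utriv_mem_padicOrd hf) (by
    have hN := D.isAdicClosed_padicNeb α
    constructor
    · intro f f' h
      obtain ⟨h1, h2⟩ := D.mem_padicOrd_iff.mp f.2
      obtain ⟨h1', h2'⟩ := D.mem_padicOrd_iff.mp f'.2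
      exact Subtype.ext (OrdinaryFor.eq_of_map_eq hN D.Utriv_central h1 h1' h2 h2'
        (congrArg Subtype.val h))
    · intro f
      obtain ⟨h1, h2⟩ := D.mem_padicOrd_iff.mp f.2
      obtain ⟨L, hL, hL', h⟩ := h2.exists_preimage hN (fun _ => D.Utriv_mem_padicNeb)
        (fun _ => D.central_mem_padicNeb) D.Utriv_central h1
      exact ⟨⟨L, D.mem_padicOrd_iff.mpr ⟨hL, hL'⟩⟩, Subtype.ext h⟩)

/-- The operator `U_p⁻¹` on `V_p^ord`. -/
def ordInv (α : D.Tor →* Oˣ) : Module.End O (D.padicOrd α) := (D.ordEquiv α).symm.toLinearMap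

theorem Utriv_ordInv (h : D.padicOrd α) : D.Utriv O (D.ordInv α h).1 = h.1 :=
  congrArg Subtype.val ((D.ordEquiv α).apply_symm_apply h)

theorem ordInv_eq_of_Utriv_eq {h h' : D.padicOrd α} (e : D.Utriv O h.1 = h'.1) :
    D.ordInv α h' = h :=
  (D.ordEquiv α).symm_apply_eq.mpr (Subtype.ext e.symm)

theorem Utriv_ordInv_pow (n : ℕ) (h : D.padicOrd α) :
    D.Utriv O ((D.ordInv α ^ (n + 1)) h).1 = ((D.ordInv α ^ n) h).1 := by
  rw [pow_succ', Module.End.mul_apply, Utriv_ordInv]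

theorem Utriv_pow_ordInv_pow (n : ℕ) (h : D.padicOrd α) :
    (D.Utriv O ^ n) ((D.ordInv α ^ n) h).1 = h.1 := by
  induction n with
  | zero => rfl
  | succ n ih => rw [pow_succ, Module.End.mul_apply, Utriv_ordInv_pow, ih]

theorem ordInv_pow_eq_of_Utriv_pow_eq (n : ℕ) {h h' : D.padicOrd α}
    (e : (D.Utriv O ^ n) h.1 = h'.1) : (D.ordInv α ^ n) h' = h := by
  induction n generalizing h h' with
  | zero => exact Subtype.ext e.symm
  | succ n ih =>
    rw [pow_succ', Module.End.mul_apply]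
    refine D.ordInv_eq_of_Utriv_eq ?_
    rw [pow_succ, Module.End.mul_apply] at e
    exact (congrArg Subtype.val (ih (h := ⟨_, D.Utriv_mem_padicOrd h.2⟩) e)).symm

-- Modulo `p^m` one has `U⁻¹ h ≡ T^{r!} U⁻¹ h = T^{r!-1} S h`, and the operators `T` and `S`
-- preserve the level. All `U⁻ⁱ h` thus share one level modulo `p^m`, which makes the limit pairing
-- converge.
variable {D} in
theorem HasLevel.ordInv {m n : ℕ} (hn : 1 ≤ n) {h : D.padicOrd α} (hh : D.HasLevel m n h.1) :
    D.HasLevel m n (D.ordInv α h).1 := by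
  obtain ⟨-, hord⟩ := D.mem_padicOrd_iff.mp (D.ordInv α h).2
  obtain ⟨r, hr⟩ := hord m
  refine HasLevel.of_close ?_ (hr r le_rfl)
  have hT : (D.heckeT O ^ r !) (D.ordInv α h).1
      = (D.heckeT O ^ ((r !) - 1)) (D.central O O h.1) := by
    rw [← Nat.sub_add_cancel (Nat.factorial_pos r), pow_succ, Module.End.mul_apply,
      Datum.heckeT, D.Utriv_central.eq, Module.End.mul_apply, Utriv_ordInv]
    rfl
  change D.HasLevel m n ((D.heckeT O ^ r !) (D.ordInv α h).1)
  rw [hT]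
  exact hh.central.heckeT_pow hn _

variable {D} in
theorem HasLevel.ordInv_pow {m n : ℕ} (hn : 1 ≤ n) {h : D.padicOrd α} (hh : D.HasLevel m n h.1)
    (i : ℕ) : D.HasLevel m n ((D.ordInv α ^ i) h).1 := by
  induction i with
  | zero => exact hh
  | succ i ih => rw [pow_succ']; exact ih.ordInv hn

end Complete

section Reduction

variable (m : ℕ)

/-- The reduction of a nebentypus modulo `p ^ m`. -/
def redNeb (α : D.Tor →* Oˣ) : D.Tor →* (O ⧸ Ideal.span {(p : O) ^ m})ˣ :=
  (Units.map (Ideal.Quotient.mk (Ideal.span {(p : O) ^ m})).toMonoidHom).comp α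

/-- The reduction of a function modulo `p ^ m`. -/
def red (f : D.G → O) : D.G → O ⧸ Ideal.span {(p : O) ^ m} :=
  fun g => Ideal.Quotient.mk (Ideal.span {(p : O) ^ m}) (f g)

variable {m}

theorem close_iff_red_eq : Close (p : O) m f f' ↔ D.red m f = D.red m f' := by
  rw [Close.pi_iff, funext_iff]
  exact forall_congr' fun _ => close_iff_mk_eq

theorem red_mem_nebForms {n : ℕ} (hf : f ∈ D.padicNeb α) (hlev : D.HasLevel m n f) :
    D.red m f ∈ D.nebForms n (D.redNeb m α) := by
  refine ⟨⟨fun γ hγ g => congrArg (Ideal.Quotient.mk _) (hf.1.1 γ hγ g), fun u hu g =>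
    close_iff_mk_eq.mp (hlev u hu g)⟩, fun u t g => ?_⟩
  exact (congrArg (Ideal.Quotient.mk _) (hf.2 u t g)).trans (map_mul _ _ _)

theorem red_Utriv (f : D.G → O) : D.red m (D.Utriv O f) = D.Utriv _ (D.red m f) :=
  (D.Utriv_comp (Ideal.Quotient.mk (Ideal.span {(p : O) ^ m})).toAddMonoidHom f).symm

theorem red_heckeT_pow (i : ℕ) (f : D.G → O) :
    D.red m ((D.heckeT O ^ i) f) = (D.heckeT _ ^ i) (D.red m f) :=
  (D.heckeT_pow_comp (Ideal.Quotient.mk (Ideal.span {(p : O) ^ m})).toAddMonoidHom i f).symm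

theorem red_Utriv_pow (i : ℕ) (f : D.G → O) :
    D.red m ((D.Utriv O ^ i) f) = (D.Utriv _ ^ i) (D.red m f) := by
  induction i with
  | zero => rfl
  | succ i ih =>
    rw [pow_succ', pow_succ', Module.End.mul_apply, Module.End.mul_apply, red_Utriv, ih]

variable [NumberField.IsTotallyReal F] [NumberField.IsTotallyComplex K]

theorem mk_levelPairing (n : ℕ) (f f' : D.G → O) :
    Ideal.Quotient.mk (Ideal.span {(p : O) ^ m}) (D.levelPairing n f f')
      = D.levelPairing n (D.red m f) (D.red m f') :=
  D.map_levelPairing _ n f f'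

variable [IsAdicComplete (Ideal.span {(p : O)}) O]

/-- After reduction modulo `p^m` this is the relation between levels `n` and `n + 1` for functions
of finite level, applied to `U^{-(n+1)} h'`. -/
theorem close_levelPairing_succ (hD : D.SufficientlySmall) {n : ℕ} (hn : 1 ≤ n)
    {h h' : D.padicOrd α} (hh : D.HasLevel m n h.1) (hh' : D.HasLevel m n h'.1) :
    Close (p : O) m (D.levelPairing (n + 1) h.1 ((D.ordInv α ^ (n + 1)) h').1)
      (D.levelPairing n h.1 ((D.ordInv α ^ n) h').1) := by
  rw [close_iff_mk_eq, mk_levelPairing, mk_levelPairing, ← D.Utriv_ordInv_pow n h', red_Utriv]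
  exact (D.levelPairing_Utriv hD hn (D.red_mem_nebForms (D.mem_padicOrd_iff.mp h.2).1 hh)
    (D.red_mem_nebForms (D.mem_padicOrd_iff.mp ((D.ordInv α ^ (n + 1)) h').2).1
      (hh'.ordInv_pow hn _))).symm

theorem close_levelPairing (hD : D.SufficientlySmall) {n : ℕ} (hn : 1 ≤ n)
    {h h' : D.padicOrd α} (hh : D.HasLevel m n h.1) (hh' : D.HasLevel m n h'.1) {n' : ℕ}
    (hnn' : n ≤ n') :
    Close (p : O) m (D.levelPairing n' h.1 ((D.ordInv α ^ n') h').1)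
      (D.levelPairing n h.1 ((D.ordInv α ^ n) h').1) := by
  induction n', hnn' using Nat.le_induction with
  | base => exact Close.refl _
  | succ n' hn' ih =>
    exact (D.close_levelPairing_succ hD (hn.trans hn') (hh.mono hn') (hh'.mono hn')).trans ih

theorem exists_common_level (h h' : D.padicOrd α) (m : ℕ) :
    ∃ n ≥ 1, D.HasLevel m n h.1 ∧ D.HasLevel m n h'.1 := by
  obtain ⟨n, hn, hl⟩ := exists_hasLevel (D.mem_padicOrd_iff.mp h.2).1.1 m
  obtain ⟨n', hn', hl'⟩ := exists_hasLevel (D.mem_padicOrd_iff.mp h'.2).1.1 m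
  exact ⟨max n n', le_max_of_le_left hn, hl.mono (le_max_left _ _), hl'.mono (le_max_right _ _)⟩

/-- The pairing on `V_p^ord` as a limit. -/
theorem exists_padicPairing (hD : D.SufficientlySmall) (α : D.Tor →* Oˣ) :
    ∃ B : D.padicOrd α →ₗ[O] D.padicOrd α →ₗ[O] O, ∀ h h',
      AdicLim (p : O) (fun n => D.levelPairing n h.1 ((D.ordInv α ^ n) h').1) (B h h') := by
  have hO : IsAdicClosed (p : O) (⊤ : Submodule O O) := isAdicClosed_top
  have hex : ∀ h h' : D.padicOrd α, ∃ L : O, L ∈ (⊤ : Submodule O O) ∧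
      AdicLim (p : O) (fun n => D.levelPairing n h.1 ((D.ordInv α ^ n) h').1) L := fun h h' =>
    -- Modulo `p^m` the sequence is constant from a common level of `h` and `h'` on, hence Cauchy.
    hO.lim _ (fun _ => trivial) fun m => by
      obtain ⟨n, hn, hl, hl'⟩ := D.exists_common_level h h' m
      exact ⟨n, fun r hr => D.close_levelPairing hD hn hl hl' hr⟩
  choose B _ hB using hex
  refine ⟨LinearMap.mk₂ O B (fun h₁ h₂ h' => ?_) (fun a h h' => ?_) (fun h h₁ h₂ => ?_)
    (fun a h h' => ?_), hB⟩
  · refine (hB _ _).unique hO trivial trivial ?_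
    have := (hB h₁ h').add (hB h₂ h')
    simp only [← levelPairing_add_left] at this
    exact this
  · refine (hB _ _).unique hO trivial trivial ?_
    have := (hB h h').map (LinearMap.lsmul O O a)
    simp only [LinearMap.lsmul_apply, smul_eq_mul, ← levelPairing_smul_left] at this
    exact this
  · refine (hB _ _).unique hO trivial trivial ?_
    have := (hB h h₁).add (hB h h₂)
    simp only [← levelPairing_add_right] at this
    simp only [map_add]
    exact this
  · refine (hB _ _).unique hO trivial trivial ?_
    have := (hB h h').map (LinearMap.lsmul O O a)
    simp only [LinearMap.lsmul_apply, smul_eq_mul, ← levelPairing_smul_right] at this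
    simp only [map_smul]
    exact this

theorem close_of_adicLim (hD : D.SufficientlySmall) {h h' : D.padicOrd α} {L : O}
    (hL : AdicLim (p : O) (fun n => D.levelPairing n h.1 ((D.ordInv α ^ n) h').1) L) {n : ℕ}
    (hn : 1 ≤ n) (hh : D.HasLevel m n h.1) (hh' : D.HasLevel m n h'.1) :
    Close (p : O) m L (D.levelPairing n h.1 ((D.ordInv α ^ n) h').1) := by
  obtain ⟨r, hr⟩ := hL m
  exact (hr _ (le_max_left r n)).symm.trans (D.close_levelPairing hD hn hh hh' (le_max_right r n))

/-- Modulo `p^m`, write `h = Uⁿ U⁻ⁿ h` and move `Uⁿ` to the other argument, where it cancels `U⁻ⁿ`.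
Then exchange the arguments by the symmetry at level `n`. -/
theorem adicLim_symm (hD : D.SufficientlySmall) {h h' : D.padicOrd α} {L L' : O}
    (hL : AdicLim (p : O) (fun n => D.levelPairing n h.1 ((D.ordInv α ^ n) h').1) L)
    (hL' : AdicLim (p : O) (fun n => D.levelPairing n h'.1 ((D.ordInv α ^ n) h).1) L') :
    L = L' := by
  have hO : IsAdicClosed (p : O) (⊤ : Submodule O O) := isAdicClosed_top
  refine hO.eq trivial trivial fun m => ?_
  obtain ⟨n, hn, hh, hh'⟩ := D.exists_common_level h h' m
  refine (D.close_of_adicLim hD hL hn hh hh').trans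
    (Close.trans ?_ (D.close_of_adicLim hD hL' hn hh' hh).symm)
  have hmem : ∀ h : D.padicOrd α, D.HasLevel m n h.1 →
      D.red m h.1 ∈ D.nebForms n (D.redNeb m α) := fun h hh =>
    D.red_mem_nebForms (D.mem_padicOrd_iff.mp h.2).1 hh
  rw [close_iff_mk_eq, mk_levelPairing, mk_levelPairing]
  conv_lhs => rw [← D.Utriv_pow_ordInv_pow n h]
  conv_rhs => rw [← D.Utriv_pow_ordInv_pow n h']
  rw [red_Utriv_pow, red_Utriv_pow, D.levelPairing_pow (fun _ => D.Utriv_mem_nebForms hn)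
    (fun _ hf _ hf' => D.levelPairing_Utriv_left hD hn hf hf') n
    (hmem _ (hh.ordInv_pow hn n)) (hmem _ (hh'.ordInv_pow hn n)), D.levelPairing_comm hn
    (hmem _ (hh.ordInv_pow hn n)) (pow_mem (fun _ => D.Utriv_mem_nebForms hn) n
      (hmem _ (hh'.ordInv_pow hn n)))]

end Reduction

end Datum

end PadicForms

end

end HidaU2

namespace HidaU2

noncomputable section

/-! ### Functions supported on one coset and non-degeneracy -/

section DeltaFunctions

variable {F K : Type*} [Field F] [NumberField F] [Field K] [NumberField K] [Algebra F K] {p : ℕ}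
  (D : Datum F K p)

namespace Datum

/-- The upper left entries of the components of `x` at `p` and at `𝔰`, the latter modulo `𝔰`,
are the units given by `τ`. -/
def HasEntry (x : D.G) (τ : D.Tor) : Prop :=
  (∀ v, ∃ A : GL (Fin 2) (v.1.adicCompletionIntegers F), intGL v.1 A = D.atP v x ∧
    A.1 0 0 = (τ.1 v).1) ∧
  ∀ v, ∃ A : GL (Fin 2) (v.1.adicCompletionIntegers F), intGL v.1 A = D.atS v x ∧
    Ideal.Quotient.mk (locIdeal v.1 D.s) (A.1 0 0) = (τ.2 v).1

theorem mul_apply_zero_zero {A : Type*} [CommRing A] (g h : GL (Fin 2) A) :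
    (g * h).1 0 0 = g.1 0 0 * h.1 0 0 + g.1 0 1 * h.1 1 0 := by
  rw [Units.val_mul, Matrix.mul_apply, Fin.sum_univ_two]

theorem exists_hasEntry {n : ℕ} (hn : 1 ≤ n) {x : D.G} (hx : x ∈ D.K00 n) :
    ∃ τ, D.HasEntry x τ := by
  choose A hA hA' using hx.2.1
  choose C hC hC' using hx.2.2
  have hu : ∀ v, IsUnit ((A v).1 0 0) := fun v =>
    (isUnit_of_det (A v) (D.p_pow_mem_maximalIdeal hn v (hA v))).1
  have ht : ∀ v, IsUnit ((C v).1 0 0) := fun v =>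
    (isUnit_of_det (C v) (locIdeal_le_maximalIdeal v.2 (hC v))).1
  exact ⟨(fun v => (hu v).unit, fun v => Units.map (Ideal.Quotient.mk _).toMonoidHom (ht v).unit),
    fun v => ⟨A v, hA' v, rfl⟩, fun v => ⟨C v, hC' v, rfl⟩⟩

variable {D}

theorem HasEntry.eq {x : D.G} {τ τ' : D.Tor} (h : D.HasEntry x τ) (h' : D.HasEntry x τ') :
    τ = τ' := by
  refine Prod.ext (funext fun v => Units.ext ?_) (funext fun v => Units.ext ?_)
  · obtain ⟨A, hA, e⟩ := h.1 v
    obtain ⟨A', hA', e'⟩ := h'.1 v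
    rw [← e, ← e', intGL_injective v.1 (hA.trans hA'.symm)]
  · obtain ⟨A, hA, e⟩ := h.2 v
    obtain ⟨A', hA', e'⟩ := h'.2 v
    rw [← e, ← e', intGL_injective v.1 (hA.trans hA'.symm)]

theorem HasEntry.mul_scalar {x : D.G} {τ : D.Tor} (h : D.HasEntry x τ)
    (u : ∀ v : D.Sp, (v.1.adicCompletionIntegers F)ˣ)
    (t : ∀ v : D.Ss, (v.1.adicCompletionIntegers F)ˣ) :
    D.HasEntry (x * D.scalar u t)
      (τ * (u, fun v => Units.map (Ideal.Quotient.mk (locIdeal v.1 D.s)).toMonoidHom (t v))) := by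
  have key : ∀ {A : Type _} [CommRing A] (g : GL (Fin 2) A) (a : Aˣ),
      (g * Units.map (Matrix.scalar (Fin 2)).toMonoidHom a).1 0 0 = g.1 0 0 * a.1 := by
    intro A _ g a
    have h1 : (Units.map (Matrix.scalar (Fin 2)).toMonoidHom a).1 = Matrix.scalar (Fin 2) a.1 := rfl
    rw [mul_apply_zero_zero, h1]
    simp
  refine ⟨fun v => ?_, fun v => ?_⟩
  · obtain ⟨A, hA, e⟩ := h.1 v
    refine ⟨A * Units.map (Matrix.scalar (Fin 2)).toMonoidHom (u v), ?_, ?_⟩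
    · rw [map_mul, map_mul, hA, atP_scalar]
    · rw [key, e]
      rfl
  · obtain ⟨A, hA, e⟩ := h.2 v
    refine ⟨A * Units.map (Matrix.scalar (Fin 2)).toMonoidHom (t v), ?_, ?_⟩
    · rw [map_mul, map_mul, hA, atS_scalar]
    · rw [key, map_mul, e]
      rfl

theorem HasEntry.mul_K1 {x y : D.G} {τ τ' : D.Tor} {n : ℕ} (h : D.HasEntry x τ) (hy : y ∈ D.K1 n)
    (h' : D.HasEntry (x * y) τ') :
    τ'.2 = τ.2 ∧ ∀ v, (τ'.1 v).1 - (τ.1 v).1 ∈ D.pIdeal n v := by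
  obtain ⟨-, hp, hs⟩ := D.mem_K1_iff.mp hy
  refine ⟨funext fun v => Units.ext ?_, fun v => ?_⟩
  · obtain ⟨A, hA, e⟩ := h.2 v
    obtain ⟨B, hB, hB'⟩ := hs v
    obtain ⟨C, hC, e'⟩ := h'.2 v
    rw [map_mul, ← hA, ← hB', ← map_mul] at hC
    rw [← e', ← e, intGL_injective v.1 hC, mul_apply_zero_zero, Ideal.Quotient.eq]
    have h1 := Ideal.mul_mem_left _ (A.1 0 0) hB.1
    have h2 := Ideal.mul_mem_left _ (A.1 0 1) hB.2
    refine (congrArg (· ∈ locIdeal v.1 D.s) ?_).mp (Ideal.add_mem _ h1 h2)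
    ring
  · obtain ⟨A, hA, e⟩ := h.1 v
    obtain ⟨B, hB, hB'⟩ := hp v
    obtain ⟨C, hC, e'⟩ := h'.1 v
    rw [map_mul, ← hA, ← hB', ← map_mul] at hC
    rw [← e', ← e, intGL_injective v.1 hC, mul_apply_zero_zero]
    have h1 := Ideal.mul_mem_left _ (A.1 0 0) hB.1
    have h2 := Ideal.mul_mem_left _ (A.1 0 1) hB.2
    refine (congrArg (· ∈ D.pIdeal n v) ?_).mp (Ideal.add_mem _ h1 h2)
    ring

variable (D)

theorem hasEntry_one : D.HasEntry 1 1 :=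
  ⟨fun v => ⟨1, by rw [map_one, map_one], rfl⟩, fun v => ⟨1, by rw [map_one, map_one], map_one _⟩⟩

variable {O : Type*} [CommRing O]

theorem close_weightChar (k : D.Emb O →₀ ℕ) {n : ℕ}
    {u : ∀ v : D.Sp, (v.1.adicCompletionIntegers F)ˣ} (hu : ∀ v, (u v).1 - 1 ∈ D.pIdeal n v) :
    Close (p : O) n (D.weightChar k u) 1 := by
  rw [close_iff_mk_eq, weightChar, Finsupp.prod, map_prod, map_one]
  refine Finset.prod_eq_one fun σ _ => ?_
  obtain ⟨y, hy⟩ := D.mem_pIdeal_iff.mp (hu σ.1)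
  have h := congrArg σ.2 hy
  rw [map_sub, map_one, map_mul, map_pow, map_natCast] at h
  rw [map_pow, close_iff_mk_eq.mp (⟨_, h⟩ : Close (p : O) n (σ.2 (u σ.1)) 1), map_one, one_pow]

/-- Having a weight makes `α` continuous: units congruent to `1` modulo `pⁿ` are sent to values
congruent to `1` modulo `pⁿ`. It ensures that functions built from `α` on a single coset are
`p`-adic forms. -/
theorem close_of_hasWeight {k : D.Emb O →₀ ℕ} {n₀ n : ℕ} {α : D.Tor →* Oˣ}
    (hα : D.HasWeight k n₀ α) (hn : n₀ ≤ n) {τ τ' : D.Tor} (h2 : τ'.2 = τ.2)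
    (h1 : ∀ v, (τ'.1 v).1 - (τ.1 v).1 ∈ D.pIdeal n v) :
    Close (p : O) n ((α τ' : Oˣ) : O) ((α τ : Oˣ) : O) := by
  have hu : ∀ v, ((τ'.1 v / τ.1 v : (v.1.adicCompletionIntegers F)ˣ)).1 - 1 ∈ D.pIdeal n v := by
    intro v
    refine (congrArg (· ∈ D.pIdeal n v) ?_).mp (Ideal.mul_mem_right ((τ.1 v)⁻¹).1 _ (h1 v))
    rw [sub_mul, Units.mul_inv, div_eq_mul_inv, Units.val_mul]
  have hτ : τ' = ((τ'.1 / τ.1, 1) : D.Tor) * τ :=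
    Prod.ext (div_mul_cancel _ _).symm (h2.trans (one_mul _).symm)
  have h3 := hα (τ'.1 / τ.1) fun v => D.pIdeal_anti hn v (hu v)
  rw [hτ, map_mul, Units.val_mul, h3]
  have h4 := (D.close_weightChar k hu).mul (Close.refl ((α τ : Oˣ) : O))
  rwa [one_mul] at h4

/-- The function supported on `G₁(F) t K₀₀ⁿ` with value `α(a(x))` at `t x`. -/
theorem exists_deltaFun (hD : D.SufficientlySmall) {n : ℕ} (hn : 1 ≤ n) (t : D.G)
    (α : D.Tor →* Oˣ) : ∃ ψ : D.G → O,
      (∀ γ ∈ D.rational, ∀ x ∈ D.K00 n, ∀ τ, D.HasEntry x τ → ψ (γ * t * x) = ((α τ : Oˣ) : O)) ∧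
      ∀ g, ψ g ≠ 0 → ∃ γ ∈ D.rational, ∃ x ∈ D.K00 n, g = γ * t * x := by
  classical
  have hval : ∀ g, ∃ a : O, (∀ γ ∈ D.rational, ∀ x ∈ D.K00 n, ∀ τ, D.HasEntry x τ →
      g = γ * t * x → a = ((α τ : Oˣ) : O)) ∧
      (a ≠ 0 → ∃ γ ∈ D.rational, ∃ x ∈ D.K00 n, g = γ * t * x) := by
    intro g
    by_cases hg : ∃ γ ∈ D.rational, ∃ x ∈ D.K00 n, g = γ * t * x
    · obtain ⟨γ, hγ, x, hx, rfl⟩ := hg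
      obtain ⟨τ, hτ⟩ := D.exists_hasEntry hn hx
      refine ⟨((α τ : Oˣ) : O), fun γ' hγ' x' hx' τ' hτ' e => ?_, fun _ => ⟨γ, hγ, x, hx, rfl⟩⟩
      -- The value is well defined because `K₀₀ⁿ` lies in the sufficiently small level: the rational
      -- factor, and then `x`, is determined by `g`.
      have h1 : γ'⁻¹ * γ = 1 := by
        refine hD t _ (mul_mem (inv_mem hγ') hγ) ?_
        have h2 : t⁻¹ * (γ'⁻¹ * γ) * t = x' * x⁻¹ := by
          have h3 : t⁻¹ * (γ'⁻¹ * γ) * t = t⁻¹ * γ'⁻¹ * (γ * t * x) * x⁻¹ := by group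
          rw [h3, e]
          group
        rw [h2]
        exact D.K00_le_levelCirc n (mul_mem hx' (inv_mem hx))
      have h2 : γ = γ' := (inv_mul_eq_one.mp h1).symm
      rw [h2] at e
      rw [mul_left_cancel e] at hτ
      rw [hτ.eq hτ']
    · refine ⟨0, fun γ hγ x hx τ _ e => absurd ⟨γ, hγ, x, hx, e⟩ hg, fun h => absurd rfl h⟩
  choose ψ h1 h2 using hval
  exact ⟨ψ, fun γ hγ x hx τ hτ => h1 _ γ hγ x hx τ hτ rfl, h2⟩

theorem K1_le_K00 {n n' : ℕ} (h : n ≤ n') : D.K1 n' ≤ D.K00 n :=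
  (D.K1_anti h).trans ((D.K1_le_K0 n).trans (D.K0_le_K00 n))

section DeltaProperties

variable {n : ℕ} {t : D.G} {α : D.Tor →* Oˣ} {ψ : D.G → O}

theorem deltaFun_hasLevel (hn : 1 ≤ n)
    (h1 : ∀ γ ∈ D.rational, ∀ x ∈ D.K00 n, ∀ τ, D.HasEntry x τ →
      ψ (γ * t * x) = ((α τ : Oˣ) : O))
    (h2 : ∀ g, ψ g ≠ 0 → ∃ γ ∈ D.rational, ∃ x ∈ D.K00 n, g = γ * t * x)
    {k : D.Emb O →₀ ℕ} {n₀ : ℕ} (hα : D.HasWeight k n₀ α) (hn₀ : n₀ ≤ n) {m n' : ℕ}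
    (hn' : n ≤ n') (hm : m ≤ n') : D.HasLevel m n' ψ := by
  intro u hu g
  have hu' := D.K1_le_K00 hn' hu
  by_cases hg : ∃ γ ∈ D.rational, ∃ x ∈ D.K00 n, g = γ * t * x
  · obtain ⟨γ, hγ, x, hx, rfl⟩ := hg
    obtain ⟨τ, hτ⟩ := D.exists_hasEntry hn hx
    obtain ⟨τ', hτ'⟩ := D.exists_hasEntry hn (mul_mem hx hu')
    rw [mul_assoc, h1 γ hγ _ (mul_mem hx hu') τ' hτ', h1 γ hγ x hx τ hτ]
    obtain ⟨e2, e1⟩ := hτ.mul_K1 hu hτ'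
    exact (D.close_of_hasWeight hα (hn₀.trans hn') e2 e1).mono hm
  · have e1 : ψ g = 0 := by
      by_contra h
      exact hg (h2 g h)
    have e2 : ψ (g * u) = 0 := by
      by_contra h
      obtain ⟨γ, hγ, x, hx, e⟩ := h2 _ h
      refine hg ⟨γ, hγ, x * u⁻¹, mul_mem hx (inv_mem hu'), ?_⟩
      rw [← mul_assoc, ← e, mul_inv_cancel_right]
    rw [e1, e2]
    exact Close.refl _

theorem deltaFun_mem_padicNeb (hn : 1 ≤ n)
    (h1 : ∀ γ ∈ D.rational, ∀ x ∈ D.K00 n, ∀ τ, D.HasEntry x τ →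
      ψ (γ * t * x) = ((α τ : Oˣ) : O))
    (h2 : ∀ g, ψ g ≠ 0 → ∃ γ ∈ D.rational, ∃ x ∈ D.K00 n, g = γ * t * x)
    {k : D.Emb O →₀ ℕ} {n₀ : ℕ} (hα : D.HasWeight k n₀ α) (hn₀ : n₀ ≤ n) :
    ψ ∈ D.padicNeb α := by
  have h0 : ∀ g, (¬ ∃ γ ∈ D.rational, ∃ x ∈ D.K00 n, g = γ * t * x) → ψ g = 0 := fun g hg => by
    by_contra h
    exact hg (h2 g h)
  refine ⟨⟨fun γ hγ g => ?_, fun m => ⟨max n m, le_max_of_le_left hn,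
    D.deltaFun_hasLevel hn h1 h2 hα hn₀ (le_max_left _ _) (le_max_right _ _)⟩⟩, fun u s g => ?_⟩
  · by_cases hg : ∃ γ ∈ D.rational, ∃ x ∈ D.K00 n, g = γ * t * x
    · obtain ⟨δ, hδ, x, hx, rfl⟩ := hg
      obtain ⟨τ, hτ⟩ := D.exists_hasEntry hn hx
      rw [h1 δ hδ x hx τ hτ, ← mul_assoc, ← mul_assoc, h1 _ (mul_mem hγ hδ) x hx τ hτ]
    · rw [h0 g hg, h0]
      rintro ⟨δ, hδ, x, hx, e⟩
      refine hg ⟨γ⁻¹ * δ, mul_mem (inv_mem hγ) hδ, x, hx, ?_⟩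
      rw [mul_assoc, mul_assoc, ← mul_assoc δ, ← e, inv_mul_cancel_left]
  · by_cases hg : ∃ γ ∈ D.rational, ∃ x ∈ D.K00 n, g = γ * t * x
    · obtain ⟨γ, hγ, x, hx, rfl⟩ := hg
      obtain ⟨τ, hτ⟩ := D.exists_hasEntry hn hx
      rw [mul_assoc, h1 γ hγ _ (mul_mem hx (D.scalar_mem_K00 u s n)) _ (hτ.mul_scalar u s),
        h1 γ hγ x hx τ hτ, map_mul, Units.val_mul, smul_eq_mul, mul_comm]
    · rw [h0 g hg, smul_zero, h0]
      rintro ⟨γ, hγ, x, hx, e⟩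
      refine hg ⟨γ, hγ, x * (D.scalar u s)⁻¹, mul_mem hx (inv_mem (D.scalar_mem_K00 u s n)), ?_⟩
      rw [← mul_assoc, ← e, mul_inv_cancel_right]

end DeltaProperties

section Nondegenerate

variable [NumberField.IsTotallyReal F] [NumberField.IsTotallyComplex K]
  [IsAdicComplete (Ideal.span {(p : O)}) O]

/-- The ordinary projection of a `p`-adic form. -/
theorem exists_ordinary_projection {α : D.Tor →* Oˣ} {ψ : D.G → O} (hψ : ψ ∈ D.padicNeb α) :
    ∃ L ∈ D.padicOrd α, AdicLim (p : O) (fun r => (D.heckeT O ^ r !) ψ) L := by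
  obtain ⟨L, hL, hord, hlim⟩ := exists_ordinary_limit (T := D.heckeT O) (D.isAdicClosed_padicNeb α)
    (fun _ => D.heckeT_mem_padicNeb) hψ fun m => by
      obtain ⟨n, hn, hlev⟩ := exists_hasLevel hψ.1 m
      obtain ⟨a, d, hd, h⟩ := D.exists_period (A := O ⧸ Ideal.span {(p : O) ^ m}) hn
        (N := p ^ m) (pow_ne_zero _ D.prime.ne_zero) (by
          have : ((p ^ m : ℕ) : O ⧸ Ideal.span {(p : O) ^ m})
              = Ideal.Quotient.mk (Ideal.span {(p : O) ^ m}) ((p : O) ^ m) := by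
            rw [map_pow, map_natCast, Nat.cast_pow]
          rw [this, Ideal.Quotient.eq_zero_iff_mem]
          exact Ideal.mem_span_singleton_self _)
      refine ⟨a, d, hd, ?_⟩
      rw [close_iff_red_eq, red_heckeT_pow, red_heckeT_pow]
      exact h _ (D.red_mem_nebForms hψ hlev).1
  exact ⟨L, D.mem_padicOrd_iff.mpr ⟨hL, hord⟩, hlim⟩

/-- Suppose `h(t) ≠ 0` and choose `m` so that `|Δ_𝔰| h(t)` is nonzero modulo `p^m`. Let `ψ` be
supported on the coset of `ḡ τ_n` for `g = t`, and `L` its ordinary projection. Modulo `p^m` the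
pairing of `h` with `L` at level `n` equals that of `T^{r!} h ≡ h` with `ψ`, which is `|Δ_𝔰| h(t)`.
Characteristic zero makes `|Δ_𝔰|` harmless. -/
theorem padicPairing_nondegenerate [IsDomain O] [CharZero O] (hD : D.SufficientlySmall)
    {α : D.Tor →* Oˣ} {k : D.Emb O →₀ ℕ} {n₀ : ℕ} (hα : D.HasWeight k n₀ α)
    (h : D.padicOrd α) (hzero : ∀ h' : D.padicOrd α,
      AdicLim (p : O) (fun n => D.levelPairing n h.1 ((D.ordInv α ^ n) h').1) 0) : h = 0 := by
  have hO : IsAdicClosed (p : O) (⊤ : Submodule O O) := isAdicClosed_top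
  by_contra hne
  obtain ⟨t, ht⟩ : ∃ t, h.1 t ≠ 0 := by
    by_contra hall
    push Not at hall
    exact hne (Subtype.ext (funext hall))
  have hΔ : ((Nat.card D.Delta : ℕ) : O) * h.1 t ≠ 0 := by
    have := D.finite_Delta
    exact mul_ne_zero (Nat.cast_ne_zero.mpr Nat.card_pos.ne') ht
  obtain ⟨m, hm⟩ : ∃ m, ¬ Close (p : O) m (((Nat.card D.Delta : ℕ) : O) * h.1 t) 0 := by
    by_contra hall
    push Not at hall
    exact hΔ (hO.sep _ trivial hall)
  obtain ⟨hneb, hord⟩ := D.mem_padicOrd_iff.mp h.2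
  obtain ⟨n₁, hn₁, hlev₁⟩ := exists_hasLevel hneb.1 m
  -- Large enough for `h` to have level `n` modulo `p^m`, for the weight condition on `α` to apply,
  -- and for the function `ψ` to have level `n` modulo `p^m`.
  set n := max n₁ (max n₀ m)
  have hn : 1 ≤ n := hn₁.trans (le_max_left _ _)
  have hnn₀ : n₀ ≤ n := (le_max_left _ _).trans (le_max_right _ _)
  have hnm : m ≤ n := (le_max_right _ _).trans (le_max_right _ _)
  have hlev := hlev₁.mono (le_max_left n₁ (max n₀ m))
  obtain ⟨ψ, hψ1, hψ2⟩ := D.exists_deltaFun hD hn (D.iota n t) α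
  have hψ := D.deltaFun_mem_padicNeb hn hψ1 hψ2 hα hnn₀
  have hψlev := D.deltaFun_hasLevel hn hψ1 hψ2 hα hnn₀ le_rfl hnm
  obtain ⟨L, hL, hlim⟩ := D.exists_ordinary_projection hψ
  have hLlev : D.HasLevel m n L := by
    obtain ⟨r, hr⟩ := hlim m
    exact (hψlev.heckeT_pow hn _).of_close (hr r le_rfl)
  have hUL : ∀ i, (D.Utriv O ^ i) L ∈ D.padicOrd α ∧ D.HasLevel m n ((D.Utriv O ^ i) L) := by
    intro i
    induction i with
    | zero => exact ⟨hL, hLlev⟩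
    | succ i ih => rw [pow_succ']; exact ⟨D.Utriv_mem_padicOrd ih.1, ih.2.Utriv hn⟩
  -- The test element is `Uⁿ L`: the factor `U⁻ⁿ` in the definition of the pairing turns it back
  -- into `L`.
  have h1 := D.close_of_adicLim hD (hzero ⟨_, (hUL n).1⟩) hn hlev (hUL n).2
  rw [D.ordInv_pow_eq_of_Utriv_pow_eq n (h := ⟨L, hL⟩) rfl] at h1
  obtain ⟨r₀, h₀⟩ := hlim m
  obtain ⟨r₁, h₁⟩ := hord m
  set r := max r₀ r₁
  have e0 := D.close_iff_red_eq.mp (h₀ r (le_max_left _ _))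
  have e1 := D.close_iff_red_eq.mp (h₁ r (le_max_right _ _))
  rw [red_heckeT_pow] at e0 e1
  have hT : ∀ f ∈ D.nebForms n (D.redNeb m α), D.heckeT _ f ∈ D.nebForms n (D.redNeb m α) :=
    fun f hf => D.heckeT_mem_nebForms hn hf
  have hh := D.red_mem_nebForms hneb hlev
  have hψr := D.red_mem_nebForms hψ hψlev
  rw [close_iff_mk_eq, mk_levelPairing, ← e0, ← D.levelPairing_pow hT
    (fun _ hf _ hf' => D.levelPairing_heckeT hD hn hf hf') (r !) hh hψr, e1,
    D.levelPairing_eq_of_support hD hn hh hψr t] at h1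
  · refine hm (close_iff_mk_eq.mpr ?_)
    rw [h1, map_mul, map_natCast]
    rfl
  · have := hψ1 1 (one_mem _) 1 (one_mem _) 1 D.hasEntry_one
    rw [one_mul, mul_one, map_one, Units.val_one] at this
    rw [red, this, map_one]
  · intro g hg
    refine hψ2 g fun h0 => hg ?_
    rw [red, h0, map_zero]

end Nondegenerate

end Datum

end DeltaFunctions

end

end HidaU2

namespace HidaU2

noncomputable section

/-! ### Leading coefficients and the comparison of the pairings -/

section LeadingCoefficients

theorem Close.eval {R ι : Type*} [CommRing R] {π : R} {m : ℕ} {x y : ι → R}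
    (h : ∀ i, Close π m (x i) (y i)) (P : MvPolynomial ι R) :
    Close π m (MvPolynomial.eval x P) (MvPolynomial.eval y P) := by
  induction P using MvPolynomial.induction_on with
  | C a => rw [MvPolynomial.eval_C, MvPolynomial.eval_C]; exact Close.refl a
  | add P Q hP hQ => rw [map_add, map_add]; exact hP.add hQ
  | mul_X P i hP =>
    rw [map_mul, map_mul, MvPolynomial.eval_X, MvPolynomial.eval_X]
    exact hP.mul (h i)

variable {F K : Type*} [Field F] [NumberField F] [Field K] [NumberField K] [Algebra F K] {p : ℕ}
  (D : Datum F K p) {O : Type*} [CommRing O]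

namespace Datum

variable {k : D.Emb O →₀ ℕ} {α : D.Tor →* Oˣ} {f f' : D.G → D.Poly O O}

theorem beta_eq_eval (hf : ∀ g, f g ∈ D.Lk k) (g : D.G) :
    D.beta k f g = MvPolynomial.eval (fun x => if x.2 = 0 then 1 else 0) (f g) :=
  D.coeff_eq_eval (hf g)

/-- The leading coefficient is the value at `(X, Y) = (1, 0)`. The transposed adjugate of `(p b; 0
1)` has first row `(1, 0)`, so the normalised action does not change this value. -/
theorem beta_Uk (hf : ∀ g, f g ∈ D.Lk k) : D.beta k (D.Uk f) = D.Utriv O (D.beta k f) := by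
  obtain ⟨_⟩ := D.exists_fintype_residue
  funext g
  rw [Utriv_apply, beta, Uk, hecke_apply, MvPolynomial.coeff_sum]
  refine Finset.sum_congr rfl fun b _ => ?_
  have h1 := D.rhoNorm_mem_Lk (fun v => !![(p : v.1.adicCompletionIntegers F),
    algebraMap (𝓞 F) (v.1.adicCompletionIntegers F) (Quotient.out b); 0, 1])
    (hf (g * D.upper (Quotient.out b)))
  refine (D.coeff_eq_eval h1).trans ?_
  rw [beta_eq_eval D hf, rhoNorm, eval_subst]
  congr 2
  funext x
  obtain ⟨σ, i⟩ := x
  rw [embMat, Matrix.adjugate_fin_two_of]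
  revert i
  rw [Fin.forall_fin_two]
  constructor <;> simp

theorem heckeOp_mem_forms {n : ℕ} (hn : 1 ≤ n) {f : D.G → D.Poly O O} (hf : f ∈ D.forms k n) :
    (D.Uk * D.central O (D.Poly O O) : Module.End O (D.G → D.Poly O O)) f ∈ D.forms k n :=
  D.Uk_mem_forms hn (D.central_mem_forms hf)

theorem beta_heckeOp_pow {n : ℕ} (hn : 1 ≤ n) (hf : f ∈ D.forms k n) (r : ℕ) :
    D.beta k (((D.Uk * D.central O (D.Poly O O) : Module.End O (D.G → D.Poly O O)) ^ r) f) = (D.heckeT O ^ r) (D.beta k f) := by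
  induction r with
  | zero => rfl
  | succ r ih =>
    have h1 := pow_mem (fun _ => D.heckeOp_mem_forms hn) r hf
    rw [pow_succ', pow_succ', Module.End.mul_apply, Module.End.mul_apply,
      Module.End.mul_apply (D.heckeT O), ← ih]
    exact D.beta_Uk (D.central_mem_forms h1).1

theorem beta_Uk_pow {n : ℕ} (hn : 1 ≤ n) (hf : f ∈ D.forms k n) (r : ℕ) :
    D.beta k ((D.Uk ^ r) f) = (D.Utriv O ^ r) (D.beta k f) := by
  induction r with
  | zero => rfl
  | succ r ih =>
    rw [pow_succ', pow_succ', Module.End.mul_apply, Module.End.mul_apply, ← ih]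
    exact D.beta_Uk (pow_mem (fun _ => D.Uk_mem_forms hn) r hf).1

theorem Close.beta {m : ℕ} (h : Close (p : O) m f f') :
    Close (p : O) m (D.beta k f) (D.beta k f') :=
  Close.pi_iff.mpr fun g =>
    (Close.pi_iff.mp h g).map (MvPolynomial.lcoeff O (k.mapDomain fun σ => (σ, 0)))

/-- Under `u ∈ K₁ⁿ'` the evaluation point `(1, 0)` moves to the first column of `u`, which is
congruent to `(1, 0)` modulo `pⁿ'`; so does the value, up to `p^m` for `m ≤ n'`. -/
theorem beta_hasLevel {n n' m : ℕ} (hf : f ∈ D.forms k n) (hn : n ≤ n') (hm : m ≤ n') :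
    D.HasLevel m n' (D.beta k f) := by
  intro u hu g
  obtain ⟨A, hA, hA'⟩ := D.exists_intGL_of_mem_K1 hu
  rw [beta_eq_eval D hf.1, beta_eq_eval D hf.1, hf.2.2 u (D.K1_anti hn hu) A hA, rho_inv_eq,
    eval_subst]
  refine Close.eval (fun x => Close.mono hm ?_) _
  obtain ⟨σ, i⟩ := x
  have key : ∀ {x y : σ.1.1.adicCompletionIntegers F}, x - y ∈ D.pIdeal n' σ.1 →
      Close (p : O) n' (σ.2 x) (σ.2 y) := by
    intro x y h
    obtain ⟨z, hz⟩ := D.mem_pIdeal_iff.mp h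
    refine ⟨σ.2 z, ?_⟩
    rw [← map_sub, hz, map_mul, map_pow, map_natCast, smul_eq_mul]
  revert i
  rw [Fin.forall_fin_two]
  constructor
  · have := key (y := 1) (hA' σ.1).1
    rwa [map_one] at this
  · have := key (y := 0) (by rw [sub_zero]; exact (hA' σ.1).2)
    rwa [map_zero] at this

theorem beta_mem_padicOrd {n : ℕ} (hn : 1 ≤ n) (hf : f ∈ D.ordForms k n α) :
    D.beta k f ∈ D.padicOrd α := by
  obtain ⟨⟨h1, h2⟩, hord⟩ := D.mem_ordForms_iff.mp hf
  refine D.mem_padicOrd_iff.mpr ⟨⟨⟨fun γ hγ g => ?_, fun m => ⟨max n m, le_max_of_le_left hn,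
    D.beta_hasLevel h1 (le_max_left _ _) (le_max_right _ _)⟩⟩, fun u t g => ?_⟩, fun m => ?_⟩
  · rw [beta, beta, h1.2.1 γ hγ]
  · rw [beta, beta, h2 u t g, MvPolynomial.coeff_smul]
  · obtain ⟨r₀, h₀⟩ := hord m
    refine ⟨r₀, fun r hr => ?_⟩
    change Close (p : O) m ((D.heckeT O ^ r !) (D.beta k f)) (D.beta k f)
    rw [← D.beta_heckeOp_pow hn h1]
    exact Close.beta D (h₀ r hr)

section Comparison

variable [NumberField.IsTotallyReal F] [NumberField.IsTotallyComplex K]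
  [IsAdicComplete (Ideal.span {(p : O)}) O]

/-- Both sides come from elements of `O`, which embeds in `O[1/k!]`. At a level `i` large compared
with `m` the algebraic pairing is congruent modulo `p^m` to the pairing of leading coefficients. As
`β_k` commutes with `U`, the latter is the `i`-th term of the sequence with limit `L`. -/
theorem pairing_eq_padicPairing [IsDomain O] [CharZero O] (hD : D.SufficientlySmall) {n : ℕ}
    (hn : 1 ≤ n) (hf : f ∈ D.ordForms k n α) (hf' : f' ∈ D.ordForms k n α) {L : O}
    (hL : AdicLim (p : O) (fun i => D.levelPairing i (D.beta k f)
      ((D.ordInv α ^ i) ⟨_, D.beta_mem_padicOrd hn hf'⟩).1) L)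
    {h : D.G → D.Poly O O} (hh : h ∈ D.ordForms k n α) (e : (D.Uk ^ n) h = f') :
    D.pairing k n f h = algebraMap O _ L := by
  have hO : IsAdicClosed (p : O) (⊤ : Submodule O O) := isAdicClosed_top
  obtain ⟨H, hH, hHU, hHs, huniq⟩ := D.exists_Uk_inverse hn hf'
  obtain ⟨N₀, hN₀⟩ := D.exists_pairing_eq (R := O) k
  obtain ⟨r, hr⟩ := D.exists_pairing_value hD hn hf hf'
  rw [hr n le_rfl h hh e]
  congr 1
  have hinj : Function.Injective (algebraMap O (Localization.Away ((D.fact k : ℕ) : O))) := by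
    have hfact : ((D.fact k : ℕ) : O) ≠ 0 := Nat.cast_ne_zero.mpr
      (Finset.prod_ne_zero_iff.mpr fun σ _ => Nat.factorial_ne_zero _)
    exact IsLocalization.injective _ (powers_le_nonZeroDivisors_of_noZeroDivisors hfact)
  refine hO.eq trivial trivial fun m => ?_
  obtain ⟨i₀, hi₀⟩ := hL m
  set i := max i₀ (max n (N₀ + m))
  have hni : n ≤ i := (le_max_left _ _).trans (le_max_right _ _)
  obtain ⟨s, hs⟩ := hN₀ m i ((le_max_right _ _).trans (le_max_right _ _)) f (H i) hf.1.1.1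
  rw [hr i hni (H i) (D.ordForms_anti k hni α (hH i)) (hHU i)] at hs
  have hb : (D.ordInv α ^ i) ⟨_, D.beta_mem_padicOrd hn hf'⟩
      = ⟨_, D.beta_mem_padicOrd hn (hH i)⟩ := by
    refine D.ordInv_pow_eq_of_Utriv_pow_eq i ?_
    change (D.Utriv O ^ i) (D.beta k (H i)) = D.beta k f'
    rw [← D.beta_Uk_pow hn (hH i).1.1, hHU]
  have h1 : Close (p : O) m (D.levelPairing i (D.beta k f)
      ((D.ordInv α ^ i) ⟨_, D.beta_mem_padicOrd hn hf'⟩).1) L := hi₀ i (le_max_left _ _)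
  rw [hb] at h1
  refine Close.trans ?_ h1
  rw [hinj hs, close_iff_mk_eq]
  have := D.finite_K0 i
  rw [map_cosetSum, levelPairing, map_cosetSum]
  refine cosetSum_congr fun g => ?_
  rw [← close_iff_mk_eq]
  exact ⟨s g, by rw [smul_eq_mul]; exact add_sub_cancel_left _ _⟩

end Comparison

end Datum

end LeadingCoefficients

/-! ### The closed unit ball as a `p`-adically complete ring -/

section CoefficientRing

variable {p : ℕ} [Fact p.Prime] (E : Type*) [NormedField E] [NormedAlgebra ℚ_[p] E]
  [IsUltrametricDist E]

theorem norm_natCast_prime : ‖(p : E)‖ = (p : ℝ)⁻¹ := by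
  have h := norm_algebraMap' E (p : ℚ_[p])
  rwa [map_natCast, Padic.norm_p] at h

theorem charZero_ringOfIntegers (p : ℕ) [Fact p.Prime] [NormedAlgebra ℚ_[p] E] :
    CharZero (ringOfIntegers E) := by
  have hE : CharZero E := charZero_of_injective_algebraMap (algebraMap ℚ_[p] E).injective
  refine ⟨fun a b h => ?_⟩
  have h' := congrArg (fun x : ringOfIntegers E => (x : E)) h
  exact_mod_cast h'

theorem close_ringOfIntegers_iff {m : ℕ} {x y : ringOfIntegers E} :
    Close (p : ringOfIntegers E) m x y ↔ ‖(x : E) - y‖ ≤ ((p : ℝ)⁻¹) ^ m := by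
  have hp0 : (p : E) ≠ 0 := by
    rw [← norm_ne_zero_iff, norm_natCast_prime]
    exact inv_ne_zero (Nat.cast_ne_zero.mpr (Fact.out : p.Prime).ne_zero)
  constructor
  · rintro ⟨z, hz⟩
    have h := congrArg (fun x : ringOfIntegers E => (x : E)) hz
    change (x : E) - y = (p : E) ^ m * z at h
    rw [h, norm_mul, norm_pow, norm_natCast_prime]
    exact mul_le_of_le_one_right (by positivity) z.2
  · intro h
    refine ⟨⟨((p : E) ^ m)⁻¹ * (x - y), ?_⟩, Subtype.ext ?_⟩
    · change ‖_‖ ≤ 1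
      rw [norm_mul, norm_inv, norm_pow, norm_natCast_prime]
      have hpos : 0 < ((p : ℝ)⁻¹) ^ m :=
        pow_pos (inv_pos.mpr (Nat.cast_pos.mpr (Fact.out : p.Prime).pos)) m
      rwa [inv_mul_le_iff₀ hpos, mul_one]
    · change (x : E) - y = (p : E) ^ m * (((p : E) ^ m)⁻¹ * (x - y))
      rw [mul_inv_cancel_left₀ (pow_ne_zero m hp0)]

/-- Divisibility by `p^m` in the unit ball means norm at most `p^{-m}`, so adic completeness is
completeness of `E` together with closedness of the unit ball. -/
theorem isAdicComplete_ringOfIntegers [CompleteSpace E] :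
    IsAdicComplete (Ideal.span {(p : ringOfIntegers E)}) (ringOfIntegers E) := by
  have key : ∀ (m : ℕ) (x y : ringOfIntegers E),
      x ≡ y [SMOD (Ideal.span {(p : ringOfIntegers E)} ^ m • ⊤ :
        Submodule (ringOfIntegers E) (ringOfIntegers E))] ↔
      ‖(x : E) - y‖ ≤ ((p : ℝ)⁻¹) ^ m := by
    intro m x y
    rw [← close_ringOfIntegers_iff, SModEq.sub_mem, smul_eq_mul, Ideal.mul_top,
      Ideal.span_singleton_pow, Ideal.mem_span_singleton]
    rfl
  have hlt : (p : ℝ)⁻¹ < 1 := inv_lt_one_of_one_lt₀ (by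
    exact_mod_cast (Fact.out : p.Prime).one_lt)
  have hlim : Filter.Tendsto (fun m : ℕ => ((p : ℝ)⁻¹) ^ m) Filter.atTop (nhds 0) :=
    tendsto_pow_atTop_nhds_zero_of_lt_one (by positivity) hlt
  refine { haus' := fun x hx => ?_, prec' := fun a ha => ?_ }
  · have h0 : ‖(x : E)‖ ≤ 0 := ge_of_tendsto' hlim fun m => by
      have := (key m x 0).mp (hx m)
      simpa using this
    exact Subtype.ext (norm_le_zero_iff.mp h0)
  · have hc : CauchySeq fun m => (a m : E) := by
      refine cauchySeq_of_le_tendsto_0' _ (fun m n hmn => ?_) hlim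
      rw [dist_eq_norm]
      exact (key m _ _).mp (ha hmn)
    obtain ⟨L, hL⟩ := cauchySeq_tendsto_of_complete hc
    have hdist : ∀ m, ‖(a m : E) - L‖ ≤ ((p : ℝ)⁻¹) ^ m := fun m =>
      le_of_tendsto (tendsto_const_nhds.sub hL).norm
        (Filter.eventually_atTop.mpr ⟨m, fun n hn => (key m _ _).mp (ha hn)⟩)
    have hLm : ‖L‖ ≤ 1 := le_of_tendsto' hL.norm fun m => (a m).2
    exact ⟨⟨L, hLm⟩, fun m => (key m _ _).mpr (hdist m)⟩

end CoefficientRing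

end

end HidaU2

theorem proposition5
    {F K : Type*} [Field F] [NumberField F] [NumberField.IsTotallyReal F]
    [Field K] [NumberField K] [NumberField.IsTotallyComplex K] [Algebra F K]
    (p : ℕ) [Fact p.Prime] (hp : p ≠ 2)
    (D : HidaU2.Datum F K p) (hD : D.SufficientlySmall)
    (E : Type*) [NormedField E] [NormedAlgebra ℚ_[p] E] [IsUltrametricDist E] [CompleteSpace E]
    (hE : Nat.card (K →+* E) = Module.finrank ℚ K) :
    (∀ (R : Type*) [CommRing R] [Algebra (HidaU2.ringOfIntegers E) R]
        [IsAdicComplete (Ideal.span {(p : R)}) R]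
        (α : D.Tor →* Rˣ) (k : D.Emb (HidaU2.ringOfIntegers E) →₀ ℕ) (n₀ : ℕ),
        1 ≤ n₀ → D.HasWeight k n₀ α →
      (∀ n ≥ n₀, Set.BijOn D.Uk
        (D.ordForms k n α : Set (D.G → D.Poly (HidaU2.ringOfIntegers E) R))
        (D.ordForms k n α)) ∧
      ∀ f₁ ∈ D.ordForms k n₀ α, ∀ f₂ ∈ D.ordForms k n₀ α,
        ∃ r : R, ∀ n ≥ n₀, ∀ h ∈ D.ordForms k n α, (D.Uk ^ n) h = f₂ →
          D.pairing k n f₁ h = algebraMap R _ r) ∧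
    (∀ α : D.Tor →* (HidaU2.ringOfIntegers E)ˣ,
      (∃ k : D.Emb (HidaU2.ringOfIntegers E) →₀ ℕ, ∃ n ≥ 1, D.HasWeight k n α) →
      ∃ B : D.padicOrd α →ₗ[HidaU2.ringOfIntegers E]
          D.padicOrd α →ₗ[HidaU2.ringOfIntegers E] HidaU2.ringOfIntegers E,
        (∀ f₁ f₂, B f₁ f₂ = B f₂ f₁) ∧
        (∀ f₁, (∀ f₂, B f₁ f₂ = 0) → f₁ = 0) ∧
        ∀ (k : D.Emb (HidaU2.ringOfIntegers E) →₀ ℕ) (n : ℕ), 1 ≤ n → D.HasWeight k n α →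
          ∀ f₁ ∈ D.ordForms k n α, ∀ f₂ ∈ D.ordForms k n α,
            ∃ (h₁ : D.beta k f₁ ∈ D.padicOrd α) (h₂ : D.beta k f₂ ∈ D.padicOrd α),
              ∀ h ∈ D.ordForms k n α, (D.Uk ^ n) h = f₂ →
                D.pairing k n f₁ h
                  = algebraMap (HidaU2.ringOfIntegers E) _ (B ⟨_, h₁⟩ ⟨_, h₂⟩)) := by
  have hchar := HidaU2.charZero_ringOfIntegers E p
  have hcomplete := HidaU2.isAdicComplete_ringOfIntegers (p := p) E
  refine ⟨fun R _ _ _ α k n₀ hn₀ _ => ⟨fun n hn => D.Uk_bijOn k (hn₀.trans hn) α,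
    fun f₁ hf₁ f₂ hf₂ => D.exists_pairing_value hD hn₀ hf₁ hf₂⟩, fun α hα => ?_⟩
  obtain ⟨k₀, n₀, -, hα⟩ := hα
  obtain ⟨B, hB⟩ := D.exists_padicPairing hD α
  refine ⟨B, fun f₁ f₂ => D.adicLim_symm hD (hB f₁ f₂) (hB f₂ f₁), fun f₁ h => ?_,
    fun k n hn _ f₁ hf₁ f₂ hf₂ => ⟨D.beta_mem_padicOrd hn hf₁, D.beta_mem_padicOrd hn hf₂,
      fun h hh e => D.pairing_eq_padicPairing hD hn hf₁ hf₂
        (hB ⟨_, D.beta_mem_padicOrd hn hf₁⟩ ⟨_, D.beta_mem_padicOrd hn hf₂⟩) hh e⟩⟩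
  refine D.padicPairing_nondegenerate hD hα f₁ fun f₂ => ?_
  rw [← h f₂]
  exact hB f₁ f₂
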